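/- Let $M$ be a non-empty Hausdorff hyperkähler manifold of positive (finite) dimension $4n$: a smooth manifold with a smooth action of the quaternions on $TM$ and a Riemannian metric $s$ such that every quaternion $L$ with $L^2=-1$ is an integrable complex structure for which $s$ is Kähler. Let $I,J,K=IJ$ be the standard quaternions, $\omega_L(x,y)=s(x,Ly)$, and let $\Lambda^*(M)$ be the space of complex-valued smooth differential forms. For $L\in\{I,J,K\}$ let $L_L$ be exterior multiplication by $\omega_L$, $\Lambda_L$ its Hermitian adjoint, $\mathrm{ad}\,L$ the operator equal to $\sqrt{-1}\,(p-q)$ on forms of Hodge type $(p,q)$ with respect to $L$, and let $H$ be multiplication by $k-2n$ on $k$-forms. The (complexified) hyperkähler-de Rham superalgebra ${\mathfrak g}\subset \mathrm{End}_{\mathbb C}(\Lambda^*(M))$ is the complex Lie superalgebra, with respect to the supercommutator, generated by the operators $L_L,\Lambda_L,\mathrm{ad}\,L$ ($L=I,J,K$), $H$ and the de Rham differential $d$. Put $\Omega=\frac12(\omega_J+\sqrt{-1}\,\omega_K)$, a $(2,0)$-form on $(M,I)$; let $L_\Omega$ be exterior multiplication by $\Omega$, $\Lambda_\Omega$ its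 Hermitian adjoint, and $H_\Omega=[L_\Omega,\Lambda_\Omega]$. Let $\partial,\bar\partial$ be the Dolbeault differentials of $(M,I)$ on $\Lambda^*(M)$, let $\partial_J=J^{-1}\circ\bar\partial\circ J$, where $J$ acts on forms by $(J\eta)(v_1,\dots,v_k)=\eta(Jv_1,\dots,Jv_k)$, let $\partial^*=-{*}\,\overline{\partial}\,{*}$, $\partial_J^*=-{*}\,\overline{\partial_J}\,{*}$ and $d^*=-{*}\,d\,{*}$ be the Hermitian adjoints (with $*$ the complex-linear Hodge star and $\overline{P}(\eta)=\overline{P(\overline\eta)}$), and let $\Delta=dd^*+d^*d$. The Kähler-de Rham superalgebra is the complex Lie superalgebra defined by even generators $L,\Lambda,H$, odd generators $d,d^c$ and the relations $$[L,\Lambda]=H,\quad [H,L]=2L,\quad [H,\Lambda]=-2\Lambda,\quad [H,d]=d,\quad [H,d^c]=d^c,\quad [L,d]=[L,d^c]=0,$$ $$[\Lambda,[\Lambda,d]]=[\Lambda,[\Lambda,d^c]]=0,\qquad \{d,d\}=\{d^c,d^c\}=\{d,d^c\}=0 .$$ Then the eight operators $$L_\Omega,\ \Lambda_\Omega,\ H_\Omega,\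 \partial,\ \partial^*,\ \partial_J,\ \partial_J^*,\ \Delta$$ belong to ${\mathfrak g}$ and are linearly independent over $\mathbb C$. Their $8$-dimensional complex span ${\mathfrak g}^{*,0}_I\subset{\mathfrak g}$ is closed under the supercommutator, and there is an isomorphism of Lie superalgebras (linear, compatible with brackets and with parity) from the Kähler-de Rham superalgebra onto ${\mathfrak g}^{*,0}_I$ that maps $L,\Lambda,H,d,d^c$ to $L_\Omega,\Lambda_\Omega,H_\Omega,\partial,\partial_J$ respectively. -/

import Mathlib

open scoped Manifold ContDiff Quaternion Topology

namespace HK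

noncomputable section

open ContinuousAlternatingMap

set_option linter.unusedSectionVars false
set_option maxSynthPendingDepth 3

/-- Complex-valued alternating `k`-linear forms on the real vector space `E`. -/
abbrev Alt (E : Type*) [NormedAddCommGroup E] [NormedSpace ℝ E] (k : ℕ) : Type _ :=
  E [⋀^Fin k]→L[ℝ] ℂ

section Pointwise
variable {E : Type*} [NormedAddCommGroup E] [NormedSpace ℝ E]

/-- The value of an alternating form in no variables. -/
def ev0 : Alt E 0 →L[ℝ] ℂ :=
  (constOfIsEmptyLIE ℝ E ℂ (Fin 0)).symm.toContinuousLinearEquiv.toContinuousLinearMap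

theorem ev0_apply (α : Alt E 0) (v : Fin 0 → E) : ev0 α = α v := by
  rw [Subsingleton.elim v 0]; rfl

/-- The exterior product `(α, β) ↦ k! α ∧ β` of alternating forms, defined recursively by
antisymmetrizing `v ↦ (ι_v α) ∧ β`. -/
def wedgeAux : ∀ k l : ℕ, Alt E k →L[ℝ] Alt E l →L[ℝ] Alt E (l + k)
  | 0, _ => (ContinuousLinearMap.lsmul ℝ ℂ).comp ev0
  | k + 1, l =>
    (ContinuousLinearMap.compL ℝ (Alt E l) (E →L[ℝ] Alt E (l + k)) (Alt E (l + k + 1))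
        (alternatizeUncurryFinCLM ℝ E ℂ)) ∘L
      (ContinuousLinearMap.flipₗᵢ ℝ E (Alt E l) (Alt E (l + k))).toContinuousLinearEquiv.toContinuousLinearMap ∘L
      (ContinuousLinearMap.compL ℝ E (Alt E k) (Alt E l →L[ℝ] Alt E (l + k)) (wedgeAux k l)) ∘L
      curryLeftLI.toContinuousLinearMap

theorem wedgeAux_zero (l : ℕ) (α : Alt E 0) (β : Alt E l) : wedgeAux 0 l α β = ev0 α • β := rfl

theorem wedgeAux_succ (k l : ℕ) (α : Alt E (k + 1)) (β : Alt E l) :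
    wedgeAux (k + 1) l α β =
      alternatizeUncurryFin (((wedgeAux k l).flip β) ∘L α.curryLeft) := rfl

theorem wedgeAux_smul (k l : ℕ) (c : ℂ) (α : Alt E k) (β : Alt E l) :
    wedgeAux k l α (c • β) = c • wedgeAux k l α β := by
  induction k with
  | zero => simp only [wedgeAux_zero]; exact smul_comm _ _ _
  | succ k ih =>
    rw [wedgeAux_succ, wedgeAux_succ, ← alternatizeUncurryFin_smul]
    congr 1
    ext1 v
    exact ih _

theorem wedgeAux_comp (k l : ℕ) (α : Alt E k) (β : Alt E l) (A : E →L[ℝ] E) :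
    (wedgeAux k l α β).compContinuousLinearMap A =
      wedgeAux k l (α.compContinuousLinearMap A) (β.compContinuousLinearMap A) := by
  induction k with
  | zero => 
    ext v
    simp [wedgeAux_zero]
    left; rw [ev0_apply _ 0, ev0_apply _ 0, compContinuousLinearMap_apply]; congr 1
    exact Subsingleton.elim _ _
  | succ k ih =>
    ext v
    simp only [wedgeAux_succ, compContinuousLinearMap_apply, alternatizeUncurryFin_apply]
    refine Finset.sum_congr rfl fun i _ => ?_
    congr 1
    simp only [ContinuousLinearMap.comp_apply, ContinuousLinearMap.flip_apply,
      curryLeft_compContinuousLinearMap, ← ih]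
    rfl

variable [FiniteDimensional ℝ E]
set_option maxSynthPendingDepth 3

/-- The contraction `(α, β) ↦ k! (α ⌟ β)` of `β` with `α` by means of the inverse metric `G`: the
indices of `α` are contracted, in this order, with the first `k` indices of `β`. It is complex-bilinear,
and contraction with the complex conjugate of `α` is the Hermitian adjoint of `α ∧ ·`. -/
def contractAux (G : (E →L[ℝ] ℝ) →L[ℝ] E) :
    ∀ k l : ℕ, Alt E k →L[ℝ] Alt E (l + k) →L[ℝ] Alt E l
  | 0, _ => (ContinuousLinearMap.lsmul ℝ ℂ).comp ev0
  | k + 1, l => ∑ i, (contractAux G k l).bilinearComp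
      ((ContinuousLinearMap.apply ℝ (Alt E k) (Module.finBasis ℝ E i)) ∘L
        curryLeftLI.toContinuousLinearMap)
      ((ContinuousLinearMap.apply ℝ (Alt E (l + k))
          (G (LinearMap.toContinuousLinearMap ((Module.finBasis ℝ E).coord i)))) ∘L
        curryLeftLI.toContinuousLinearMap)

theorem contractAux_zero (G : (E →L[ℝ] ℝ) →L[ℝ] E) (l : ℕ) (α : Alt E 0) (β : Alt E l) :
    contractAux G 0 l α β = ev0 α • β := rfl

theorem contractAux_succ (G : (E →L[ℝ] ℝ) →L[ℝ] E) (k l : ℕ) (α : Alt E (k + 1))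
    (β : Alt E (l + (k + 1))) :
    contractAux G (k + 1) l α β = ∑ i, contractAux G k l (α.curryLeft (Module.finBasis ℝ E i))
      (curryLeft (n := l + k) β
        (G (LinearMap.toContinuousLinearMap ((Module.finBasis ℝ E).coord i)))) := by
  rw [contractAux, _root_.sum_apply, _root_.sum_apply]
  rfl

theorem contractAux_smul (G : (E →L[ℝ] ℝ) →L[ℝ] E) (k l : ℕ) (c : ℂ) (α : Alt E k)
    (β : Alt E (l + k)) : contractAux G k l α (c • β) = c • contractAux G k l α β := by
  induction k with
  | zero => simp only [contractAux_zero]; exact smul_comm _ _ _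
  | succ k ih =>
    rw [contractAux_succ, contractAux_succ, Finset.smul_sum]
    refine Finset.sum_congr rfl fun i _ => ?_
    rw [← ih]; rfl

theorem contractAux_smul_left (G : (E →L[ℝ] ℝ) →L[ℝ] E) (k l : ℕ) (c : ℂ) (α : Alt E k)
    (β : Alt E (l + k)) : contractAux G k l (c • α) β = c • contractAux G k l α β := by
  induction k with
  | zero => simp only [contractAux_zero]; exact smul_assoc c (ev0 α) β
  | succ k ih =>
    rw [contractAux_succ, contractAux_succ, Finset.smul_sum]
    refine Finset.sum_congr rfl fun i _ => ?_
    rw [← ih]; rfl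

/-- Basis independence of the contraction of a bilinear expression in a vector and a covector. -/
theorem sum_basis_indep {V : Type*} [AddCommGroup V] [Module ℝ V]
    (T : E →ₗ[ℝ] (E →L[ℝ] ℝ) →ₗ[ℝ] V) (A : E ≃L[ℝ] E) :
    ∑ i, T (A (Module.finBasis ℝ E i))
        ((LinearMap.toContinuousLinearMap ((Module.finBasis ℝ E).coord i)) ∘L
          (A.symm : E →L[ℝ] E)) =
      ∑ i, T (Module.finBasis ℝ E i)
        (LinearMap.toContinuousLinearMap ((Module.finBasis ℝ E).coord i)) := by
  set b := Module.finBasis ℝ E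
  have h1 : ∀ i, A (b i) = ∑ j, b.coord j (A (b i)) • b j := fun i => (b.sum_repr _).symm
  have h2 : ∀ j, ∑ i, b.coord j (A (b i)) •
      ((LinearMap.toContinuousLinearMap (b.coord i)) ∘L (A.symm : E →L[ℝ] E)) =
      LinearMap.toContinuousLinearMap (b.coord j) := by
    intro j
    ext u
    have h3 : A (∑ i, b.coord i (A.symm u) • b i) = u := by
      have := b.sum_repr (A.symm u)
      simp only [Module.Basis.coord_apply]
      rw [this, A.apply_symm_apply]
    have h4 := congrArg (b.coord j) h3
    rw [LinearMap.coe_toContinuousLinearMap', ← h4]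
    simp only [_root_.map_sum, _root_.map_smul, smul_eq_mul, _root_.sum_apply,
      _root_.smul_apply, ContinuousLinearMap.comp_apply,
      LinearMap.coe_toContinuousLinearMap', ContinuousLinearEquiv.coe_coe]
    exact Finset.sum_congr rfl fun i _ => mul_comm _ _
  calc _ = ∑ i, ∑ j, T (b j) (b.coord j (A (b i)) •
      ((LinearMap.toContinuousLinearMap (b.coord i)) ∘L (A.symm : E →L[ℝ] E))) := by
        refine Finset.sum_congr rfl fun i _ => ?_
        conv_lhs => rw [h1 i]
        simp only [_root_.map_sum, LinearMap.sum_apply, _root_.map_smul, LinearMap.smul_apply]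
    _ = _ := by
        rw [Finset.sum_comm]
        refine Finset.sum_congr rfl fun j _ => ?_
        rw [← _root_.map_sum, h2]

theorem contractAux_comp (G : (E →L[ℝ] ℝ) →L[ℝ] E) (k l : ℕ) (α : Alt E k) (β : Alt E (l + k))
    (A : E ≃L[ℝ] E) :
    (contractAux G k l α β).compContinuousLinearMap (A : E →L[ℝ] E) =
      contractAux ((A.symm : E →L[ℝ] E) ∘L G ∘L
          ((ContinuousLinearMap.compL ℝ E E ℝ).flip (A.symm : E →L[ℝ] E))) k l
        (α.compContinuousLinearMap (A : E →L[ℝ] E))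
        (β.compContinuousLinearMap (A : E →L[ℝ] E)) := by
  induction k with
  | zero => 
    ext v
    simp [contractAux_zero]
    left; rw [ev0_apply _ 0, ev0_apply _ 0, compContinuousLinearMap_apply]; congr 1
    exact Subsingleton.elim _ _
  | succ k ih =>
    rw [contractAux_succ, contractAux_succ]
    let T : E →ₗ[ℝ] (E →L[ℝ] ℝ) →ₗ[ℝ] Alt E l := 
      LinearMap.mk₂ ℝ (fun u ξ => contractAux G k l (α.curryLeft u) (curryLeft (n := l + k) β (G ξ)))
       (by intros; simp) (by intros; simp) (by intros; simp) (by intros; simp)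
    have key := sum_basis_indep T A
    simp only [T, LinearMap.mk₂_apply] at key
    rw [← key]
    ext1 v
    simp only [compContinuousLinearMap_apply, ContinuousAlternatingMap.sum_apply]
    refine Finset.sum_congr rfl fun i _ => ?_
    rw [curryLeft_compContinuousLinearMap, curryLeft_compContinuousLinearMap (n := l + k),
      ← compContinuousLinearMap_apply, ih]
    simp

theorem contDiff_bilinearComp {X A A' B B' Z : Type*} [NormedAddCommGroup X] [NormedSpace ℝ X]
    [NormedAddCommGroup A] [NormedSpace ℝ A] [NormedAddCommGroup A'] [NormedSpace ℝ A']
    [NormedAddCommGroup B] [NormedSpace ℝ B] [NormedAddCommGroup B'] [NormedSpace ℝ B']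
    [NormedAddCommGroup Z] [NormedSpace ℝ Z] {f : X → A →L[ℝ] B →L[ℝ] Z} (hf : ContDiff ℝ ∞ f)
    (p : A' →L[ℝ] A) {q : X → B' →L[ℝ] B} (hq : ContDiff ℝ ∞ q) :
    ContDiff ℝ ∞ fun x => (f x).bilinearComp p (q x) := by
  have h1 := (ContinuousLinearMap.flipₗᵢ ℝ A' B Z).toContinuousLinearEquiv.contDiff.comp
    (hf.clm_comp (contDiff_const (c := p)))
  exact (ContinuousLinearMap.flipₗᵢ ℝ B' A' Z).toContinuousLinearEquiv.contDiff.comp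
    (h1.clm_comp hq)

theorem contDiff_contractAux (k l : ℕ) :
    ContDiff ℝ ∞ fun G : (E →L[ℝ] ℝ) →L[ℝ] E => contractAux G k l := by
  induction k with
  | zero => exact contDiff_const
  | succ k ih =>
    simp only [contractAux]
    refine ContDiff.sum fun i _ => ?_
    exact contDiff_bilinearComp ih _ (((ContinuousLinearMap.apply ℝ (Alt E (l + k))).contDiff.comp
        (contDiff_id.clm_apply contDiff_const)).clm_comp contDiff_const)

end Pointwise
section Forms
variable {E : Type*} [NormedAddCommGroup E] [NormedSpace ℝ E]
  {M : Type*} [TopologicalSpace M] [ChartedSpace E M] [IsManifold 𝓘(ℝ, E) ∞ M]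

/-- The form `η` at `x`, read in the preferred chart at `x₀`. -/
def inChart {k : ℕ} (x₀ : M) (η : M → Alt E k) (x : M) : Alt E k :=
  (η x).compContinuousLinearMap (tangentCoordChange 𝓘(ℝ, E) x₀ x x)

/-- Smoothness of a field of alternating forms on the tangent spaces. -/
def IsSmoothForm {k : ℕ} (η : M → Alt E k) : Prop :=
  ∀ x₀ : M, ContMDiffAt 𝓘(ℝ, E) 𝓘(ℝ, Alt E k) ∞ (inChart x₀ η) x₀

variable (E M) in
/-- The space `Λ^k(M)` of smooth complex-valued differential `k`-forms. The tangent space `T_x M` is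
the model space `E`, read in the preferred chart at `x`. -/
def Form (k : ℕ) : Submodule ℂ (M → Alt E k) where
  carrier := {η | IsSmoothForm η}
  add_mem' {a b} ha hb x₀ := (ha x₀).add (hb x₀)
  zero_mem' x₀ := contMDiffAt_const (c := (0 : Alt E k))
  smul_mem' c η h x₀ := by
    have := (ContinuousLinearMap.contMDiff (𝕜 := ℝ) (n := ∞)
      ((c • ContinuousLinearMap.id ℂ (Alt E k)).restrictScalars ℝ)).contMDiffAt.comp x₀ (h x₀)
    exact this

/-- The coordinate expression of `η` in the preferred chart at `x₀`. -/
def chartRep {k : ℕ} (η : M → Alt E k) (x₀ : M) (y : E) : Alt E k :=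
  inChart x₀ η ((extChartAt 𝓘(ℝ, E) x₀).symm y)

/-- The exterior derivative of `η` at `x`, computed in the preferred chart at `x`. -/
def extDerivAt {k : ℕ} (η : M → Alt E k) (x : M) : Alt E (k + 1) :=
  extDeriv (chartRep η x) (extChartAt 𝓘(ℝ, E) x x)

theorem contDiffAt_chartRep {k : ℕ} {η : M → Alt E k} {x₀ : M}
    (h : ContMDiffAt 𝓘(ℝ, E) 𝓘(ℝ, Alt E k) ∞ (inChart x₀ η) x₀) :
    ContDiffAt ℝ ∞ (chartRep η x₀) (extChartAt 𝓘(ℝ, E) x₀ x₀) := by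
  have := (contMDiffAt_iff.1 h).2
  simp only [modelWithCornersSelf_coe, Set.range_id, contDiffWithinAt_univ] at this
  exact this

theorem extDerivAt_comp {k : ℕ} {η : M → Alt E k} (h : IsSmoothForm η)
    {x₀ x : M} (hx : x ∈ (extChartAt 𝓘(ℝ, E) x₀).source) :
    inChart x₀ (extDerivAt η) x = extDeriv (chartRep η x₀) (extChartAt 𝓘(ℝ, E) x₀ x) := by
  set φ := extChartAt 𝓘(ℝ, E) x₀ with hφ
  set ψ := extChartAt 𝓘(ℝ, E) x with hψ
  have hopen : ∀ᶠ y in 𝓝 (φ x), y ∈ φ.target ∧ φ.symm y ∈ ψ.source := by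
    have h1 : φ.target ∈ 𝓝 (φ x) := extChartAt_target_mem_nhds' (φ.map_source hx)
    have h2 : ContinuousAt φ.symm (φ x) := continuousAt_extChartAt_symm' hx
    have h3 : ψ.source ∈ 𝓝 (φ.symm (φ x)) := by
      rw [φ.left_inv hx]; exact extChartAt_source_mem_nhds x
    exact (Filter.eventually_mem_set.2 h1).and (h2.eventually_mem h3)
  have hder : ∀ y, y ∈ φ.target → φ.symm y ∈ ψ.source →
      fderiv ℝ (ψ ∘ φ.symm) y = tangentCoordChange 𝓘(ℝ, E) x₀ x (φ.symm y) := by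
    intro y hy hy'
    have := hasFDerivWithinAt_tangentCoordChange (I := 𝓘(ℝ, E)) (x := x₀) (y := x)
      (z := φ.symm y) ⟨φ.map_target hy, hy'⟩
    simp only [modelWithCornersSelf_coe, Set.range_id, hasFDerivWithinAt_univ] at this
    rw [← hφ, φ.right_inv hy] at this
    exact this.fderiv
  have hev : chartRep η x₀ =ᶠ[𝓝 (φ x)] fun y =>
      (chartRep η x ((ψ ∘ φ.symm) y)).compContinuousLinearMap (fderiv ℝ (ψ ∘ φ.symm) y) := by
    filter_upwards [hopen] with y ⟨hy, hy'⟩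
    rw [hder y hy hy']
    simp only [chartRep, inChart, Function.comp_apply, ← hφ, ← hψ, ψ.left_inv hy']
    ext v
    simp only [compContinuousLinearMap_apply]
    congr 1
    ext i
    simp only [Function.comp_apply]
    exact (tangentCoordChange_comp ⟨⟨φ.map_target hy, hy'⟩, mem_extChartAt_source _⟩).symm
  have hsm : ContDiffAt ℝ ∞ (ψ ∘ φ.symm) (φ x) := by
    have := contDiffWithinAt_ext_coord_change (I := 𝓘(ℝ, E)) (n := ∞) x x₀ (y := φ x) (by
      rw [PartialEquiv.trans_source'', PartialEquiv.symm_symm, PartialEquiv.symm_target]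
      exact Set.mem_image_of_mem _ ⟨hx, mem_extChartAt_source x⟩)
    simp only [modelWithCornersSelf_coe, Set.range_id, contDiffWithinAt_univ] at this
    exact this
  have hτ : (ψ ∘ φ.symm) (φ x) = ψ x := by simp [φ.left_inv hx]
  have hd : DifferentiableAt ℝ (chartRep η x) ((ψ ∘ φ.symm) (φ x)) := by
    rw [hτ]
    exact (contDiffAt_chartRep (h x)).differentiableAt (by simp)
  rw [hev.extDeriv_eq, extDeriv_pullback hd hsm (by simp; exact ENat.LEInfty.out), hτ,
    hder _ (φ.map_source hx) (by rw [φ.left_inv hx]; exact mem_extChartAt_source x),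
    φ.left_inv hx, inChart, HK.extDerivAt]

theorem IsSmoothForm.extDerivAt {k : ℕ} {η : M → Alt E k}
    (h : IsSmoothForm η) : IsSmoothForm (extDerivAt η) := by
  intro x₀
  have h1 : ContDiffAt ℝ ∞ (extDeriv (chartRep η x₀)) (extChartAt 𝓘(ℝ, E) x₀ x₀) :=
    (alternatizeUncurryFinCLM ℝ E ℂ).contDiff.contDiffAt.comp _
      ((contDiffAt_chartRep (h x₀)).fderiv_right (by simp))
  have h2 : ContMDiffAt 𝓘(ℝ, E) 𝓘(ℝ, Alt E (k + 1)) ∞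
      (fun x => extDeriv (chartRep η x₀) (extChartAt 𝓘(ℝ, E) x₀ x)) x₀ :=
    h1.contMDiffAt.comp x₀ contMDiffAt_extChartAt
  refine h2.congr_of_eventuallyEq ?_
  filter_upwards [extChartAt_source_mem_nhds (I := 𝓘(ℝ, E)) x₀] with x hx
  exact extDerivAt_comp h hx

variable (E M) in
/-- The de Rham differential `Λ^k(M) → Λ^(k+1)(M)`. -/
def dForm (k : ℕ) : Form E M k →ₗ[ℂ] Form E M (k + 1) where
  toFun η := ⟨extDerivAt η.1, IsSmoothForm.extDerivAt η.2⟩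
  map_add' a b := Subtype.ext <| funext fun x =>
    extDeriv_add ((contDiffAt_chartRep (a.2 x)).differentiableAt (by simp))
      ((contDiffAt_chartRep (b.2 x)).differentiableAt (by simp))
  map_smul' c η := Subtype.ext <| funext fun x => by
    have h : DifferentiableAt ℝ (chartRep η.1 x) (extChartAt 𝓘(ℝ, E) x x) := 
      (contDiffAt_chartRep (η.2 x)).differentiableAt (by simp)
    let C : Alt E k →L[ℝ] Alt E k := (c • ContinuousLinearMap.id ℂ (Alt E k)).restrictScalars ℝ
    have h2 := C.hasFDerivAt.comp _ h.hasFDerivAt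
    have h3 : fderiv ℝ (chartRep (c • η.1) x) (extChartAt 𝓘(ℝ, E) x x) = 
       c • fderiv ℝ (chartRep η.1 x) (extChartAt 𝓘(ℝ, E) x x) := h2.fderiv
    change alternatizeUncurryFin (fderiv ℝ (chartRep (c • η.1) x) (extChartAt 𝓘(ℝ, E) x x)) =
      c • alternatizeUncurryFin (fderiv ℝ (chartRep η.1 x) (extChartAt 𝓘(ℝ, E) x x))
    rw [← alternatizeUncurryFin_smul, ← h3]
end Forms

section Smoothness
variable {E : Type*} [NormedAddCommGroup E] [NormedSpace ℝ E] [FiniteDimensional ℝ E]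
  {M : Type*} [TopologicalSpace M] [ChartedSpace E M] 

theorem contMDiffAt_alt {k : ℕ} {f : M → Alt E k} {x₀ : M}
    (h : ∀ v, ContMDiffAt 𝓘(ℝ, E) 𝓘(ℝ, ℂ) ∞ (fun x => f x v) x₀) :
    ContMDiffAt 𝓘(ℝ, E) 𝓘(ℝ, Alt E k) ∞ f x₀ := by
  let b := Module.finBasis ℝ E
  let L : Alt E k →ₗ[ℝ] ((Fin k → Fin (Module.finrank ℝ E)) → ℂ) :=
    { toFun := fun α r => α (b ∘ r), map_add' := fun _ _ => rfl, map_smul' := fun _ _ => rfl }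
  have hL : LinearMap.ker L = ⊥ := by
    rw [LinearMap.ker_eq_bot]
    intro α β hαβ
    apply ContinuousAlternatingMap.toContinuousMultilinearMap_injective
    apply ContinuousMultilinearMap.toMultilinearMap_injective
    exact Module.Basis.ext_multilinear (fun _ => b) fun r => congrFun hαβ r
  obtain ⟨g, hg⟩ := L.exists_leftInverse_of_injective hL
  have h1 : ContMDiffAt 𝓘(ℝ, E) 𝓘(ℝ, (Fin k → Fin (Module.finrank ℝ E)) → ℂ) ∞
      (fun x => L (f x)) x₀ :=
    contMDiffAt_pi_space.2 fun r => h (b ∘ r)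
  have h2 := (LinearMap.toContinuousLinearMap g).contMDiff.contMDiffAt.comp x₀ h1
  refine h2.congr_of_eventuallyEq (Filter.Eventually.of_forall fun x => ?_)
  exact (LinearMap.congr_fun hg (f x)).symm

theorem contMDiffAt_clm {F : Type*} [NormedAddCommGroup F] [NormedSpace ℝ F] {f : M → E →L[ℝ] F}
    {x₀ : M} (h : ∀ u, ContMDiffAt 𝓘(ℝ, E) 𝓘(ℝ, F) ∞ (fun x => f x u) x₀) :
    ContMDiffAt 𝓘(ℝ, E) 𝓘(ℝ, E →L[ℝ] F) ∞ f x₀ := by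
  let b := Module.finBasis ℝ E
  have h1 : f = fun x => ∑ i, ContinuousLinearMap.smulRightL ℝ E F
      (LinearMap.toContinuousLinearMap (b.coord i)) (f x (b i)) := by
    ext x u
    conv_lhs => rw [← b.sum_repr u]
    simp only [_root_.map_sum, _root_.map_smul, _root_.sum_apply]
    rfl
  rw [h1]
  exact ContMDiffAt.sum fun i _ => (ContinuousLinearMap.contMDiff _).contMDiffAt.comp x₀ (h _)

theorem ContMDiffAt.altComp {k : ℕ} {f : M → Alt E k} {A : M → E →L[ℝ] E} {x₀ : M}
    (hf : ContMDiffAt 𝓘(ℝ, E) 𝓘(ℝ, Alt E k) ∞ f x₀)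
    (hA : ContMDiffAt 𝓘(ℝ, E) 𝓘(ℝ, E →L[ℝ] E) ∞ A x₀) :
    ContMDiffAt 𝓘(ℝ, E) 𝓘(ℝ, Alt E k) ∞ (fun x => (f x).compContinuousLinearMap (A x)) x₀ := by
  refine contMDiffAt_alt fun v => ?_
  let b := Module.finBasis ℝ E
  have h1 : (fun x => (f x).compContinuousLinearMap (A x) v) = fun x =>
      ∑ r : Fin k → Fin (Module.finrank ℝ E),
        (∏ i, LinearMap.toContinuousLinearMap (b.coord (r i)) (A x (v i))) • f x (b ∘ r) := by
    funext x
    rw [compContinuousLinearMap_apply]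
    have : (A x ∘ v) = fun i => ∑ j, b.coord j (A x (v i)) • b j :=
      funext fun i => (b.sum_repr _).symm
    rw [this, ContinuousAlternatingMap.map_sum]
    refine Finset.sum_congr rfl fun r _ => ?_
    exact (f x).toMultilinearMap.map_smul_univ _ _
  rw [h1]
  refine ContMDiffAt.sum fun r _ => ?_
  have h2 : ContMDiffAt 𝓘(ℝ, E) 𝓘(ℝ, ℝ) ∞ (fun x =>
      ∏ i, LinearMap.toContinuousLinearMap (b.coord (r i)) (A x (v i))) x₀ :=
    contMDiffAt_finsetProd fun i _ => (ContinuousLinearMap.contMDiff _).contMDiffAt.comp x₀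
      (hA.clm_apply contMDiffAt_const)
  have h3 : ContMDiffAt 𝓘(ℝ, E) 𝓘(ℝ, ℂ) ∞ (fun x => f x (b ∘ r)) x₀ := by
    let ev : Alt E k →ₗ[ℝ] ℂ :=
      { toFun := fun α => α (b ∘ r), map_add' := fun _ _ => rfl, map_smul' := fun _ _ => rfl }
    have hev : Continuous ev := ContinuousEvalConst.continuous_eval_const (b ∘ r)
    exact (ContinuousLinearMap.contMDiff (𝕜 := ℝ) (⟨ev, hev⟩ : Alt E k →L[ℝ] ℂ)).contMDiffAt.comp x₀ hf
  exact h2.smul h3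

variable [IsManifold 𝓘(ℝ, E) ∞ M]

/-- The coordinate change from the preferred chart at `x₀` to the one at `x`, at `x`. -/
def tcEquiv (x₀ x : M) (hx : x ∈ (extChartAt 𝓘(ℝ, E) x₀).source) : E ≃L[ℝ] E :=
  ContinuousLinearEquiv.equivOfInverse' (tangentCoordChange 𝓘(ℝ, E) x₀ x x)
    (tangentCoordChange 𝓘(ℝ, E) x x₀ x)
    (by 
      ext v
      simp only [ContinuousLinearMap.comp_apply]
      rw [tangentCoordChange_comp ⟨⟨mem_extChartAt_source x, hx⟩, mem_extChartAt_source x⟩,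
        tangentCoordChange_self (mem_extChartAt_source x)]; rfl)
    (by 
      ext v
      simp only [ContinuousLinearMap.comp_apply]
      rw [tangentCoordChange_comp ⟨⟨hx, mem_extChartAt_source x⟩, hx⟩,
        tangentCoordChange_self hx]; rfl)

theorem tcEquiv_coe {x₀ x : M} (hx : x ∈ (extChartAt 𝓘(ℝ, E) x₀).source) :
    (tcEquiv x₀ x hx : E →L[ℝ] E) = tangentCoordChange 𝓘(ℝ, E) x₀ x x := rfl

theorem tcEquiv_symm_coe {x₀ x : M} (hx : x ∈ (extChartAt 𝓘(ℝ, E) x₀).source) :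
    ((tcEquiv x₀ x hx).symm : E →L[ℝ] E) = tangentCoordChange 𝓘(ℝ, E) x x₀ x := rfl

open Bundle in
theorem contMDiffAt_section_iff {s : M → E} {x₀ : M} :
    ContMDiffAt 𝓘(ℝ, E) (𝓘(ℝ, E).prod 𝓘(ℝ, E)) ∞
      (fun x => TotalSpace.mk' E (E := fun x : M => TangentSpace 𝓘(ℝ, E) x) x (s x)) x₀ ↔
    ContMDiffAt 𝓘(ℝ, E) 𝓘(ℝ, E) ∞ (fun x => tangentCoordChange 𝓘(ℝ, E) x x₀ x (s x)) x₀ := by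
  exact contMDiffAt_section (F := E) (E := fun x : M => TangentSpace 𝓘(ℝ, E) x) (s := s) x₀

open Bundle in
theorem contMDiffAt_coordField (x₀ : M) (u : E) :
    ContMDiffAt 𝓘(ℝ, E) (𝓘(ℝ, E).prod 𝓘(ℝ, E)) ∞
      (fun x => TotalSpace.mk' E (E := fun x : M => TangentSpace 𝓘(ℝ, E) x) x
        (tangentCoordChange 𝓘(ℝ, E) x₀ x x u)) x₀ := by
  rw [contMDiffAt_section_iff]
  refine (contMDiffAt_const (c := u)).congr_of_eventuallyEq ?_
  filter_upwards [extChartAt_source_mem_nhds (I := 𝓘(ℝ, E)) x₀] with x hx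
  exact (tcEquiv x₀ x hx).symm_apply_apply u

/-- A field of endomorphisms of the tangent spaces, read in the preferred chart at `x₀`. -/
def endInChart (x₀ : M) (A : M → E →L[ℝ] E) (x : M) : E →L[ℝ] E :=
  tangentCoordChange 𝓘(ℝ, E) x x₀ x ∘L A x ∘L tangentCoordChange 𝓘(ℝ, E) x₀ x x

/-- Smoothness of a field of endomorphisms of the tangent spaces. -/
def IsSmoothEnd (A : M → E →L[ℝ] E) : Prop :=
  ∀ x₀ : M, ContMDiffAt 𝓘(ℝ, E) 𝓘(ℝ, E →L[ℝ] E) ∞ (endInChart x₀ A) x₀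

/-- A field of bilinear forms on the tangent spaces, read in the preferred chart at `x₀`. -/
def biInChart (x₀ : M) (g : M → E →L[ℝ] E →L[ℝ] ℝ) (x : M) : E →L[ℝ] E →L[ℝ] ℝ :=
  (g x).bilinearComp (tangentCoordChange 𝓘(ℝ, E) x₀ x x) (tangentCoordChange 𝓘(ℝ, E) x₀ x x)

open Bundle in
theorem isSmoothEnd_of_contMDiff {A : ∀ x : M, TangentSpace 𝓘(ℝ, E) x →L[ℝ] TangentSpace 𝓘(ℝ, E) x}
    (h : ContMDiff 𝓘(ℝ, E) (𝓘(ℝ, E).prod 𝓘(ℝ, E →L[ℝ] E)) ∞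
      (fun x => TotalSpace.mk' (E →L[ℝ] E)
        (E := fun x : M => TangentSpace 𝓘(ℝ, E) x →L[ℝ] TangentSpace 𝓘(ℝ, E) x) x (A x))) :
    IsSmoothEnd (M := M) (E := E) A := by
  intro x₀
  refine contMDiffAt_clm fun u => ?_
  exact contMDiffAt_section_iff.1 ((h x₀).clm_bundle_apply (contMDiffAt_coordField x₀ u))

open Bundle in
theorem contMDiffAt_biInChart
    (g : ContMDiffRiemannianMetric 𝓘(ℝ, E) ∞ E (fun x : M => TangentSpace 𝓘(ℝ, E) x)) (x₀ : M) :
    ContMDiffAt 𝓘(ℝ, E) 𝓘(ℝ, E →L[ℝ] E →L[ℝ] ℝ) ∞ (biInChart x₀ g.inner) x₀ := by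
  refine contMDiffAt_clm fun u => contMDiffAt_clm fun v => ?_
  have : ContMDiffAt 𝓘(ℝ, E) (𝓘(ℝ, E).prod 𝓘(ℝ, ℝ)) ∞
      (fun x ↦ TotalSpace.mk' ℝ (E := Bundle.Trivial M ℝ) x
        (g.inner x (tangentCoordChange 𝓘(ℝ, E) x₀ x x u) (tangentCoordChange 𝓘(ℝ, E) x₀ x x v)))
      x₀ :=
    ContMDiffAt.clm_bundle_apply₂ (F₁ := E) (F₂ := E) g.contMDiff.contMDiffAt
      (contMDiffAt_coordField x₀ u) (contMDiffAt_coordField x₀ v)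
  simp only [contMDiffAt_totalSpace] at this
  exact this.2

end Smoothness

section FormOps
variable {E : Type*} [NormedAddCommGroup E] [NormedSpace ℝ E] [FiniteDimensional ℝ E]
  {M : Type*} [TopologicalSpace M] [ChartedSpace E M] [IsManifold 𝓘(ℝ, E) ∞ M]

theorem IsSmoothForm.pull {k : ℕ} {η : M → Alt E k} (hη : IsSmoothForm η) {A : M → E →L[ℝ] E}
    (hA : IsSmoothEnd A) : IsSmoothForm fun x => (η x).compContinuousLinearMap (A x) := by
  intro x₀
  refine (ContMDiffAt.altComp (hη x₀) (hA x₀)).congr_of_eventuallyEq ?_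
  filter_upwards [extChartAt_source_mem_nhds (I := 𝓘(ℝ, E)) x₀] with x hx
  ext v
  simp only [inChart, compContinuousLinearMap_apply, endInChart]
  congr 1
  ext i
  exact ((tcEquiv x₀ x hx).apply_symm_apply _).symm

/-- Pull-back of differential forms by a smooth field of endomorphisms of the tangent bundle,
`(A^* η)(v₁, …, v_k) = η (A v₁, …, A v_k)`. -/
def pullForm (A : M → E →L[ℝ] E) (hA : IsSmoothEnd A) (k : ℕ) : Form E M k →ₗ[ℂ] Form E M k where
  toFun η := ⟨fun x => (η.1 x).compContinuousLinearMap (A x), η.2.pull hA⟩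
  map_add' _ _ := rfl
  map_smul' _ _ := rfl

theorem IsSmoothForm.wedge {k l : ℕ} {α : M → Alt E k} {β : M → Alt E l} (hα : IsSmoothForm α)
    (hβ : IsSmoothForm β) : IsSmoothForm fun x => wedgeAux k l (α x) (β x) := by
  intro x₀
  have h1 : ContMDiffAt 𝓘(ℝ, E) 𝓘(ℝ, Alt E (l + k)) ∞
      (fun x => wedgeAux k l (inChart x₀ α x) (inChart x₀ β x)) x₀ :=
    ((wedgeAux k l).contMDiff.contMDiffAt.comp x₀ (hα x₀)).clm_apply (hβ x₀)
  exact h1.congr_of_eventuallyEq (Filter.Eventually.of_forall fun x => wedgeAux_comp _ _ _ _ _)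

/-- The exterior product `α ∧ β`. -/
def wedge {k : ℕ} (α : Form E M k) (l : ℕ) : Form E M l →ₗ[ℂ] Form E M (l + k) where
  toFun β := ⟨fun x => ((k.factorial : ℂ)⁻¹) • wedgeAux k l (α.1 x) (β.1 x),
    (Form E M (l + k)).smul_mem ((k.factorial : ℂ)⁻¹) (α.2.wedge β.2)⟩
  map_add' a b := Subtype.ext <| funext fun x => by
    simp only [Submodule.coe_add, Pi.add_apply, _root_.map_add, smul_add]
  map_smul' c b := Subtype.ext <| funext fun x => by
    simp only [Submodule.coe_smul, Pi.smul_apply, wedgeAux_smul, RingHom.id_apply]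
    exact smul_comm _ _ _

theorem IsSmoothForm.conj {k : ℕ} {η : M → Alt E k} (hη : IsSmoothForm η) : IsSmoothForm fun x =>
    (Complex.conjCLE : ℂ →L[ℝ] ℂ).compContinuousAlternatingMap (η x) := by
  intro x₀
  refine contMDiffAt_alt fun v => ?_
  let ev : Alt E k →ₗ[ℝ] ℂ :=
    { toFun := fun α => α v, map_add' := fun _ _ => rfl, map_smul' := fun _ _ => rfl }
  have hev : Continuous ev := ContinuousEvalConst.continuous_eval_const v
  have h1 : ContMDiffAt 𝓘(ℝ, E) 𝓘(ℝ, ℂ) ∞ (fun x => inChart x₀ η x v) x₀ :=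
    (ContinuousLinearMap.contMDiff (𝕜 := ℝ) (⟨ev, hev⟩ : Alt E k →L[ℝ] ℂ)).contMDiffAt.comp x₀
      (hη x₀)
  exact (ContinuousLinearMap.contMDiff (Complex.conjCLE : ℂ →L[ℝ] ℂ)).contMDiffAt.comp x₀ h1

/-- Complex conjugation of forms. -/
def conjForm (k : ℕ) : Form E M k →ₛₗ[starRingEnd ℂ] Form E M k where
  toFun η := ⟨_, η.2.conj⟩
  map_add' a b := Subtype.ext <| funext fun x => ContinuousAlternatingMap.ext fun v =>
    _root_.map_add (starRingEnd ℂ) (a.1 x v) (b.1 x v)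
  map_smul' c b := Subtype.ext <| funext fun x => ContinuousAlternatingMap.ext fun v =>
    _root_.map_mul (starRingEnd ℂ) c (b.1 x v)

open Bundle in
/-- The metric at `x` as a bilinear form on `T_x M = E`. -/
def metricAt (g : ContMDiffRiemannianMetric 𝓘(ℝ, E) ∞ E (fun x : M => TangentSpace 𝓘(ℝ, E) x))
    (x : M) : E →L[ℝ] E →L[ℝ] ℝ := g.inner x

open Bundle in
theorem metricAt_pos
    (g : ContMDiffRiemannianMetric 𝓘(ℝ, E) ∞ E (fun x : M => TangentSpace 𝓘(ℝ, E) x))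
    (x : M) (v : E) (hv : v ≠ 0) : 0 < metricAt g x v v := g.pos x v hv

theorem isInvertible_of_pos (b : E →L[ℝ] E →L[ℝ] ℝ) (hb : ∀ v, v ≠ 0 → 0 < b v v) :
    b.IsInvertible := by
  have hinj : Function.Injective (b : E →ₗ[ℝ] (E →L[ℝ] ℝ)) := by
    rw [← LinearMap.ker_eq_bot, LinearMap.ker_eq_bot']
    intro v hv
    by_contra h
    have h1 := hb v h
    have h2 : b v = 0 := hv
    simp [h2] at h1
  have hdim : Module.finrank ℝ E = Module.finrank ℝ (E →L[ℝ] ℝ) := by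
    rw [← (LinearMap.toContinuousLinearMap : (E →ₗ[ℝ] ℝ) ≃ₗ[ℝ] (E →L[ℝ] ℝ)).finrank_eq]
    exact (Subspace.dual_finrank_eq (K := ℝ) (V := E)).symm
  exact ⟨(LinearEquiv.ofInjectiveOfFinrankEq (b : E →ₗ[ℝ] (E →L[ℝ] ℝ)) hinj
    hdim).toContinuousLinearEquiv, by ext; rfl⟩

theorem bilinearComp_inverse (b : E →L[ℝ] E →L[ℝ] ℝ) (hb : b.IsInvertible) (A : E ≃L[ℝ] E) :
    (b.bilinearComp (A : E →L[ℝ] E) (A : E →L[ℝ] E)).inverse =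
      (A.symm : E →L[ℝ] E) ∘L b.inverse ∘L
        ((ContinuousLinearMap.compL ℝ E E ℝ).flip (A.symm : E →L[ℝ] E)) := by
  apply ContinuousLinearMap.inverse_eq
  · ext ξ v
    simp [hb.self_apply_inverse]
  · ext u
    have : ((b.bilinearComp (A : E →L[ℝ] E) (A : E →L[ℝ] E)) u) ∘L (A.symm : E →L[ℝ] E) = b (A u) := by
      ext; simp
    simp [this, hb.inverse_apply_self]

theorem IsSmoothForm.contract {b : M → E →L[ℝ] E →L[ℝ] ℝ} (hpos : ∀ x v, v ≠ 0 → 0 < b x v v)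
    (hb : ∀ x₀, ContMDiffAt 𝓘(ℝ, E) 𝓘(ℝ, E →L[ℝ] E →L[ℝ] ℝ) ∞ (biInChart x₀ b) x₀)
    {k l : ℕ} {α : M → Alt E k} {β : M → Alt E (l + k)} (hα : IsSmoothForm α)
    (hβ : IsSmoothForm β) : IsSmoothForm fun x => contractAux (b x).inverse k l (α x) (β x) := by
  intro x₀
  have hinv : ∀ x, (b x).IsInvertible := fun x => isInvertible_of_pos _ (hpos x)
  have hinv' : (biInChart x₀ b x₀).IsInvertible := by
    refine isInvertible_of_pos _ fun v hv => ?_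
    refine hpos x₀ (tangentCoordChange 𝓘(ℝ, E) x₀ x₀ x₀ v) fun h => hv ?_
    rwa [tangentCoordChange_self (mem_extChartAt_source x₀)] at h
  have hG : ContMDiffAt 𝓘(ℝ, E) 𝓘(ℝ, (E →L[ℝ] ℝ) →L[ℝ] E) ∞
      (fun x => (biInChart x₀ b x).inverse) x₀ :=
    (hinv'.contDiffAt_map_inverse (n := ∞)).contMDiffAt.comp x₀ (hb x₀)
  have hC : ContMDiffAt 𝓘(ℝ, E) 𝓘(ℝ, Alt E k →L[ℝ] Alt E (l + k) →L[ℝ] Alt E l) ∞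
      (fun x => contractAux ((biInChart x₀ b x).inverse) k l) x₀ :=
    (contDiff_contractAux (E := E) k l).contMDiff.contMDiffAt.comp x₀ hG
  have h1 : ContMDiffAt 𝓘(ℝ, E) 𝓘(ℝ, Alt E l) ∞ (fun x => contractAux
      ((biInChart x₀ b x).inverse) k l (inChart x₀ α x) (inChart x₀ β x)) x₀ :=
    (hC.clm_apply (hα x₀)).clm_apply (hβ x₀)
  refine h1.congr_of_eventuallyEq ?_
  filter_upwards [extChartAt_source_mem_nhds (I := 𝓘(ℝ, E)) x₀] with x hx
  have h2 := contractAux_comp (b x).inverse k l (α x) (β x) (tcEquiv x₀ x hx)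
  have h3 := bilinearComp_inverse _ (hinv x) (tcEquiv x₀ x hx)
  rw [← h3] at h2
  exact h2

open Bundle in
/-- The contraction `α ⌟ β`, complex-bilinear in `α` and `β`. -/
def contract (g : ContMDiffRiemannianMetric 𝓘(ℝ, E) ∞ E (fun x : M => TangentSpace 𝓘(ℝ, E) x))
    (k l : ℕ) : Form E M k →ₗ[ℂ] Form E M (l + k) →ₗ[ℂ] Form E M l :=
  LinearMap.mk₂ ℂ (fun α β => ⟨fun x => ((k.factorial : ℂ)⁻¹) •
        contractAux (metricAt g x).inverse k l (α.1 x) (β.1 x),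
      (Form E M l).smul_mem ((k.factorial : ℂ)⁻¹) (α.2.contract (metricAt_pos g) (contMDiffAt_biInChart g) β.2)⟩)
    (fun a b c => Subtype.ext <| funext fun x => by
      simp only [Submodule.coe_add, Pi.add_apply, _root_.map_add, smul_add, _root_.add_apply])
    (fun c a b => Subtype.ext <| funext fun x => by
      simp only [Submodule.coe_smul, Pi.smul_apply, contractAux_smul_left]
      exact smul_comm _ _ _)
    (fun a b c => Subtype.ext <| funext fun x => by
      simp only [Submodule.coe_add, Pi.add_apply, _root_.map_add, smul_add])
    (fun c a b => Subtype.ext <| funext fun x => by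
      simp only [Submodule.coe_smul, Pi.smul_apply, contractAux_smul]
      exact smul_comm _ _ _)

variable (E M) in
/-- The constant function `1`. -/
def oneForm : Form E M 0 :=
  ⟨fun _ => constOfIsEmpty ℝ E (Fin 0) 1, fun _ => contMDiffAt_const (c := constOfIsEmpty ℝ E (Fin 0) 1)⟩

end FormOps

section Structures
variable (E : Type*) [NormedAddCommGroup E] [NormedSpace ℝ E]
  (M : Type*) [TopologicalSpace M] [ChartedSpace E M] [IsManifold 𝓘(ℝ, E) ∞ M]

open Bundle in
/-- Smooth vector fields on `M`. -/
def IsSmoothField {E : Type*} [NormedAddCommGroup E] [NormedSpace ℝ E] {M : Type*}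
    [TopologicalSpace M] [ChartedSpace E M] [IsManifold 𝓘(ℝ, E) ∞ M]
    (X : ∀ x : M, TangentSpace 𝓘(ℝ, E) x) : Prop :=
  ContMDiff 𝓘(ℝ, E) (𝓘(ℝ, E).prod 𝓘(ℝ, E)) ∞
    fun x => TotalSpace.mk' E (E := fun x : M => TangentSpace 𝓘(ℝ, E) x) x (X x)

open Bundle VectorField in
/-- A hypercomplex structure: a smooth action of the quaternions on the tangent bundle such that each
quaternion `q` with `q² = -1` is an integrable almost complex structure (its Nijenhuis tensor
vanishes). -/
structure HypercomplexStructure where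
  act : ∀ x : M, ℍ[ℝ] →ₐ[ℝ] (TangentSpace 𝓘(ℝ, E) x →L[ℝ] TangentSpace 𝓘(ℝ, E) x)
  contMDiff_act : ∀ q : ℍ[ℝ], ContMDiff 𝓘(ℝ, E) (𝓘(ℝ, E).prod 𝓘(ℝ, E →L[ℝ] E)) ∞
    fun x => TotalSpace.mk' (E →L[ℝ] E)
      (E := fun x : M => TangentSpace 𝓘(ℝ, E) x →L[ℝ] TangentSpace 𝓘(ℝ, E) x) x (act x q)
  integrable : ∀ q : ℍ[ℝ], q * q = -1 → ∀ X Y : ∀ x : M, TangentSpace 𝓘(ℝ, E) x,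
    IsSmoothField X → IsSmoothField Y → ∀ x,
      mlieBracket 𝓘(ℝ, E) X Y x
        + act x q (mlieBracket 𝓘(ℝ, E) (fun y => act y q (X y)) Y x)
        + act x q (mlieBracket 𝓘(ℝ, E) X (fun y => act y q (Y y)) x)
        - mlieBracket 𝓘(ℝ, E) (fun y => act y q (X y)) (fun y => act y q (Y y)) x = 0

open Bundle in
/-- A hypercomplex Hermitian structure: a hypercomplex structure with a Riemannian metric that is
Hermitian for each induced complex structure. -/
structure HypercomplexHermitian extends HypercomplexStructure E M where
  metric : ContMDiffRiemannianMetric 𝓘(ℝ, E) ∞ E (fun x : M => TangentSpace 𝓘(ℝ, E) x)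
  hermitian : ∀ q : ℍ[ℝ], q * q = -1 → ∀ (x : M) (u v : TangentSpace 𝓘(ℝ, E) x),
    metric.inner x (act x q u) (act x q v) = metric.inner x u v

end Structures

section Ops
variable {E : Type*} [NormedAddCommGroup E] [NormedSpace ℝ E] [FiniteDimensional ℝ E]
  {M : Type*} [TopologicalSpace M] [ChartedSpace E M] [IsManifold 𝓘(ℝ, E) ∞ M]

/-- The action of the quaternion `q` on `T_x M = E`. -/
def HypercomplexStructure.endo (X : HypercomplexStructure E M) (q : ℍ[ℝ]) (x : M) : E →L[ℝ] E :=
  X.act x q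

theorem HypercomplexStructure.isSmoothEnd (X : HypercomplexStructure E M) (q : ℍ[ℝ]) :
    IsSmoothEnd (X.endo q) := isSmoothEnd_of_contMDiff (X.contMDiff_act q)

/-- The imaginary unit quaternions. -/
abbrev ImagUnit : Type := {q : ℍ[ℝ] // q * q = -1}

theorem quaternion_sq (q : ℍ[ℝ]) (h : q.re = 0)
    (h' : q.imI * q.imI + q.imJ * q.imJ + q.imK * q.imK = 1) : q * q = -1 := by
  ext
  · rw [Quaternion.re_mul, h, Quaternion.re_neg, Quaternion.re_one]; linarith
  · rw [Quaternion.imI_mul, h, Quaternion.imI_neg, Quaternion.imI_one]; ring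
  · rw [Quaternion.imJ_mul, h, Quaternion.imJ_neg, Quaternion.imJ_one]; ring
  · rw [Quaternion.imK_mul, h, Quaternion.imK_neg, Quaternion.imK_one]; ring

/-- The quaternion `I`. -/
def qI : ImagUnit := ⟨⟨0, 1, 0, 0⟩, quaternion_sq _ rfl (by norm_num)⟩

/-- The quaternion `J`. -/
def qJ : ImagUnit := ⟨⟨0, 0, 1, 0⟩, quaternion_sq _ rfl (by norm_num)⟩

/-- The quaternion `K`. -/
def qK : ImagUnit := ⟨⟨0, 0, 0, 1⟩, quaternion_sq _ rfl (by norm_num)⟩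

theorem qI_mul_qJ : qI.1 * qJ.1 = qK.1 := by
  ext
  · rw [Quaternion.re_mul]; norm_num [qI, qJ, qK]
  · rw [Quaternion.imI_mul]; norm_num [qI, qJ, qK]
  · rw [Quaternion.imJ_mul]; norm_num [qI, qJ, qK]
  · rw [Quaternion.imK_mul]; norm_num [qI, qJ, qK]

/-- The 2-form `(u, v) ↦ g (u, A v)`. -/
def twoForm (g : E →L[ℝ] E →L[ℝ] ℝ) (A : E →L[ℝ] E) (h : ∀ v, g v (A v) = 0) : Alt E 2 where
  toFun v := (g (v 0) (A (v 1)) : ℂ)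
  map_update_add' := by
    intro inst v i x y
    rw [Subsingleton.elim inst (instDecidableEqFin 2)]
    fin_cases i <;> simp
  map_update_smul' := by
    intro inst v i c x
    rw [Subsingleton.elim inst (instDecidableEqFin 2)]
    fin_cases i <;> simp
  cont := by
    refine Complex.continuous_ofReal.comp ?_
    fun_prop
  map_eq_zero_of_eq' := by
    intro v i j hv hij
    have : v 0 = v 1 := by
      fin_cases i <;> fin_cases j <;> simp_all
    simp [this, h]

namespace HypercomplexHermitian
variable (X : HypercomplexHermitian E M)

theorem skew (q : ImagUnit) (x : M) (v : E) :
    metricAt X.metric x v (X.endo q.1 x v) = 0 := by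
  have h1 := X.hermitian q.1 q.2 x v (X.act x q.1 v)
  have h2 : X.act x q.1 (X.act x q.1 v) = -v := by
    have h : X.act x q.1 * X.act x q.1 = -1 := by rw [← map_mul, q.2, map_neg, map_one]
    exact congrArg (fun f => f v) h
  rw [h2] at h1
  have h3 := X.metric.symm x (X.act x q.1 v) v
  have h4 : X.metric.inner x (X.act x q.1 v) (-v) = - X.metric.inner x (X.act x q.1 v) v :=
    _root_.map_neg _ _
  have h5 : X.metric.inner x v (X.act x q.1 v) = 0 := by linarith
  exact h5

/-- The fundamental form `ω_q (u, v) = g (u, q v)` of the induced complex structure `q`. -/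
def kahlerForm (q : ImagUnit) : Form E M 2 :=
  ⟨fun x => twoForm (metricAt X.metric x) (X.endo q.1 x) (X.skew q x), by
    intro x₀
    refine contMDiffAt_alt fun v => ?_
    have h1 : ContMDiffAt 𝓘(ℝ, E) 𝓘(ℝ, ℝ) ∞ (fun x => biInChart x₀ (metricAt X.metric) x (v 0)
        (endInChart x₀ (X.endo q.1) x (v 1))) x₀ :=
      ((contMDiffAt_biInChart X.metric x₀).clm_apply contMDiffAt_const).clm_apply
        ((X.isSmoothEnd q.1 x₀).clm_apply contMDiffAt_const)
    refine (Complex.ofRealCLM.contMDiff.contMDiffAt.comp x₀ h1).congr_of_eventuallyEq ?_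
    filter_upwards [extChartAt_source_mem_nhds (I := 𝓘(ℝ, E)) x₀] with x hx
    have h2 : ∀ w, tangentCoordChange 𝓘(ℝ, E) x₀ x x (tangentCoordChange 𝓘(ℝ, E) x x₀ x w) = w :=
      (tcEquiv x₀ x hx).apply_symm_apply
    simp only [Function.comp_apply, biInChart, endInChart, ContinuousLinearMap.bilinearComp_apply,
      ContinuousLinearMap.comp_apply, h2]
    rfl⟩

theorem kahlerForm_apply (q : ImagUnit) (x : M) (v : Fin 2 → E) :
    (X.kahlerForm q).1 x v = (X.metric.inner x (v 0) (X.act x q.1 (v 1)) : ℂ) := rfl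

/-- The manifold is hyperkähler: the metric is Kähler for each induced complex structure. -/
def IsHyperkahler : Prop := ∀ q : ImagUnit, dForm E M 2 (X.kahlerForm q) = 0

end HypercomplexHermitian
end Ops

section AllForms
variable {E : Type*} [NormedAddCommGroup E] [NormedSpace ℝ E] [FiniteDimensional ℝ E]
  {M : Type*} [TopologicalSpace M] [ChartedSpace E M] [IsManifold 𝓘(ℝ, E) ∞ M]

variable (E M) in
/-- The space `Λ^*(M)` of complex-valued smooth differential forms on `M`, the product of the
spaces `Λ^k(M)`; `Λ^k(M) = 0` for `k > dim M`, so this is also their direct sum. -/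
abbrev AllForms : Type _ := ∀ k : ℕ, Form E M k

instance : AddCommGroup (AllForms E M) := Pi.addCommGroup

instance : Module ℂ (AllForms E M) := Pi.module _ _ _

variable (E M) in
/-- The complex-linear operators on `Λ^*(M)`. -/
abbrev FormEnd : Type _ := AllForms E M →ₗ[ℂ] AllForms E M

instance : AddCommGroup (FormEnd E M) := LinearMap.addCommGroup

instance : Module ℂ (FormEnd E M) := LinearMap.module

variable (E M) in
/-- The de Rham differential on `Λ^*(M)`. -/
def dOp : FormEnd E M := LinearMap.pi fun k => match k with
  | 0 => 0
  | k + 1 => dForm E M k ∘ₗ LinearMap.proj k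

/-- Exterior multiplication by a 2-form. -/
def wedgeOp (w : Form E M 2) : FormEnd E M := LinearMap.pi fun k => match k with
  | 0 => 0
  | 1 => 0
  | k + 2 => wedge w k ∘ₗ LinearMap.proj k

open Bundle in
/-- The Hermitian adjoint of exterior multiplication by the 2-form `w`: contraction, by means of the
metric, with the complex conjugate of `w`. -/
def contractOp (g : ContMDiffRiemannianMetric 𝓘(ℝ, E) ∞ E (fun x : M => TangentSpace 𝓘(ℝ, E) x))
    (w : Form E M 2) : FormEnd E M :=
  LinearMap.pi fun l => contract g 2 l (conjForm 2 w) ∘ₗ LinearMap.proj (l + 2)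

/-- Multiplication of `k`-forms by the scalar `c k`. -/
def gradeOp (c : ℕ → ℂ) : FormEnd E M := LinearMap.pi fun k => c k • LinearMap.proj k

variable (E M) in
/-- The parity operator, `(-1)^k` on `k`-forms. -/
def parityOp : FormEnd E M := gradeOp fun k => (-1) ^ k

variable (E M) in
/-- Complex conjugation on `Λ^*(M)`. -/
def conjAll : AllForms E M →ₛₗ[starRingEnd ℂ] AllForms E M where
  toFun η k := conjForm k (η k)
  map_add' _ _ := funext fun _ => _root_.map_add _ _ _
  map_smul' c η := funext fun k => (conjForm k).map_smulₛₗ c (η k)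

/-- The complex conjugate `η ↦ conj (P (conj η))` of an operator. -/
def conjOp (P : FormEnd E M) : FormEnd E M :=
  ((conjAll E M).comp P).comp (conjAll E M)

/-- An operator is even if it preserves the parity of forms. -/
def IsEvenOp (A : FormEnd E M) : Prop := parityOp E M ∘ₗ A = A ∘ₗ parityOp E M

/-- An operator is odd if it reverses the parity of forms. -/
def IsOddOp (A : FormEnd E M) : Prop := parityOp E M ∘ₗ A = -(A ∘ₗ parityOp E M)

/-- The even component of an operator. -/
def evenPart (A : FormEnd E M) : FormEnd E M :=
  (2 : ℂ)⁻¹ • (A + parityOp E M ∘ₗ A ∘ₗ parityOp E M)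

/-- The odd component of an operator. -/
def oddPart (A : FormEnd E M) : FormEnd E M :=
  (2 : ℂ)⁻¹ • (A - parityOp E M ∘ₗ A ∘ₗ parityOp E M)

/-- The supercommutator: `A B - B A` if `A` or `B` is even, `A B + B A` if both are odd, extended
bilinearly. -/
def superBracket (A B : FormEnd E M) : FormEnd E M :=
  A ∘ₗ B - evenPart B ∘ₗ A - oddPart B ∘ₗ (evenPart A - oddPart A)

theorem parityOp_parityOp : parityOp E M ∘ₗ parityOp E M = LinearMap.id := by
  ext η k : 2
  simp only [parityOp, gradeOp, LinearMap.comp_apply, LinearMap.pi_apply, LinearMap.smul_apply,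
    LinearMap.proj_apply, LinearMap.id_apply, smul_smul, ← mul_pow]
  simp

theorem parityOp_sandwich (A : FormEnd E M) (h : IsEvenOp A) :
    parityOp E M ∘ₗ A ∘ₗ parityOp E M = A := by
  rw [← h, ← LinearMap.comp_assoc, parityOp_parityOp, LinearMap.id_comp]

theorem parityOp_sandwich_odd (A : FormEnd E M) (h : IsOddOp A) :
    parityOp E M ∘ₗ A ∘ₗ parityOp E M = -A := by
  rw [← LinearMap.comp_assoc, h, LinearMap.neg_comp, LinearMap.comp_assoc, parityOp_parityOp,
    LinearMap.comp_id]

theorem IsEvenOp.evenPart_eq {A : FormEnd E M} (h : IsEvenOp A) : evenPart A = A := by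
  rw [evenPart, parityOp_sandwich A h, ← two_smul ℂ, smul_smul]; norm_num

theorem IsEvenOp.oddPart_eq {A : FormEnd E M} (h : IsEvenOp A) : oddPart A = 0 := by
  rw [oddPart, parityOp_sandwich A h, sub_self, smul_zero]

theorem IsOddOp.evenPart_eq {A : FormEnd E M} (h : IsOddOp A) : evenPart A = 0 := by
  rw [evenPart, parityOp_sandwich_odd A h, add_neg_cancel, smul_zero]

theorem IsOddOp.oddPart_eq {A : FormEnd E M} (h : IsOddOp A) : oddPart A = A := by
  rw [oddPart, parityOp_sandwich_odd A h, sub_neg_eq_add, ← two_smul ℂ, smul_smul]; norm_num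

theorem superBracket_of_even {A B : FormEnd E M} (h : IsEvenOp B) :
    superBracket A B = A ∘ₗ B - B ∘ₗ A := by
  rw [superBracket, h.evenPart_eq, h.oddPart_eq, LinearMap.zero_comp, sub_zero]

theorem superBracket_even_odd {A B : FormEnd E M} (hA : IsEvenOp A) (hB : IsOddOp B) :
    superBracket A B = A ∘ₗ B - B ∘ₗ A := by
  rw [superBracket, hB.evenPart_eq, hB.oddPart_eq, hA.evenPart_eq, hA.oddPart_eq,
    LinearMap.zero_comp, sub_zero, sub_zero]

theorem superBracket_odd_odd {A B : FormEnd E M} (hA : IsOddOp A) (hB : IsOddOp B) :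
    superBracket A B = A ∘ₗ B + B ∘ₗ A := by
  rw [superBracket, hB.evenPart_eq, hB.oddPart_eq, hA.evenPart_eq, hA.oddPart_eq,
    LinearMap.zero_comp, sub_zero, zero_sub, LinearMap.comp_neg, sub_neg_eq_add]

/-- A space of operators is closed under the supercommutator. -/
def IsSuperClosed (S : Submodule ℂ (FormEnd E M)) : Prop :=
  ∀ A ∈ S, ∀ B ∈ S, superBracket A B ∈ S

/-- The Lie superalgebra of operators on `Λ^*(M)` generated by a set of operators. -/
def superAlgebraGenerated (s : Set (FormEnd E M)) : Submodule ℂ (FormEnd E M) :=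
  sInf {S | s ⊆ S ∧ IsSuperClosed S}

theorem superAlgebraGenerated_isSuperClosed (s : Set (FormEnd E M)) :
    IsSuperClosed (superAlgebraGenerated s) := fun A hA B hB =>
  Submodule.mem_sInf.2 fun S hS =>
    hS.2 A (Submodule.mem_sInf.1 hA S hS) B (Submodule.mem_sInf.1 hB S hS)

namespace HypercomplexStructure
variable (X : HypercomplexStructure E M)

/-- `(q^* η)(v₁, …, v_k) = η (q v₁, …, q v_k)`. -/
def quatOp (q : ℍ[ℝ]) : FormEnd E M :=
  LinearMap.pi fun k => pullForm (X.endo q) (X.isSmoothEnd q) k ∘ₗ LinearMap.proj k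

/-- The complex number `a + b i` acting on `T M` as `a + b q`. -/
def complexEndo (q : ImagUnit) (z : ℂ) : ℍ[ℝ] := (z.re : ℍ[ℝ]) + z.im • q.1

/-- The `k`-form `η` is of Hodge type `(p, k - p)` with respect to the complex structure `q`
(where `p ≤ k`): `η (z v₁, …, z v_k) = z^p \bar z^(k-p) η (v₁, …, v_k)` for all complex `z`. -/
def IsType (q : ImagUnit) (k p : ℕ) (η : Form E M k) : Prop :=
  ∀ z : ℂ, pullForm (X.endo (complexEndo q z)) (X.isSmoothEnd _) k η =
    (z ^ p * (starRingEnd ℂ z) ^ (k - p)) • η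

/-- The projection of `Λ^k(M)` to forms of Hodge type `(p, k - p)`, for `p ≤ k`. -/
def typeProj (q : ImagUnit) (k p : ℕ) : Form E M k →ₗ[ℂ] Form E M k :=
  (2 * k + 1 : ℂ)⁻¹ • ∑ s ∈ Finset.range (2 * k + 1),
    Complex.exp (-(2 * Real.pi * Complex.I * s * (2 * p - k) / (2 * k + 1))) •
      pullForm (X.endo (complexEndo q (Complex.exp (2 * Real.pi * Complex.I * s / (2 * k + 1)))))
        (X.isSmoothEnd _) k

/-- The Dolbeault differential `∂` of the complex structure `q`, the part of `d` of type `(1,0)`. -/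
def delOp (q : ImagUnit) : FormEnd E M := LinearMap.pi fun k => match k with
  | 0 => 0
  | k + 1 => (∑ p ∈ Finset.range (k + 1),
      X.typeProj q (k + 1) (p + 1) ∘ₗ dForm E M k ∘ₗ X.typeProj q k p) ∘ₗ LinearMap.proj k

/-- The Dolbeault differential of type `(0,1)`. -/
def delBarOp (q : ImagUnit) : FormEnd E M := LinearMap.pi fun k => match k with
  | 0 => 0
  | k + 1 => (∑ p ∈ Finset.range (k + 1),
      X.typeProj q (k + 1) p ∘ₗ dForm E M k ∘ₗ X.typeProj q k p) ∘ₗ LinearMap.proj k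

/-- The operator `ad q`, equal to `√-1 (p - r)` on forms of type `(p, r)` with respect to `q`. -/
def adOp (q : ImagUnit) : FormEnd E M := LinearMap.pi fun k =>
  (∑ p ∈ Finset.range (k + 1), (Complex.I * (2 * p - k)) • X.typeProj q k p) ∘ₗ LinearMap.proj k

/-- `∂_J = J⁻¹ ∘ \bar∂ ∘ J`, with `\bar∂` the `(0,1)` Dolbeault differential of `I`, and `J` acting on
forms multiplicatively; `J⁻¹` is the action of the quaternion `-J`. -/
def delJOp : FormEnd E M := X.quatOp (-qJ.1) ∘ₗ X.delBarOp qI ∘ₗ X.quatOp qJ.1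

end HypercomplexStructure

namespace HypercomplexHermitian
variable (X : HypercomplexHermitian E M)

/-- `L_q`, exterior multiplication by the fundamental form `ω_q`. -/
def lefschetz (q : ImagUnit) : FormEnd E M := wedgeOp (X.kahlerForm q)

/-- `Λ_q`, the Hermitian adjoint of `L_q`. -/
def lefschetzDual (q : ImagUnit) : FormEnd E M := contractOp X.metric (X.kahlerForm q)

variable (E M) in
/-- `H`, equal to `k - dim M / 2` on `k`-forms. -/
def degreeOp : FormEnd E M := gradeOp fun k => k - (Module.finrank ℝ E : ℂ) / 2

/-- The Riemannian volume form `ω_I^N / N!`, with `N = dim M / 2`. -/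
def volForm : AllForms E M :=
  ((Module.finrank ℝ E / 2).factorial : ℂ)⁻¹ •
    ((X.lefschetz qI) ^ (Module.finrank ℝ E / 2)) (Pi.single 0 (oneForm E M))

/-- The (complex-linear) Hodge star operator: `*η` is the contraction of the volume form with `η`. -/
def star : FormEnd E M := LinearMap.pi fun l =>
  ∑ k ∈ Finset.range (Module.finrank ℝ E + 1),
    (contract X.metric k l).flip (X.volForm (l + k)) ∘ₗ LinearMap.proj k

/-- The formal Hermitian adjoint `- * \bar P *` of a differential `P`. -/
def starAdjoint (P : FormEnd E M) : FormEnd E M := -(X.star ∘ₗ conjOp P ∘ₗ X.star)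

/-- The Laplacian `d d^* + d^* d`. -/
def laplacian : FormEnd E M :=
  dOp E M ∘ₗ X.starAdjoint (dOp E M) + X.starAdjoint (dOp E M) ∘ₗ dOp E M

/-- The (complexified) hyperkähler-de Rham superalgebra acting on `Λ^*(M)`: the Lie superalgebra of
operators generated by `L_q, Λ_q, ad q` (`q = I, J, K`), `H` and the de Rham differential `d`. -/
def hyperkahlerDeRham : Submodule ℂ (FormEnd E M) :=
  superAlgebraGenerated
    ({X.lefschetz qI, X.lefschetz qJ, X.lefschetz qK,
      X.lefschetzDual qI, X.lefschetzDual qJ, X.lefschetzDual qK, degreeOp E M,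
      X.adOp qI, X.adOp qJ, X.adOp qK} ∪ {dOp E M})

/-- The form `Ω = (ω_J + √-1 ω_K) / 2`. -/
def omegaForm : Form E M 2 := (2 : ℂ)⁻¹ • (X.kahlerForm qJ + Complex.I • X.kahlerForm qK)

/-- `L_Ω`, exterior multiplication by `Ω`. -/
def opL : FormEnd E M := wedgeOp X.omegaForm

/-- `Λ_Ω`, the Hermitian adjoint of `L_Ω`. -/
def opLambda : FormEnd E M := contractOp X.metric X.omegaForm

/-- `H_Ω = [L_Ω, Λ_Ω]`. -/
def opH : FormEnd E M := superBracket X.opL X.opLambda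

/-- The Dolbeault differential `∂` of `(M, I)`. -/
def opDel : FormEnd E M := X.delOp qI

/-- The operator `∂_J`. -/
def opDelJ : FormEnd E M := X.delJOp

/-- The eight operators `L_Ω, Λ_Ω, H_Ω, ∂, ∂^*, ∂_J, ∂_J^*, Δ`. -/
def dolbeaultOps : Fin 8 → FormEnd E M :=
  ![X.opL, X.opLambda, X.opH, X.opDel, X.starAdjoint X.opDel, X.opDelJ, X.starAdjoint X.opDelJ,
    X.laplacian]

/-- The linear span of the eight operators. -/
def dolbeaultSpan : Submodule ℂ (FormEnd E M) := Submodule.span ℂ (Set.range X.dolbeaultOps)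

end HypercomplexHermitian
end AllForms

section TypeDecomposition

/-- The functions spanned by `z ↦ z^p \bar z^r`, `p + r = k`. -/
def biPoly (k : ℕ) : Submodule ℂ (ℂ → ℂ) :=
  Submodule.span ℂ {f | ∃ p r, p + r = k ∧ f = fun z => z ^ p * (starRingEnd ℂ z) ^ r}

theorem biPoly_mul {k : ℕ} {f : ℂ → ℂ} (hf : f ∈ biPoly k) (α β : ℂ) :
    (fun z => (α * z + β * starRingEnd ℂ z) * f z) ∈ biPoly (k + 1) := by
  induction hf using Submodule.span_induction with
  | mem f hf =>
    obtain ⟨p, r, hpr, rfl⟩ := hf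
    have h1 : (fun z : ℂ => z ^ (p + 1) * (starRingEnd ℂ z) ^ r) ∈ biPoly (k + 1) :=
      Submodule.subset_span ⟨p + 1, r, by omega, rfl⟩
    have h2 : (fun z : ℂ => z ^ p * (starRingEnd ℂ z) ^ (r + 1)) ∈ biPoly (k + 1) :=
      Submodule.subset_span ⟨p, r + 1, by omega, rfl⟩
    convert (biPoly (k + 1)).add_mem ((biPoly (k + 1)).smul_mem α h1)
      ((biPoly (k + 1)).smul_mem β h2) using 1
    funext z
    simp only [Pi.add_apply, Pi.smul_apply, smul_eq_mul]
    ring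
  | zero => convert (biPoly (k + 1)).zero_mem using 1; funext z; simp
  | add f g _ _ hf hg =>
    convert (biPoly (k + 1)).add_mem hf hg using 1
    funext z; simp only [Pi.add_apply]; ring
  | smul c f _ hf =>
    convert (biPoly (k + 1)).smul_mem c hf using 1
    funext z; simp only [Pi.smul_apply, smul_eq_mul]; ring

/-- The average of `f` over the roots of unity of order `2 k + 1`, which is the coefficient of
`z ^ p * \bar z ^ (k - p)`. -/
def rootAvg (k p : ℕ) (f : ℂ → ℂ) : ℂ :=
  (2 * k + 1 : ℂ)⁻¹ * ∑ s ∈ Finset.range (2 * k + 1),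
    Complex.exp (-(2 * Real.pi * Complex.I * s * (2 * p - k) / (2 * k + 1))) *
      f (Complex.exp (2 * Real.pi * Complex.I * s / (2 * k + 1)))

theorem rootAvg_add (k p : ℕ) (f g : ℂ → ℂ) :
    rootAvg k p (f + g) = rootAvg k p f + rootAvg k p g := by
  simp only [rootAvg, Pi.add_apply, mul_add, Finset.sum_add_distrib]

theorem rootAvg_smul (k p : ℕ) (c : ℂ) (f : ℂ → ℂ) :
    rootAvg k p (c • f) = c * rootAvg k p f := by
  simp only [rootAvg, Pi.smul_apply, smul_eq_mul, Finset.mul_sum]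
  exact Finset.sum_congr rfl fun _ _ => by ring

theorem rootAvg_monomial {k p p' : ℕ} (hp : p ≤ k) (hp' : p' ≤ k) :
    rootAvg k p (fun z => z ^ p' * (starRingEnd ℂ z) ^ (k - p')) = if p' = p then 1 else 0 := by
  have hN : (2 * k + 1 : ℂ) ≠ 0 := by exact_mod_cast Nat.succ_ne_zero (2 * k)
  have hterm : ∀ s : ℕ,
      Complex.exp (-(2 * Real.pi * Complex.I * s * (2 * p - k) / (2 * k + 1))) *
        (Complex.exp (2 * Real.pi * Complex.I * s / (2 * k + 1)) ^ p' *
          (starRingEnd ℂ (Complex.exp (2 * Real.pi * Complex.I * s / (2 * k + 1)))) ^ (k - p')) =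
      Complex.exp (2 * Real.pi * Complex.I * (2 * ((p' : ℂ) - p)) / (2 * k + 1)) ^ s := by
    intro s
    rw [← Complex.exp_conj, ← Complex.exp_nat_mul, ← Complex.exp_nat_mul, ← Complex.exp_nat_mul,
      ← Complex.exp_add, ← Complex.exp_add]
    congr 1
    rw [Nat.cast_sub hp']
    simp only [map_div₀, map_mul, map_add, Complex.conj_I, Complex.conj_ofReal, map_natCast,
      map_ofNat, map_one]
    field_simp
    ring
  rw [rootAvg, Finset.sum_congr rfl fun s _ => hterm s]
  split_ifs with h
  · subst h
    simp only [sub_self, mul_zero, zero_div, Complex.exp_zero, one_pow, Finset.sum_const,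
      Finset.card_range, nsmul_eq_mul, mul_one]
    push_cast
    exact inv_mul_cancel₀ hN
  · rw [geom_sum_eq, ← Complex.exp_nat_mul]
    · have : ((2 * k + 1 : ℕ) : ℂ) * (2 * Real.pi * Complex.I * (2 * ((p' : ℂ) - p)) / (2 * k + 1)) =
          ((2 * ((p' : ℤ) - p) : ℤ) : ℂ) * (2 * Real.pi * Complex.I) := by
        push_cast; field_simp
      rw [this, Complex.exp_int_mul_two_pi_mul_I, sub_self, zero_div, mul_zero]
    · intro h1
      obtain ⟨n, hn⟩ := Complex.exp_eq_one_iff.1 h1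
      have h2 : ((2 * ((p' : ℤ) - p) : ℤ) : ℂ) = ((n * (2 * k + 1) : ℤ) : ℂ) := by
        have := Complex.two_pi_I_ne_zero
        push_cast
        rw [div_eq_iff hN] at hn
        apply mul_left_cancel₀ this
        rw [hn]; ring
      have h3 : 2 * ((p' : ℤ) - p) = n * (2 * k + 1) := by exact_mod_cast h2
      have h4 : n = 0 := by
        by_contra h5
        rcases lt_or_gt_of_ne h5 with h6 | h6 <;> nlinarith
      rw [h4] at h3
      omega

theorem sum_rootAvg {k : ℕ} {f : ℂ → ℂ} (hf : f ∈ biPoly k) :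
    ∑ p ∈ Finset.range (k + 1), rootAvg k p f = f 1 := by
  induction hf using Submodule.span_induction with
  | mem f hf =>
    obtain ⟨p', r, hpr, rfl⟩ := hf
    obtain rfl : r = k - p' := by omega
    rw [Finset.sum_congr rfl fun p hp => rootAvg_monomial (p' := p')
      (by have := Finset.mem_range.1 hp; omega : p ≤ k) (by omega)]
    rw [Finset.sum_ite_eq, if_pos (Finset.mem_range.2 (by omega))]
    simp
  | zero => simp [rootAvg]
  | add f g _ _ hf hg => simp only [rootAvg_add, Finset.sum_add_distrib, hf, hg, Pi.add_apply]
  | smul c f _ hf => simp only [rootAvg_smul, ← Finset.mul_sum, hf, Pi.smul_apply, smul_eq_mul]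

theorem rootAvg_scale {k p : ℕ} (hp : p ≤ k) {f : ℂ → ℂ} (hf : f ∈ biPoly k) (w : ℂ) :
    rootAvg k p (fun z => f (z * w)) =
      (w ^ p * (starRingEnd ℂ w) ^ (k - p)) * rootAvg k p f := by
  induction hf using Submodule.span_induction with
  | mem f hf =>
    obtain ⟨p', r, hpr, rfl⟩ := hf
    obtain rfl : r = k - p' := by omega
    have h1 : (fun z : ℂ => (z * w) ^ p' * (starRingEnd ℂ (z * w)) ^ (k - p')) =
        (w ^ p' * (starRingEnd ℂ w) ^ (k - p')) •
          fun z : ℂ => z ^ p' * (starRingEnd ℂ z) ^ (k - p') := by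
      funext z
      simp only [map_mul, mul_pow, Pi.smul_apply, smul_eq_mul]
      ring
    rw [h1, rootAvg_smul, rootAvg_monomial hp (by omega)]
    split_ifs with h
    · rw [h]
    · simp
  | zero => simp [rootAvg]
  | add f g _ _ hf hg =>
    have h := rootAvg_add k p (fun z => f (z * w)) (fun z => g (z * w))
    rw [rootAvg_add, mul_add, ← hf, ← hg, ← h]; rfl
  | smul c f _ hf =>
    have h := rootAvg_smul k p c (fun z => f (z * w))
    rw [rootAvg_smul, mul_left_comm, ← hf, ← h]; rfl

theorem biPoly_of_alt {E : Type*} [NormedAddCommGroup E] [NormedSpace ℝ E] (A : E →L[ℝ] E) {k : ℕ}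
    (α : Alt E k) (v : Fin k → E) :
    (fun z : ℂ => α fun i => z.re • v i + z.im • A (v i)) ∈ biPoly k := by
  induction k with
  | zero =>
    have h1 : (fun z : ℂ => z ^ 0 * (starRingEnd ℂ z) ^ 0) ∈ biPoly 0 :=
      Submodule.subset_span ⟨0, 0, rfl, rfl⟩
    convert (biPoly 0).smul_mem (α v) h1 using 1
    funext z
    simp only [pow_zero, mul_one, Pi.smul_apply, smul_eq_mul]
    congr 1
    exact Subsingleton.elim _ _
  | succ k ih =>
    have h1 := biPoly_mul (ih (α.curryLeft (v 0)) (Fin.tail v)) (1 / 2) (1 / 2)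
    have h2 := biPoly_mul (ih (α.curryLeft (A (v 0))) (Fin.tail v))
      (-Complex.I / 2) (Complex.I / 2)
    convert (biPoly (k + 1)).add_mem h1 h2 using 1
    funext z
    have h3 : (fun i => z.re • v i + z.im • A (v i)) =
        Fin.cons (z.re • v 0 + z.im • A (v 0))
          (fun i => z.re • Fin.tail v i + z.im • A (Fin.tail v i)) := by
      funext i
      refine Fin.cases ?_ (fun j => ?_) i
      · simp
      · simp [Fin.tail]
    have h4 : ∀ (u : E) (w : Fin k → E), α (Fin.cons u w) = α.curryLeft u w := fun _ _ => rfl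
    have h5 : (z.re : ℂ) = 1 / 2 * z + 1 / 2 * starRingEnd ℂ z := by
      rw [Complex.re_eq_add_conj]; ring
    have h6 : (z.im : ℂ) = -Complex.I / 2 * z + Complex.I / 2 * starRingEnd ℂ z := by
      rw [Complex.im_eq_sub_conj]; field_simp; ring_nf; simp; ring
    rw [h3, h4, _root_.map_add, _root_.map_smul, _root_.map_smul]
    simp only [Pi.add_apply, ← h5, ← h6, ContinuousAlternatingMap.add_apply,
      ContinuousAlternatingMap.smul_apply, Complex.real_smul]

variable {E : Type*} [NormedAddCommGroup E] [NormedSpace ℝ E] [FiniteDimensional ℝ E]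
  {M : Type*} [TopologicalSpace M] [ChartedSpace E M] [IsManifold 𝓘(ℝ, E) ∞ M]

namespace HypercomplexStructure
variable (X : HypercomplexStructure E M)

theorem endo_complexEndo (q : ImagUnit) (z : ℂ) (x : M) (v : E) :
    X.endo (complexEndo q z) x v = z.re • v + z.im • X.endo q.1 x v := by
  have h : X.act x (complexEndo q z) = z.re • 1 + z.im • X.act x q.1 := by
    rw [complexEndo, _root_.map_add, _root_.map_smul, ← Algebra.algebraMap_eq_smul_one]
    congr 1
    exact (X.act x).commutes z.re
  exact congrArg (fun f => f v) h

theorem endo_mul_self (q : ImagUnit) (x : M) (v : E) :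
    X.endo q.1 x (X.endo q.1 x v) = -v := by
  have h : X.act x q.1 * X.act x q.1 = -1 := by rw [← map_mul, q.2, map_neg, map_one]
  exact congrArg (fun f => f v) h

theorem endo_complexEndo_mul (q : ImagUnit) (z w : ℂ) (x : M) (v : E) :
    X.endo (complexEndo q z) x (X.endo (complexEndo q w) x v) =
      X.endo (complexEndo q (z * w)) x v := by
  simp only [endo_complexEndo, _root_.map_add, _root_.map_smul, endo_mul_self, Complex.mul_re,
    Complex.mul_im]
  module

theorem typeProj_apply (q : ImagUnit) (k p : ℕ) (η : Form E M k) (x : M) (v : Fin k → E) :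
    (X.typeProj q k p η).1 x v =
      rootAvg k p fun z => η.1 x fun i => X.endo (complexEndo q z) x (v i) := by
  let T : Form E M k →ₗ[ℂ] ℂ :=
    { toFun := fun η => η.1 x v, map_add' := fun _ _ => rfl, map_smul' := fun _ _ => rfl }
  change T (X.typeProj q k p η) = _
  rw [typeProj, LinearMap.smul_apply, LinearMap.sum_apply, _root_.map_smul, _root_.map_sum]
  rfl

theorem mem_biPoly (q : ImagUnit) {k : ℕ} (η : Form E M k) (x : M) (v : Fin k → E) :
    (fun z => η.1 x fun i => X.endo (complexEndo q z) x (v i)) ∈ biPoly k := by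
  simp only [endo_complexEndo]
  exact biPoly_of_alt (X.endo q.1 x) (η.1 x) v

/-- Every form is the sum of its components of types `(p, k - p)`. -/
theorem sum_typeProj (q : ImagUnit) (k : ℕ) (η : Form E M k) :
    ∑ p ∈ Finset.range (k + 1), X.typeProj q k p η = η := by
  refine Subtype.ext (funext fun x => ?_)
  ext v
  let T : Form E M k →ₗ[ℂ] ℂ :=
    { toFun := fun η => η.1 x v, map_add' := fun _ _ => rfl, map_smul' := fun _ _ => rfl }
  change T (∑ p ∈ Finset.range (k + 1), X.typeProj q k p η) = _
  rw [_root_.map_sum]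
  refine (Finset.sum_congr rfl fun p _ => X.typeProj_apply q k p η x v).trans ?_
  rw [sum_rootAvg (X.mem_biPoly q η x v)]
  simp [endo_complexEndo]

/-- The `p`-th component is of type `(p, k - p)`. -/
theorem isType_typeProj (q : ImagUnit) {k p : ℕ} (hp : p ≤ k) (η : Form E M k) :
    X.IsType q k p (X.typeProj q k p η) := by
  intro w
  refine Subtype.ext (funext fun x => ?_)
  ext v
  have h := rootAvg_scale hp (X.mem_biPoly q η x v) w
  rw [← typeProj_apply] at h
  refine Eq.trans ?_ h
  refine (X.typeProj_apply q k p η x fun i => X.endo (complexEndo q w) x (v i)).trans ?_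
  simp only [endo_complexEndo_mul, mul_comm]

end HypercomplexStructure
end TypeDecomposition

section KaehlerDeRham

/-- The generators `L, Λ, H, d, d^c` of the Kähler-de Rham superalgebra. -/
inductive KGen
  | L | Lam | H | d | dc

/-- The parity of a generator: `L, Λ, H` are even, `d, d^c` are odd. -/
def KGen.parity : KGen → ZMod 2
  | .L => 0
  | .Lam => 0
  | .H => 0
  | .d => 1
  | .dc => 1

/-- The parity of a non-associative monomial in the generators. -/
def wordParity : FreeMagma KGen → ZMod 2
  | .of g => g.parity
  | .mul a b => wordParity a + wordParity b

/-- The sign `(-1)^{ab}`. -/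
def koszulSign (a b : ZMod 2) : ℂ := if a = 1 ∧ b = 1 then -1 else 1

/-- The free non-associative algebra on the generators. -/
abbrev KFree : Type := FreeNonUnitalNonAssocAlgebra ℂ KGen

/-- A monomial, as an element of the free algebra. -/
def word (u : FreeMagma KGen) : KFree := MonoidAlgebra.single u 1

/-- A generator, as an element of the free algebra. -/
def kgen (g : KGen) : KFree := FreeNonUnitalNonAssocAlgebra.of ℂ g

/-- The relations of the Kähler-de Rham superalgebra: the axioms of a Lie superalgebra (super
anticommutativity and the super Jacobi identity), the relations of an `sl₂`-triple, the relations
saying that `d` and `d^c` are highest weight vectors of `sl₂`-representations of weight `1`, and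
the vanishing of the supercommutators of `d` and `d^c`. -/
inductive KRel : KFree → Prop
  | anticomm (u v : FreeMagma KGen) :
      KRel (word u * word v + koszulSign (wordParity u) (wordParity v) • (word v * word u))
  | jacobi (u v w : FreeMagma KGen) :
      KRel (word u * (word v * word w) - (word u * word v) * word w
        - koszulSign (wordParity u) (wordParity v) • (word v * (word u * word w)))
  | L_Lam : KRel (kgen .L * kgen .Lam - kgen .H)
  | H_L : KRel (kgen .H * kgen .L - (2 : ℂ) • kgen .L)
  | H_Lam : KRel (kgen .H * kgen .Lam + (2 : ℂ) • kgen .Lam)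
  | H_d : KRel (kgen .H * kgen .d - kgen .d)
  | H_dc : KRel (kgen .H * kgen .dc - kgen .dc)
  | L_d : KRel (kgen .L * kgen .d)
  | L_dc : KRel (kgen .L * kgen .dc)
  | Lam_Lam_d : KRel (kgen .Lam * (kgen .Lam * kgen .d))
  | Lam_Lam_dc : KRel (kgen .Lam * (kgen .Lam * kgen .dc))
  | d_d : KRel (kgen .d * kgen .d)
  | dc_dc : KRel (kgen .dc * kgen .dc)
  | d_dc : KRel (kgen .d * kgen .dc)

/-- The two-sided ideal generated by the relations. -/
def kIdeal : Submodule ℂ KFree :=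
  sInf {S | (∀ x, KRel x → x ∈ S) ∧ ∀ x, ∀ s ∈ S, x * s ∈ S ∧ s * x ∈ S}

theorem kIdeal_mul_mem (x : KFree) {s : KFree} (hs : s ∈ kIdeal) :
    x * s ∈ kIdeal ∧ s * x ∈ kIdeal :=
  ⟨Submodule.mem_sInf.2 fun S hS => (hS.2 x s (Submodule.mem_sInf.1 hs S hS)).1,
    Submodule.mem_sInf.2 fun S hS => (hS.2 x s (Submodule.mem_sInf.1 hs S hS)).2⟩

theorem mem_kIdeal_of_rel {x : KFree} (hx : KRel x) : x ∈ kIdeal :=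
  Submodule.mem_sInf.2 fun _ hS => hS.1 x hx

/-- The Kähler-de Rham superalgebra. -/
abbrev KaehlerDeRham : Type := KFree ⧸ kIdeal

namespace KaehlerDeRham

/-- The class of a generator. -/
def gen (g : KGen) : KaehlerDeRham := kIdeal.mkQ (kgen g)

/-- The bracket of the Kähler-de Rham superalgebra. -/
def bracket : KaehlerDeRham →ₗ[ℂ] KaehlerDeRham →ₗ[ℂ] KaehlerDeRham :=
  kIdeal.liftQ
    (LinearMap.mk₂ ℂ (fun x => kIdeal.mapQ kIdeal (LinearMap.mulLeft ℂ x)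
        fun _ hs => (kIdeal_mul_mem x hs).1)
      (fun x y a => by
        obtain ⟨a, rfl⟩ := kIdeal.mkQ_surjective a
        exact congrArg kIdeal.mkQ (add_mul x y a))
      (fun c x a => by
        obtain ⟨a, rfl⟩ := kIdeal.mkQ_surjective a
        exact congrArg kIdeal.mkQ (smul_mul_assoc c x a))
      (fun x a b => _root_.map_add _ a b)
      (fun c x a => _root_.map_smul _ c a))
    (by
      intro x hx
      rw [LinearMap.mem_ker]
      refine LinearMap.ext fun a => ?_
      obtain ⟨a, rfl⟩ := kIdeal.mkQ_surjective a
      exact (Submodule.Quotient.mk_eq_zero _).2 (kIdeal_mul_mem a hx).2)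

theorem bracket_mk (x y : KFree) :
    bracket (kIdeal.mkQ x) (kIdeal.mkQ y) = kIdeal.mkQ (x * y) := rfl

theorem word_mul (u v : FreeMagma KGen) : word (u * v) = word u * word v := by
  rw [word, word, word, MonoidAlgebra.single_mul_single, one_mul]

theorem word_of (g : KGen) : word (.of g) = kgen g := rfl

/-- The homogeneous component of parity `i` of the Kähler-de Rham superalgebra. -/
def homogeneous (i : ZMod 2) : Submodule ℂ KaehlerDeRham :=
  Submodule.span ℂ {x | ∃ u, wordParity u = i ∧ x = kIdeal.mkQ (word u)}

end KaehlerDeRham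
end KaehlerDeRham

end

end HK

/-! The proof is representation theory of `sl₂`, applied to operators under commutators. At each
point of `M` the operators `L_J`, `L_K`, their adjoints, `H` and `ad I` satisfy the relations
`IsPair`, and for the two roots `j = ±√-1` of `j² = -1` they combine into two `sl₂`-triples
(`IsPair.sl2_of_sq`): that of `Ω` and that of its conjugate. The two weight operators add up to `H`.

Closedness of the Kähler forms makes `d` commute with `L_J` and `L_K`, so `d` is a highest weight
vector for both triples, of total weight `1`. The lowering operators being nilpotent, highest
weights are natural numbers, so `d` splits into parts of weights `(1, 0)` and `(0, 1)`. This is `d =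
∂ + \bar∂` (`IsPair.ad_ad_eq_neg`, `dOp_eq_delOp_add`). Comparing weights for `ad I` shows that
`L_Ω` commutes with `∂` and `∂_J`, that both have weight `1` for the `Ω`-triple, and that `∂² = 0`.
The relation `{∂, ∂_J} = 0` comes from `d = ∂' + \bar∂'` for the complex structure `J`
(`IsHKSystem.a_aJ`). So the Kähler-de Rham relations hold (`isKaehlerSystem`), and they define a
representation of the abstract superalgebra (`IsKaehlerSystem.exists_rep`).

The adjoints are handled algebraically. Exterior multiplication by covectors and the value on `1`
determine an operator on forms (`end_ext_eps`), and this identifies the Hodge star with the Weyl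
element of a Lefschetz triple, times the action of the complex structure, times a sign (`pStar_eq`).
The volume form is built from `ω_I`, but the powers of `ω_I` and `ω_J` in top degree agree
(`pL_pow_pOne_eq`), so the star can be written through `I` or through `J` (`star_eq`). Since a Weyl
element exchanges highest and lowest weight vectors, conjugation by the star becomes a commutator
with a `Λ` (`star_mul_mul_star`). Through `J` this gives `∂^* = -[Λ_Ω, ∂_J]` and `∂_J^* = [Λ_Ω, ∂]`;
through `I` it gives the classical Kähler identities, hence `Δ = 2 {∂, ∂^*} = -2 {∂, [Λ_Ω, ∂_J]}`
(`laplacian_eq_smul`).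

The relations alone show that eight elements span the abstract superalgebra (`span_basisVec`) and
that an ideal containing neither `H` nor `{d, [Λ, d^c]}` meets their linear combinations trivially
(`coeff_eq_zero_of_mem`). The kernel of the representation is such an ideal: `H_Ω` is nonzero on the
constant `1`, and `Δ` is nonzero because its symbol is, up to sign, the squared length of a covector
(`laplacian_ne_zero`). Finally the operators lie in `𝔤`: `∂` and `\bar∂` come from `d` and `[ad I,
d]`, `∂^*` from `[Λ_I, \bar∂]`, and `∂_J` is recovered as `[L_Ω, [Λ_Ω, ∂_J]]` (`dolbeaultOps_mem`).
-/

namespace HK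

noncomputable section

open Finset

/-! ### Highest weight vectors of `sl₂`-triples whose lowering operator is nilpotent. -/

section Sl2Module
variable {V : Type*} [AddCommGroup V] [Module ℂ V]

/-- The commutation relations of an `sl₂`-triple in an associative algebra. -/
structure IsSl2 {A : Type*} [Ring A] (e f h : A) : Prop where
  ef : e * f - f * e = h
  he : h * e - e * h = 2 * e
  hf : h * f - f * h = -(2 * f)

theorem IsSl2.h_mul_f {A : Type*} [Ring A] {e f h : A} (t : IsSl2 e f h) :
    h * f = f * h - 2 * f := by
  rw [sub_eq_iff_eq_add.1 t.hf]; abel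

theorem IsSl2.h_mul_f_pow {A : Type*} [Ring A] {e f h : A} (t : IsSl2 e f h) (m : ℕ) :
    h * f ^ m = f ^ m * (h - 2 * m) := by
  induction m with
  | zero => simp
  | succ m ih =>
    have h1 : h * f = f * h - 2 * f := t.h_mul_f
    have h2 : (m : A) * f = f * m := Nat.cast_comm m f
    rw [pow_succ, ← mul_assoc, ih, mul_assoc, mul_assoc, sub_mul, h1, mul_assoc, h2]
    push_cast
    noncomm_ring

/-- Pulling `e` through each further factor `f` contributes one `h`, and moving these to the right
past powers of `f` shifts them by even integers; the shifts sum to the factor `(m + 1) (h - m)`. -/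
theorem IsSl2.e_mul_f_pow {A : Type*} [Ring A] {e f h : A} (t : IsSl2 e f h) (m : ℕ) :
    e * f ^ (m + 1) = f ^ (m + 1) * e + f ^ m * ((m + 1) * (h - m)) := by
  induction m with
  | zero => simp [← t.ef]
  | succ m ih =>
    have h1 : e * f = f * e + h := by rw [← t.ef]; abel
    have h2 := t.h_mul_f_pow (m + 1)
    have h3 : (m : A) * f = f * m := Nat.cast_comm m f
    have h4 : h * f = f * h - 2 * f := t.h_mul_f
    rw [pow_succ, ← mul_assoc, ih, add_mul, mul_assoc, h1, mul_add, ← mul_assoc, ← pow_succ,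
      mul_assoc, mul_assoc, sub_mul, h4, h3]
    have h5 : ((m : A) + 1) * (f * h - 2 * f - f * m) = f * ((m + 1) * (h - 2 - m)) := by
      have h6 : ((m : A) + 1) * f = f * (m + 1) := by rw [add_mul, h3]; noncomm_ring
      rw [show f * h - 2 * f - f * m = f * (h - 2 - m) by noncomm_ring, ← mul_assoc, h6, mul_assoc]
    rw [h5, ← mul_assoc (f ^ m), ← pow_succ, add_assoc, ← mul_add]
    congr 2
    have h7 : (m : A) * h = h * m := Nat.cast_comm m h
    push_cast
    simp only [add_mul, mul_sub, mul_add, h7]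
    noncomm_ring

/-- A vector killed by `e` and by `f ^ m` is killed by `h (h - 1) ⋯ (h - m + 1)`. -/
theorem IsSl2.prod_eq_zero {e f h : Module.End ℂ V} (t : IsSl2 e f h) (m : ℕ) (v : V)
    (he : e v = 0) (hf : (f ^ m) v = 0) :
    Polynomial.aeval h (∏ j ∈ range m, (Polynomial.X - Polynomial.C (j : ℂ))) v = 0 := by
  induction m generalizing v with
  | zero => simpa using hf
  | succ m ih =>
    have h1 : (e * f ^ (m + 1)) v = _ := congrArg (fun T => T v) (t.e_mul_f_pow m)
    have h2 : ((m : Module.End ℂ V) + 1) = ((m + 1 : ℂ)) • 1 := by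
      rw [add_smul, one_smul]; congr 1; ext; simp [Nat.cast_smul_eq_nsmul]
    rw [h2] at h1
    simp only [LinearMap.add_apply, hf, he, map_zero, zero_add, Module.End.mul_apply, LinearMap.smul_apply, Module.End.one_apply, map_smul] at h1
    -- On `v` the commutation formula reads `0 = (m + 1) f^m (h - m) v`, and the scalar is
    -- invertible. So `(h - m) v` satisfies the induction hypothesis with exponent `m`.
    have h3 : (f ^ m) ((h - (m : Module.End ℂ V)) v) = 0 :=
      ((smul_eq_zero.1 h1.symm).resolve_left (by exact_mod_cast Nat.succ_ne_zero m))
    have h4 : e ((h - (m : Module.End ℂ V)) v) = 0 := by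
      have h5 := congrArg (fun T => T v) t.he
      simp only [Module.End.mul_apply, LinearMap.sub_apply, he, map_zero, zero_sub] at h5
      simp only [LinearMap.sub_apply, map_sub]
      have h6 : e (h v) = 0 := by
        have : (2 : Module.End ℂ V) (e v) = 0 := by rw [he, map_zero]
        simpa [this] using h5
      rw [h6, Module.End.natCast_apply, map_nsmul, he]; simp
    have h5 := ih _ h4 h3
    rw [prod_range_succ, map_mul, Module.End.mul_apply]
    convert h5 using 2
    simp [Module.End.natCast_apply]

/-- On an eigenvector the product in `IsSl2.prod_eq_zero` acts as the scalar `c (c - 1) ⋯ (c - m +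
1)`, so one of its factors vanishes. Nilpotency of `f` replaces finite-dimensionality: the modules
in question are spaces of forms and spaces of operators. -/
theorem IsSl2.weight_mem {e f h : Module.End ℂ V} (t : IsSl2 e f h) {v : V} (he : e v = 0)
    (hf : IsNilpotent f) {c : ℂ} (hv : h v = c • v) (hv0 : v ≠ 0) : ∃ n : ℕ, c = n := by
  obtain ⟨m, hm⟩ := hf
  have h1 := t.prod_eq_zero m v he (by simp [hm])
  have h2 : ∀ p : Polynomial ℂ, Polynomial.aeval h p v = p.eval c • v := by
    intro p
    by_cases hv1 : v = 0
    · simp [hv1]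
    · exact Module.End.aeval_apply_of_hasEigenvector ⟨Module.End.mem_eigenspace_iff.2 hv, hv1⟩
  rw [h2, Polynomial.eval_prod, smul_eq_zero, or_iff_left hv0, prod_eq_zero_iff] at h1
  obtain ⟨n, -, hn⟩ := h1
  refine ⟨n, ?_⟩
  simpa [sub_eq_zero] using hn

theorem IsSl2.symm {A : Type*} [Ring A] {e f h : A} (t : IsSl2 e f h) : IsSl2 f e (-h) where
  ef := by rw [← t.ef]; abel
  he := by rw [neg_mul, mul_neg, t.h_mul_f]; abel
  hf := by have := t.he; rw [neg_mul, mul_neg, ← this]; abel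

/-- Otherwise `f v` would be a highest weight vector of weight `-2`, which is not a natural number.
-/
theorem IsSl2.f_eq_zero {e f h : Module.End ℂ V} (t : IsSl2 e f h) {v : V} (he : e v = 0)
    (hf : IsNilpotent f) (hv : h v = 0) : f v = 0 := by
  by_contra h0
  have h1 : e (f v) = 0 := by
    have := congrArg (fun T => T v) t.ef
    simpa [he, hv] using this
  have h2 : h (f v) = (-2 : ℂ) • f v := by
    have := congrArg (fun T => T v) t.hf
    simp only [LinearMap.sub_apply, Module.End.mul_apply, hv, map_zero, sub_zero,
      LinearMap.neg_apply] at this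
    rw [this, neg_smul, two_smul, ← one_add_one_eq_two]; simp
  obtain ⟨n, hn⟩ := t.weight_mem h1 hf h2 h0
  have : ((-2 : ℤ) : ℂ) = ((n : ℤ) : ℂ) := by push_cast; exact hn
  have := Int.cast_injective this
  omega

/-- Otherwise `f (f v)` would be a highest weight vector of weight `-3`, which is not a natural
number. -/
theorem IsSl2.f_f_eq_zero {e f h : Module.End ℂ V} (t : IsSl2 e f h) {v : V} (he : e v = 0)
    (hf : IsNilpotent f) (hv : h v = v) : f (f v) = 0 := by
  by_contra h0
  have h1 : e (f (f v)) = 0 := by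
    have := congrArg (fun T => T v) (t.e_mul_f_pow 1)
    simpa [he, hv, pow_two] using this
  have h2 : h (f (f v)) = (-3 : ℂ) • f (f v) := by
    have := congrArg (fun T => T v) (t.h_mul_f_pow 2)
    simp only [Module.End.mul_apply, pow_two, LinearMap.sub_apply, hv, Nat.cast_ofNat] at this
    rw [this]
    have h3 : (2 : Module.End ℂ V) ((2 : Module.End ℂ V) v) = (4 : ℂ) • v := by
      have : ∀ u, (2 : Module.End ℂ V) u = (2 : ℂ) • u := fun u => by
        rw [two_smul, ← one_add_one_eq_two]; simp
      rw [this, this, smul_smul]; norm_num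
    rw [h3, map_sub, map_sub, map_smul, map_smul]
    module
  obtain ⟨n, hn⟩ := t.weight_mem h1 hf h2 h0
  have : ((-3 : ℤ) : ℂ) = ((n : ℤ) : ℂ) := by push_cast; exact hn
  have := Int.cast_injective this
  omega

/-- A vector of highest weight for `(e, f, h)` as well as for a second triple whose weight operator
acts on it, and on its images under `h`, as `1 - h`, is a sum of vectors of `h`-weights `0` and `1`. -/
theorem IsSl2.weights_zero_one {e f h e' f' h' : Module.End ℂ V} (t : IsSl2 e f h)
    (t' : IsSl2 e' f' h') {v : V} (he : e v = 0) (he' : e' v = 0) (hf : IsNilpotent f)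
    (hf' : IsNilpotent f') {g : Module.End ℂ V} (hg : h + h' = g) (hgv : g v = v)
    (hgh : Commute g h) : h (h v) = h v := by
  obtain ⟨m, hm⟩ := hf
  obtain ⟨m', hm'⟩ := hf'
  -- The exponents are raised by two so that each product contains the factors with roots `0` and
  -- `1`, which are then split off.
  have h1 := t.prod_eq_zero (m + 2) v he (by simp [pow_add, hm])
  have h2 := t'.prod_eq_zero (m' + 2) v he' (by simp [pow_add, hm'])
  -- As `g` fixes `v` and commutes with `h`, it acts as the identity on all of `ℂ[h] v`, so `h' = g
  -- - h` acts there as `1 - h`.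
  have h3 : ∀ (p : Polynomial ℂ), Polynomial.aeval h' p v =
      Polynomial.aeval h (p.comp (1 - Polynomial.X)) v := by
    intro p
    induction p using Polynomial.induction_on' with
    | add p q hp hq => simp [hp, hq]
    | monomial n a =>
      have key : (h' ^ n) v = ((1 - h) ^ n) v := by
        induction n with
        | zero => simp
        | succ n ih =>
          have h5 : h' = g - h := by rw [← hg]; abel
          have h6 : Commute g ((1 - h) ^ n) := ((Commute.one_right g).sub_right hgh).pow_right n
          rw [pow_succ', Module.End.mul_apply, ih, h5, LinearMap.sub_apply,
            ← Module.End.mul_apply g, h6.eq, Module.End.mul_apply, hgv, pow_succ', sub_mul]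
          simp
      simp [key]
  rw [h3] at h2
  rw [prod_range_succ', prod_range_succ'] at h1 h2
  simp only [Polynomial.mul_comp, Polynomial.prod_comp, Polynomial.sub_comp, Polynomial.X_comp,
    Polynomial.C_comp, zero_add, Nat.cast_one, Nat.cast_zero, map_zero, sub_zero] at h1 h2
  set u : V := (Polynomial.aeval h ((Polynomial.X - Polynomial.C (1 : ℂ)) * Polynomial.X)) v
    with hu
  have e1 : Polynomial.aeval h (∏ k ∈ range m, (Polynomial.X - Polynomial.C (((k + 1 + 1 : ℕ) : ℂ)))) u
      = 0 := by
    rw [hu, ← Module.End.mul_apply, ← map_mul, ← mul_assoc]; exact h1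
  have e2 : Polynomial.aeval h
      (∏ k ∈ range m', (1 - Polynomial.X - Polynomial.C (((k + 1 + 1 : ℕ) : ℂ)))) u = 0 := by
    have : Polynomial.aeval h ((∏ k ∈ range m', (1 - Polynomial.X - Polynomial.C (((k + 1 + 1 : ℕ) : ℂ))))
      * ((Polynomial.X - Polynomial.C (1 : ℂ)) * Polynomial.X)) v = 0 := by
      rw [← h2]; congr 2; simp; ring
    rw [map_mul] at this
    exact this
  -- One product has its roots at integers `≥ 2`, the other at integers `≤ -1`. The sum of two
  -- linear factors is the nonzero constant `-(i + j + 3)`, which is an explicit Bézout relation.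
  have hco : IsCoprime (∏ k ∈ range m, (Polynomial.X - Polynomial.C (((k + 1 + 1 : ℕ) : ℂ))))
      (∏ k ∈ range m', (1 - Polynomial.X - Polynomial.C (((k + 1 + 1 : ℕ) : ℂ)))) := by
    refine IsCoprime.prod_left fun i _ => IsCoprime.prod_right fun j _ => ?_
    have hne : (-((i : ℂ) + j + 3)) ≠ 0 := by
      rw [neg_ne_zero]; exact_mod_cast Nat.succ_ne_zero (i + j + 2)
    refine ⟨Polynomial.C (-((i : ℂ) + j + 3))⁻¹, Polynomial.C (-((i : ℂ) + j + 3))⁻¹, ?_⟩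
    rw [← mul_add]
    have : (Polynomial.X - Polynomial.C (((i + 1 + 1 : ℕ) : ℂ)) +
        (1 - Polynomial.X - Polynomial.C (((j + 1 + 1 : ℕ) : ℂ)))) =
        Polynomial.C (-((i : ℂ) + j + 3)) := by
      rw [← Polynomial.C_1]
      have : ∀ (a b : ℂ), Polynomial.X - Polynomial.C a + (Polynomial.C 1 - Polynomial.X -
        Polynomial.C b) = Polynomial.C (1 - a - b) := fun a b => by simp only [Polynomial.C_sub]; ring
      rw [this]; congr 1; push_cast; ring
    rw [this, ← Polynomial.C_mul, inv_mul_cancel₀ hne, Polynomial.C_1]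
  obtain ⟨a, b, hab⟩ := hco
  have hu0 : u = 0 := by
    have : Polynomial.aeval h (1 : Polynomial ℂ) u = u := by simp
    rw [← this, ← hab, map_add, map_mul, map_mul, LinearMap.add_apply, Module.End.mul_apply,
      Module.End.mul_apply, e1, e2, map_zero, map_zero, add_zero]
  rw [hu] at hu0
  simpa [sub_eq_zero, sub_mul] using hu0

end Sl2Module

/-! ### Exponentials of nilpotent elements and the Weyl element of `SL₂`. -/

section Weyl
variable {A : Type*} [Ring A] [Algebra ℚ A]

/-- If `[e, y] = x` commutes with `e`, then `exp(e) y = (y + x) exp(e)`. -/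
theorem exp_mul_eq {e x y : A} (he : IsNilpotent e) (h1 : e * y - y * e = x)
    (h2 : e * x = x * e) : IsNilpotent.exp e * y = (y + x) * IsNilpotent.exp e := by
  -- Divided by `(k + 1)!`, the correction term becomes `x` times the `k`-th term of the exponential
  -- series.
  have hpow : ∀ k : ℕ, e ^ (k + 1) * y = y * e ^ (k + 1) + ((k + 1 : ℕ) : ℚ) • (x * e ^ k) := by
    intro k
    induction k with
    | zero => simp [← h1]
    | succ k ih =>
      have h3 : e * y = y * e + x := by rw [← h1]; abel
      rw [pow_succ', mul_assoc, ih, mul_add, ← mul_assoc, h3, mul_smul_comm, ← mul_assoc, h2,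
        add_mul, mul_assoc, mul_assoc, ← pow_succ', ← pow_succ', add_assoc]
      congr 1
      rw [Nat.cast_succ (k + 1), add_smul, one_smul, add_comm]
  obtain ⟨k, hk⟩ := he
  have hk1 : e ^ (k + 1) = 0 := by rw [pow_succ, hk, zero_mul]
  have hexp : IsNilpotent.exp e * y = (∑ i ∈ range (k + 1), (i.factorial : ℚ)⁻¹ • e ^ i) * y := by
    rw [IsNilpotent.exp_eq_sum hk1]
  rw [hexp, sum_range_succ', add_mul, sum_mul]
  have h4 : ∀ i ∈ range k, ((i + 1).factorial : ℚ)⁻¹ • e ^ (i + 1) * y =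
      y * (((i + 1).factorial : ℚ)⁻¹ • e ^ (i + 1)) + x * ((i.factorial : ℚ)⁻¹ • e ^ i) := by
    intro i _
    rw [smul_mul_assoc, hpow, smul_add, mul_smul_comm, mul_smul_comm, smul_smul]
    congr 2
    rw [Nat.factorial_succ]
    push_cast
    field_simp
  rw [sum_congr rfl h4, sum_add_distrib, ← mul_sum, ← mul_sum, add_mul]
  rw [← IsNilpotent.exp_eq_sum hk, IsNilpotent.exp_eq_sum hk1, sum_range_succ']
  simp only [pow_zero, smul_mul_assoc, one_mul, mul_add, mul_smul_comm, mul_one]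
  abel

theorem exp_mul_comm {e x : A} (h : e * x = x * e) :
    IsNilpotent.exp e * x = x * IsNilpotent.exp e := by
  rw [IsNilpotent.exp, sum_mul, mul_sum]
  refine sum_congr rfl fun i _ => ?_
  rw [smul_mul_assoc, mul_smul_comm, (Commute.pow_left h i).eq]

theorem exp_mul_anti {e t : A} (he : IsNilpotent e) (h : t * e = -(e * t)) :
    t * IsNilpotent.exp e = IsNilpotent.exp (-e) * t := by
  obtain ⟨k, hk⟩ := he
  have hk' : (-e) ^ k = 0 := by rw [neg_pow, hk, mul_zero]
  rw [IsNilpotent.exp_eq_sum hk, IsNilpotent.exp_eq_sum hk', sum_mul, mul_sum]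
  refine sum_congr rfl fun i _ => ?_
  have h1 : SemiconjBy t e (-e) := by rw [SemiconjBy, h, neg_mul]
  rw [smul_mul_assoc, mul_smul_comm, (h1.pow_right i).eq]

/-- The element `exp(e) exp(-f) exp(e)`, representing the nontrivial element of the Weyl group of
`SL₂`. -/
noncomputable def weyl (e f : A) : A :=
  IsNilpotent.exp e * IsNilpotent.exp (-f) * IsNilpotent.exp e

theorem weyl_mul_comm {e f x : A} (h : e * x = x * e) (h' : f * x = x * f) :
    weyl e f * x = x * weyl e f := by
  have h1 := exp_mul_comm h
  have h2 : IsNilpotent.exp (-f) * x = x * IsNilpotent.exp (-f) :=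
    exp_mul_comm (by rw [neg_mul, mul_neg, h'])
  rw [weyl, mul_assoc, h1, mul_assoc, ← mul_assoc _ x, h2, ← mul_assoc, ← mul_assoc, h1,
    mul_assoc, mul_assoc, mul_assoc]

/-- The Weyl element maps a highest weight vector of weight `1` to the opposite of the lowest weight
vector. -/
theorem weyl_mul_highest {e f x y : A} (he : IsNilpotent e) (hf : IsNilpotent f)
    (h1 : e * x = x * e) (h2 : f * x - x * f = y) (h3 : f * y = y * f) (h4 : e * y - y * e = x) :
    weyl e f * x = -y * weyl e f := by
  have a1 := exp_mul_comm h1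
  have a2 : IsNilpotent.exp (-f) * x = (x - y) * IsNilpotent.exp (-f) := by
    rw [exp_mul_eq (e := -f) (x := -y) hf.neg (by rw [← h2]; noncomm_ring)
      (by simp [h3]), sub_eq_add_neg]
  have a3 := exp_mul_eq he h4 h1
  rw [weyl, mul_assoc, a1, mul_assoc, ← mul_assoc _ x, a2, mul_assoc, ← mul_assoc, mul_sub, a1, a3]
  noncomm_ring

/-- Under conjugation `exp(e)` takes `y` to `x + y`, `exp(-f)` takes `x + y` to `x`, and `exp(e)`
fixes `x`. -/
theorem weyl_mul_lowest {e f x y : A} (he : IsNilpotent e) (hf : IsNilpotent f)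
    (h1 : e * x = x * e) (h2 : f * x - x * f = y) (h3 : f * y = y * f) (h4 : e * y - y * e = x) :
    weyl e f * y = x * weyl e f := by
  have a1 := exp_mul_comm h1
  have a2 : IsNilpotent.exp (-f) * x = (x - y) * IsNilpotent.exp (-f) := by
    rw [exp_mul_eq (e := -f) (x := -y) hf.neg (by rw [← h2]; noncomm_ring)
      (by simp [h3]), sub_eq_add_neg]
  have a2' : IsNilpotent.exp (-f) * y = y * IsNilpotent.exp (-f) :=
    exp_mul_comm (by simp [h3])
  have a3 := exp_mul_eq he h4 h1
  have a4 : IsNilpotent.exp (-f) * (y + x) = x * IsNilpotent.exp (-f) := by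
    rw [mul_add, a2, a2', ← add_mul]; congr 1; abel
  rw [weyl, mul_assoc, a3, mul_assoc, ← mul_assoc _ (y + x), a4, mul_assoc, ← mul_assoc, a1]
  noncomm_ring

end Weyl

end

end HK

namespace HK

noncomputable section

open ContinuousAlternatingMap

set_option linter.unusedSectionVars false
set_option maxSynthPendingDepth 3

/-! ### Interior and exterior products on forms at a point, and their anticommutation relations. -/

section ExteriorAlgebra
variable {E : Type*} [NormedAddCommGroup E] [NormedSpace ℝ E]

variable (E) in
/-- Complex-valued alternating forms of all degrees on `E`. -/
abbrev PForm : Type _ := ∀ k : ℕ, Alt E k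

instance : AddCommGroup (PForm E) := Pi.addCommGroup

instance : Module ℂ (PForm E) := Pi.module _ _ _

instance : Module ℝ (PForm E) := Pi.module _ _ _

instance : Ring (Module.End ℂ (PForm E)) := Module.End.instRing

/-- The interior product with the vector `v`. -/
def iota (v : E) : Module.End ℂ (PForm E) where
  toFun η k := (η (k + 1)).curryLeft v
  map_add' _ _ := rfl
  map_smul' _ _ := rfl

theorem iota_apply (v : E) (η : PForm E) (k : ℕ) : iota v η k = (η (k + 1)).curryLeft v := rfl

/-- The exterior product with the covector `ξ`. -/
def eps (ξ : E →L[ℝ] ℝ) : Module.End ℂ (PForm E) where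
  toFun η k := match k with
    | 0 => 0
    | k + 1 => alternatizeUncurryFin (ξ.smulRight (η k))
  map_add' a b := by
    funext k
    cases k with
    | zero => simp
    | succ k =>
      simp only [Pi.add_apply, ← alternatizeUncurryFin_add]
      congr 1; ext u; simp
  map_smul' c b := by
    funext k
    cases k with
    | zero => simp
    | succ k =>
      simp only [Pi.smul_apply, RingHom.id_apply, ← alternatizeUncurryFin_smul]
      congr 1; ext u; simp; ring

theorem eps_zero (ξ : E →L[ℝ] ℝ) (η : PForm E) : eps ξ η 0 = 0 := rfl

theorem eps_succ (ξ : E →L[ℝ] ℝ) (η : PForm E) (k : ℕ) :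
    eps ξ η (k + 1) = alternatizeUncurryFin (ξ.smulRight (η k)) := rfl

/-! Shortcut instances, which save most of the time spent on instance search. -/

scoped instance : Mul (Module.End ℂ (PForm E)) := inferInstance
scoped instance : Ring (Module.End ℂ (PForm E)) := inferInstance
scoped instance : Semiring (Module.End ℂ (PForm E)) := inferInstance
scoped instance : NonUnitalNonAssocRing (Module.End ℂ (PForm E)) := inferInstance
scoped instance : NonUnitalNonAssocSemiring (Module.End ℂ (PForm E)) := inferInstance
scoped instance : Semigroup (Module.End ℂ (PForm E)) := inferInstance
scoped instance : Algebra ℂ (Module.End ℂ (PForm E)) := inferInstance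
scoped instance : SMul ℂ (Module.End ℂ (PForm E)) := inferInstance
scoped instance : SMul ℝ (Module.End ℂ (PForm E)) := inferInstance
scoped instance : Module ℂ (Module.End ℂ (PForm E)) := inferInstance
scoped instance : Module ℝ (Module.End ℂ (PForm E)) := inferInstance
scoped instance : Add (Module.End ℂ (PForm E)) := inferInstance
scoped instance : Sub (Module.End ℂ (PForm E)) := inferInstance
scoped instance : Neg (Module.End ℂ (PForm E)) := inferInstance
scoped instance : Zero (Module.End ℂ (PForm E)) := inferInstance
scoped instance : AddCommMonoid (Module.End ℂ (PForm E)) := inferInstance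
scoped instance : AddGroup (Module.End ℂ (PForm E)) := inferInstance
scoped instance : AddCommGroup (Module.End ℂ (PForm E)) := inferInstance
scoped instance : IsScalarTower ℂ (Module.End ℂ (PForm E)) (Module.End ℂ (PForm E)) := inferInstance
scoped instance : SMulCommClass ℂ (Module.End ℂ (PForm E)) (Module.End ℂ (PForm E)) := inferInstance
scoped instance : IsScalarTower ℝ (Module.End ℂ (PForm E)) (Module.End ℂ (PForm E)) := inferInstance
scoped instance : SMulCommClass ℝ (Module.End ℂ (PForm E)) (Module.End ℂ (PForm E)) := inferInstance

theorem iota_add (v w : E) : iota (v + w) = iota v + iota w := by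
  ext η k : 2
  exact (η (k + 1)).curryLeft.map_add v w

theorem iota_smul (c : ℝ) (v : E) : iota (c • v) = c • iota v := by
  ext η k : 2
  exact (η (k + 1)).curryLeft.map_smul c v

theorem eps_add (ξ ζ : E →L[ℝ] ℝ) : eps (ξ + ζ) = eps ξ + eps ζ := by
  ext η k : 2
  cases k with
  | zero => simp [eps_zero]
  | succ k =>
    simp only [eps_succ, LinearMap.add_apply, Pi.add_apply, ← alternatizeUncurryFin_add]
    congr 1; ext u; simp [add_mul]

theorem eps_smul (c : ℝ) (ξ : E →L[ℝ] ℝ) : eps (c • ξ) = c • eps ξ := by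
  ext η k : 2
  cases k with
  | zero => simp [eps_zero]
  | succ k =>
    simp only [eps_succ, LinearMap.smul_apply, Pi.smul_apply, ← alternatizeUncurryFin_smul]
    congr 1; ext u; simp [mul_assoc]

/-- `iota` as a linear map. -/
def iotaL : E →ₗ[ℝ] Module.End ℂ (PForm E) where
  toFun := iota
  map_add' := iota_add
  map_smul' := iota_smul

/-- `eps` as a linear map. -/
def epsL : (E →L[ℝ] ℝ) →ₗ[ℝ] Module.End ℂ (PForm E) where
  toFun := eps
  map_add' := eps_add
  map_smul' := eps_smul

theorem iota_neg (v : E) : iota (-v) = -iota v := iotaL.map_neg v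

theorem eps_neg (ξ : E →L[ℝ] ℝ) : eps (-ξ) = -eps ξ := epsL.map_neg ξ

/-- Antisymmetrization is a signed sum over the argument that is fed to `f`. The term of index `0`
feeds `v`; in the others `v` stays the first argument of the form, and the index shift by one
changes their sign. -/
theorem alternatizeUncurryFin_cons {k : ℕ} (f : E →L[ℝ] Alt E (k + 1)) (v : E) :
    (alternatizeUncurryFin f).curryLeft v =
      f v - alternatizeUncurryFin (((curryLeftLI (𝕜 := ℝ) (E := E) (F := ℂ) (n := k)).toContinuousLinearMap.comp f).flip v) := by
  ext u
  simp only [curryLeft_apply_apply, alternatizeUncurryFin_apply, ContinuousAlternatingMap.sub_apply]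
  rw [Fin.sum_univ_succ]
  have h0 : Fin.removeNth 0 (Matrix.vecCons v u) = u := by
    funext i; simp [Fin.removeNth_apply, Fin.zero_succAbove]
  simp only [Fin.val_zero, pow_zero, one_smul, Matrix.cons_val_zero, h0, sub_eq_add_neg]
  congr 1
  rw [← Finset.sum_neg_distrib]
  refine Finset.sum_congr rfl fun i _ => ?_
  have h1 : Fin.removeNth i.succ (Matrix.vecCons v u) = Matrix.vecCons v (Fin.removeNth i u) := by
    funext j
    refine Fin.cases ?_ (fun j => ?_) j
    · simp [Fin.removeNth_apply]
    · simp [Fin.removeNth_apply, Fin.succ_succAbove_succ]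
  rw [h1, Fin.val_succ, pow_succ, Matrix.cons_val_succ]
  simp only [mul_neg, mul_one, neg_smul]
  rfl

theorem alternatizeUncurryFin_cons_zero (f : E →L[ℝ] Alt E 0) (v : E) :
    (alternatizeUncurryFin f).curryLeft v = f v := by
  ext u
  simp only [curryLeft_apply_apply, alternatizeUncurryFin_apply]
  simp [Subsingleton.elim _ u]

theorem iota_mul_eps (v : E) (ξ : E →L[ℝ] ℝ) : iota v * eps ξ = ξ v • 1 - eps ξ * iota v := by
  ext η k : 2
  simp only [Module.End.mul_apply, LinearMap.sub_apply, LinearMap.smul_apply, Pi.sub_apply,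
    Pi.smul_apply, iota_apply, eps_succ, Module.End.one_apply]
  cases k with
  | zero => rw [alternatizeUncurryFin_cons_zero, eps_zero]; simp
  | succ k =>
    rw [alternatizeUncurryFin_cons, eps_succ]
    rfl

theorem iota_mul_iota (v w : E) : iota v * iota w = -(iota w * iota v) := by
  have h : ∀ u : E, iota u * iota u = 0 := by
    intro u
    ext η k : 2
    exact curryLeft_same (η (k + 2)) u
  have := h (v + w)
  rw [iota_add, add_mul, mul_add, mul_add, h, h, zero_add, add_zero] at this
  exact eq_neg_of_add_eq_zero_left this

/-- Induction on the degree: a form of positive degree is determined by its contractions, and moving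
`iota v` through both sides produces the same terms up to the statement for `iota v η`, one degree
lower. -/
theorem eps_mul_eps (ξ ζ : E →L[ℝ] ℝ) : eps ξ * eps ζ = -(eps ζ * eps ξ) := by
  ext η k : 2
  induction k generalizing η with
  | zero => simp [eps_zero]
  | succ k ih =>
    ext u
    have h1 : ∀ v, iota v ((eps ξ * eps ζ) η) k = iota v ((-(eps ζ * eps ξ)) η) k := by
      intro v
      have e1 : iota v * (eps ξ * eps ζ) = ξ v • eps ζ - ζ v • eps ξ + eps ξ * eps ζ * iota v := by
        rw [← mul_assoc, iota_mul_eps, sub_mul, mul_assoc, iota_mul_eps]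
        simp only [mul_sub, smul_mul_assoc, one_mul, mul_smul_comm, mul_one, mul_assoc]
        abel
      have e2 : iota v * -(eps ζ * eps ξ) =
          ξ v • eps ζ - ζ v • eps ξ - eps ζ * eps ξ * iota v := by
        rw [mul_neg, ← mul_assoc, iota_mul_eps, sub_mul, mul_assoc, iota_mul_eps]
        simp only [mul_sub, smul_mul_assoc, one_mul, mul_smul_comm, mul_one, mul_assoc]
        abel
      have e3 := ih (iota v η)
      rw [← Module.End.mul_apply, ← Module.End.mul_apply, e1, e2]
      simp only [LinearMap.add_apply, LinearMap.sub_apply, Pi.add_apply, Pi.sub_apply,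
        Module.End.mul_apply, LinearMap.neg_apply, Pi.neg_apply] at e3 ⊢
      rw [e3, ← sub_eq_add_neg]
    have := congrArg (fun α => α (Fin.tail u)) (h1 (u 0))
    simp only [iota_apply, curryLeft_apply_apply] at this
    have h2 : Matrix.vecCons (u 0) (Fin.tail u) = u := Fin.cons_self_tail u
    rwa [h2] at this

/-- Multiplication of forms of degree `k` by `c k`. -/
def grade (c : ℕ → ℂ) : Module.End ℂ (PForm E) := LinearMap.pi fun k => c k • LinearMap.proj k

theorem grade_apply (c : ℕ → ℂ) (η : PForm E) (k : ℕ) : grade c η k = c k • η k := rfl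

theorem iota_mul_grade (c : ℕ → ℂ) (v : E) :
    iota v * grade c = grade (fun k => c (k + 1)) * iota v := by
  ext η k : 2; rfl

theorem grade_mul_eps (c : ℕ → ℂ) (ξ : E →L[ℝ] ℝ) :
    grade c * eps ξ = eps ξ * grade (fun k => c (k + 1)) := by
  ext η k : 2
  cases k with
  | zero => simp [grade_apply, eps_zero]
  | succ k =>
    simp only [Module.End.mul_apply, grade_apply, eps_succ, ← alternatizeUncurryFin_smul]
    congr 1; ext u; simp; ring

theorem grade_mul_grade (c c' : ℕ → ℂ) :
    (grade c * grade c' : Module.End ℂ (PForm E)) = grade fun k => c k * c' k := by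
  ext η k : 2
  simp [grade_apply, smul_smul]

theorem grade_one : (grade (fun _ => 1) : Module.End ℂ (PForm E)) = 1 := by
  ext η k : 2
  simp [grade_apply]

/-- Pull-back of forms by an endomorphism. -/
def pull (A : E →L[ℝ] E) : Module.End ℂ (PForm E) where
  toFun η k := (η k).compContinuousLinearMap A
  map_add' _ _ := rfl
  map_smul' _ _ := rfl

theorem pull_apply (A : E →L[ℝ] E) (η : PForm E) (k : ℕ) :
    pull A η k = (η k).compContinuousLinearMap A := rfl

theorem pull_mul_pull (A B : E →L[ℝ] E) : pull A * pull B = pull (B ∘L A) := rfl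

theorem iota_mul_pull (A : E →L[ℝ] E) (v : E) : iota v * pull A = pull A * iota (A v) := by
  ext η k : 2
  exact curryLeft_compContinuousLinearMap _ _ _

theorem pull_mul_eps (A : E →L[ℝ] E) (ξ : E →L[ℝ] ℝ) : pull A * eps ξ = eps (ξ ∘L A) * pull A := by
  ext η k : 2
  cases k with
  | zero => simp only [Module.End.mul_apply, pull_apply, eps_zero]; rfl
  | succ k =>
    ext u
    simp only [Module.End.mul_apply, pull_apply, eps_succ, compContinuousLinearMap_apply,
      alternatizeUncurryFin_apply]
    rfl

theorem pull_mul_grade (A : E →L[ℝ] E) (c : ℕ → ℂ) : pull A * grade c = grade c * pull A := rfl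

theorem pull_one : pull (1 : E →L[ℝ] E) = 1 := rfl

theorem pull_neg_one : pull (-1 : E →L[ℝ] E) = grade fun k => (-1) ^ k := by
  ext η k u
  rw [pull_apply, grade_apply, compContinuousLinearMap_apply]
  have h : (⇑(-1 : E →L[ℝ] E) ∘ u) = fun i => (-1 : ℝ) • u i := by funext i; simp
  have := (η k).toMultilinearMap.map_smul_univ (fun _ => (-1 : ℝ)) u
  rw [h]
  refine this.trans ?_
  simp

variable (E) in
/-- The constant `1`, as a form. -/
def pOne : PForm E := Pi.single 0 (constOfIsEmpty ℝ E (Fin 0) 1)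

theorem pOne_zero : pOne E 0 = constOfIsEmpty ℝ E (Fin 0) 1 := Pi.single_eq_same _ _

theorem pOne_succ (k : ℕ) : pOne E (k + 1) = 0 := Pi.single_eq_of_ne (by omega) _

theorem pOne_ne_zero : pOne E ≠ 0 := fun h => by
  have := congrArg (fun η => η 0) h
  simp only [pOne_zero] at this
  have := congrArg (fun α => α (0 : Fin 0 → E)) this
  simp at this

theorem iota_pOne (v : E) : iota v (pOne E) = 0 := by
  funext k
  simp [iota_apply, pOne_succ]

theorem grade_pOne (c : ℕ → ℂ) : grade c (pOne E) = c 0 • pOne E := by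
  funext k
  cases k with
  | zero => rfl
  | succ k => simp [grade_apply, pOne_succ]

theorem pull_pOne (A : E →L[ℝ] E) : pull A (pOne E) = pOne E := by
  funext k
  cases k with
  | zero => simp only [pull_apply, pOne_zero]; rfl
  | succ k => simp only [pull_apply, pOne_succ]; rfl

end ExteriorAlgebra

/-! ### Derivations, and wedge and contraction operators, written in a basis. -/

section FiniteDimensional
variable {E : Type*} [NormedAddCommGroup E] [NormedSpace ℝ E] [FiniteDimensional ℝ E]

variable (E) in
/-- The vectors of a basis of `E`. -/
def bas (i : Fin (Module.finrank ℝ E)) : E := Module.finBasis ℝ E i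

variable (E) in
/-- The dual basis. -/
def cob (i : Fin (Module.finrank ℝ E)) : E →L[ℝ] ℝ :=
  LinearMap.toContinuousLinearMap ((Module.finBasis ℝ E).coord i)

theorem sum_cob_smul_bas (u : E) : ∑ i, cob E i u • bas E i = u :=
  (Module.finBasis ℝ E).sum_repr u

theorem cob_bas (i j : Fin (Module.finrank ℝ E)) : cob E i (bas E j) = if j = i then 1 else 0 := by
  simp [cob, bas, Finsupp.single_apply]

theorem clm_eq_sum {F : Type*} [NormedAddCommGroup F] [NormedSpace ℝ F] (f : E →L[ℝ] F) :
    f = ∑ i, (cob E i).smulRight (f (bas E i)) := by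
  ext u
  conv_lhs => rw [← sum_cob_smul_bas u]
  simp

theorem sum_apply_bas_smul_cob (ξ : E →L[ℝ] ℝ) : ∑ i, ξ (bas E i) • cob E i = ξ := by
  ext u
  conv_rhs => rw [← sum_cob_smul_bas u]
  simp [mul_comm]

theorem alternatizeUncurryFin_eq_sum {k : ℕ} (f : E →L[ℝ] Alt E k) :
    alternatizeUncurryFin f = ∑ i, alternatizeUncurryFin ((cob E i).smulRight (f (bas E i))) := by
  conv_lhs => rw [clm_eq_sum f]
  exact _root_.map_sum (alternatizeUncurryFinCLM ℝ E ℂ) _ _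

/-- The derivation of the exterior algebra extending the transpose of `C`. -/
def der (C : E →L[ℝ] E) : Module.End ℂ (PForm E) := ∑ i, eps (cob E i) * iota (C (bas E i))

/-- The sum depends only on the tensor `∑ ξ_j ⊗ v_j`, that is, on the endomorphism it represents.
Derivations can therefore be recognized in any frame, in particular in the metrically dual one. -/
theorem sum_eps_mul_iota {ι : Type*} (s : Finset ι) (ξ : ι → E →L[ℝ] ℝ) (v : ι → E)
    (C : E →L[ℝ] E) (h : ∀ u, ∑ j ∈ s, ξ j u • v j = C u) : ∑ j ∈ s, eps (ξ j) * iota (v j) = der C := by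
  have h1 : ∀ j, eps (ξ j) * iota (v j) = ∑ i, eps (cob E i) * iota (ξ j (bas E i) • v j) := by
    intro j
    conv_lhs => rw [← sum_apply_bas_smul_cob (ξ j)]
    change epsL _ * _ = _
    rw [_root_.map_sum, Finset.sum_mul]
    refine Finset.sum_congr rfl fun i _ => ?_
    rw [_root_.map_smul, iota_smul, smul_mul_assoc, mul_smul_comm]; rfl
  rw [Finset.sum_congr rfl fun j _ => h1 j, Finset.sum_comm, der]
  refine Finset.sum_congr rfl fun i _ => ?_
  rw [← h, ← Finset.mul_sum]
  change _ = _ * iotaL _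
  rw [_root_.map_sum]; rfl

theorem der_apply_succ (C : E →L[ℝ] E) (η : PForm E) (k : ℕ) :
    der C η (k + 1) = alternatizeUncurryFin ((η (k + 1)).curryLeft ∘L C) := by
  rw [alternatizeUncurryFin_eq_sum, der, LinearMap.sum_apply, Finset.sum_apply]
  rfl

theorem der_apply_zero (C : E →L[ℝ] E) (η : PForm E) : der C η 0 = 0 := by
  rw [der, LinearMap.sum_apply, Finset.sum_apply]
  exact Finset.sum_eq_zero fun i _ => rfl

theorem der_one : der (1 : E →L[ℝ] E) = grade fun k => (k : ℂ) := by
  ext η k : 2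
  cases k with
  | zero => rw [der_apply_zero, grade_apply]; simp
  | succ k =>
    rw [der_apply_succ, grade_apply]
    refine (alternatizeUncurryFin_curryLeft (η (k + 1))).trans ?_
    rw [← Nat.cast_smul_eq_nsmul ℂ]

/-- Moving the inserted vector from the first slot to slot `j` produces a sign that cancels the sign
in the antisymmetrization. This is the form in which `der` is compared with the derivative of a
pull-back. -/
theorem der_apply (C : E →L[ℝ] E) (η : PForm E) (k : ℕ) (u : Fin k → E) :
    der C η k u = ∑ j, η k (Function.update u j (C (u j))) := by
  cases k with
  | zero => rw [der_apply_zero]; simp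
  | succ k =>
    rw [der_apply_succ, alternatizeUncurryFin_apply]
    refine Finset.sum_congr rfl fun i _ => ?_
    change (-1) ^ (i : ℕ) • (η (k + 1)) (Matrix.vecCons (C (u i)) (Fin.removeNth i u)) = _
    rw [← neg_one_pow_smul_map_insertNth, smul_smul, ← pow_add, Even.neg_one_pow ⟨_, rfl⟩, one_smul,
      Fin.insertNth_removeNth]

theorem der_neg (C : E →L[ℝ] E) : der (-C) = -der C := by
  simp only [der, _root_.neg_apply, iota_neg, mul_neg, Finset.sum_neg_distrib]

theorem iota_mul_der (C : E →L[ℝ] E) (v : E) : iota v * der C = der C * iota v + iota (C v) := by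
  have h : iota (C v) = ∑ i, cob E i v • iota (C (bas E i)) := by
    conv_lhs => rw [← sum_cob_smul_bas v, _root_.map_sum]
    change iotaL _ = _
    rw [_root_.map_sum]
    exact Finset.sum_congr rfl fun i _ => by rw [_root_.map_smul, _root_.map_smul]; rfl
  rw [der, Finset.mul_sum, Finset.sum_mul, h, ← Finset.sum_add_distrib]
  refine Finset.sum_congr rfl fun i _ => ?_
  rw [← mul_assoc, iota_mul_eps, sub_mul, mul_assoc, iota_mul_iota v, smul_mul_assoc, one_mul]
  noncomm_ring

theorem der_mul_eps (C : E →L[ℝ] E) (ξ : E →L[ℝ] ℝ) :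
    der C * eps ξ = eps ξ * der C + eps (ξ ∘L C) := by
  have h : eps (ξ ∘L C) = ∑ i, ξ (C (bas E i)) • eps (cob E i) := by
    rw [← sum_apply_bas_smul_cob (ξ ∘L C)]
    change epsL _ = _
    rw [_root_.map_sum]
    exact Finset.sum_congr rfl fun i _ => by rw [_root_.map_smul]; rfl
  rw [der, Finset.mul_sum, Finset.sum_mul, h, ← Finset.sum_add_distrib]
  refine Finset.sum_congr rfl fun i _ => ?_
  rw [mul_assoc, iota_mul_eps, mul_sub, ← mul_assoc, ← mul_assoc, eps_mul_eps, mul_smul_comm, mul_one]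
  noncomm_ring

theorem der_pOne (C : E →L[ℝ] E) : der C (pOne E) = 0 := by
  simp [der, iota_pOne]

/-- Exterior multiplication by a form of degree `k`, multiplied by `k!`. -/
def wOp : ∀ k : ℕ, Alt E k → Module.End ℂ (PForm E)
  | 0, α => ev0 α • 1
  | k + 1, α => ∑ i, eps (cob E i) * wOp k (α.curryLeft (bas E i))

/-- It turns the recursively defined wedge product into products of the operators `eps`, so that the
anticommutation relations apply. -/
theorem wOp_apply (k l : ℕ) (α : Alt E k) (η : PForm E) :
    wOp k α η (l + k) = wedgeAux k l α (η l) := by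
  induction k generalizing η with
  | zero => rfl
  | succ k ih =>
    rw [wedgeAux_succ, alternatizeUncurryFin_eq_sum, wOp, LinearMap.sum_apply, Finset.sum_apply]
    refine Finset.sum_congr rfl fun i _ => ?_
    change alternatizeUncurryFin ((cob E i).smulRight (wOp k (α.curryLeft (bas E i)) η (l + k))) = _
    rw [ih]; rfl

theorem wOp_sub (k : ℕ) (α β : Alt E k) : wOp k (α - β) = wOp k α - wOp k β := by
  induction k with
  | zero => simp only [wOp, _root_.map_sub, sub_smul]
  | succ k ih =>
    simp only [wOp, ← Finset.sum_sub_distrib, ← mul_sub, ← ih]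
    rfl

theorem wOp_smul (k : ℕ) (c : ℝ) (α : Alt E k) : wOp k (c • α) = c • wOp k α := by
  induction k with
  | zero => simp only [wOp, _root_.map_smul, smul_assoc]
  | succ k ih =>
    simp only [wOp, Finset.smul_sum, ← mul_smul_comm, ← ih]
    rfl

theorem wOp_sum {ι : Type*} (s : Finset ι) (k : ℕ) (α : ι → Alt E k) :
    wOp k (∑ i ∈ s, α i) = ∑ i ∈ s, wOp k (α i) := by
  have h0 : wOp k (0 : Alt E k) = 0 := by simpa using wOp_sub k 0 0
  have hadd : ∀ a b : Alt E k, wOp k (a + b) = wOp k a + wOp k b := by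
    intro a b
    have h1 := wOp_sub k (a + b) b
    rw [add_sub_cancel_right] at h1
    rw [h1, sub_add_cancel]
  exact _root_.map_sum (⟨⟨wOp k, h0⟩, hadd⟩ : Alt E k →+ Module.End ℂ (PForm E)) _ _

theorem sum_smul_eps (ξ : E →L[ℝ] ℝ) : ∑ i, ξ (bas E i) • eps (cob E i) = eps ξ := by
  conv_rhs => rw [← sum_apply_bas_smul_cob ξ]
  change _ = epsL _
  rw [_root_.map_sum]
  exact Finset.sum_congr rfl fun i _ => by rw [_root_.map_smul]; rfl

theorem curryLeft_alternatizeUncurryFin_smulRight {k : ℕ} (ξ : E →L[ℝ] ℝ) (α : Alt E (k + 1))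
    (v : E) : (alternatizeUncurryFin (ξ.smulRight α)).curryLeft v =
      ξ v • α - alternatizeUncurryFin (ξ.smulRight (α.curryLeft v)) := by
  rw [alternatizeUncurryFin_cons]
  rfl

/-- The factor `k + 1` is the ratio of the normalizations `(k + 1)!` and `k!`. In the induction the
term `ξ(v) α` of the contracted form gives one copy, and the term `ξ ∧ ι_v α` gives the remaining
ones after two `eps` are exchanged. -/
theorem wOp_alternatizeUncurryFin (k : ℕ) (ξ : E →L[ℝ] ℝ) (α : Alt E k) :
    wOp (k + 1) (alternatizeUncurryFin (ξ.smulRight α)) = ((k + 1 : ℕ) : ℝ) • (eps ξ * wOp k α) := by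
  induction k with
  | zero =>
    simp only [wOp, alternatizeUncurryFin_cons_zero, ContinuousLinearMap.smulRight_apply,
      _root_.map_smul]
    rw [← sum_smul_eps ξ, Finset.sum_mul, zero_add, Nat.cast_one, one_smul]
    exact Finset.sum_congr rfl fun i _ => by rw [smul_assoc, mul_smul_comm, smul_mul_assoc]
  | succ k ih =>
    rw [wOp]
    simp only [curryLeft_alternatizeUncurryFin_smulRight, wOp_sub, ih, wOp_smul, mul_sub,
      Finset.sum_sub_distrib, mul_smul_comm]
    have h1 : ∑ i, ξ (bas E i) • (eps (cob E i) * wOp (k + 1) α) = eps ξ * wOp (k + 1) α := by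
      rw [← sum_smul_eps ξ, Finset.sum_mul]
      exact Finset.sum_congr rfl fun i _ => by rw [smul_mul_assoc]
    have h2 : ∑ i, ((k + 1 : ℕ) : ℝ) • (eps (cob E i) * (eps ξ * wOp k (α.curryLeft (bas E i)))) =
        -(((k + 1 : ℕ) : ℝ) • (eps ξ * wOp (k + 1) α)) := by
      rw [wOp, Finset.mul_sum, Finset.smul_sum, ← Finset.sum_neg_distrib]
      refine Finset.sum_congr rfl fun i _ => ?_
      rw [← mul_assoc, eps_mul_eps, neg_mul, smul_neg, mul_assoc]
    rw [h1, h2, sub_neg_eq_add, Nat.cast_succ (k + 1), add_smul, one_smul, add_comm]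

/-- Contraction of forms with a form of degree `k`, multiplied by `k!`. -/
def cOp (G : (E →L[ℝ] ℝ) →L[ℝ] E) : ∀ k : ℕ, Alt E k → Module.End ℂ (PForm E)
  | 0, α => ev0 α • 1
  | k + 1, α => ∑ i, cOp G k (α.curryLeft (bas E i)) * iota (G (cob E i))

variable (G : (E →L[ℝ] ℝ) →L[ℝ] E)

theorem cOp_apply (k l : ℕ) (α : Alt E k) (η : PForm E) :
    cOp G k α η l = contractAux G k l α (η (l + k)) := by
  induction k generalizing η with
  | zero => rfl
  | succ k ih =>
    rw [contractAux_succ, cOp, LinearMap.sum_apply, Finset.sum_apply]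
    refine Finset.sum_congr rfl fun i _ => ?_
    rw [Module.End.mul_apply, ih]
    rfl

theorem cOp_sub (k : ℕ) (α β : Alt E k) : cOp G k (α - β) = cOp G k α - cOp G k β := by
  induction k with
  | zero => simp only [cOp, _root_.map_sub, sub_smul]
  | succ k ih =>
    simp only [cOp, ← Finset.sum_sub_distrib, ← sub_mul, ← ih]
    rfl

theorem cOp_smul (k : ℕ) (c : ℝ) (α : Alt E k) : cOp G k (c • α) = c • cOp G k α := by
  induction k with
  | zero => simp only [cOp, _root_.map_smul, smul_assoc]
  | succ k ih =>
    simp only [cOp, Finset.smul_sum, ← smul_mul_assoc, ← ih]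
    rfl

theorem sum_smul_iota (ξ : E →L[ℝ] ℝ) : ∑ i, ξ (bas E i) • iota (G (cob E i)) = iota (G ξ) := by
  conv_rhs => rw [← sum_apply_bas_smul_cob ξ, _root_.map_sum]
  change _ = iotaL _
  rw [_root_.map_sum]
  exact Finset.sum_congr rfl fun i _ => by rw [_root_.map_smul, _root_.map_smul]; rfl

/-- As for `wOp`, but the indices of the contracting form act in their order, so the contraction
with the leading covector is applied first and stands on the right. -/
theorem cOp_alternatizeUncurryFin (k : ℕ) (ξ : E →L[ℝ] ℝ) (α : Alt E k) :
    cOp G (k + 1) (alternatizeUncurryFin (ξ.smulRight α)) =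
      ((k + 1 : ℕ) : ℝ) • (cOp G k α * iota (G ξ)) := by
  induction k with
  | zero =>
    simp only [cOp, alternatizeUncurryFin_cons_zero, ContinuousLinearMap.smulRight_apply,
      _root_.map_smul]
    rw [← sum_smul_iota G ξ, Finset.mul_sum, zero_add, Nat.cast_one, one_smul]
    exact Finset.sum_congr rfl fun i _ => by rw [smul_assoc, mul_smul_comm, smul_mul_assoc]
  | succ k ih =>
    rw [cOp]
    simp only [curryLeft_alternatizeUncurryFin_smulRight, cOp_sub, ih, cOp_smul, sub_mul,
      Finset.sum_sub_distrib, smul_mul_assoc]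
    have h1 : ∑ i, ξ (bas E i) • (cOp G (k + 1) α * iota (G (cob E i))) =
        cOp G (k + 1) α * iota (G ξ) := by
      rw [← sum_smul_iota G ξ, Finset.mul_sum]
      exact Finset.sum_congr rfl fun i _ => by rw [mul_smul_comm]
    have h2 : ∑ i, ((k + 1 : ℕ) : ℝ) • (cOp G k (α.curryLeft (bas E i)) * iota (G ξ) *
        iota (G (cob E i))) = -(((k + 1 : ℕ) : ℝ) • (cOp G (k + 1) α * iota (G ξ))) := by
      rw [cOp, Finset.sum_mul, Finset.smul_sum, ← Finset.sum_neg_distrib]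
      refine Finset.sum_congr rfl fun i _ => ?_
      rw [mul_assoc, iota_mul_iota, mul_neg, smul_neg, mul_assoc]
    rw [h1, h2, sub_neg_eq_add, Nat.cast_succ (k + 1), add_smul, one_smul, add_comm]

theorem iota_mul_cOp (k : ℕ) (α : Alt E k) (v : E) :
    iota v * cOp G k α = (-1 : ℝ) ^ k • (cOp G k α * iota v) := by
  induction k with
  | zero => simp [cOp]
  | succ k ih =>
    rw [cOp, Finset.mul_sum, Finset.sum_mul, Finset.smul_sum]
    refine Finset.sum_congr rfl fun i _ => ?_
    rw [← mul_assoc, ih, smul_mul_assoc, mul_assoc, iota_mul_iota v, pow_succ, mul_smul, mul_neg,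
      neg_one_smul, smul_neg, mul_assoc, smul_neg]

end FiniteDimensional

/-! ### Pointwise Lefschetz operators of skew endomorphisms and their commutators. -/

section Metric
variable {E : Type*} [NormedAddCommGroup E] [NormedSpace ℝ E] [FiniteDimensional ℝ E]

/-- `G` is the inverse of the symmetric bilinear form `g`. -/
structure IsDualMetric (g : E →L[ℝ] E →L[ℝ] ℝ) (G : (E →L[ℝ] ℝ) →L[ℝ] E) : Prop where
  symm : ∀ u v, g u v = g v u
  left : ∀ ξ, g (G ξ) = ξ
  right : ∀ v, G (g v) = v

/-- An endomorphism that is skew with respect to `g`. -/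
def IsSkew (g : E →L[ℝ] E →L[ℝ] ℝ) (A : E →L[ℝ] E) : Prop := ∀ u v, g (A u) v = -g u (A v)

/-- Exterior multiplication by the form `(u, v) ↦ g (u, A v)`. -/
def pL (g : E →L[ℝ] E →L[ℝ] ℝ) (A : E →L[ℝ] E) : Module.End ℂ (PForm E) :=
  (2⁻¹ : ℂ) • ∑ i, eps (cob E i) * eps (g (bas E i) ∘L A)

/-- Contraction with the form `(u, v) ↦ g (u, A v)`. -/
def pLam (G : (E →L[ℝ] ℝ) →L[ℝ] E) (A : E →L[ℝ] E) : Module.End ℂ (PForm E) :=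
  (2⁻¹ : ℂ) • ∑ i, iota (G (cob E i)) * iota (A (bas E i))

variable {g : E →L[ℝ] E →L[ℝ] ℝ} {G : (E →L[ℝ] ℝ) →L[ℝ] E} {A B C : E →L[ℝ] E}

theorem pL_neg : pL g (-A) = -pL g A := by
  simp only [pL, ContinuousLinearMap.comp_neg, eps_neg, mul_neg, Finset.sum_neg_distrib, smul_neg]

theorem pLam_neg : pLam G (-A) = -pLam G A := by
  simp only [pLam, _root_.neg_apply, iota_neg, mul_neg, Finset.sum_neg_distrib, smul_neg]

theorem pL_sub : pL g (A - B) = pL g A - pL g B := by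
  have : ∀ i, eps (g (bas E i) ∘L (A - B)) = eps (g (bas E i) ∘L A) - eps (g (bas E i) ∘L B) :=
    fun i => by rw [ContinuousLinearMap.comp_sub]; exact epsL.map_sub _ _
  simp only [pL, this, mul_sub, Finset.sum_sub_distrib, smul_sub]

theorem pLam_sub : pLam G (A - B) = pLam G A - pLam G B := by
  have : ∀ i, iota ((A - B) (bas E i)) = iota (A (bas E i)) - iota (B (bas E i)) :=
    fun i => iotaL.map_sub _ _
  simp only [pLam, this, mul_sub, Finset.sum_sub_distrib, smul_sub]

variable (hG : IsDualMetric g G)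
include hG

theorem IsDualMetric.apply_cob (v : E) (i : Fin (Module.finrank ℝ E)) :
    g v (G (cob E i)) = cob E i v := by rw [hG.symm, hG.left]

theorem IsDualMetric.sum_smul (u : E) : ∑ i, g (bas E i) u • G (cob E i) = u := by
  simp only [hG.symm _ u, ← _root_.map_smul, ← _root_.map_sum, sum_apply_bas_smul_cob, hG.right]

theorem IsDualMetric.sum_smul' (ξ : E →L[ℝ] ℝ) : ∑ i, ξ (G (cob E i)) • bas E i = G ξ := by
  conv_rhs => rw [← sum_cob_smul_bas (G ξ)]
  refine Finset.sum_congr rfl fun i _ => ?_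
  rw [← hG.apply_cob, hG.left]

theorem IsDualMetric.map_skew (hA : IsSkew g A) (ξ : E →L[ℝ] ℝ) : G (ξ ∘L A) = -A (G ξ) := by
  have : ξ ∘L A = g (-A (G ξ)) := by
    ext v
    rw [_root_.map_neg, _root_.neg_apply, hA, neg_neg, hG.left]; rfl
  rw [this, hG.right]

/-- A skew endomorphism annihilates the inverse metric. -/
theorem IsDualMetric.sum_skew {V : Type*} [AddCommGroup V] [Module ℝ V] (hA : IsSkew g A)
    (T : E →ₗ[ℝ] E →ₗ[ℝ] V) :
    ∑ i, T (A (G (cob E i))) (bas E i) = -∑ i, T (G (cob E i)) (A (bas E i)) := by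
  have h1 : ∀ j, T (A (G (cob E j))) (bas E j) =
      ∑ i, T (G (cob E i)) (g (bas E i) (A (G (cob E j))) • bas E j) := by
    intro j
    conv_lhs => rw [← hG.sum_smul (A (G (cob E j)))]
    simp only [_root_.map_sum, LinearMap.sum_apply, _root_.map_smul, LinearMap.smul_apply]
  rw [Finset.sum_congr rfl fun j _ => h1 j, Finset.sum_comm, ← Finset.sum_neg_distrib]
  refine Finset.sum_congr rfl fun i _ => ?_
  rw [← _root_.map_sum, ← _root_.map_neg]
  congr 1
  have h2 : ∀ j, g (bas E i) (A (G (cob E j))) = -(cob E j (A (bas E i))) := by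
    intro j
    rw [← hG.apply_cob, hA, neg_neg]
  simp only [h2, neg_smul, Finset.sum_neg_distrib, sum_cob_smul_bas]

/-- Contracting either of the two factors of each summand gives the same covector, by skewness of
`A` and symmetry of `g`; this cancels the factor `1/2` in `pL`. -/
theorem pL_mul_iota (hA : IsSkew g A) (v : E) :
    pL g A * iota v = iota v * pL g A - eps (g v ∘L A) := by
  have h1 : ∀ i, iota v * (eps (cob E i) * eps (g (bas E i) ∘L A)) =
      cob E i v • eps (g (bas E i) ∘L A) - g (bas E i) (A v) • eps (cob E i) +
        eps (cob E i) * eps (g (bas E i) ∘L A) * iota v := by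
    intro i
    rw [← mul_assoc, iota_mul_eps, sub_mul, mul_assoc, iota_mul_eps, mul_sub, smul_mul_assoc, one_mul,
      mul_smul_comm, mul_one, mul_assoc]
    simp only [ContinuousLinearMap.comp_apply]
    abel
  have h2 : ∑ i, cob E i v • eps (g (bas E i) ∘L A) = eps (g v ∘L A) := by
    have : g v ∘L A = ∑ i, cob E i v • (g (bas E i) ∘L A) := by
      conv_lhs => rw [← sum_cob_smul_bas v]
      ext u; simp
    rw [this]
    change _ = epsL _
    rw [_root_.map_sum]
    exact Finset.sum_congr rfl fun i _ => by rw [_root_.map_smul]; rfl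
  have h3 : ∑ i, g (bas E i) (A v) • eps (cob E i) = -eps (g v ∘L A) := by
    have : g v ∘L A = - g (A v) := by ext u; simp [hA v u]
    rw [this, eps_neg, neg_neg, ← sum_smul_eps]
    exact Finset.sum_congr rfl fun i _ => by rw [hG.symm]
  rw [pL, mul_smul_comm, Finset.mul_sum, Finset.sum_congr rfl fun i _ => h1 i,
    Finset.sum_add_distrib, Finset.sum_sub_distrib, h2, h3, smul_mul_assoc, Finset.sum_mul]
  module

/-- Dual to `pL_mul_iota`: the two contractions with `ξ` contribute equally by skewness, which
cancels the factor `1/2`. -/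
theorem pLam_mul_eps (hA : IsSkew g A) (ξ : E →L[ℝ] ℝ) :
    pLam G A * eps ξ = eps ξ * pLam G A - iota (A (G ξ)) := by
  have h1 : ∀ i, iota (G (cob E i)) * iota (A (bas E i)) * eps ξ =
      ξ (A (bas E i)) • iota (G (cob E i)) - ξ (G (cob E i)) • iota (A (bas E i)) +
        eps ξ * (iota (G (cob E i)) * iota (A (bas E i))) := by
    intro i
    rw [mul_assoc, iota_mul_eps, mul_sub, ← mul_assoc, iota_mul_eps, sub_mul, mul_smul_comm, mul_one,
      smul_mul_assoc, one_mul, mul_assoc]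
    abel
  have h2 : ∑ i, ξ (A (bas E i)) • iota (G (cob E i)) = -iota (A (G ξ)) := by
    have := sum_smul_iota G (ξ ∘L A)
    rw [hG.map_skew hA, iota_neg] at this
    exact this
  have h3 : ∑ i, ξ (G (cob E i)) • iota (A (bas E i)) = iota (A (G ξ)) := by
    conv_rhs => rw [← hG.sum_smul' ξ, _root_.map_sum]
    change _ = iotaL _
    rw [_root_.map_sum]
    exact Finset.sum_congr rfl fun i _ => by rw [_root_.map_smul, _root_.map_smul]; rfl
  rw [pLam, smul_mul_assoc, Finset.sum_mul, Finset.sum_congr rfl fun i _ => h1 i,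
    Finset.sum_add_distrib, Finset.sum_sub_distrib, h2, h3, mul_smul_comm, Finset.mul_sum]
  module

omit hG in
theorem pL_mul_eps (ξ : E →L[ℝ] ℝ) : pL g A * eps ξ = eps ξ * pL g A := by
  rw [pL, smul_mul_assoc, mul_smul_comm, Finset.sum_mul, Finset.mul_sum]
  congr 1
  refine Finset.sum_congr rfl fun i _ => ?_
  rw [mul_assoc, eps_mul_eps _ ξ, mul_neg, ← mul_assoc, eps_mul_eps _ ξ, neg_mul, neg_neg, mul_assoc]

omit hG in
theorem pLam_mul_iota (v : E) : pLam G A * iota v = iota v * pLam G A := by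
  rw [pLam, smul_mul_assoc, mul_smul_comm, Finset.sum_mul, Finset.mul_sum]
  congr 1
  refine Finset.sum_congr rfl fun i _ => ?_
  rw [mul_assoc, iota_mul_iota _ v, mul_neg, ← mul_assoc, iota_mul_iota _ v, neg_mul, neg_neg,
    mul_assoc]

omit hG in
theorem pL_comm : pL g A * pL g B = pL g B * pL g A := by
  conv_lhs => rw [pL, smul_mul_assoc, Finset.sum_mul]
  conv_rhs => arg 2; rw [pL]
  rw [mul_smul_comm, Finset.mul_sum]
  congr 1
  refine Finset.sum_congr rfl fun i _ => ?_
  rw [← mul_assoc, pL_mul_eps, mul_assoc, mul_assoc, pL_mul_eps]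

/-- Moving `pL g A` past both contractions leaves a scalar and two terms of type `eps * iota`. In
the metrically dual frame these are `-der (B ∘L A)` and `der (B ∘L A)`, entering with opposite
signs, so they add up and cancel the `1/2`. -/
theorem pL_mul_pLam (hA : IsSkew g A) (hB : IsSkew g B) :
    pL g A * pLam G B - pLam G B * pL g A = -der (B ∘L A) -
      (2⁻¹ * (∑ i, g (B (bas E i)) (A (G (cob E i)))) : ℝ) • 1 := by
  have h1 : ∀ i, pL g A * (iota (G (cob E i)) * iota (B (bas E i))) =
      iota (G (cob E i)) * iota (B (bas E i)) * pL g A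
      - g (B (bas E i)) (A (G (cob E i))) • 1
      + eps (g (B (bas E i)) ∘L A) * iota (G (cob E i))
      - eps (g (G (cob E i)) ∘L A) * iota (B (bas E i)) := by
    intro i
    rw [← mul_assoc, pL_mul_iota hG hA, sub_mul, mul_assoc, pL_mul_iota hG hA, mul_sub,
      iota_mul_eps, ← mul_assoc]
    simp only [ContinuousLinearMap.comp_apply]
    abel
  have h2 : ∑ i, eps (g (B (bas E i)) ∘L A) * iota (G (cob E i)) = -der (B ∘L A) := by
    rw [← der_neg]
    refine sum_eps_mul_iota _ _ _ _ fun u => ?_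
    simp only [ContinuousLinearMap.comp_apply, hB _ (A u), neg_smul, Finset.sum_neg_distrib,
      hG.sum_smul]
    rfl
  have h3 : ∑ i, eps (g (G (cob E i)) ∘L A) * iota (B (bas E i)) = der (B ∘L A) := by
    refine sum_eps_mul_iota _ _ _ _ fun u => ?_
    simp only [ContinuousLinearMap.comp_apply, hG.left, ← _root_.map_smul, ← _root_.map_sum,
      sum_cob_smul_bas]
  have h4 : pL g A * pLam G B = (2⁻¹ : ℂ) • ∑ i, pL g A * (iota (G (cob E i)) * iota (B (bas E i))) := by
    rw [pLam, mul_smul_comm, Finset.mul_sum]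
  rw [h4, Finset.sum_congr rfl fun i _ => h1 i, Finset.sum_sub_distrib, Finset.sum_add_distrib,
    Finset.sum_sub_distrib, h2, h3, ← Finset.sum_mul, pLam, smul_mul_assoc, ← Finset.sum_smul]
  have : ∀ (c : ℝ) (x : Module.End ℂ (PForm E)), (2⁻¹ * c) • x = (2⁻¹ : ℂ) • c • x := by
    intro c x
    rw [← Complex.coe_smul, ← Complex.coe_smul, smul_smul]; push_cast; rfl
  rw [this]
  module

/-- A derivation acts on each factor of `e^i ∧ g (e_i, A ·)` in turn: on the second it composes with
`C`, giving `A C`; on the first, `C` is moved across the metric by skewness, giving `-C A`. -/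
theorem der_mul_pL (hC : IsSkew g C) :
    der C * pL g A = pL g A * der C + pL g (A ∘L C - C ∘L A) := by
  have h1 : ∀ i, der C * (eps (cob E i) * eps (g (bas E i) ∘L A)) =
      eps (cob E i) * eps (g (bas E i) ∘L A) * der C + eps (cob E i) * eps (g (bas E i) ∘L (A ∘L C)) +
        eps (cob E i ∘L C) * eps (g (bas E i) ∘L A) := by
    intro i
    rw [← mul_assoc, der_mul_eps, add_mul, mul_assoc, der_mul_eps, mul_add, ← mul_assoc]
    rfl
  have h2 : ∑ i, eps (cob E i ∘L C) * eps (g (bas E i) ∘L A) =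
      -∑ i, eps (cob E i) * eps (g (bas E i) ∘L (C ∘L A)) := by
    have h3 : ∀ i, eps (cob E i ∘L C) * eps (g (bas E i) ∘L A) =
        ∑ j, eps (cob E j) * eps (g (cob E i (C (bas E j)) • bas E i) ∘L A) := by
      intro i
      rw [← sum_smul_eps (cob E i ∘L C), Finset.sum_mul]
      refine Finset.sum_congr rfl fun j _ => ?_
      rw [_root_.map_smul, ContinuousLinearMap.smul_comp, eps_smul, mul_smul_comm, smul_mul_assoc]
      rfl
    rw [Finset.sum_congr rfl fun i _ => h3 i, Finset.sum_comm, ← Finset.sum_neg_distrib]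
    refine Finset.sum_congr rfl fun j _ => ?_
    rw [← Finset.mul_sum, ← mul_neg, ← eps_neg]
    congr 1
    have h4 : -(g (bas E j) ∘L (C ∘L A)) =
        ∑ i, (g (cob E i (C (bas E j)) • bas E i) ∘L A) := by
      ext u
      simp only [_root_.neg_apply, ContinuousLinearMap.comp_apply, _root_.sum_apply]
      rw [← hC]
      conv_lhs => rw [← sum_cob_smul_bas (C (bas E j))]
      rw [_root_.map_sum, _root_.sum_apply]
    rw [h4]
    change _ = epsL _
    rw [_root_.map_sum]; rfl
  rw [pL_sub]
  simp only [pL]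
  rw [mul_smul_comm, Finset.mul_sum, Finset.sum_congr rfl fun i _ => h1 i,
    Finset.sum_add_distrib, Finset.sum_add_distrib, h2, smul_mul_assoc, Finset.sum_mul]
  module

theorem der_mul_pLam (hC : IsSkew g C) :
    der C * pLam G A = pLam G A * der C + pLam G (A ∘L C - C ∘L A) := by
  have hder : ∀ v : E, der C * iota v = iota v * der C - iota (C v) := fun v => by
    rw [iota_mul_der]; abel
  have h1 : ∀ i, der C * (iota (G (cob E i)) * iota (A (bas E i))) =
      iota (G (cob E i)) * iota (A (bas E i)) * der C - iota (G (cob E i)) * iota (C (A (bas E i))) -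
        iota (C (G (cob E i))) * iota (A (bas E i)) := by
    intro i
    rw [← mul_assoc, hder, sub_mul, mul_assoc, hder, mul_sub, ← mul_assoc]
  let T : E →ₗ[ℝ] E →ₗ[ℝ] Module.End ℂ (PForm E) :=
    (LinearMap.mul ℝ _).compl₁₂ iotaL (iotaL ∘ₗ A.toLinearMap)
  have h2 : ∑ i, iota (C (G (cob E i))) * iota (A (bas E i)) =
      -∑ i, iota (G (cob E i)) * iota (A (C (bas E i))) := hG.sum_skew hC T
  rw [pLam_sub]
  simp only [pLam]
  rw [mul_smul_comm, Finset.mul_sum, Finset.sum_congr rfl fun i _ => h1 i,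
    Finset.sum_sub_distrib, Finset.sum_sub_distrib, h2, smul_mul_assoc, Finset.sum_mul]
  simp only [ContinuousLinearMap.comp_apply]
  module

omit hG in
theorem pull_mul_iota (hA : A ∘L A = -1) (v : E) : pull A * iota v = -(iota (A v) * pull A) := by
  have := iota_mul_pull A (A v)
  have h : A (A v) = -v := congrArg (fun T => T v) hA
  rw [this, h, iota_neg, mul_neg, neg_neg]

/-- Pull-back is multiplicative and changes the form `g (u, B v)` into `g (A u, B A v) = -g (u, A B
A v)`. -/
theorem pull_mul_pL (hA : IsSkew g A) :
    pull A * pL g B = pL g (-(A ∘L B ∘L A)) * pull A := by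
  have h1 : ∀ i, pull A * (eps (cob E i) * eps (g (bas E i) ∘L B)) =
      eps (cob E i ∘L A) * eps (g (bas E i) ∘L B ∘L A) * pull A := by
    intro i
    rw [← mul_assoc, pull_mul_eps, mul_assoc, pull_mul_eps, ← mul_assoc]; rfl
  have h2 : ∑ i, eps (cob E i ∘L A) * eps (g (bas E i) ∘L B ∘L A) =
      -∑ i, eps (cob E i) * eps (g (bas E i) ∘L (A ∘L B ∘L A)) := by
    have h3 : ∀ i, eps (cob E i ∘L A) * eps (g (bas E i) ∘L B ∘L A) =
        ∑ j, eps (cob E j) * eps (g (cob E i (A (bas E j)) • bas E i) ∘L B ∘L A) := by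
      intro i
      rw [← sum_smul_eps (cob E i ∘L A), Finset.sum_mul]
      refine Finset.sum_congr rfl fun j _ => ?_
      rw [_root_.map_smul, ContinuousLinearMap.smul_comp, eps_smul, mul_smul_comm, smul_mul_assoc]
      rfl
    rw [Finset.sum_congr rfl fun i _ => h3 i, Finset.sum_comm, ← Finset.sum_neg_distrib]
    refine Finset.sum_congr rfl fun j _ => ?_
    rw [← Finset.mul_sum, ← mul_neg, ← eps_neg]
    congr 1
    have h4 : -(g (bas E j) ∘L (A ∘L B ∘L A)) =
        ∑ i, (g (cob E i (A (bas E j)) • bas E i) ∘L B ∘L A) := by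
      ext u
      simp only [_root_.neg_apply, ContinuousLinearMap.comp_apply, _root_.sum_apply]
      rw [← hA]
      conv_lhs => rw [← sum_cob_smul_bas (A (bas E j))]
      rw [_root_.map_sum, _root_.sum_apply]
    rw [h4]
    change _ = epsL _
    rw [_root_.map_sum]; rfl
  rw [pL_neg]
  simp only [pL]
  rw [mul_smul_comm, Finset.mul_sum, Finset.sum_congr rfl fun i _ => h1 i, ← Finset.sum_mul, h2, neg_mul, neg_mul, smul_mul_assoc,
    smul_neg]

theorem pull_mul_pLam (hA : IsSkew g A) (hA2 : A ∘L A = -1) :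
    pull A * pLam G B = pLam G (-(A ∘L B ∘L A)) * pull A := by
  have h1 : ∀ i, pull A * (iota (G (cob E i)) * iota (B (bas E i))) =
      iota (A (G (cob E i))) * iota (A (B (bas E i))) * pull A := by
    intro i
    rw [← mul_assoc, pull_mul_iota hA2, neg_mul, mul_assoc, pull_mul_iota hA2, mul_neg, neg_neg,
      mul_assoc]
  let T : E →ₗ[ℝ] E →ₗ[ℝ] Module.End ℂ (PForm E) :=
    (LinearMap.mul ℝ _).compl₁₂ iotaL (iotaL ∘ₗ (A ∘L B).toLinearMap)
  have h2 : ∑ i, iota (A (G (cob E i))) * iota (A (B (bas E i))) =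
      -∑ i, iota (G (cob E i)) * iota (A (B (A (bas E i)))) := hG.sum_skew hA T
  rw [pLam_neg]
  simp only [pLam]
  rw [mul_smul_comm, Finset.mul_sum, Finset.sum_congr rfl fun i _ => h1 i, ← Finset.sum_mul, h2, neg_mul, neg_mul, smul_mul_assoc,
    smul_neg]
  rfl

omit hG in
theorem pull_mul_der (hA2 : A ∘L A = -1) : pull A * der C = der (-(A ∘L C ∘L A)) * pull A := by
  have h1 : ∀ i, pull A * (eps (cob E i) * iota (C (bas E i))) =
      -(eps (cob E i ∘L A) * iota (A (C (bas E i))) * pull A) := by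
    intro i
    rw [← mul_assoc, pull_mul_eps, mul_assoc, pull_mul_iota hA2, mul_neg, mul_assoc]
  rw [der, Finset.mul_sum, Finset.sum_congr rfl fun i _ => h1 i, Finset.sum_neg_distrib,
    ← Finset.sum_mul, ← neg_mul, der_neg]
  congr 2
  refine sum_eps_mul_iota _ _ _ _ fun u => ?_
  simp only [← _root_.map_smul, ← _root_.map_sum, ContinuousLinearMap.comp_apply, sum_cob_smul_bas]

end Metric

/-! ### Two `sl₂`-triples from the operators of a hyperkähler structure. -/

section PairAlgebra
variable {R : Type*} [Ring R] [Algebra ℂ R]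

/-- The commutation relations of the operators `L_J, L_K, Λ_J, Λ_K, H, ad I` of a hyperkähler
structure. -/
structure IsPair (Lb Lc Mb Mc H D : R) : Prop where
  bb : Lb * Mb - Mb * Lb = H
  cc : Lc * Mc - Mc * Lc = H
  bc : Lb * Mc - Mc * Lb = D
  cb : Lc * Mb - Mb * Lc = -D
  Hb : H * Lb - Lb * H = 2 * Lb
  Hc : H * Lc - Lc * H = 2 * Lc
  Hb' : H * Mb - Mb * H = -(2 * Mb)
  Hc' : H * Mc - Mc * H = -(2 * Mc)
  Db : D * Lb - Lb * D = -(2 * Lc)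
  Dc : D * Lc - Lc * D = 2 * Lb
  Db' : D * Mb - Mb * D = -(2 * Mc)
  Dc' : D * Mc - Mc * D = 2 * Mb

variable {Lb Lc Mb Mc H D : R}

/-- Expanding bilinearly, only `j² = -1` and the relations of the pair are needed. For `j = √-1`
this is the triple `L_Ω, Λ_Ω, H_Ω`; for `j = -√-1` it is that of the conjugate form. -/
theorem IsPair.sl2_of_sq (t : IsPair Lb Lc Mb Mc H D) {j : ℂ} (hj : j * j = -1) :
    IsSl2 ((2⁻¹ : ℂ) • (Lb + j • Lc)) ((2⁻¹ : ℂ) • (Mb - j • Mc)) ((2⁻¹ : ℂ) • (H - j • D)) where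
  ef := by
    have e : ((2⁻¹ : ℂ) • (Lb + j • Lc)) * ((2⁻¹ : ℂ) • (Mb - j • Mc)) -
        ((2⁻¹ : ℂ) • (Mb - j • Mc)) * ((2⁻¹ : ℂ) • (Lb + j • Lc)) =
        (2⁻¹ * 2⁻¹ : ℂ) • ((Lb * Mb - Mb * Lb) - (j * j) • (Lc * Mc - Mc * Lc) -
          j • (Lb * Mc - Mc * Lb) + j • (Lc * Mb - Mb * Lc)) := by
      simp only [mul_add, mul_sub, sub_mul, add_mul, smul_mul_assoc, mul_smul_comm]
      module
    rw [e, t.bb, t.cc, t.bc, t.cb, hj]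
    module
  he := by
    have e : ((2⁻¹ : ℂ) • (H - j • D)) * ((2⁻¹ : ℂ) • (Lb + j • Lc)) -
        ((2⁻¹ : ℂ) • (Lb + j • Lc)) * ((2⁻¹ : ℂ) • (H - j • D)) =
        (2⁻¹ * 2⁻¹ : ℂ) • ((H * Lb - Lb * H) - (j * j) • (D * Lc - Lc * D) -
          j • (D * Lb - Lb * D) + j • (H * Lc - Lc * H)) := by
      simp only [mul_add, mul_sub, sub_mul, add_mul, smul_mul_assoc, mul_smul_comm]
      module
    rw [e, t.Hb, t.Hc, t.Db, t.Dc, hj]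
    simp only [two_mul]
    module
  hf := by
    have e : ((2⁻¹ : ℂ) • (H - j • D)) * ((2⁻¹ : ℂ) • (Mb - j • Mc)) -
        ((2⁻¹ : ℂ) • (Mb - j • Mc)) * ((2⁻¹ : ℂ) • (H - j • D)) =
        (2⁻¹ * 2⁻¹ : ℂ) • ((H * Mb - Mb * H) + (j * j) • (D * Mc - Mc * D) -
          j • (D * Mb - Mb * D) - j • (H * Mc - Mc * H)) := by
      simp only [mul_sub, sub_mul, smul_mul_assoc, mul_smul_comm]
      module
    rw [e, t.Hb', t.Hc', t.Db', t.Dc', hj]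
    simp only [two_mul]
    module

end PairAlgebra

/-! ### The hyperkähler commutation relations at a point. -/

section Relations
variable {E : Type*} [NormedAddCommGroup E] [NormedSpace ℝ E] [FiniteDimensional ℝ E]
  {g : E →L[ℝ] E →L[ℝ] ℝ} {G : (E →L[ℝ] ℝ) →L[ℝ] E} {A B C : E →L[ℝ] E}

variable (E) in
/-- Multiplication of `k`-forms by `k - dim E / 2`. -/
def pH : Module.End ℂ (PForm E) := grade fun k => k - (Module.finrank ℝ E : ℂ) / 2

theorem pH_eq : pH E = der 1 - ((Module.finrank ℝ E : ℂ) / 2) • 1 := by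
  rw [der_one]
  ext η k : 2
  simp [pH, grade_apply, sub_smul]

theorem trace_sum (T : E →L[ℝ] E) : ∑ i, cob E i (T (bas E i)) = LinearMap.trace ℝ E T := by
  rw [LinearMap.trace_eq_matrix_trace ℝ (Module.finBasis ℝ E), Matrix.trace]
  refine Finset.sum_congr rfl fun i _ => ?_
  rw [Matrix.diag_apply, LinearMap.toMatrix_apply]
  rfl

theorem IsSkew.isometry (hA : IsSkew g A) (hA2 : A ∘L A = -1) (u v : E) :
    g (A u) (A v) = g u v := by
  have h : A (A v) = -v := congrArg (fun T => T v) hA2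
  rw [hA, h, _root_.map_neg, neg_neg]

/-- With `A² = -1` the derivation term of `pL_mul_pLam` is the degree, and the scalar is half the
trace of the identity. -/
theorem pL_mul_pLam_self (hG : IsDualMetric g G) (hA : IsSkew g A) (hA2 : A ∘L A = -1) :
    pL g A * pLam G A - pLam G A * pL g A = pH E := by
  rw [pL_mul_pLam hG hA hA, hA2, der_neg, neg_neg, pH_eq]
  have h1 : ∑ i, g (A (bas E i)) (A (G (cob E i))) = Module.finrank ℝ E := by
    simp only [hA.isometry hA2, hG.apply_cob, cob_bas]
    simp
  rw [h1, ← Complex.coe_smul]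
  congr 2
  push_cast; ring

/-- The scalar in `pL_mul_pLam` is a multiple of the trace of `B C`, which vanishes because `tr (B
C) = tr (C B) = -tr (B C)`. -/
theorem pL_mul_pLam_anti (hG : IsDualMetric g G) (hB : IsSkew g B) (hC : IsSkew g C)
    (hBC : B ∘L C = -(C ∘L B)) :
    pL g B * pLam G C - pLam G C * pL g B = der (B ∘L C) := by
  rw [pL_mul_pLam hG hB hC, hBC, der_neg]
  have h1 : ∑ i, g (C (bas E i)) (B (G (cob E i))) = 0 := by
    have h2 : ∀ i, g (C (bas E i)) (B (G (cob E i))) = -cob E i ((B ∘L C) (bas E i)) := by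
      intro i
      have := hB (C (bas E i)) (G (cob E i))
      rw [hG.apply_cob] at this
      rw [ContinuousLinearMap.comp_apply, this, neg_neg]
    have h3 : LinearMap.trace ℝ E (B ∘L C) = 0 := by
      have h4 := LinearMap.trace_mul_comm ℝ B.toLinearMap C.toLinearMap
      have h5 : B.toLinearMap * C.toLinearMap = -(C.toLinearMap * B.toLinearMap) := by
        have := congrArg ContinuousLinearMap.toLinearMap hBC
        exact this
      have h6 : LinearMap.trace ℝ E (B ∘L C) = LinearMap.trace ℝ E (B.toLinearMap * C.toLinearMap) := rfl
      rw [h6]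
      rw [h5, _root_.map_neg] at h4 ⊢
      linarith
    rw [Finset.sum_congr rfl fun i _ => h2 i, Finset.sum_neg_distrib, trace_sum, h3, neg_zero]
  rw [h1, mul_zero, zero_smul, sub_zero]

theorem pH_mul_pL : pH E * pL g A - pL g A * pH E = 2 * pL g A := by
  have h : ∀ i, pH E * (eps (cob E i) * eps (g (bas E i) ∘L A)) =
      eps (cob E i) * eps (g (bas E i) ∘L A) * (pH E + (2 : ℂ) • 1) := by
    intro i
    rw [pH, ← mul_assoc, grade_mul_eps, mul_assoc, grade_mul_eps, ← mul_assoc]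
    congr 1
    ext η k : 2
    simp only [grade_apply, LinearMap.add_apply, Pi.add_apply, LinearMap.smul_apply,
      Module.End.one_apply, Pi.smul_apply]
    rw [← add_smul]
    congr 1; push_cast; ring
  have h2 : pH E * pL g A = pL g A * (pH E + (2 : ℂ) • 1) := by
    rw [pL, mul_smul_comm, Finset.mul_sum, Finset.sum_congr rfl fun i _ => h i, ← Finset.sum_mul,
      smul_mul_assoc]
  rw [h2, mul_add, add_sub_cancel_left, mul_smul_comm, mul_one, two_smul, two_mul]

theorem pH_mul_pLam : pH E * pLam G A - pLam G A * pH E = -(2 * pLam G A) := by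
  have h : ∀ i, iota (G (cob E i)) * iota (A (bas E i)) * pH E =
      (pH E + (2 : ℂ) • 1) * (iota (G (cob E i)) * iota (A (bas E i))) := by
    intro i
    rw [pH, mul_assoc, iota_mul_grade, ← mul_assoc, iota_mul_grade, mul_assoc]
    congr 1
    ext η k : 2
    simp only [grade_apply, LinearMap.add_apply, Pi.add_apply, LinearMap.smul_apply,
      Module.End.one_apply, Pi.smul_apply]
    rw [← add_smul]
    congr 1; push_cast; ring
  have h2 : pLam G A * pH E = (pH E + (2 : ℂ) • 1) * pLam G A := by
    rw [pLam, smul_mul_assoc, Finset.sum_mul, Finset.sum_congr rfl fun i _ => h i, ← Finset.mul_sum,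
      mul_smul_comm]
  rw [h2, add_mul, sub_add_cancel_left, smul_mul_assoc, one_mul, two_smul, two_mul]

/-- Anticommuting complex structures `B`, `C` with `B C = A`, orthogonal with respect to `g`. -/
structure IsHypTriple (g : E →L[ℝ] E →L[ℝ] ℝ) (A B C : E →L[ℝ] E) : Prop where
  skewA : IsSkew g A
  skewB : IsSkew g B
  skewC : IsSkew g C
  sqA : A ∘L A = -1
  sqB : B ∘L B = -1
  sqC : C ∘L C = -1
  bc : B ∘L C = A
  cb : C ∘L B = -A
  ca : C ∘L A = B
  ac : A ∘L C = -B
  ab : A ∘L B = C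
  ba : B ∘L A = -C

theorem IsHypTriple.isPair (hG : IsDualMetric g G) (t : IsHypTriple g A B C) :
    IsPair (pL g B) (pL g C) (pLam G B) (pLam G C) (pH E) (der A) where
  bb := pL_mul_pLam_self hG t.skewB t.sqB
  cc := pL_mul_pLam_self hG t.skewC t.sqC
  bc := by rw [pL_mul_pLam_anti hG t.skewB t.skewC (by rw [t.bc, t.cb, neg_neg]), t.bc]
  cb := by rw [pL_mul_pLam_anti hG t.skewC t.skewB (by rw [t.bc, t.cb]), t.cb, der_neg]
  Hb := pH_mul_pL
  Hc := pH_mul_pL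
  Hb' := pH_mul_pLam
  Hc' := pH_mul_pLam
  Db := by
    rw [der_mul_pL hG t.skewA, add_sub_cancel_left, t.ba, t.ab, pL_sub, pL_neg, two_mul]; abel
  Dc := by
    rw [der_mul_pL hG t.skewA, add_sub_cancel_left, t.ca, t.ac, pL_sub, pL_neg, two_mul]; abel
  Db' := by
    rw [der_mul_pLam hG t.skewA, add_sub_cancel_left, t.ba, t.ab, pLam_sub, pLam_neg, two_mul]; abel
  Dc' := by
    rw [der_mul_pLam hG t.skewA, add_sub_cancel_left, t.ca, t.ac, pLam_sub, pLam_neg, two_mul]; abel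

end Relations

/-! ### Forms of fixed degree, nilpotency, and a uniqueness principle for operators. -/

section Homogeneous
variable {E : Type*} [NormedAddCommGroup E] [NormedSpace ℝ E]

variable (E) in
/-- The forms of degree `r`. -/
def hom (r : ℤ) : Submodule ℂ (PForm E) where
  carrier := {η | ∀ j : ℕ, (j : ℤ) ≠ r → η j = 0}
  add_mem' ha hb j hj := by simp [ha j hj, hb j hj]
  zero_mem' _ _ := rfl
  smul_mem' c η h j hj := by simp [h j hj]

theorem iota_mem_hom {r : ℤ} {η : PForm E} (h : η ∈ hom E r) (v : E) : iota v η ∈ hom E (r - 1) := by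
  intro j hj
  rw [iota_apply, h (j + 1) (by push_cast; omega)]
  rfl

theorem eps_mem_hom {r : ℤ} {η : PForm E} (h : η ∈ hom E r) (ξ : E →L[ℝ] ℝ) :
    eps ξ η ∈ hom E (r + 1) := by
  intro j hj
  cases j with
  | zero => rfl
  | succ j =>
    rw [eps_succ, h j (by push_cast at hj; omega)]
    have : ξ.smulRight (0 : Alt E j) = 0 := by ext; simp
    rw [this]
    exact _root_.map_zero (alternatizeUncurryFinCLM ℝ E ℂ)

theorem pOne_mem_hom : pOne E ∈ hom E 0 := by
  intro j hj
  cases j with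
  | zero => simp at hj
  | succ j => exact pOne_succ j

variable [FiniteDimensional ℝ E] {g : E →L[ℝ] E →L[ℝ] ℝ} {G : (E →L[ℝ] ℝ) →L[ℝ] E}
  {A B C : E →L[ℝ] E}

theorem pL_mem_hom {r : ℤ} {η : PForm E} (h : η ∈ hom E r) : pL g A η ∈ hom E (r + 2) := by
  rw [pL, LinearMap.smul_apply, LinearMap.sum_apply]
  refine Submodule.smul_mem _ _ (Submodule.sum_mem _ fun i _ => ?_)
  rw [show r + 2 = r + 1 + 1 by ring]
  exact eps_mem_hom (eps_mem_hom h _) _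

theorem pLam_mem_hom {r : ℤ} {η : PForm E} (h : η ∈ hom E r) : pLam G A η ∈ hom E (r - 2) := by
  rw [pLam, LinearMap.smul_apply, LinearMap.sum_apply]
  refine Submodule.smul_mem _ _ (Submodule.sum_mem _ fun i _ => ?_)
  rw [show r - 2 = r - 1 - 1 by ring]
  exact iota_mem_hom (iota_mem_hom h _) _

theorem alt_eq_zero {k : ℕ} (hk : Module.finrank ℝ E < k) (α : Alt E k) : α = 0 := by
  ext v
  exact α.toAlternatingMap.map_linearDependent v fun h => by
    have := h.fintype_card_le_finrank
    simp at this
    omega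

theorem single_mem_hom (k : ℕ) (α : Alt E k) : (Pi.single k α : PForm E) ∈ hom E k :=
  fun j hj => Pi.single_eq_of_ne (by exact_mod_cast hj) _

theorem hom_eq_zero_of_neg {r : ℤ} (hr : r < 0) {η : PForm E} (h : η ∈ hom E r) : η = 0 :=
  funext fun j => h j (by omega)

theorem hom_eq_zero_of_gt {r : ℤ} (hr : Module.finrank ℝ E < r) {η : PForm E} (h : η ∈ hom E r) :
    η = 0 := by
  funext j
  by_cases hj : (j : ℤ) = r
  · exact alt_eq_zero (by omega) _
  · exact h j hj

theorem PForm.eq_sum (η : PForm E) :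
    η = ∑ k ∈ Finset.range (Module.finrank ℝ E + 1), Pi.single k (η k) := by
  funext j
  rw [Finset.sum_apply]
  by_cases hj : j ∈ Finset.range (Module.finrank ℝ E + 1)
  · rw [Finset.sum_eq_single_of_mem j hj fun k _ hk => Pi.single_eq_of_ne (Ne.symm hk) _]
    exact (Pi.single_eq_same _ _).symm
  · rw [alt_eq_zero (by simpa using hj) (η j)]
    refine (Finset.sum_eq_zero fun k hk => Pi.single_eq_of_ne ?_ _).symm
    rintro rfl; exact hj hk

theorem end_ext {S T : Module.End ℂ (PForm E)} (h : ∀ (k : ℕ), ∀ η ∈ hom E k, S η = T η) : S = T := by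
  ext1 η
  rw [PForm.eq_sum η, _root_.map_sum, _root_.map_sum]
  exact Finset.sum_congr rfl fun k _ => h k _ (single_mem_hom k _)

theorem pow_mem_hom {S : Module.End ℂ (PForm E)} {d : ℤ}
    (hS : ∀ (r : ℤ), ∀ η ∈ hom E r, S η ∈ hom E (r + d)) (m : ℕ) {r : ℤ} {η : PForm E}
    (hη : η ∈ hom E r) : (S ^ m) η ∈ hom E (r + m * d) := by
  induction m with
  | zero => simpa using hη
  | succ m ih =>
    rw [pow_succ', Module.End.mul_apply]
    have := hS _ _ ih
    convert this using 2
    push_cast; ring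

theorem pL_pow : pL g A ^ (Module.finrank ℝ E + 1) = 0 := by
  refine end_ext fun k η hη => ?_
  refine hom_eq_zero_of_gt ?_ (pow_mem_hom (fun r η h => pL_mem_hom h) _ hη)
  push_cast; omega

theorem pLam_pow : pLam G A ^ (Module.finrank ℝ E + 1) = 0 := by
  refine end_ext fun k η hη => ?_
  by_cases hk : Module.finrank ℝ E < k
  · rw [hom_eq_zero_of_gt (by exact_mod_cast hk) hη, _root_.map_zero, _root_.map_zero]
  · refine hom_eq_zero_of_neg ?_
      (pow_mem_hom (d := -2) (fun r η h => by
        have := pLam_mem_hom (G := G) (A := A) h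
        rwa [sub_eq_add_neg] at this) _ hη)
    push_cast; omega

/-- An operator is determined by its value on `1` and its commutation with exterior products. -/
theorem end_ext_eps {S T : Module.End ℂ (PForm E)} {R : (E →L[ℝ] ℝ) → Module.End ℂ (PForm E)}
    {c : ℕ → ℂ} (hS : ∀ ξ, S * eps ξ = R ξ * S * grade c) (hT : ∀ ξ, T * eps ξ = R ξ * T * grade c)
    (h1 : S (pOne E) = T (pOne E)) : S = T := by
  refine end_ext fun k => ?_
  have hgrade : ∀ (k : ℕ) (η : PForm E), η ∈ hom E k → ∀ c' : ℕ → ℂ, grade c' η = c' k • η := by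
    intro k η hη c'
    funext j
    rw [grade_apply, Pi.smul_apply]
    by_cases hj : j = k
    · rw [hj]
    · rw [hη j (by exact_mod_cast hj), smul_zero, smul_zero]
  induction k with
  | zero =>
    intro η hη
    have : η = η 0 0 • pOne E := by
      funext j
      cases j with
      | zero =>
        ext v
        rw [Pi.smul_apply, pOne_zero]
        simp [Subsingleton.elim v 0]
      | succ j => rw [hη (j + 1) (by push_cast; omega), Pi.smul_apply, pOne_succ, smul_zero]
    rw [this, _root_.map_smul, _root_.map_smul, h1]
  | succ k ih =>
    intro η hη
    -- Euler's identity: `∑ e^i ∧ ι_i` multiplies forms by their degree, so a form of degree `k + 1`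
    -- is a combination of covectors wedged with forms of degree `k`.
    have h2 : ((k + 1 : ℕ) : ℂ) • η = ∑ i, eps (cob E i) (iota (bas E i) η) := by
      rw [← hgrade (k + 1) η hη fun k => (k : ℂ), ← der_one, der, LinearMap.sum_apply]
      rfl
    have h3 : ∀ i, S (eps (cob E i) (iota (bas E i) η)) = T (eps (cob E i) (iota (bas E i) η)) := by
      intro i
      have hmem : iota (bas E i) η ∈ hom E k := by
        have := iota_mem_hom hη (bas E i)
        simpa using this
      rw [← Module.End.mul_apply, hS, ← Module.End.mul_apply T, hT]
      simp only [Module.End.mul_apply, hgrade k _ hmem, _root_.map_smul, ih _ hmem]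
    have h4 : S (((k + 1 : ℕ) : ℂ) • η) = T (((k + 1 : ℕ) : ℂ) • η) := by
      rw [h2, _root_.map_sum, _root_.map_sum]
      exact Finset.sum_congr rfl fun i _ => h3 i
    rw [_root_.map_smul, _root_.map_smul] at h4
    exact smul_right_injective _ (by exact_mod_cast Nat.succ_ne_zero k : ((k + 1 : ℕ) : ℂ) ≠ 0) h4

end Homogeneous

/-! ### Exponentials of nilpotent operators applied to vectors. -/

section ExpApply
variable {V : Type*} [AddCommGroup V] [Module ℂ V] [Module ℚ V]

theorem exp_apply_of_eq_zero {e : Module.End ℂ V} (he : IsNilpotent e) {v : V} (hv : e v = 0) :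
    IsNilpotent.exp e v = v := by
  obtain ⟨k, hk⟩ := he
  have hk1 : e ^ (k + 1) = 0 := by rw [pow_succ, hk, zero_mul]
  rw [IsNilpotent.exp_eq_sum hk1, LinearMap.sum_apply, Finset.sum_range_succ']
  rw [Finset.sum_eq_zero fun i _ => ?_]
  · simp
  · rw [LinearMap.smul_apply, pow_succ, Module.End.mul_apply, hv, _root_.map_zero, smul_zero]

theorem exp_apply_exp_neg {e : Module.End ℂ V} (he : IsNilpotent e) (v : V) :
    IsNilpotent.exp e (IsNilpotent.exp (-e) v) = v := by
  rw [← Module.End.mul_apply, IsNilpotent.exp_mul_exp_neg_self he, Module.End.one_apply]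

theorem exp_neg_apply_exp {e : Module.End ℂ V} (he : IsNilpotent e) (v : V) :
    IsNilpotent.exp (-e) (IsNilpotent.exp e v) = v := by
  rw [← Module.End.mul_apply, IsNilpotent.exp_neg_mul_exp_self he, Module.End.one_apply]

end ExpApply

/-! ### The Weyl element of a Lefschetz triple acting on forms. -/

section WeylForms
variable {E : Type*} [NormedAddCommGroup E] [NormedSpace ℝ E] [FiniteDimensional ℝ E]
  {g : E →L[ℝ] E →L[ℝ] ℝ} {G : (E →L[ℝ] ℝ) →L[ℝ] E} {A B C : E →L[ℝ] E}

variable (g G A) in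
/-- The action of the Weyl element of the Lefschetz `sl₂`-triple of `A` on forms. -/
def pWeyl : Module.End ℂ (PForm E) := weyl (pL g A) (pLam G A)

theorem pL_isNilpotent : IsNilpotent (pL g A) := ⟨_, pL_pow⟩

theorem pLam_isNilpotent : IsNilpotent (pLam G A) := ⟨_, pLam_pow⟩

theorem pL_iota_aux (hG : IsDualMetric g G) (hA : IsSkew g A) (hA2 : A ∘L A = -1)
    (ξ : E →L[ℝ] ℝ) : pL g A * -iota (A (G ξ)) - -iota (A (G ξ)) * pL g A = eps ξ := by
  have : g (A (G ξ)) ∘L A = ξ := by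
    ext v
    rw [ContinuousLinearMap.comp_apply, hA.isometry hA2, hG.left]
  rw [mul_neg, pL_mul_iota hG hA, this]
  noncomm_ring

/-- Under commutators, `eps ξ` and `-iota (A (G ξ))` span a two-dimensional module of the Lefschetz
triple, with `eps ξ` as highest weight vector. -/
theorem pWeyl_mul_eps (hG : IsDualMetric g G) (hA : IsSkew g A) (hA2 : A ∘L A = -1)
    (ξ : E →L[ℝ] ℝ) : pWeyl g G A * eps ξ = iota (A (G ξ)) * pWeyl g G A := by
  have := weyl_mul_highest (e := pL g A) (f := pLam G A) (x := eps ξ) (y := -iota (A (G ξ)))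
    pL_isNilpotent pLam_isNilpotent (pL_mul_eps ξ) (by rw [pLam_mul_eps hG hA]; abel)
    (by rw [mul_neg, neg_mul, pLam_mul_iota]) (pL_iota_aux hG hA hA2 ξ)
  rwa [neg_neg] at this

theorem pWeyl_mul_iota (hG : IsDualMetric g G) (hA : IsSkew g A) (hA2 : A ∘L A = -1)
    (ξ : E →L[ℝ] ℝ) : pWeyl g G A * iota (A (G ξ)) = -(eps ξ * pWeyl g G A) := by
  have := weyl_mul_lowest (e := pL g A) (f := pLam G A) (x := eps ξ) (y := -iota (A (G ξ)))
    pL_isNilpotent pLam_isNilpotent (pL_mul_eps ξ) (by rw [pLam_mul_eps hG hA]; abel)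
    (by rw [mul_neg, neg_mul, pLam_mul_iota]) (pL_iota_aux hG hA hA2 ξ)
  rw [mul_neg] at this
  rw [pWeyl, ← this, neg_neg]

theorem pWeyl_mul_pull (hG : IsDualMetric g G) (hA : IsSkew g A) (hA2 : A ∘L A = -1) :
    pWeyl g G A * pull A = pull A * pWeyl g G A := by
  have h : -(A ∘L A ∘L A) = A := by
    rw [hA2]; ext v; simp
  refine weyl_mul_comm ?_ ?_
  · rw [pull_mul_pL hG hA, h]
  · rw [pull_mul_pLam hG hA hA2, h]

theorem sum_iota_mul_eps : ∑ i, iota (bas E i) * eps (cob E i) =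
    grade fun k => (Module.finrank ℝ E : ℂ) - k := by
  simp only [iota_mul_eps, cob_bas, if_true, one_smul, Finset.sum_sub_distrib]
  have := der_one (E := E)
  rw [der] at this
  simp only [one_apply_eq_self] at this
  rw [this]
  ext η k : 2
  simp [grade_apply, sub_smul, Nat.cast_smul_eq_nsmul]

/-- Contractions kill `1`, and the Weyl element turns them into exterior products, so every covector
kills its value on `1`. Since `∑ ι_i (e^i ∧ ·)` multiplies `k`-forms by `dim E - k`, only the top
degree survives. -/
theorem pWeyl_pOne_mem (hG : IsDualMetric g G) (hA : IsSkew g A) (hA2 : A ∘L A = -1) :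
    pWeyl g G A (pOne E) ∈ hom E (Module.finrank ℝ E) ∧
      ∀ ξ, eps ξ (pWeyl g G A (pOne E)) = 0 := by
  have h1 : ∀ ξ, eps ξ (pWeyl g G A (pOne E)) = 0 := by
    intro ξ
    have := congrArg (fun T => T (pOne E)) (pWeyl_mul_iota hG hA hA2 ξ)
    simpa [iota_pOne] using this
  refine ⟨fun j hj => ?_, h1⟩
  have h2 := congrArg (fun T => T (pWeyl g G A (pOne E)) j) (sum_iota_mul_eps (E := E))
  simp only [LinearMap.sum_apply, Module.End.mul_apply, h1, _root_.map_zero, grade_apply,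
    Finset.sum_const_zero, Pi.zero_apply] at h2
  refine (smul_eq_zero.1 h2.symm).resolve_left ?_
  intro h
  exact hj (by exact_mod_cast (sub_eq_zero.1 h).symm)

/-- With `u` the image of `1`, the definition of the Weyl element gives `exp(-L) u = exp(-Λ) exp(L)
1`. The left side is `u`, because `L` kills forms of top degree. -/
theorem exp_pL_pOne (hG : IsDualMetric g G) (hA : IsSkew g A) (hA2 : A ∘L A = -1) :
    pL g A (pWeyl g G A (pOne E)) = 0 ∧
    IsNilpotent.exp (pL g A) (pOne E) = IsNilpotent.exp (pLam G A) (pWeyl g G A (pOne E)) := by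
  have h0 : pL g A (pWeyl g G A (pOne E)) = 0 := by
    rw [pL, LinearMap.smul_apply, LinearMap.sum_apply]
    simp [(pWeyl_pOne_mem hG hA hA2).2]
  refine ⟨h0, ?_⟩
  have h1 : IsNilpotent.exp (-pL g A) (pWeyl g G A (pOne E)) = pWeyl g G A (pOne E) :=
    exp_apply_of_eq_zero pL_isNilpotent.neg (by rw [LinearMap.neg_apply, h0, neg_zero])
  have h2 : IsNilpotent.exp (-pL g A) (pWeyl g G A (pOne E)) =
      IsNilpotent.exp (-pLam G A) (IsNilpotent.exp (pL g A) (pOne E)) := by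
    rw [pWeyl, weyl, Module.End.mul_apply, Module.End.mul_apply, exp_neg_apply_exp pL_isNilpotent]
  rw [← h1, h2, exp_apply_exp_neg pLam_isNilpotent]

/-- Compare the top-degree components in `exp(L) 1 = exp(Λ) u`: on the left only `L^N / N!`
contributes, on the right only the constant term of the exponential. -/
theorem pWeyl_pOne (hG : IsDualMetric g G) (hA : IsSkew g A) (hA2 : A ∘L A = -1) {N : ℕ}
    (hN : Module.finrank ℝ E = 2 * N) :
    pWeyl g G A (pOne E) = (N.factorial : ℂ)⁻¹ • (pL g A ^ N) (pOne E) := by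
  obtain ⟨hu, -⟩ := pWeyl_pOne_mem (E := E) hG hA hA2
  have h1 := (exp_pL_pOne (E := E) hG hA hA2).2
  set u := pWeyl g G A (pOne E) with hu_def
  have hL : ∀ i : ℕ, (pL g A ^ i) (pOne E) ∈ hom E (0 + i * 2) := fun i =>
    pow_mem_hom (fun r η h => pL_mem_hom h) i pOne_mem_hom
  have hΛ : ∀ i : ℕ, (pLam G A ^ i) u ∈ hom E (Module.finrank ℝ E + i * (-2)) := fun i =>
    pow_mem_hom (d := -2) (fun r η h => by
      have := pLam_mem_hom (G := G) (A := A) h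
      rwa [sub_eq_add_neg] at this) i hu
  have h2 := congrFun h1 (Module.finrank ℝ E)
  rw [IsNilpotent.exp_eq_sum pL_pow, IsNilpotent.exp_eq_sum pLam_pow, LinearMap.sum_apply,
    LinearMap.sum_apply, Finset.sum_apply, Finset.sum_apply,
    Finset.sum_eq_single_of_mem N (Finset.mem_range.2 (by omega)),
    Finset.sum_eq_single_of_mem 0 (Finset.mem_range.2 (by omega))] at h2
  · funext j
    by_cases hj : j = Module.finrank ℝ E
    · rw [hj]
      have h3 : ((N.factorial : ℚ)⁻¹ • (pL g A ^ N)) (pOne E) (Module.finrank ℝ E) =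
          (N.factorial : ℂ)⁻¹ • (pL g A ^ N) (pOne E) (Module.finrank ℝ E) := by
        rw [LinearMap.smul_apply, Pi.smul_apply]
        ext v
        simp [Rat.smul_def]
      rw [h3] at h2
      rw [Pi.smul_apply, h2]
      simp
    · rw [hu j (by exact_mod_cast hj), Pi.smul_apply, hL N j (by omega), smul_zero]
  · intro i _ hi
    rw [LinearMap.smul_apply, Pi.smul_apply, hΛ i _ (by omega), smul_zero]
  · intro i _ hi
    rw [LinearMap.smul_apply, Pi.smul_apply, hL i _ (by omega), smul_zero]

/-- The operator raises the degree by two and `√-1² = -1`. This sign turns identities for `exp(L)`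
into identities for `exp(-L)`. -/
theorem grade_I_mul_pL : grade (fun k => Complex.I ^ k) * pL g A =
    -(pL g A * grade (fun k => Complex.I ^ k)) := by
  have h : ∀ i, grade (fun k => Complex.I ^ k) * (eps (cob E i) * eps (g (bas E i) ∘L A)) =
      -(eps (cob E i) * eps (g (bas E i) ∘L A) * grade (fun k => Complex.I ^ k)) := by
    intro i
    rw [← mul_assoc, grade_mul_eps, mul_assoc, grade_mul_eps, mul_assoc, ← mul_neg, ← mul_neg]
    congr 2
    ext η k : 2
    simp only [grade_apply, LinearMap.neg_apply, Pi.neg_apply, pow_succ, mul_assoc, Complex.I_mul_I]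
    rw [mul_neg, mul_one, neg_smul]
  rw [pL, mul_smul_comm, Finset.mul_sum, Finset.sum_congr rfl fun i _ => h i, smul_mul_assoc,
    Finset.sum_mul, Finset.sum_neg_distrib, smul_neg]

theorem grade_I_mul_pLam : grade (fun k => Complex.I ^ k) * pLam G A =
    -(pLam G A * grade (fun k => Complex.I ^ k)) := by
  have h : ∀ i, iota (G (cob E i)) * iota (A (bas E i)) * grade (fun k => Complex.I ^ k) =
      -(grade (fun k => Complex.I ^ k) * (iota (G (cob E i)) * iota (A (bas E i)))) := by
    intro i
    rw [mul_assoc, iota_mul_grade, ← mul_assoc, iota_mul_grade, mul_assoc, ← neg_mul]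
    congr 1
    ext η k : 2
    simp only [grade_apply, LinearMap.neg_apply, Pi.neg_apply, pow_succ, mul_assoc, Complex.I_mul_I]
    rw [mul_neg, mul_one, neg_smul]
  rw [pLam, smul_mul_assoc, Finset.sum_mul, Finset.sum_congr rfl fun i _ => h i, mul_smul_comm,
    Finset.mul_sum, Finset.sum_neg_distrib, smul_neg, neg_neg]

/-- Applying the operator `√-1^k` to `exp(L) 1 = exp(Λ) u` gives `exp(-L) 1 = (-1)^N exp(-Λ) u`,
where the sign is its value on the form `u` of degree `2 N`. As `L u = 0`, the image of `u` is
`exp(L) exp(-Λ) u`. -/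
theorem pWeyl_pWeyl_pOne (hG : IsDualMetric g G) (hA : IsSkew g A) (hA2 : A ∘L A = -1) {N : ℕ}
    (hN : Module.finrank ℝ E = 2 * N) :
    pWeyl g G A (pWeyl g G A (pOne E)) = (-1 : ℂ) ^ N • pOne E := by
  obtain ⟨hu, -⟩ := pWeyl_pOne_mem (E := E) hG hA hA2
  obtain ⟨h0, h1⟩ := exp_pL_pOne (E := E) hG hA hA2
  set u := pWeyl g G A (pOne E) with hu_def
  have h2 := congrArg (grade fun k => Complex.I ^ k) h1
  rw [← Module.End.mul_apply, ← Module.End.mul_apply, exp_mul_anti pL_isNilpotent grade_I_mul_pL,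
    exp_mul_anti pLam_isNilpotent grade_I_mul_pLam, Module.End.mul_apply, Module.End.mul_apply,
    grade_pOne, pow_zero, one_smul] at h2
  have h3 : grade (fun k => Complex.I ^ k) u = (-1 : ℂ) ^ N • u := by
    funext j
    rw [grade_apply, Pi.smul_apply]
    by_cases hj : j = Module.finrank ℝ E
    · rw [hj, hN, pow_mul, Complex.I_sq]
    · rw [hu j (by exact_mod_cast hj), smul_zero, smul_zero]
  rw [h3, _root_.map_smul] at h2
  have h4 : IsNilpotent.exp (-pLam G A) u = (-1 : ℂ) ^ N • IsNilpotent.exp (-pL g A) (pOne E) := by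
    rw [h2, smul_smul, ← mul_pow]; simp
  have h5 : pWeyl g G A u =
      IsNilpotent.exp (pL g A) (IsNilpotent.exp (-pLam G A) (IsNilpotent.exp (pL g A) u)) := rfl
  rw [h5, exp_apply_of_eq_zero pL_isNilpotent h0, h4, _root_.map_smul,
    exp_apply_exp_neg pL_isNilpotent]

end WeylForms

/-! ### The Hodge star as a Weyl element, and its square. -/

section Star
variable {E : Type*} [NormedAddCommGroup E] [NormedSpace ℝ E] [FiniteDimensional ℝ E]
  {g : E →L[ℝ] E →L[ℝ] ℝ} {G : (E →L[ℝ] ℝ) →L[ℝ] E} {A B C : E →L[ℝ] E}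

/-- The Hodge star operator with volume form `μ`. -/
def pStar (G : (E →L[ℝ] ℝ) →L[ℝ] E) (μ : PForm E) : Module.End ℂ (PForm E) where
  toFun η l := ∑ k ∈ Finset.range (Module.finrank ℝ E + 1),
    ((k.factorial : ℂ)⁻¹) • contractAux G k l (η k) (μ (l + k))
  map_add' a b := by
    funext l
    simp only [Pi.add_apply, _root_.map_add, _root_.add_apply, smul_add, Finset.sum_add_distrib]
  map_smul' c a := by
    funext l
    simp only [Pi.smul_apply, contractAux_smul_left, RingHom.id_apply, Finset.smul_sum]
    exact Finset.sum_congr rfl fun _ _ => smul_comm _ _ _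

theorem pStar_apply (μ η : PForm E) (l : ℕ) : pStar G μ η l =
    ∑ k ∈ Finset.range (Module.finrank ℝ E + 1), ((k.factorial : ℂ)⁻¹) • cOp G k (η k) μ l := by
  simp only [cOp_apply]; rfl

theorem pStar_pOne (μ : PForm E) : pStar G μ (pOne E) = μ := by
  funext l
  rw [pStar_apply, Finset.sum_range_succ', Finset.sum_eq_zero fun k _ => ?_]
  · rw [pOne_zero]
    simp [cOp, ev0_apply _ 0]
  · rw [pOne_succ, cOp_apply]; simp

variable (E) in
/-- The parity operator on forms. -/
def pPar : Module.End ℂ (PForm E) := grade fun k => (-1) ^ k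

/-- Contracting `μ` with `ξ ∧ η` is contracting with `ξ` and then with `η`. Exchanging the two
contractions costs `(-1)^k`, which is the parity operator, and the factor `k + 1` is absorbed by the
factorials. -/
theorem pStar_mul_eps {μ : PForm E} (hμ : μ ∈ hom E (Module.finrank ℝ E)) (ξ : E →L[ℝ] ℝ) :
    pStar G μ * eps ξ = iota (G ξ) * pStar G μ * pPar E := by
  ext η l : 2
  simp only [Module.End.mul_apply, pStar_apply, iota_apply]
  have hR : ∀ k, (cOp G k (pPar E η k) μ (l + 1)).curryLeft (G ξ) =
      cOp G k (η k) (iota (G ξ) μ) l := by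
    intro k
    have h1 := congrArg (fun T => T μ l) (iota_mul_cOp G k (η k) (G ξ))
    simp only [Module.End.mul_apply, iota_apply, LinearMap.smul_apply, Pi.smul_apply] at h1
    have h2 : pPar E η k = ((-1 : ℝ) ^ k) • η k := by
      rw [pPar, grade_apply, ← Complex.coe_smul]; push_cast; rfl
    rw [h2, cOp_smul, LinearMap.smul_apply, Pi.smul_apply, curryLeft_smul, _root_.smul_apply, h1,
      smul_smul, ← mul_pow]
    simp
  have hsum : (∑ k ∈ Finset.range (Module.finrank ℝ E + 1),
      ((k.factorial : ℂ)⁻¹) • cOp G k (pPar E η k) μ (l + 1)).curryLeft (G ξ) =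
      ∑ k ∈ Finset.range (Module.finrank ℝ E + 1),
        ((k.factorial : ℂ)⁻¹) • cOp G k (η k) (iota (G ξ) μ) l := by
    simp only [← hR]
    let T : Alt E (l + 1) →ₗ[ℂ] Alt E l :=
      { toFun := fun α => α.curryLeft (G ξ), map_add' := fun _ _ => rfl, map_smul' := fun _ _ => rfl }
    change T _ = ∑ k ∈ _, (_ : ℂ) • T _
    rw [_root_.map_sum]
    exact Finset.sum_congr rfl fun k _ => _root_.map_smul _ _ _
  -- The two sums are offset by one. The left one loses its term of degree `0`, since an exterior
  -- product has none; the right one loses its last term, since `iota (G ξ) μ` has degree `dim E -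
  -- 1`.
  rw [hsum, Finset.sum_range_succ', eps_zero, Finset.sum_range_succ]
  have h0 : cOp G 0 (0 : Alt E 0) μ l = 0 := by simp [cOp]
  have hlast : cOp G (Module.finrank ℝ E) (η (Module.finrank ℝ E)) (iota (G ξ) μ) l = 0 := by
    rw [cOp_apply, iota_apply, hμ _ (by push_cast; omega)]
    simp
  rw [h0, hlast, smul_zero, smul_zero, add_zero, add_zero]
  refine Finset.sum_congr rfl fun k _ => ?_
  rw [eps_succ, cOp_alternatizeUncurryFin, LinearMap.smul_apply, Pi.smul_apply, ← Complex.coe_smul,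
    smul_smul, Module.End.mul_apply]
  congr 1
  rw [Nat.factorial_succ]
  push_cast
  have : ((k : ℂ) + 1) ≠ 0 := by exact_mod_cast Nat.succ_ne_zero k
  field_simp

variable (E) in
/-- The sign `(-1)^(k (k - 1) / 2)` on `k`-forms. -/
def pSig : Module.End ℂ (PForm E) := grade fun k => (-1) ^ (k.choose 2)

/-- The sign exponents of consecutive degrees differ by `choose (k + 1) 2 - choose k 2 = k`. -/
theorem pSig_mul_eps (ξ : E →L[ℝ] ℝ) : pSig E * eps ξ = eps ξ * pSig E * pPar E := by
  rw [pSig, grade_mul_eps, mul_assoc, pPar, grade_mul_grade]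
  congr 2
  funext k
  rw [Nat.choose_succ_succ' k 1, Nat.choose_one_right, pow_add, mul_comm]

/-- Both sides satisfy the same commutation rule with `eps ξ` and take the value `μ` on `1`, so
`end_ext_eps` applies. The pull-back by `A` removes the `A` in `pWeyl_mul_eps`, and `pSig` supplies
the parity factor. -/
theorem pStar_eq (hG : IsDualMetric g G) (hA : IsSkew g A) (hA2 : A ∘L A = -1) {μ : PForm E}
    (hμ : μ = pWeyl g G A (pOne E)) : pStar G μ = pWeyl g G A * pull A * pSig E := by
  have hmem : μ ∈ hom E (Module.finrank ℝ E) := hμ ▸ (pWeyl_pOne_mem hG hA hA2).1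
  refine end_ext_eps (R := fun ξ => iota (G ξ)) (c := fun k => (-1) ^ k)
    (fun ξ => pStar_mul_eps hmem ξ) (fun ξ => ?_) ?_
  · have h1 : A (G (ξ ∘L A)) = G ξ := by
      rw [hG.map_skew hA, _root_.map_neg]
      have : A (A (G ξ)) = -G ξ := congrArg (fun T => T (G ξ)) hA2
      rw [this, neg_neg]
    rw [mul_assoc _ _ (eps ξ), pSig_mul_eps, ← mul_assoc, ← mul_assoc, mul_assoc _ (pull A),
      pull_mul_eps, ← mul_assoc, pWeyl_mul_eps hG hA hA2, h1, mul_assoc, mul_assoc, mul_assoc,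
      mul_assoc, mul_assoc]
    rfl
  · rw [pStar_pOne, hμ, Module.End.mul_apply, Module.End.mul_apply, pSig, grade_pOne]
    simp [pull_pOne]

theorem pPar_mul_pPar : pPar E * pPar E = 1 := by
  rw [pPar, grade_mul_grade, ← grade_one]
  congr 1; funext k; rw [← mul_pow]; simp

theorem pPar_mul_eps (ξ : E →L[ℝ] ℝ) : pPar E * eps ξ = -(eps ξ * pPar E) := by
  rw [pPar, grade_mul_eps, ← mul_neg]
  congr 1
  ext η k : 2
  simp [grade_apply, pow_succ]

theorem pPar_mul_iota (v : E) : pPar E * iota v = -(iota v * pPar E) := by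
  rw [pPar, iota_mul_grade, ← neg_mul]
  congr 1
  ext η k : 2
  simp [grade_apply, pow_succ]

theorem pPar_comm_pL : pL g A * pPar E = pPar E * pL g A := by
  have h : ∀ ξ ζ : E →L[ℝ] ℝ, eps ξ * eps ζ * pPar E = pPar E * (eps ξ * eps ζ) := by
    intro ξ ζ
    rw [← mul_assoc, pPar_mul_eps, neg_mul, mul_assoc _ (pPar E), pPar_mul_eps]
    noncomm_ring
  rw [pL, smul_mul_assoc, mul_smul_comm, Finset.sum_mul, Finset.mul_sum]
  congr 1
  exact Finset.sum_congr rfl fun i _ => h _ _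

theorem pPar_comm_pLam : pLam G A * pPar E = pPar E * pLam G A := by
  have h : ∀ u v : E, iota u * iota v * pPar E = pPar E * (iota u * iota v) := by
    intro u v
    rw [← mul_assoc, pPar_mul_iota, neg_mul, mul_assoc _ (pPar E), pPar_mul_iota]
    noncomm_ring
  rw [pLam, smul_mul_assoc, mul_smul_comm, Finset.sum_mul, Finset.mul_sum]
  congr 1
  exact Finset.sum_congr rfl fun i _ => h _ _

theorem pWeyl_mul_pPar : pWeyl g G A * pPar E = pPar E * pWeyl g G A :=
  weyl_mul_comm pPar_comm_pL pPar_comm_pLam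

theorem pSig_mul_pPar : pSig E * pPar E = pPar E * pSig E := by
  rw [pSig, pPar, grade_mul_grade, grade_mul_grade]
  congr 1; funext k; ring

/-- The square of the Hodge star operator is `(-1)^k` on `k`-forms in even dimension. -/
theorem pStar_mul_pStar (hG : IsDualMetric g G) (hA : IsSkew g A) (hA2 : A ∘L A = -1) {N : ℕ}
    (hN : Module.finrank ℝ E = 2 * N) :
    (pWeyl g G A * pull A * pSig E) * (pWeyl g G A * pull A * pSig E) = pPar E := by
  set S := pWeyl g G A * pull A * pSig E with hS
  have hSε : ∀ ξ, S * eps ξ = iota (G ξ) * S * pPar E := by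
    intro ξ
    have hμ := pStar_eq (E := E) hG hA hA2 rfl
    rw [hS, ← hμ]
    exact pStar_mul_eps (pWeyl_pOne_mem hG hA hA2).1 ξ
  have hSP : S * pPar E = pPar E * S := by
    rw [hS, mul_assoc, pSig_mul_pPar, ← mul_assoc, mul_assoc _ (pull A), pPar, pull_mul_grade,
      ← pPar, ← mul_assoc, pWeyl_mul_pPar, mul_assoc, mul_assoc, mul_assoc]
  have hSι : ∀ ξ, S * iota (G ξ) = -(eps ξ * S * pPar E) := by
    intro ξ
    have h1 : pSig E * iota (G ξ) = -(iota (G ξ) * (pPar E * pSig E)) := by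
      ext η k : 2
      rw [pSig, pPar, grade_mul_grade]
      simp only [Module.End.mul_apply, grade_apply, iota_apply, LinearMap.neg_apply, Pi.neg_apply]
      rw [Nat.choose_succ_succ' k 1, Nat.choose_one_right, pow_add]
      have h2 : ((-1 : ℂ) ^ k) * (-1) ^ k = 1 := by rw [← mul_pow]; simp
      have h3 : (-1 : ℂ) ^ k * (-1) ^ 1 * ((-1) ^ k * (-1) ^ k.choose (1 + 1)) =
          -(-1) ^ k.choose 2 := by
        linear_combination (-(-1 : ℂ) ^ k.choose 2) * h2
      rw [pow_add, h3]
      ext w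
      change (-1 : ℂ) ^ k.choose 2 • η (k + 1) _ = -(-(-1 : ℂ) ^ k.choose 2 • η (k + 1) _)
      rw [neg_smul, neg_neg]
    rw [hS, mul_assoc _ _ (iota (G ξ)), h1, mul_neg, ← mul_assoc, mul_assoc _ (pull A),
      pull_mul_iota hA2]
    simp only [mul_neg, neg_mul, neg_neg]
    rw [← mul_assoc (pWeyl g G A) (iota _) (pull A), pWeyl_mul_iota hG hA hA2, ← pSig_mul_pPar]
    noncomm_ring
  -- Both the square of the star and the parity operator anticommute with all `eps ξ`, so it remains
  -- to compare them on `1`. There the sign of `pSig` in degree `2 N` cancels that of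
  -- `pWeyl_pWeyl_pOne`.
  refine end_ext_eps (R := fun ξ => -eps ξ) (c := fun _ => 1) (fun ξ => ?_) (fun ξ => ?_) ?_
  · rw [grade_one, mul_one, mul_assoc, hSε, ← mul_assoc, ← mul_assoc, hSι, neg_mul, neg_mul, neg_mul,
      mul_assoc _ (pPar E) S, ← hSP, ← mul_assoc, mul_assoc _ (pPar E), pPar_mul_pPar, mul_one,
      mul_assoc]
  · rw [grade_one, mul_one, pPar_mul_eps, neg_mul]
  · have h2 : S (pOne E) = pWeyl g G A (pOne E) := by
      rw [hS, Module.End.mul_apply, Module.End.mul_apply, pSig, grade_pOne]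
      simp [pull_pOne]
    have h3 : pull A (pWeyl g G A (pOne E)) = pWeyl g G A (pOne E) := by
      have := congrArg (fun T => T (pOne E)) (pWeyl_mul_pull hG hA hA2)
      simp only [Module.End.mul_apply, pull_pOne] at this
      exact this.symm
    have h4 : pSig E (pWeyl g G A (pOne E)) = (-1 : ℂ) ^ N • pWeyl g G A (pOne E) := by
      funext j
      rw [pSig, grade_apply, Pi.smul_apply]
      by_cases hj : j = Module.finrank ℝ E
      · rw [hj, hN]
        congr 1
        rw [Nat.choose_two_right]
        have : 2 * N * (2 * N - 1) / 2 = N * (2 * N - 1) := by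
          rw [mul_assoc, Nat.mul_div_cancel_left _ two_pos]
        rw [this]
        rcases Nat.eq_zero_or_pos N with h | h
        · simp [h]
        · have hodd : Odd (2 * N - 1) := ⟨N - 1, by omega⟩
          rw [mul_comm, pow_mul, hodd.neg_one_pow]
      · rw [(pWeyl_pOne_mem hG hA hA2).1 j (by exact_mod_cast hj), smul_zero, smul_zero]
    rw [Module.End.mul_apply, h2, hS, Module.End.mul_apply, h4, _root_.map_smul, Module.End.mul_apply,
      h3, pWeyl_pWeyl_pOne hG hA hA2 hN, smul_smul, ← mul_pow, pPar, grade_pOne]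
    simp

end Star

/-! ### The dimension is divisible by four, and the Kähler forms give the same volume form. -/

section Volume
variable {E : Type*} [NormedAddCommGroup E] [NormedSpace ℝ E] [FiniteDimensional ℝ E]
  {g : E →L[ℝ] E →L[ℝ] ℝ} {G : (E →L[ℝ] ℝ) →L[ℝ] E} {A B C : E →L[ℝ] E}

theorem pLam_pOne : pLam G A (pOne E) = 0 := by
  rw [pLam, LinearMap.smul_apply, LinearMap.sum_apply]
  simp [iota_pOne]

theorem weight_pOne (j : ℂ) : ((2⁻¹ : ℂ) • (pH E - j • der A)) (pOne E) =
    (-((Module.finrank ℝ E : ℂ) / 4)) • pOne E := by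
  simp only [LinearMap.smul_apply, LinearMap.sub_apply, der_pOne, smul_zero, sub_zero, pH, grade_pOne,
    smul_smul]
  congr 1; push_cast; ring

/-- The constant `1` is a lowest weight vector of weight `-dim E / 4` for the `Ω`-triple, so `dim E
/ 4` is a natural number `n`. If `Ω^(n+1)` were nonzero, it would be killed by the lowering operator
and have weight `n + 2`, contradicting `IsSl2.weight_mem` for the opposite triple. -/
theorem exists_finrank_eq (hG : IsDualMetric g G) (t : IsHypTriple g A B C) :
    ∃ n : ℕ, Module.finrank ℝ E = 4 * n ∧ ∀ j : ℂ, j * j = -1 →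
      (((2⁻¹ : ℂ) • (pL g B + j • pL g C)) ^ (n + 1)) (pOne E) = 0 := by
  have key : ∀ j : ℂ, j * j = -1 → ∃ n : ℕ, Module.finrank ℝ E = 4 * n ∧
      (((2⁻¹ : ℂ) • (pL g B + j • pL g C)) ^ (n + 1)) (pOne E) = 0 := by
    intro j hj
    have s := ((t.isPair hG).sl2_of_sq hj).symm
    set e := (2⁻¹ : ℂ) • (pL g B + j • pL g C) with he
    set f := (2⁻¹ : ℂ) • (pLam G B - j • pLam G C) with hf
    set h := (2⁻¹ : ℂ) • (pH E - j • der A) with hh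
    have hf1 : f (pOne E) = 0 := by simp [hf, pLam_pOne]
    have hnil : IsNilpotent e := by
      refine ⟨Module.finrank ℝ E + 1, end_ext fun k η hη => ?_⟩
      refine hom_eq_zero_of_gt ?_ (pow_mem_hom (d := 2) (fun r η h => ?_) _ hη)
      · push_cast; omega
      · exact Submodule.smul_mem _ _ (Submodule.add_mem _ (pL_mem_hom h)
          (Submodule.smul_mem _ _ (pL_mem_hom h)))
    have hh1 : (-h) (pOne E) = ((Module.finrank ℝ E : ℂ) / 4) • pOne E := by
      rw [LinearMap.neg_apply, hh, weight_pOne, neg_smul, neg_neg]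
    obtain ⟨n, hn⟩ := s.weight_mem hf1 hnil hh1 pOne_ne_zero
    have hn' : Module.finrank ℝ E = 4 * n := by
      have : (Module.finrank ℝ E : ℂ) = 4 * n := by rw [← hn]; ring
      exact_mod_cast this
    refine ⟨n, hn', ?_⟩
    by_contra hne
    have c2 : ∀ (m : ℕ) (u : PForm E), (m : Module.End ℂ (PForm E)) u = (m : ℂ) • u := fun m u => by
      rw [Module.End.natCast_apply, Nat.cast_smul_eq_nsmul]
    have hf2 : f ((e ^ (n + 1)) (pOne E)) = 0 := by
      have := congrArg (fun T => T (pOne E)) (s.e_mul_f_pow n)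
      simp only [Module.End.mul_apply, LinearMap.add_apply, LinearMap.sub_apply, hf1,
        _root_.map_zero, zero_add, c2, hh1, hn, sub_self] at this
      exact this
    have hw : (-h) ((e ^ (n + 1)) (pOne E)) = ((-(n + 2 : ℤ) : ℤ) : ℂ) • (e ^ (n + 1)) (pOne E) := by
      have h3 := congrArg (fun T => T (pOne E)) (s.h_mul_f_pow (n + 1))
      have c3 : ∀ u : PForm E, (2 : Module.End ℂ (PForm E)) u = (2 : ℂ) • u := fun u => by
        exact_mod_cast c2 2 u
      simp only [Module.End.mul_apply, LinearMap.sub_apply, c2, c3, hh1, hn] at h3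
      rw [h3, smul_smul, ← sub_smul, _root_.map_smul]
      congr 1; push_cast; ring
    obtain ⟨m, hm⟩ := s.weight_mem hf2 hnil hw hne
    have : (-(n + 2 : ℤ) : ℤ) = (m : ℤ) := by exact_mod_cast hm
    omega
  obtain ⟨n, hn, -⟩ := key Complex.I Complex.I_mul_I
  refine ⟨n, hn, fun j hj => ?_⟩
  obtain ⟨m, hm, hm'⟩ := key j hj
  obtain rfl : m = n := by omega
  exact hm'

/-- The volume forms of two anticommuting complex structures coincide. -/
theorem pL_pow_pOne_eq (hG : IsDualMetric g G) (t : IsHypTriple g A B C) {N : ℕ}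
    (hN : Module.finrank ℝ E = 2 * N) : (pL g B ^ N) (pOne E) = (pL g C ^ N) (pOne E) := by
  obtain ⟨n, hn, hvan⟩ := exists_finrank_eq hG t
  obtain rfl : N = 2 * n := by omega
  set u := (2⁻¹ : ℂ) • (pL g B + Complex.I • pL g C) with hu
  set v := (2⁻¹ : ℂ) • (pL g B + (-Complex.I) • pL g C) with hv
  have hu0 : (u ^ (n + 1)) (pOne E) = 0 := hvan _ Complex.I_mul_I
  have hv0 : (v ^ (n + 1)) (pOne E) = 0 := hvan _ (by rw [neg_mul_neg, Complex.I_mul_I])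
  have hB : pL g B = u + v := by rw [hu, hv]; module
  -- Here `u` and `v` are multiplications by `Ω` and its conjugate; both Kähler forms are
  -- combinations of them.
  have hC : pL g C = (-Complex.I) • (u + -v) := by
    rw [hu, hv]
    have : Complex.I * Complex.I = -1 := Complex.I_mul_I
    match_scalars
    · linear_combination this
    · ring
  have hBC : Commute (pL g B) (pL g C) := pL_comm
  have huv : Commute u v := by
    rw [hu, hv]
    refine Commute.smul_left (Commute.smul_right ?_ _) _
    exact ((Commute.refl _).add_right (hBC.smul_right _)).add_left
      ((hBC.symm.add_right ((Commute.refl _).smul_right _)).smul_left _)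
  clear_value u v
  have hterm : ∀ (s : ℂ) (i : ℕ), i ∈ Finset.range (2 * n + 1) → i ≠ n →
      (u ^ i * (s • v) ^ (2 * n - i) * ((2 * n).choose i : Module.End ℂ (PForm E))) (pOne E) = 0 := by
    intro s i hi hin
    rw [Module.End.mul_apply, Module.End.natCast_apply, _root_.map_nsmul, smul_pow, mul_smul_comm,
      LinearMap.smul_apply]
    have : (u ^ i * v ^ (2 * n - i)) (pOne E) = 0 := by
      rcases lt_or_gt_of_ne hin with h | h
      · obtain ⟨m, hm⟩ := Nat.exists_eq_add_of_le (show n + 1 ≤ 2 * n - i by omega)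
        rw [hm, add_comm, pow_add, Module.End.mul_apply, Module.End.mul_apply, hv0, _root_.map_zero,
          _root_.map_zero]
      · obtain ⟨m, hm⟩ := Nat.exists_eq_add_of_le (show n + 1 ≤ i by omega)
        rw [(huv.pow_pow _ _).eq, hm, add_comm, pow_add, Module.End.mul_apply, Module.End.mul_apply,
          hu0, _root_.map_zero, _root_.map_zero]
    rw [this, smul_zero, smul_zero]
  -- As `u^(n+1)` and `v^(n+1)` kill `1`, only the middle binomial term survives. For `C` its
  -- coefficient is `(-√-1)^(2n) (-1)^n = 1`.
  have e1 : ∀ s : ℂ, ((u + s • v) ^ (2 * n)) (pOne E) =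
      s ^ n • ((u ^ n * v ^ n * ((2 * n).choose n : Module.End ℂ (PForm E))) (pOne E)) := by
    intro s
    rw [(huv.smul_right s).add_pow, LinearMap.sum_apply,
      Finset.sum_eq_single_of_mem n (Finset.mem_range.2 (by omega)) (hterm s)]
    rw [show 2 * n - n = n by omega, smul_pow, mul_smul_comm, smul_mul_assoc, LinearMap.smul_apply]
  have e2 := e1 1
  have e3 := e1 (-1)
  rw [one_smul, one_pow, one_smul] at e2
  rw [neg_one_smul] at e3
  rw [hB, e2, hC, smul_pow, LinearMap.smul_apply, e3, smul_smul, pow_mul, neg_sq, Complex.I_sq,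
    ← mul_pow]
  simp

end Volume

/-! ### Operators on forms commuting with complex conjugation. -/

section RealOps
variable {E : Type*} [NormedAddCommGroup E] [NormedSpace ℝ E] [FiniteDimensional ℝ E]

variable (E) in
/-- Complex conjugation of alternating forms. -/
def pConj : PForm E →+ PForm E where
  toFun η k := (Complex.conjCLE : ℂ →L[ℝ] ℂ).compContinuousAlternatingMap (η k)
  map_zero' := by
    funext k; ext v
    exact _root_.map_zero (starRingEnd ℂ)
  map_add' a b := by
    funext k; ext v
    exact _root_.map_add (starRingEnd ℂ) (a k v) (b k v)

theorem pConj_apply (η : PForm E) (k : ℕ) (v : Fin k → E) :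
    pConj E η k v = starRingEnd ℂ (η k v) := rfl

theorem pConj_pConj (η : PForm E) : pConj E (pConj E η) = η := by
  funext k; ext v
  exact Complex.conj_conj _

/-- Operators on forms that commute with complex conjugation. -/
def IsRealEnd (t : Module.End ℂ (PForm E)) : Prop := ∀ η, t (pConj E η) = pConj E (t η)

theorem IsRealEnd.mul {s t : Module.End ℂ (PForm E)} (hs : IsRealEnd s) (ht : IsRealEnd t) :
    IsRealEnd (s * t) := fun η => by
  rw [Module.End.mul_apply, ht, hs, Module.End.mul_apply]

theorem IsRealEnd.sum {ι : Type*} {s : Finset ι} {t : ι → Module.End ℂ (PForm E)}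
    (h : ∀ i ∈ s, IsRealEnd (t i)) : IsRealEnd (∑ i ∈ s, t i) := fun η => by
  rw [LinearMap.sum_apply, LinearMap.sum_apply, _root_.map_sum]
  exact Finset.sum_congr rfl fun i hi => h i hi η

theorem isRealEnd_iota (v : E) : IsRealEnd (iota v) := fun _ => rfl

theorem isRealEnd_pull (A : E →L[ℝ] E) : IsRealEnd (pull A) := fun _ => rfl

theorem isRealEnd_eps (ξ : E →L[ℝ] ℝ) : IsRealEnd (eps ξ) := fun η => by
  funext k
  cases k with
  | zero => exact (congrFun (pConj E).map_zero 0).symm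
  | succ k =>
    ext v
    rw [pConj_apply, eps_succ, eps_succ, alternatizeUncurryFin_apply, alternatizeUncurryFin_apply,
      _root_.map_sum]
    refine Finset.sum_congr rfl fun i _ => ?_
    rw [map_zsmul]
    congr 1
    change (ξ (v i) : ℝ) • starRingEnd ℂ (η k _) = starRingEnd ℂ ((ξ (v i) : ℝ) • η k _)
    rw [Complex.real_smul, Complex.real_smul, _root_.map_mul, Complex.conj_ofReal]

theorem isRealEnd_der (C : E →L[ℝ] E) : IsRealEnd (der C) :=
  IsRealEnd.sum fun _ _ => (isRealEnd_eps _).mul (isRealEnd_iota _)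

end RealOps

/-! ### Wedge and contraction with the form `g (u, A v)` as `pL` and `pLam`. -/

section TwoForm
variable {E : Type*} [NormedAddCommGroup E] [NormedSpace ℝ E] [FiniteDimensional ℝ E]

theorem ev0_twoForm (g : E →L[ℝ] E →L[ℝ] ℝ) (A : E →L[ℝ] E) (h : ∀ v, g v (A v) = 0) (u v : E) :
    ev0 (((twoForm g A h).curryLeft u).curryLeft v) = (g u (A v) : ℂ) := ev0_apply _ 0

theorem wOp_twoForm (g : E →L[ℝ] E →L[ℝ] ℝ) (A : E →L[ℝ] E) (h : ∀ v, g v (A v) = 0) :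
    (2⁻¹ : ℂ) • wOp 2 (twoForm g A h) = pL g A := by
  rw [pL, wOp]
  congr 1
  refine Finset.sum_congr rfl fun i _ => ?_
  rw [wOp, ← sum_smul_eps (g (bas E i) ∘L A)]
  congr 1
  refine Finset.sum_congr rfl fun j _ => ?_
  rw [wOp, ev0_twoForm, mul_smul_comm, mul_one, Complex.coe_smul]
  rfl

theorem cOp_twoForm {g : E →L[ℝ] E →L[ℝ] ℝ} {G : (E →L[ℝ] ℝ) →L[ℝ] E} (hG : IsDualMetric g G)
    (A : E →L[ℝ] E) (h : ∀ v, g v (A v) = 0) :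
    (2⁻¹ : ℂ) • cOp G 2 (twoForm g A h) = pLam G A := by
  rw [pLam, cOp]
  congr 1
  have h1 : ∀ j, iota (A (bas E j)) = ∑ i, g (bas E i) (A (bas E j)) • iota (G (cob E i)) := by
    intro j
    have := congrArg iotaL (hG.sum_smul (A (bas E j)))
    rw [_root_.map_sum] at this
    simp only [_root_.map_smul] at this
    exact this.symm
  have h2 : ∀ i, cOp G (0 + 1) ((twoForm g A h).curryLeft (bas E i)) =
      ∑ j, g (bas E i) (A (bas E j)) • iota (G (cob E j)) := by
    intro i
    rw [cOp]
    refine Finset.sum_congr rfl fun j _ => ?_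
    rw [cOp, ev0_twoForm, smul_mul_assoc, one_mul, Complex.coe_smul]
  simp only [h1]
  calc _ = ∑ i, ∑ j, g (bas E i) (A (bas E j)) • (iota (G (cob E j)) * iota (G (cob E i))) := by
        refine Finset.sum_congr rfl fun i _ => ?_
        rw [show cOp G 1 _ = _ from h2 i, Finset.sum_mul]
        exact Finset.sum_congr rfl fun j _ => smul_mul_assoc _ _ _
    _ = _ := by
        rw [Finset.sum_comm]
        refine Finset.sum_congr rfl fun j _ => ?_
        rw [Finset.mul_sum]
        exact Finset.sum_congr rfl fun i _ => (mul_smul_comm _ _ _).symm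

theorem conj_twoForm (g : E →L[ℝ] E →L[ℝ] ℝ) (A : E →L[ℝ] E) (h : ∀ v, g v (A v) = 0) :
    (Complex.conjCLE : ℂ →L[ℝ] ℂ).compContinuousAlternatingMap (twoForm g A h) = twoForm g A h := by
  ext v
  exact Complex.conj_ofReal _

theorem pL_apply_zero (g : E →L[ℝ] E →L[ℝ] ℝ) (A : E →L[ℝ] E) (η : PForm E) : pL g A η 0 = 0 := by
  rw [pL, LinearMap.smul_apply, LinearMap.sum_apply, Pi.smul_apply, Finset.sum_apply]
  simp [eps_zero]

theorem pL_apply_one (g : E →L[ℝ] E →L[ℝ] ℝ) (A : E →L[ℝ] E) (η : PForm E) : pL g A η 1 = 0 := by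
  rw [pL, LinearMap.smul_apply, LinearMap.sum_apply, Pi.smul_apply, Finset.sum_apply]
  refine (congrArg _ (Finset.sum_eq_zero fun i _ => ?_)).trans (smul_zero _)
  rw [Module.End.mul_apply, eps_succ, eps_zero]
  ext v
  simp [alternatizeUncurryFin_apply]

end TwoForm

/-! ### Operators on differential forms that act pointwise. -/

section Fibre
variable {E : Type*} [NormedAddCommGroup E] [NormedSpace ℝ E] [FiniteDimensional ℝ E]
  {M : Type*} [TopologicalSpace M] [ChartedSpace E M] [IsManifold 𝓘(ℝ, E) ∞ M]

/-- The value of a differential form at a point. -/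
def evAt (x : M) : AllForms E M →ₗ[ℂ] PForm E where
  toFun η k := (η k).1 x
  map_add' _ _ := rfl
  map_smul' _ _ := rfl

theorem AllForms.ext_evAt {η ζ : AllForms E M} (h : ∀ x, evAt x η = evAt x ζ) : η = ζ :=
  funext fun k => Subtype.ext (funext fun x => congrFun (h x) k)

/-! Shortcut instances, which save most of the time spent on instance search. -/

scoped instance : Mul (FormEnd E M) := inferInstance
scoped instance : Ring (FormEnd E M) := inferInstance
scoped instance : Semiring (FormEnd E M) := inferInstance
scoped instance : NonUnitalNonAssocRing (FormEnd E M) := inferInstance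
scoped instance : NonUnitalNonAssocSemiring (FormEnd E M) := inferInstance
scoped instance : Semigroup (FormEnd E M) := inferInstance
scoped instance : Algebra ℂ (FormEnd E M) := inferInstance
scoped instance : SMul ℂ (FormEnd E M) := inferInstance
scoped instance : Add (FormEnd E M) := inferInstance
scoped instance : Sub (FormEnd E M) := inferInstance
scoped instance : Neg (FormEnd E M) := inferInstance
scoped instance : Zero (FormEnd E M) := inferInstance
scoped instance : AddCommMonoid (FormEnd E M) := inferInstance
scoped instance : AddGroup (FormEnd E M) := inferInstance
scoped instance : IsScalarTower ℂ (FormEnd E M) (FormEnd E M) := inferInstance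
scoped instance : SMulCommClass ℂ (FormEnd E M) (FormEnd E M) := inferInstance

/-- The operator `T` acts pointwise, as `t x` at `x`. -/
def IsFib (T : FormEnd E M) (t : M → Module.End ℂ (PForm E)) : Prop :=
  ∀ η x, evAt x (T η) = t x (evAt x η)

namespace IsFib
variable {S T : FormEnd E M} {s t : M → Module.End ℂ (PForm E)}

theorem eq (hS : IsFib S s) (hT : IsFib T t) (h : ∀ x, s x = t x) : S = T :=
  LinearMap.ext fun η => AllForms.ext_evAt fun x => by rw [hS, hT, h]

theorem one : IsFib (1 : FormEnd E M) fun _ => 1 := fun _ _ => rfl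

theorem zero : IsFib (0 : FormEnd E M) fun _ => 0 := fun _ _ => rfl

theorem mul (hS : IsFib S s) (hT : IsFib T t) : IsFib (S * T) fun x => s x * t x := fun η x => by
  rw [Module.End.mul_apply, hS, hT, Module.End.mul_apply]

theorem add (hS : IsFib S s) (hT : IsFib T t) : IsFib (S + T) fun x => s x + t x := fun η x => by
  rw [LinearMap.add_apply, _root_.map_add, hS, hT, LinearMap.add_apply]

theorem sub (hS : IsFib S s) (hT : IsFib T t) : IsFib (S - T) fun x => s x - t x := fun η x => by
  rw [LinearMap.sub_apply, _root_.map_sub, hS, hT, LinearMap.sub_apply]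

theorem neg (hS : IsFib S s) : IsFib (-S) fun x => -s x := fun η x => by
  rw [LinearMap.neg_apply, _root_.map_neg, hS, LinearMap.neg_apply]

theorem smul (c : ℂ) (hS : IsFib S s) : IsFib (c • S) fun x => c • s x := fun η x => by
  rw [LinearMap.smul_apply, _root_.map_smul, hS, LinearMap.smul_apply]

theorem two_mul (hS : IsFib S s) : IsFib (2 * S) fun x => 2 * s x := by
  simp only [_root_.two_mul]
  exact hS.add hS

theorem pow (hS : IsFib S s) (n : ℕ) : IsFib (S ^ n) fun x => s x ^ n := by
  induction n with
  | zero => simpa using one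
  | succ n ih => simp only [pow_succ]; exact ih.mul hS

theorem sum {ι : Type*} {I : Finset ι} {S : ι → FormEnd E M} {s : ι → M → Module.End ℂ (PForm E)}
    (h : ∀ i, IsFib (S i) (s i)) : IsFib (∑ i ∈ I, S i) fun x => ∑ i ∈ I, s i x := fun η x => by
  rw [LinearMap.sum_apply, _root_.map_sum, LinearMap.sum_apply]
  exact Finset.sum_congr rfl fun i _ => h i η x

/-- The nilpotency exponent is the same at all points, so the exponential is one finite sum both
globally and in each fibre. -/
theorem exp (hS : IsFib S s) {n : ℕ} (hn : ∀ x, s x ^ n = 0) :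
    IsFib (IsNilpotent.exp S) fun x => IsNilpotent.exp (s x) := by
  have h0 : S ^ n = 0 := (hS.pow n).eq zero hn
  rw [IsNilpotent.exp_eq_sum h0]
  have h1 : (fun x => IsNilpotent.exp (s x)) =
      fun x => ∑ i ∈ Finset.range n, ((i.factorial : ℂ)⁻¹) • s x ^ i := by
    funext x
    rw [IsNilpotent.exp_eq_sum (hn x)]
    refine Finset.sum_congr rfl fun i _ => ?_
    rw [← algebraMap_smul ℂ ((i.factorial : ℚ)⁻¹) (s x ^ i)]
    simp
  rw [h1]
  refine sum fun i => ?_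
  rw [← algebraMap_smul ℂ ((i.factorial : ℚ)⁻¹) (S ^ i)]
  simpa using (hS.pow i).smul ((i.factorial : ℂ)⁻¹)

theorem conjOp (hS : IsFib S s) (hs : ∀ x, IsRealEnd (s x)) : conjOp S = S :=
  LinearMap.ext fun η => AllForms.ext_evAt fun x => by
    change pConj E (evAt x (S (conjAll E M η))) = _
    rw [hS, hS]
    change pConj E (s x (pConj E (evAt x η))) = _
    rw [hs, pConj_pConj]

end IsFib

theorem isFib_gradeOp (c : ℕ → ℂ) : IsFib (gradeOp c : FormEnd E M) fun _ => grade c := fun _ _ => rfl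

namespace HypercomplexHermitian
variable (X : HypercomplexHermitian E M)

theorem isFib_quatOp (q : ℍ[ℝ]) : IsFib (X.quatOp q) fun x => pull (X.endo q x) := fun _ _ => rfl

theorem isDualMetric (x : M) : IsDualMetric (metricAt X.metric x) (metricAt X.metric x).inverse := by
  have h := isInvertible_of_pos _ (metricAt_pos X.metric x)
  exact ⟨X.metric.symm x, h.self_apply_inverse, h.inverse_apply_self⟩

theorem isFib_lefschetz (q : ImagUnit) :
    IsFib (X.lefschetz q) fun x => pL (metricAt X.metric x) (X.endo q.1 x) := fun η x => by
  funext k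
  match k with
  | 0 => rw [pL_apply_zero]; rfl
  | 1 => rw [pL_apply_one]; rfl
  | k + 2 =>
    beta_reduce
    rw [← wOp_twoForm _ _ (X.skew q x), LinearMap.smul_apply, Pi.smul_apply, wOp_apply]
    change ((Nat.factorial 2 : ℂ)⁻¹) • wedgeAux 2 k _ _ = _
    norm_num [Nat.factorial]
    rfl

theorem isFib_lefschetzDual (q : ImagUnit) :
    IsFib (X.lefschetzDual q) fun x => pLam (metricAt X.metric x).inverse (X.endo q.1 x) :=
  fun η x => by
    funext k
    beta_reduce
    rw [← cOp_twoForm (X.isDualMetric x) _ (X.skew q x), LinearMap.smul_apply, Pi.smul_apply,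
      cOp_apply]
    conv_rhs => rw [← conj_twoForm]
    change ((Nat.factorial 2 : ℂ)⁻¹) • contractAux _ 2 k _ _ = _
    norm_num [Nat.factorial]
    rfl

theorem isFib_star : IsFib X.star fun x => pStar (metricAt X.metric x).inverse (evAt x X.volForm) :=
  fun η x => by
    funext l
    let T : Form E M l →ₗ[ℂ] Alt E l :=
      { toFun := fun η => η.1 x, map_add' := fun _ _ => rfl, map_smul' := fun _ _ => rfl }
    change T (X.star η l) = _
    rw [star, LinearMap.pi_apply, LinearMap.sum_apply, _root_.map_sum]
    rfl

theorem isSkew (q : ImagUnit) (x : M) : IsSkew (metricAt X.metric x) (X.endo q.1 x) := fun u v => by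
  have h1 := X.skew q x (u + v)
  simp only [_root_.map_add, _root_.add_apply, X.skew q x u, X.skew q x v] at h1
  have h2 : metricAt X.metric x (X.endo q.1 x u) v = metricAt X.metric x v (X.endo q.1 x u) :=
    X.metric.symm x _ _
  linarith

theorem endo_comp (q r : ℍ[ℝ]) (x : M) : X.endo q x ∘L X.endo r x = X.endo (q * r) x :=
  ((X.act x).map_mul q r).symm

theorem endo_neg (q : ℍ[ℝ]) (x : M) : X.endo (-q) x = -X.endo q x := (X.act x).map_neg q

theorem endo_one (x : M) : X.endo 1 x = 1 := (X.act x).map_one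

theorem endo_sq (q : ImagUnit) (x : M) : X.endo q.1 x ∘L X.endo q.1 x = -1 := by
  rw [X.endo_comp, q.2, X.endo_neg, X.endo_one]

/-- Triples of imaginary unit quaternions multiplying like `I, J, K`. -/
structure IsQuatTriple (a b c : ImagUnit) : Prop where
  bc : b.1 * c.1 = a.1
  ca : c.1 * a.1 = b.1
  ab : a.1 * b.1 = c.1
  cb : c.1 * b.1 = -a.1
  ac : a.1 * c.1 = -b.1
  ba : b.1 * a.1 = -c.1

theorem IsQuatTriple.rotate {a b c : ImagUnit} (t : IsQuatTriple a b c) : IsQuatTriple b c a :=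
  ⟨t.ca, t.ab, t.bc, t.ac, t.ba, t.cb⟩

/-- Associativity, `I J = K` and the three squares being `-1` determine all other products. -/
theorem isQuatTriple_IJK : IsQuatTriple qI qJ qK := by
  have h : ∀ q r s : ImagUnit, q.1 * r.1 = s.1 → r.1 * s.1 = q.1 ∧ s.1 * q.1 = r.1 ∧
      r.1 * q.1 = -s.1 ∧ s.1 * r.1 = -q.1 ∧ q.1 * s.1 = -r.1 := by
    rintro ⟨q, hq⟩ ⟨r, hr⟩ ⟨s, hs⟩ h
    dsimp only at h ⊢
    have h1 : q * s = -r := by rw [← h, ← mul_assoc, hq, neg_one_mul]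
    have h2 : s * r = -q := by rw [← h, mul_assoc, hr, mul_neg_one]
    have h3 : r * q = -s := by
      have e1 : s * (r * q) = 1 := by rw [← mul_assoc, h2, neg_mul, hq, neg_neg]
      have e2 : s * (s * (r * q)) = s := by rw [e1, mul_one]
      rw [← mul_assoc, hs, neg_one_mul] at e2
      rw [← e2, neg_neg]
    refine ⟨?_, ?_, h3, h2, h1⟩
    · have : r * (r * q) = -(r * s) := by rw [h3, mul_neg]
      rw [← mul_assoc, hr, neg_one_mul, neg_inj] at this
      exact this.symm
    · have : (r * q) * q = -(s * q) := by rw [h3, neg_mul]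
      rw [mul_assoc, hq, mul_neg_one, neg_inj] at this
      exact this.symm
  obtain ⟨h1, h2, h3, h4, h5⟩ := h qI qJ qK qI_mul_qJ
  exact ⟨h1, h2, qI_mul_qJ, h4, h5, h3⟩

variable {X}

theorem IsQuatTriple.isHypTriple {a b c : ImagUnit} (t : IsQuatTriple a b c) (x : M) :
    IsHypTriple (metricAt X.metric x) (X.endo a.1 x) (X.endo b.1 x) (X.endo c.1 x) where
  skewA := X.isSkew a x
  skewB := X.isSkew b x
  skewC := X.isSkew c x
  sqA := X.endo_sq a x
  sqB := X.endo_sq b x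
  sqC := X.endo_sq c x
  bc := by rw [X.endo_comp, t.bc]
  cb := by rw [X.endo_comp, t.cb, X.endo_neg]
  ca := by rw [X.endo_comp, t.ca]
  ac := by rw [X.endo_comp, t.ac, X.endo_neg]
  ab := by rw [X.endo_comp, t.ab]
  ba := by rw [X.endo_comp, t.ba, X.endo_neg]

variable (X)

theorem isNilpotent_lefschetz (q : ImagUnit) : IsNilpotent (X.lefschetz q) :=
  ⟨_, ((X.isFib_lefschetz q).pow _).eq IsFib.zero fun _ => pL_pow⟩

theorem isNilpotent_lefschetzDual (q : ImagUnit) : IsNilpotent (X.lefschetzDual q) :=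
  ⟨_, ((X.isFib_lefschetzDual q).pow _).eq IsFib.zero fun _ => pLam_pow⟩

theorem isFib_weyl (q : ImagUnit) : IsFib (weyl (X.lefschetz q) (X.lefschetzDual q)) fun x =>
    pWeyl (metricAt X.metric x) (metricAt X.metric x).inverse (X.endo q.1 x) := by
  have h1 := (X.isFib_lefschetz q).exp fun _ => pL_pow
  have h2 := (X.isFib_lefschetzDual q).neg.exp (n := Module.finrank ℝ E + 1) fun _ => by
    rw [neg_pow, pLam_pow, mul_zero]
  exact (h1.mul h2).mul h1

include X in
theorem exists_finrank [Nonempty M] : ∃ n : ℕ, Module.finrank ℝ E = 4 * n := by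
  obtain ⟨x⟩ := ‹Nonempty M›
  obtain ⟨n, hn, -⟩ := exists_finrank_eq (X.isDualMetric x) (isQuatTriple_IJK.isHypTriple x)
  exact ⟨n, hn⟩

theorem evAt_single_oneForm (x : M) : evAt x (Pi.single 0 (oneForm E M)) = pOne E := by
  funext k
  cases k with
  | zero => rfl
  | succ k => rfl

/-- The volume form is defined through `ω_I`; by `pL_pow_pOne_eq` it may equally be written through
`ω_J`, and `pWeyl_pOne` identifies either expression with a Weyl element applied to `1`. -/
theorem evAt_volForm (x : M) {q : ImagUnit} (hq : q = qI ∨ q = qJ) : evAt x X.volForm =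
    pWeyl (metricAt X.metric x) (metricAt X.metric x).inverse (X.endo q.1 x) (pOne E) := by
  have : Nonempty M := ⟨x⟩
  obtain ⟨n, hn⟩ := X.exists_finrank
  have hN : Module.finrank ℝ E = 2 * (2 * n) := by omega
  rw [volForm, _root_.map_smul, (X.isFib_lefschetz qI).pow, evAt_single_oneForm,
    pWeyl_pOne (X.isDualMetric x) (X.isSkew q x) (X.endo_sq q x) hN,
    show Module.finrank ℝ E / 2 = 2 * n by omega]
  rcases hq with rfl | rfl
  · rfl
  · rw [pL_pow_pOne_eq (X.isDualMetric x) (isQuatTriple_IJK.rotate.rotate.isHypTriple x) hN]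

/-- The choice of `q` is what matters: `q = I` will lead to the Kähler identities of `(M, I)`, and
`q = J` to the adjoints expressed by `Λ_Ω`. -/
theorem star_eq {q : ImagUnit} (hq : q = qI ∨ q = qJ) : X.star =
    weyl (X.lefschetz q) (X.lefschetzDual q) * X.quatOp q.1 * gradeOp fun k => (-1) ^ k.choose 2 :=
  X.isFib_star.eq (((X.isFib_weyl q).mul (X.isFib_quatOp q.1)).mul (isFib_gradeOp _)) fun x =>
    pStar_eq (X.isDualMetric x) (X.isSkew q x) (X.endo_sq q x) (X.evAt_volForm x hq)

theorem star_mul_star : X.star * X.star = parityOp E M :=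
  (X.isFib_star.mul X.isFib_star).eq (isFib_gradeOp _) fun x => by
    have : Nonempty M := ⟨x⟩
    obtain ⟨n, hn⟩ := X.exists_finrank
    rw [pStar_eq (X.isDualMetric x) (X.isSkew qI x) (X.endo_sq qI x) (X.evAt_volForm x (Or.inl rfl))]
    exact pStar_mul_pStar (X.isDualMetric x) (X.isSkew qI x) (X.endo_sq qI x) (N := 2 * n) (by omega)

end HypercomplexHermitian
end Fibre

/-! ### Hodge types, Dolbeault differentials, and `ad q` as a derivation. -/

section TypeProj
variable {E : Type*} [NormedAddCommGroup E] [NormedSpace ℝ E] [FiniteDimensional ℝ E]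
  {M : Type*} [TopologicalSpace M] [ChartedSpace E M] [IsManifold 𝓘(ℝ, E) ∞ M]

namespace HypercomplexStructure
variable (X : HypercomplexStructure E M)

/-- A form of type `(p, k - p)` evaluates to the monomial `z^p \bar z^(k-p)` along the circle
action, from which `rootAvg` extracts a Kronecker delta. -/
theorem typeProj_typeProj (q : ImagUnit) {k p p' : ℕ} (hp : p ≤ k) (hp' : p' ≤ k) (η : Form E M k) :
    X.typeProj q k p' (X.typeProj q k p η) = if p = p' then X.typeProj q k p η else 0 := by
  refine Subtype.ext (funext fun x => ?_)
  ext v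
  rw [typeProj_apply]
  have h : (fun z => (X.typeProj q k p η).1 x fun i => X.endo (complexEndo q z) x (v i)) =
      ((X.typeProj q k p η).1 x v) • fun z : ℂ => z ^ p * (starRingEnd ℂ z) ^ (k - p) := by
    funext z
    have h1 := congrArg (fun ζ : Form E M k => ζ.1 x v) (X.isType_typeProj q hp η z)
    refine Eq.trans h1 ?_
    exact mul_comm _ _
  rw [h, rootAvg_smul, rootAvg_monomial hp' hp]
  split_ifs
  · rw [mul_one]
  · rw [mul_zero]; rfl

/-- The operator `ad q` on `k`-forms. -/
def adForm (q : ImagUnit) (k : ℕ) : Form E M k →ₗ[ℂ] Form E M k :=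
  ∑ p ∈ Finset.range (k + 1), (Complex.I * (2 * p - k)) • X.typeProj q k p

theorem adForm_typeProj (q : ImagUnit) {k p : ℕ} (hp : p ≤ k) (η : Form E M k) :
    X.adForm q k (X.typeProj q k p η) = (Complex.I * (2 * p - k)) • X.typeProj q k p η := by
  rw [adForm, LinearMap.sum_apply, Finset.sum_eq_single_of_mem p (Finset.mem_range.2 (by omega))]
  · rw [LinearMap.smul_apply, X.typeProj_typeProj q hp hp, if_pos rfl]
  · intro p' hp' h
    rw [LinearMap.smul_apply, X.typeProj_typeProj q hp (by have := Finset.mem_range.1 hp'; omega),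
      if_neg h.symm, smul_zero]

/-- An operator acting by scalars on the type components commutes with the type projections. -/
theorem typeProj_comm (q : ImagUnit) {k : ℕ} (F : Form E M k →ₗ[ℂ] Form E M k) (c : ℕ → ℂ)
    (hF : ∀ p ≤ k, ∀ η, F (X.typeProj q k p η) = c p • X.typeProj q k p η) {p : ℕ} (hp : p ≤ k)
    (η : Form E M k) : X.typeProj q k p (F η) = c p • X.typeProj q k p η := by
  conv_lhs => rw [← X.sum_typeProj q k η]
  rw [_root_.map_sum, _root_.map_sum, Finset.sum_eq_single_of_mem p (Finset.mem_range.2 (by omega))]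
  · rw [hF p hp, _root_.map_smul, X.typeProj_typeProj q hp hp, if_pos rfl]
  · intro p' hp' h
    have h1 : p' ≤ k := by have := Finset.mem_range.1 hp'; omega
    rw [hF p' h1, _root_.map_smul, X.typeProj_typeProj q h1 hp, if_neg h, smul_zero]

theorem pullForm_typeProj (q : ImagUnit) {k p : ℕ} (hp : p ≤ k) (η : Form E M k) :
    pullForm (X.endo q.1) (X.isSmoothEnd q.1) k (X.typeProj q k p η) =
      (Complex.I ^ p * (-Complex.I) ^ (k - p)) • X.typeProj q k p η := by
  have h := X.isType_typeProj q hp η Complex.I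
  have h1 : complexEndo q Complex.I = q.1 := by simp [complexEndo]
  rw [Complex.conj_I] at h
  rw [← h]
  refine Subtype.ext (funext fun x => ?_)
  change _ = ((X.typeProj q k p η).1 x).compContinuousLinearMap (X.endo (complexEndo q Complex.I) x)
  rw [h1]
  rfl

/-- The component of type `(1, 0)` of `d`. -/
def delForm (q : ImagUnit) (k : ℕ) : Form E M k →ₗ[ℂ] Form E M (k + 1) :=
  ∑ p ∈ Finset.range (k + 1), X.typeProj q (k + 1) (p + 1) ∘ₗ dForm E M k ∘ₗ X.typeProj q k p

/-- The component of type `(0, 1)` of `d`. -/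
def delBarForm (q : ImagUnit) (k : ℕ) : Form E M k →ₗ[ℂ] Form E M (k + 1) :=
  ∑ p ∈ Finset.range (k + 1), X.typeProj q (k + 1) p ∘ₗ dForm E M k ∘ₗ X.typeProj q k p

/-- The summands of `∂` map type `p` to type `p + 1`, so the identity only compares scalars. It is
used with `(a, b) = (1, √-1)` for `ad q`, and with `(√-1, 0)` for the pull-back by `q`. -/
theorem delForm_comm (q : ImagUnit) {k : ℕ} (F : Form E M k →ₗ[ℂ] Form E M k) (c : ℕ → ℂ)
    (F' : Form E M (k + 1) →ₗ[ℂ] Form E M (k + 1)) (c' : ℕ → ℂ) (a b : ℂ)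
    (hF : ∀ p ≤ k, ∀ η, F (X.typeProj q k p η) = c p • X.typeProj q k p η)
    (hF' : ∀ p ≤ k + 1, ∀ η, F' (X.typeProj q (k + 1) p η) = c' p • X.typeProj q (k + 1) p η)
    (h : ∀ p ≤ k, c' (p + 1) = a * c p + b) (η : Form E M k) :
    F' (X.delForm q k η) = a • X.delForm q k (F η) + b • X.delForm q k η := by
  simp only [delForm, LinearMap.sum_apply, _root_.map_sum, Finset.smul_sum, ← Finset.sum_add_distrib]
  refine Finset.sum_congr rfl fun p hp => ?_
  have hp' : p ≤ k := by have := Finset.mem_range.1 hp; omega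
  simp only [LinearMap.comp_apply, X.typeProj_comm q F c hF hp', _root_.map_smul]
  rw [hF' (p + 1) (by omega), h p hp', add_smul, mul_smul]

theorem delBarForm_comm (q : ImagUnit) {k : ℕ} (F : Form E M k →ₗ[ℂ] Form E M k) (c : ℕ → ℂ)
    (F' : Form E M (k + 1) →ₗ[ℂ] Form E M (k + 1)) (c' : ℕ → ℂ) (a b : ℂ)
    (hF : ∀ p ≤ k, ∀ η, F (X.typeProj q k p η) = c p • X.typeProj q k p η)
    (hF' : ∀ p ≤ k + 1, ∀ η, F' (X.typeProj q (k + 1) p η) = c' p • X.typeProj q (k + 1) p η)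
    (h : ∀ p ≤ k, c' p = a * c p + b) (η : Form E M k) :
    F' (X.delBarForm q k η) = a • X.delBarForm q k (F η) + b • X.delBarForm q k η := by
  simp only [delBarForm, LinearMap.sum_apply, _root_.map_sum, Finset.smul_sum,
    ← Finset.sum_add_distrib]
  refine Finset.sum_congr rfl fun p hp => ?_
  have hp' : p ≤ k := by have := Finset.mem_range.1 hp; omega
  simp only [LinearMap.comp_apply, X.typeProj_comm q F c hF hp', _root_.map_smul]
  rw [hF' p (by omega), h p hp', add_smul, mul_smul]

theorem adForm_delForm (q : ImagUnit) (k : ℕ) (η : Form E M k) :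
    X.adForm q (k + 1) (X.delForm q k η) =
      X.delForm q k (X.adForm q k η) + Complex.I • X.delForm q k η := by
  have := X.delForm_comm q (X.adForm q k) _ (X.adForm q (k + 1)) _ 1 Complex.I
    (fun p hp => X.adForm_typeProj q hp) (fun p hp => X.adForm_typeProj q hp)
    (fun p _ => by push_cast; ring) η
  rwa [one_smul] at this

theorem adForm_delBarForm (q : ImagUnit) (k : ℕ) (η : Form E M k) :
    X.adForm q (k + 1) (X.delBarForm q k η) =
      X.delBarForm q k (X.adForm q k η) + (-Complex.I) • X.delBarForm q k η := by
  have := X.delBarForm_comm q (X.adForm q k) _ (X.adForm q (k + 1)) _ 1 (-Complex.I)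
    (fun p hp => X.adForm_typeProj q hp) (fun p hp => X.adForm_typeProj q hp)
    (fun p _ => by push_cast; ring) η
  rwa [one_smul] at this

theorem pullForm_delForm (q : ImagUnit) (k : ℕ) (η : Form E M k) :
    pullForm (X.endo q.1) (X.isSmoothEnd q.1) (k + 1) (X.delForm q k η) =
      Complex.I • X.delForm q k (pullForm (X.endo q.1) (X.isSmoothEnd q.1) k η) := by
  have := X.delForm_comm q _ _ _ _ Complex.I 0
    (fun p hp => X.pullForm_typeProj q hp) (fun p hp => X.pullForm_typeProj q hp)
    (fun p _ => by rw [Nat.add_sub_add_right]; ring) η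
  rwa [zero_smul, add_zero] at this

theorem pullForm_delBarForm (q : ImagUnit) (k : ℕ) (η : Form E M k) :
    pullForm (X.endo q.1) (X.isSmoothEnd q.1) (k + 1) (X.delBarForm q k η) =
      (-Complex.I) • X.delBarForm q k (pullForm (X.endo q.1) (X.isSmoothEnd q.1) k η) := by
  have := X.delBarForm_comm q _ _ _ _ (-Complex.I) 0
    (fun p hp => X.pullForm_typeProj q hp) (fun p hp => X.pullForm_typeProj q hp)
    (fun p hp => by rw [Nat.sub_add_comm hp]; ring) η
  rwa [zero_smul, add_zero] at this

theorem adOp_mul_delOp (q : ImagUnit) :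
    X.adOp q * X.delOp q - X.delOp q * X.adOp q = Complex.I • X.delOp q := by
  rw [sub_eq_iff_eq_add']
  refine LinearMap.ext fun η => funext fun k => ?_
  cases k with
  | zero =>
    change X.adForm q 0 0 = 0 + Complex.I • 0
    rw [_root_.map_zero, smul_zero, add_zero]
  | succ k => exact X.adForm_delForm q k (η k)

theorem adOp_mul_delBarOp (q : ImagUnit) :
    X.adOp q * X.delBarOp q - X.delBarOp q * X.adOp q = -(Complex.I • X.delBarOp q) := by
  rw [sub_eq_iff_eq_add', ← neg_smul]
  refine LinearMap.ext fun η => funext fun k => ?_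
  cases k with
  | zero =>
    change X.adForm q 0 0 = 0 + (-Complex.I) • 0
    rw [_root_.map_zero, smul_zero, add_zero]
  | succ k => exact X.adForm_delBarForm q k (η k)

theorem quatOp_mul_delOp (q : ImagUnit) :
    X.quatOp q.1 * X.delOp q = Complex.I • (X.delOp q * X.quatOp q.1) := by
  refine LinearMap.ext fun η => funext fun k => ?_
  cases k with
  | zero =>
    change pullForm (X.endo q.1) (X.isSmoothEnd q.1) 0 0 = Complex.I • 0
    rw [_root_.map_zero, smul_zero]
  | succ k => exact X.pullForm_delForm q k (η k)

theorem quatOp_mul_delBarOp (q : ImagUnit) :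
    X.quatOp q.1 * X.delBarOp q = -(Complex.I • (X.delBarOp q * X.quatOp q.1)) := by
  rw [← neg_smul]
  refine LinearMap.ext fun η => funext fun k => ?_
  cases k with
  | zero =>
    change pullForm (X.endo q.1) (X.isSmoothEnd q.1) 0 0 = (-Complex.I) • 0
    rw [_root_.map_zero, smul_zero]
  | succ k => exact X.pullForm_delBarForm q k (η k)

/-- If the double commutator of `ad q` with `d` is `-d`, then `d` is the sum of its components of
types `(1, 0)` and `(0, 1)`. -/
theorem dOp_eq_add (q : ImagUnit) (h : X.adOp q * (X.adOp q * dOp E M - dOp E M * X.adOp q) -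
    (X.adOp q * dOp E M - dOp E M * X.adOp q) * X.adOp q = -dOp E M) :
    dOp E M = X.delOp q + X.delBarOp q := by
  have h1 : ∀ (k : ℕ) (η : Form E M k),
      X.adForm q (k + 1) (X.adForm q (k + 1) (dForm E M k η) - dForm E M k (X.adForm q k η)) -
        (X.adForm q (k + 1) (dForm E M k (X.adForm q k η)) -
          dForm E M k (X.adForm q k (X.adForm q k η))) = -dForm E M k η := by
    intro k η
    have := congrFun (LinearMap.congr_fun h (Pi.single k η)) (k + 1)
    have e : (Pi.single k η : AllForms E M) k = η := Pi.single_eq_same _ _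
    change X.adForm q (k + 1) (X.adForm q (k + 1) (dForm E M k ((Pi.single k η : AllForms E M) k)) -
      dForm E M k (X.adForm q k ((Pi.single k η : AllForms E M) k))) -
        (X.adForm q (k + 1) (dForm E M k (X.adForm q k ((Pi.single k η : AllForms E M) k))) -
          dForm E M k (X.adForm q k (X.adForm q k ((Pi.single k η : AllForms E M) k)))) =
        -dForm E M k ((Pi.single k η : AllForms E M) k) at this
    rwa [e] at this
  -- On the component of `d` from type `p` to type `p'` the double commutator is the scalar `-(2 (p'
  -- - p) - 1)²`. It equals `-1` only for `p' = p` or `p' = p + 1`.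
  have h2 : ∀ (k p p' : ℕ), p ≤ k → p' ≤ k + 1 → p' ≠ p → p' ≠ p + 1 → ∀ η : Form E M k,
      X.typeProj q (k + 1) p' (dForm E M k (X.typeProj q k p η)) = 0 := by
    intro k p p' hp hp' hne hne' η
    have h3 := congrArg (X.typeProj q (k + 1) p') (h1 k (X.typeProj q k p η))
    set ζ := X.typeProj q (k + 1) p' (dForm E M k (X.typeProj q k p η)) with hζ
    have ad : ∀ θ, X.typeProj q (k + 1) p' (X.adForm q (k + 1) θ) =
        (Complex.I * (2 * p' - (k + 1 : ℕ))) • X.typeProj q (k + 1) p' θ :=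
      X.typeProj_comm q _ _ (fun p hp => X.adForm_typeProj q hp) hp'
    simp only [X.adForm_typeProj q hp, _root_.map_smul, _root_.map_sub, _root_.map_neg, ad,
      ← hζ, smul_smul, ← sub_smul] at h3
    rw [← neg_one_smul ℂ ζ, ← sub_eq_zero, ← sub_smul] at h3
    refine (smul_eq_zero.1 h3).resolve_left fun h4 => ?_
    have h5 : ((p' : ℂ) - p) * (p' - p - 1) = 0 := by
      have hI := Complex.I_sq
      push_cast at h4
      linear_combination (-1 / 4 : ℂ) * h4 + (1 / 4) * (2 * p' - (k + 1) - (2 * p - k)) ^ 2 * hI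
    rcases mul_eq_zero.1 h5 with h6 | h6
    · exact hne (by exact_mod_cast sub_eq_zero.1 h6)
    · refine hne' ?_
      have : (p' : ℂ) = (p + 1 : ℕ) := by push_cast; linear_combination h6
      exact_mod_cast this
  refine LinearMap.ext fun η => funext fun k => ?_
  cases k with
  | zero => exact (add_zero (0 : Form E M 0)).symm
  | succ k =>
    change dForm E M k (η k) = X.delForm q k (η k) + X.delBarForm q k (η k)
    conv_lhs => rw [← X.sum_typeProj q k (η k)]
    rw [_root_.map_sum, delForm, delBarForm, LinearMap.sum_apply, LinearMap.sum_apply,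
      ← Finset.sum_add_distrib]
    refine Finset.sum_congr rfl fun p hp => ?_
    have hp' : p ≤ k := by have := Finset.mem_range.1 hp; omega
    conv_lhs => rw [← X.sum_typeProj q (k + 1) (dForm E M k _)]
    refine Eq.trans ?_ (add_comm _ _)
    refine Finset.sum_eq_add_of_mem p (p + 1) (Finset.mem_range.2 (by omega))
      (Finset.mem_range.2 (by omega)) (by omega) fun p' hp'' hne => ?_
    exact h2 k p p' hp' (by have := Finset.mem_range.1 hp''; omega) hne.1 hne.2 _

theorem hasDerivAt_type (k p : ℕ) (hp : p ≤ k) :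
    HasDerivAt (fun t : ℝ => (1 + t * Complex.I) ^ p * (1 - t * Complex.I) ^ (k - p))
      (Complex.I * (2 * p - k)) 0 := by
  have h0 : HasDerivAt (fun t : ℝ => (t : ℂ)) 1 0 := Complex.ofRealCLM.hasDerivAt
  have h1 := ((h0.mul_const Complex.I).const_add 1).pow p
  have h2 := ((h0.mul_const Complex.I).const_sub 1).pow (k - p)
  have hv : Complex.I * (2 * p - k) =
      p * (1 + (0 : ℝ) * Complex.I) ^ (p - 1) * (1 * Complex.I) *
          (1 - (0 : ℝ) * Complex.I) ^ (k - p) +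
        (1 + (0 : ℝ) * Complex.I) ^ p *
          ((k - p : ℕ) * (1 - (0 : ℝ) * Complex.I) ^ (k - p - 1) * -(1 * Complex.I)) := by
    simp only [Complex.ofReal_zero, zero_mul, add_zero, sub_zero, one_pow, mul_one, one_mul]
    rw [Nat.cast_sub hp]
    ring
  rw [hv]
  exact h1.mul h2

/-- Both sides are the derivative at `t = 0` of the pull-back by `1 + t q`: multilinearity gives the
derivation, and the decomposition into types gives the scalars of `hasDerivAt_type`. -/
theorem isFib_adOp (q : ImagUnit) : IsFib (X.adOp q) fun x => der (X.endo q.1 x) := fun η x => by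
  funext k
  ext v
  rw [der_apply]
  change (X.adForm q k (η k)).1 x v = ∑ j, (η k).1 x (Function.update v j (X.endo q.1 x (v j)))
  let T : (Fin k → E) → Form E M k →ₗ[ℂ] ℂ := fun v =>
    { toFun := fun η => η.1 x v, map_add' := fun _ _ => rfl, map_smul' := fun _ _ => rfl }
  have hT : ∀ v (ζ : Form E M k), ζ.1 x v = T v ζ := fun _ _ => rfl
  have h1 : HasDerivAt (fun t : ℝ => (η k).1 x fun i => v i + t • X.endo q.1 x (v i))
      (∑ j, (η k).1 x (Function.update v j (X.endo q.1 x (v j)))) 0 := by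
    have e1 : HasDerivAt (fun t : ℝ => fun i => v i + t • X.endo q.1 x (v i))
        (fun i => X.endo q.1 x (v i)) 0 := by
      rw [hasDerivAt_pi]
      intro i
      have := ((hasDerivAt_id (0 : ℝ)).smul_const (X.endo q.1 x (v i))).const_add (v i)
      simpa using this
    have e2 := ((η k).1 x).toContinuousMultilinearMap.hasFDerivAt
      (fun i => v i + (0 : ℝ) • X.endo q.1 x (v i))
    have e3 := e2.comp_hasDerivAt (0 : ℝ) e1
    have hv : ∑ j, (η k).1 x (Function.update v j (X.endo q.1 x (v j))) =
        ((η k).1 x).toContinuousMultilinearMap.linearDeriv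
          (fun i => v i + (0 : ℝ) • X.endo q.1 x (v i)) fun i => X.endo q.1 x (v i) := by
      simp only [zero_smul, add_zero, ContinuousMultilinearMap.linearDeriv_apply]
      rfl
    rw [hv]
    exact e3
  have h2 : HasDerivAt (fun t : ℝ => (η k).1 x fun i => v i + t • X.endo q.1 x (v i))
      ((X.adForm q k (η k)).1 x v) 0 := by
    have e1 : (fun t : ℝ => (η k).1 x fun i => v i + t • X.endo q.1 x (v i)) = fun t : ℝ =>
        ∑ p ∈ Finset.range (k + 1), ((1 + t * Complex.I) ^ p * (1 - t * Complex.I) ^ (k - p)) *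
          T v (X.typeProj q k p (η k)) := by
      funext t
      rw [hT]
      conv_lhs => rw [← X.sum_typeProj q k (η k)]
      rw [_root_.map_sum]
      refine Finset.sum_congr rfl fun p hp => ?_
      have hp' : p ≤ k := by have := Finset.mem_range.1 hp; omega
      have e4 := congrArg (T v) (X.isType_typeProj q hp' (η k) (1 + t * Complex.I))
      rw [_root_.map_smul] at e4
      have e5 : starRingEnd ℂ (1 + t * Complex.I) = 1 - t * Complex.I := by
        simp [sub_eq_add_neg]
      rw [e5] at e4
      refine Eq.trans ?_ e4
      change (X.typeProj q k p (η k)).1 x _ = (X.typeProj q k p (η k)).1 x fun i =>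
        X.endo (complexEndo q (1 + t * Complex.I)) x (v i)
      simp [endo_complexEndo]
    rw [e1, hT, adForm, LinearMap.sum_apply, _root_.map_sum]
    refine HasDerivAt.fun_sum fun p hp => ?_
    have hp' : p ≤ k := by have := Finset.mem_range.1 hp; omega
    rw [LinearMap.smul_apply, _root_.map_smul, smul_eq_mul]
    exact (hasDerivAt_type k p hp').mul_const _
  exact h2.unique h1

end HypercomplexStructure
end TypeProj

/-! ### The de Rham differential: square, conjugation, and closed 2-forms. -/

section Differential
variable {E : Type*} [NormedAddCommGroup E] [NormedSpace ℝ E] [FiniteDimensional ℝ E]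
  {M : Type*} [TopologicalSpace M] [ChartedSpace E M] [IsManifold 𝓘(ℝ, E) ∞ M]

theorem inChart_self {k : ℕ} (η : M → Alt E k) (x : M) : inChart x η x = η x := by
  have : tangentCoordChange 𝓘(ℝ, E) x x x = ContinuousLinearMap.id ℝ E := by
    ext v; exact tangentCoordChange_self (mem_extChartAt_source x)
  rw [inChart, this]
  rfl

theorem chartRep_self {k : ℕ} (η : M → Alt E k) (x : M) :
    chartRep η x (extChartAt 𝓘(ℝ, E) x x) = η x := by
  rw [chartRep, extChartAt_to_inv, inChart_self]

theorem dForm_dForm (k : ℕ) (η : Form E M k) : dForm E M (k + 1) (dForm E M k η) = 0 := by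
  refine Subtype.ext (funext fun x => ?_)
  change extDeriv (chartRep (extDerivAt η.1) x) (extChartAt 𝓘(ℝ, E) x x) = 0
  have h : chartRep (extDerivAt η.1) x =ᶠ[𝓝 (extChartAt 𝓘(ℝ, E) x x)]
      extDeriv (chartRep η.1 x) := by
    filter_upwards [extChartAt_target_mem_nhds (I := 𝓘(ℝ, E)) x] with y hy
    rw [chartRep, extDerivAt_comp η.2 ((extChartAt 𝓘(ℝ, E) x).map_target hy),
      (extChartAt 𝓘(ℝ, E) x).right_inv hy]
  rw [h.extDeriv_eq]
  exact extDeriv_extDeriv_apply (contDiffAt_chartRep (η.2 x)) (by simp; exact ENat.LEInfty.out)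

theorem dOp_mul_dOp : dOp E M * dOp E M = 0 := by
  refine LinearMap.ext fun η => funext fun k => ?_
  match k with
  | 0 => rfl
  | 1 => exact (dForm E M 0).map_zero
  | k + 2 => exact dForm_dForm k (η k)

theorem gradeOp_mul_dOp (c : ℕ → ℂ) : gradeOp c * dOp E M = dOp E M * gradeOp fun k => c (k + 1) := by
  refine LinearMap.ext fun η => funext fun k => ?_
  cases k with
  | zero => exact smul_zero (c 0)
  | succ k => exact ((dForm E M k).map_smul (c (k + 1)) (η k)).symm

theorem dForm_conjForm (k : ℕ) (η : Form E M k) :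
    dForm E M k (conjForm k η) = conjForm (k + 1) (dForm E M k η) := by
  refine Subtype.ext (funext fun x => ?_)
  let T := ContinuousLinearMap.compContinuousAlternatingMapCLM ℝ E ℂ ℂ (Fin k)
    (Complex.conjCLE : ℂ →L[ℝ] ℂ)
  have h : DifferentiableAt ℝ (chartRep η.1 x) (extChartAt 𝓘(ℝ, E) x x) :=
    (contDiffAt_chartRep (η.2 x)).differentiableAt (by simp)
  have h2 : fderiv ℝ (chartRep (conjForm k η).1 x) (extChartAt 𝓘(ℝ, E) x x) =
      T ∘L fderiv ℝ (chartRep η.1 x) (extChartAt 𝓘(ℝ, E) x x) :=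
    (T.hasFDerivAt.comp _ h.hasFDerivAt).fderiv
  change alternatizeUncurryFin (fderiv ℝ (chartRep (conjForm k η).1 x) _) =
    (Complex.conjCLE : ℂ →L[ℝ] ℂ).compContinuousAlternatingMap
      (alternatizeUncurryFin (fderiv ℝ (chartRep η.1 x) _))
  rw [h2]
  ext v
  refine Eq.trans ?_ (congrArg Complex.conjCLE (alternatizeUncurryFin_apply _ v)).symm
  rw [alternatizeUncurryFin_apply, _root_.map_sum]
  refine Finset.sum_congr rfl fun i _ => ?_
  rw [map_zsmul]
  rfl

theorem conjForm_conjForm (k : ℕ) (η : Form E M k) : conjForm k (conjForm k η) = η := by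
  refine Subtype.ext (funext fun x => ?_)
  ext v
  exact Complex.conj_conj _

theorem conjOp_dOp : conjOp (dOp E M) = dOp E M := by
  refine LinearMap.ext fun η => funext fun k => ?_
  cases k with
  | zero => exact (conjForm 0).map_zero
  | succ k =>
    change conjForm (k + 1) (dForm E M k (conjForm k (η k))) = dForm E M k (η k)
    rw [dForm_conjForm, conjForm_conjForm]

theorem wOp_two_mul_eps (α : Alt E 2) (ξ : E →L[ℝ] ℝ) : wOp 2 α * eps ξ = eps ξ * wOp 2 α := by
  have h0 : ∀ β : Alt E 0, wOp 0 β * eps ξ = eps ξ * wOp 0 β := fun β => by simp [wOp]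
  have h1 : ∀ β : Alt E 1, wOp 1 β * eps ξ = -(eps ξ * wOp 1 β) := fun β => by
    rw [wOp, Finset.sum_mul, Finset.mul_sum, ← Finset.sum_neg_distrib]
    refine Finset.sum_congr rfl fun i _ => ?_
    rw [mul_assoc, h0, ← mul_assoc, eps_mul_eps, neg_mul, mul_assoc]
  rw [wOp, Finset.sum_mul, Finset.mul_sum]
  refine Finset.sum_congr rfl fun i _ => ?_
  rw [mul_assoc, h1, mul_neg, ← mul_assoc, eps_mul_eps, neg_mul, neg_neg, mul_assoc]

/-- The algebraic part of the Leibniz rule for a closed 2-form. The terms in `α'` assemble into the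
wedge with the antisymmetrization of `α'`, which vanishes, and in the others the even operator `α ∧
·` commutes past covectors. -/
theorem alternatizeUncurryFin_wedgeAux {k : ℕ} (α : Alt E 2) (α' : E →L[ℝ] Alt E 2)
    (β : Alt E k) (β' : E →L[ℝ] Alt E k) (f : E →L[ℝ] Alt E (k + 2))
    (hf : ∀ v, f v = wedgeAux 2 k (α' v) β + wedgeAux 2 k α (β' v))
    (hα : alternatizeUncurryFin α' = 0) :
    alternatizeUncurryFin f = wedgeAux 2 (k + 1) α (alternatizeUncurryFin β') := by
  have hs : ∀ (l : ℕ) (γ : Alt E l), (Pi.single l γ : PForm E) l = γ := fun l γ => Pi.single_eq_same _ _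
  have h1 : ∀ v, f v = (wOp 2 (α' v) (Pi.single k β)) (k + 2) +
      (wOp 2 α (Pi.single k (β' v))) (k + 2) := by
    intro v
    rw [hf, wOp_apply, wOp_apply, hs, hs]
  -- `wOp 3` of the antisymmetrization of `α'` is three times this sum.
  have h2 : ∑ i, eps (cob E i) * wOp 2 (α' (bas E i)) = 0 := by
    have e := congrArg (wOp 3) (alternatizeUncurryFin_eq_sum α')
    rw [wOp_sum, hα] at e
    have e0 : wOp 3 (0 : Alt E 3) = 0 := by simpa using wOp_smul 3 0 (0 : Alt E 3)
    rw [e0] at e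
    simp only [wOp_alternatizeUncurryFin, ← Finset.smul_sum] at e
    exact (smul_eq_zero.1 e.symm).resolve_left (by norm_num)
  have h3 : alternatizeUncurryFin f =
      ((∑ i, eps (cob E i) * wOp 2 (α' (bas E i))) (Pi.single k β) +
        ∑ i, (eps (cob E i) * wOp 2 α) (Pi.single k (β' (bas E i)))) (k + 2 + 1) := by
    rw [alternatizeUncurryFin_eq_sum, Pi.add_apply, LinearMap.sum_apply, Finset.sum_apply,
      Finset.sum_apply, ← Finset.sum_add_distrib]
    refine Finset.sum_congr rfl fun i _ => ?_
    rw [Module.End.mul_apply, Module.End.mul_apply, eps_succ, eps_succ, h1,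
      ← alternatizeUncurryFin_add]
    congr 1
    ext v
    simp [smul_add]
  rw [h3, h2, LinearMap.zero_apply, zero_add]
  have h4 : ∀ i, (eps (cob E i) * wOp 2 α) (Pi.single k (β' (bas E i))) =
      wOp 2 α (eps (cob E i) (Pi.single k (β' (bas E i)))) := by
    intro i
    rw [← wOp_two_mul_eps]
    rfl
  rw [Finset.sum_congr rfl fun i _ => h4 i, ← _root_.map_sum]
  have h5 := wOp_apply 2 (k + 1) α (∑ i, eps (cob E i) (Pi.single k (β' (bas E i))))
  refine Eq.trans h5 ?_
  congr 1
  rw [alternatizeUncurryFin_eq_sum, Finset.sum_apply]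
  refine Finset.sum_congr rfl fun i _ => ?_
  rw [eps_succ, hs]

theorem dForm_wedge {w : Form E M 2} (hw : dForm E M 2 w = 0) (k : ℕ) (η : Form E M k) :
    dForm E M (k + 2) (wedge w k η) = wedge w (k + 1) (dForm E M k η) := by
  refine Subtype.ext (funext fun x => ?_)
  set y := extChartAt 𝓘(ℝ, E) x x with hy
  have hα : DifferentiableAt ℝ (chartRep w.1 x) y :=
    (contDiffAt_chartRep (w.2 x)).differentiableAt (by simp)
  have hβ : DifferentiableAt ℝ (chartRep η.1 x) y :=
    (contDiffAt_chartRep (η.2 x)).differentiableAt (by simp)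
  have hrep : chartRep (wedge w k η).1 x = fun z =>
      ((2 : ℝ)⁻¹) • wedgeAux 2 k (chartRep w.1 x z) (chartRep η.1 x z) := by
    funext z
    rw [chartRep, chartRep, chartRep, inChart, inChart, inChart, ← wedgeAux_comp]
    ext v
    simp [wedge, Nat.factorial]
  have hd := (((wedgeAux (E := E) 2 k).hasFDerivAt.comp y hα.hasFDerivAt).clm_apply
    hβ.hasFDerivAt).const_smul ((2 : ℝ)⁻¹)
  have hd' : fderiv ℝ (chartRep (wedge w k η).1 x) y = (2 : ℝ)⁻¹ •
      (wedgeAux 2 k (chartRep w.1 x y) ∘L fderiv ℝ (chartRep η.1 x) y +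
        (wedgeAux 2 k ∘L fderiv ℝ (chartRep w.1 x) y).flip (chartRep η.1 x y)) := by
    rw [hrep]
    exact hd.fderiv
  change alternatizeUncurryFin (fderiv ℝ (chartRep (wedge w k η).1 x) y) =
    ((Nat.factorial 2 : ℂ)⁻¹) • wedgeAux 2 (k + 1) (w.1 x)
      (alternatizeUncurryFin (fderiv ℝ (chartRep η.1 x) y))
  rw [hd', alternatizeUncurryFin_smul]
  have hcl : alternatizeUncurryFin (fderiv ℝ (chartRep w.1 x) y) = 0 :=
    congrArg (fun ζ : Form E M 3 => ζ.1 x) hw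
  rw [alternatizeUncurryFin_wedgeAux (w.1 x) (fderiv ℝ (chartRep w.1 x) y) (chartRep η.1 x y)
    (fderiv ℝ (chartRep η.1 x) y) _ (fun v => ?_) hcl]
  · ext v
    simp [Nat.factorial]
  · rw [← chartRep_self w.1 x]
    exact add_comm _ _

theorem wedgeOp_mul_dOp {w : Form E M 2} (hw : dForm E M 2 w = 0) :
    wedgeOp w * dOp E M = dOp E M * wedgeOp w := by
  refine LinearMap.ext fun η => funext fun k => ?_
  match k with
  | 0 => rfl
  | 1 => exact (dForm E M 0).map_zero.symm
  | 2 => 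
    refine ((wedge w 0).map_zero).trans ?_
    exact (dForm E M 1).map_zero.symm
  | k + 3 => exact (dForm_wedge hw k (η k)).symm

end Differential

end

end HK

namespace HK

noncomputable section

set_option linter.unusedSectionVars false

/-! ### Elements of given weight under a commutator, and separation of weights. -/

section Weights
variable {A : Type*} [Ring A] [Algebra ℂ A]

/-- The element `x` has weight `c` with respect to the commutator with `D`. -/
def IsWt (D : A) (c : ℂ) (x : A) : Prop := D * x - x * D = c • x

namespace IsWt
variable {D x y z : A} {a b c : ℂ}

theorem mul (hx : IsWt D a x) (hy : IsWt D b y) : IsWt D (a + b) (x * y) := by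
  have h : D * (x * y) - x * y * D = (D * x - x * D) * y + x * (D * y - y * D) := by noncomm_ring
  rw [IsWt, h, hx, hy, smul_mul_assoc, mul_smul_comm, add_smul]

theorem add (hx : IsWt D a x) (hy : IsWt D a y) : IsWt D a (x + y) := by
  have h : D * (x + y) - (x + y) * D = (D * x - x * D) + (D * y - y * D) := by noncomm_ring
  rw [IsWt, h, hx, hy, smul_add]

theorem neg (hx : IsWt D a x) : IsWt D a (-x) := by
  rw [IsWt, mul_neg, neg_mul, sub_neg_eq_add, neg_add_eq_sub, ← neg_sub, hx, smul_neg]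

theorem sub (hx : IsWt D a x) (hy : IsWt D a y) : IsWt D a (x - y) := by
  rw [sub_eq_add_neg]; exact hx.add hy.neg

theorem smul (r : ℂ) (hx : IsWt D a x) : IsWt D a (r • x) := by
  rw [IsWt, mul_smul_comm, smul_mul_assoc, ← smul_sub, hx, smul_comm]

theorem commutator (hx : IsWt D a x) (hy : IsWt D b y) : IsWt D (a + b) (x * y - y * x) :=
  (hx.mul hy).sub (add_comm b a ▸ hy.mul hx)

theorem anticommutator (hx : IsWt D a x) (hy : IsWt D b y) : IsWt D (a + b) (x * y + y * x) :=
  (hx.mul hy).add (add_comm b a ▸ hy.mul hx)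

theorem eq_zero_of_add (hx : IsWt D a x) (hy : IsWt D b y) (h : x + y = 0) (hab : a ≠ b) :
    x = 0 ∧ y = 0 := by
  obtain rfl : y = -x := (neg_eq_of_add_eq_zero_right h).symm
  have h1 := hx.neg
  rw [IsWt, hy] at h1
  rw [← sub_eq_zero, ← sub_smul] at h1
  have h2 := (smul_eq_zero.1 h1).resolve_left (sub_ne_zero.2 hab.symm)
  exact ⟨neg_eq_zero.1 h2, h2⟩

theorem eq_zero_of_add_add (hx : IsWt D a x) (hy : IsWt D b y) (hz : IsWt D c z)
    (h : x + y + z = 0) (hab : a ≠ b) (hac : a ≠ c) (hbc : b ≠ c) : x = 0 ∧ y = 0 ∧ z = 0 := by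
  obtain rfl : z = -(x + y) := (neg_eq_of_add_eq_zero_right h).symm
  have h1 : (a - c) • x + (b - c) • y = 0 := by
    have e : D * -(x + y) - -(x + y) * D = -(D * x - x * D) - (D * y - y * D) := by noncomm_ring
    rw [IsWt, e, hx, hy] at hz
    rw [← sub_eq_zero] at hz
    rw [← neg_eq_zero, ← hz]
    module
  obtain ⟨h2, h3⟩ := (hx.smul _).eq_zero_of_add (hy.smul _) h1 hab
  have h4 := (smul_eq_zero.1 h2).resolve_left (sub_ne_zero.2 hac)
  have h5 := (smul_eq_zero.1 h3).resolve_left (sub_ne_zero.2 hbc)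
  exact ⟨h4, h5, by rw [h4, h5, add_zero, neg_zero]⟩

/-- If `x + y` commutes with an element `e` of some weight and `x`, `y` have different weights, then
`x` and `y` commute with `e`. -/
theorem commute_of_add {e : A} (he : IsWt D c e) (hx : IsWt D a x) (hy : IsWt D b y) (hab : a ≠ b)
    (h : e * (x + y) = (x + y) * e) : e * x = x * e ∧ e * y = y * e := by
  have h1 : (e * x - x * e) + (e * y - y * e) = 0 := by
    have : (e * x - x * e) + (e * y - y * e) = e * (x + y) - (x + y) * e := by noncomm_ring
    rw [this, h, sub_self]
  obtain ⟨h2, h3⟩ := (he.commutator hx).eq_zero_of_add (he.commutator hy) h1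
    (fun h => hab (add_left_cancel h))
  exact ⟨sub_eq_zero.1 h2, sub_eq_zero.1 h3⟩

/-- The anticommutator splits into parts of weights `2 a`, `0` and `-2 a`, which are distinct and so
vanish separately. -/
theorem anticommute_of_add {x' y' : A} (ha : a ≠ 0) (hx : IsWt D a x) (hy : IsWt D (-a) y)
    (hx' : IsWt D a x') (hy' : IsWt D (-a) y')
    (h : (x + y) * (x' + y') + (x' + y') * (x + y) = 0) :
    x * x' + x' * x = 0 ∧ (x * y' + y' * x) + (y * x' + x' * y) = 0 ∧ y * y' + y' * y = 0 := by
  have h0 : a + a ≠ 0 := by rw [← two_mul]; exact mul_ne_zero two_ne_zero ha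
  have h1 : IsWt D (a + -a) (y * x' + x' * y) := add_comm (-a) a ▸ hy.anticommutator hx'
  refine eq_zero_of_add_add (hx.anticommutator hx')
    ((hx.anticommutator hy').add h1) (hy.anticommutator hy') ?_ ?_ ?_ ?_
  · rw [← h]; noncomm_ring
  · rwa [add_neg_cancel]
  · intro h1
    refine h0 ?_
    have : (a + a) + (a + a) = 0 := by linear_combination h1
    rw [← two_mul] at this
    exact (mul_eq_zero.1 this).resolve_left two_ne_zero
  · rw [add_neg_cancel, ← neg_add]
    exact fun h1 => h0 (neg_eq_zero.1 h1.symm)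

theorem sq_eq_zero_of_add (ha : a ≠ 0) (hx : IsWt D a x) (hy : IsWt D (-a) y)
    (h : (x + y) * (x + y) = 0) : x * x = 0 ∧ x * y + y * x = 0 ∧ y * y = 0 := by
  have key : ∀ u : A, u + u = 0 → u = 0 := fun u hu => by
    rw [← two_smul ℂ] at hu
    exact (smul_eq_zero.1 hu).resolve_left two_ne_zero
  obtain ⟨h1, h2, h3⟩ := anticommute_of_add ha hx hy hx hy (by rw [h, add_zero])
  refine ⟨key _ h1, key _ ?_, key _ h3⟩
  rw [← h2]; abel

end IsWt
end Weights

/-! ### `sl₂`-triples acting on operators by commutators. -/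

section Adjoint
variable {A : Type*} [Ring A] [Algebra ℂ A]

/-- The commutator with `a`. -/
def adMap (a : A) : Module.End ℂ A := LinearMap.mulLeft ℂ a - LinearMap.mulRight ℂ a

theorem adMap_apply (a x : A) : adMap a x = a * x - x * a := rfl

theorem adMap_commutator (a b : A) :
    adMap a * adMap b - adMap b * adMap a = adMap (a * b - b * a) := by
  ext x
  simp only [LinearMap.sub_apply, Module.End.mul_apply, adMap_apply]
  noncomm_ring

theorem IsSl2.adMap {e f h : A} (t : IsSl2 e f h) : IsSl2 (adMap e) (adMap f) (adMap h) where
  ef := by rw [adMap_commutator, t.ef]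
  he := by
    rw [adMap_commutator, t.he, two_mul, two_mul]
    ext x; simp only [adMap_apply, LinearMap.add_apply]; noncomm_ring
  hf := by
    rw [adMap_commutator, t.hf, two_mul, two_mul]
    ext x; simp only [adMap_apply, LinearMap.add_apply, LinearMap.neg_apply]; noncomm_ring

theorem isNilpotent_adMap {a : A} (ha : IsNilpotent a) : IsNilpotent (adMap a) := by
  refine Commute.isNilpotent_sub (LinearMap.commute_mulLeft_right a a) ?_ ?_
  · obtain ⟨n, hn⟩ := ha
    exact ⟨n, by rw [LinearMap.pow_mulLeft, hn, LinearMap.mulLeft_zero_eq_zero]⟩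
  · obtain ⟨n, hn⟩ := ha
    exact ⟨n, by rw [LinearMap.pow_mulRight, hn, LinearMap.mulRight_zero_eq_zero]⟩

/-- Under commutators `x` is a highest weight vector of weight `0`, so `IsSl2.f_eq_zero` applies. -/
theorem IsSl2.commute_of_weight_zero {e f h x : A} (t : IsSl2 e f h) (hf : IsNilpotent f)
    (he : e * x = x * e) (hx : h * x = x * h) : f * x = x * f :=
  sub_eq_zero.1 (t.adMap.f_eq_zero (v := x) (sub_eq_zero.2 he) (isNilpotent_adMap hf)
    (sub_eq_zero.2 hx))

/-- Under commutators `x` is a highest weight vector of weight `1`, so `IsSl2.f_f_eq_zero` applies.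
-/
theorem IsSl2.double_commutator {e f h x : A} (t : IsSl2 e f h) (hf : IsNilpotent f)
    (he : e * x = x * e) (hx : h * x - x * h = x) :
    f * (f * x - x * f) = (f * x - x * f) * f :=
  sub_eq_zero.1 (t.adMap.f_f_eq_zero (v := x) (sub_eq_zero.2 he) (isNilpotent_adMap hf) hx)

/-- By the Jacobi identity `[e, [f, x]] = [h, x]` when `e` commutes with `x`. -/
theorem IsSl2.commutator_lower {e f h x : A} (t : IsSl2 e f h) (he : e * x = x * e)
    (hx : h * x - x * h = x) : e * (f * x - x * f) - (f * x - x * f) * e = x := by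
  have h1 : e * (f * x - x * f) - (f * x - x * f) * e =
      (e * f - f * e) * x - x * (e * f - f * e) + (f * (e * x) - f * (x * e)) -
        ((e * x) * f - (x * e) * f) := by noncomm_ring
  rw [h1, t.ef, hx, he, sub_self, sub_self, add_zero, sub_zero]

variable {Lb Lc Mb Mc H D : A}

theorem IsPair.sl2 (t : IsPair Lb Lc Mb Mc H D) : IsSl2 Lb Mb H := ⟨t.bb, t.Hb, t.Hb'⟩

theorem IsPair.H_mul_D (t : IsPair Lb Lc Mb Mc H D) : H * D = D * H := by
  have h1 : H * D - D * H = (H * Lb - Lb * H) * Mc + Lb * (H * Mc - Mc * H) -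
      (H * Mc - Mc * H) * Lb - Mc * (H * Lb - Lb * H) := by
    rw [← t.bc]; noncomm_ring
  rw [← sub_eq_zero, h1, t.Hb, t.Hc']
  noncomm_ring

theorem IsPair.isNilpotent (hb : IsNilpotent Mb) (hc : IsNilpotent Mc) (hbc : Commute Mb Mc) (j : ℂ) :
    IsNilpotent ((2⁻¹ : ℂ) • (Mb - j • Mc)) :=
  IsNilpotent.smul (Commute.isNilpotent_sub (hbc.smul_right j) hb (hc.smul j)) _

theorem IsPair.commute_e (j : ℂ) {x : A} (hb : Lb * x = x * Lb) (hc : Lc * x = x * Lc) :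
    ((2⁻¹ : ℂ) • (Lb + j • Lc)) * x = x * ((2⁻¹ : ℂ) • (Lb + j • Lc)) := by
  simp only [smul_mul_assoc, mul_smul_comm, add_mul, mul_add, hb, hc]

/-- An operator of degree one commuting with the Lefschetz operators has components of type `(1, 0)`
and `(0, 1)` only. -/
theorem IsPair.ad_ad_eq_neg (t : IsPair Lb Lc Mb Mc H D) (hb : IsNilpotent Mb) (hc : IsNilpotent Mc)
    (hbc : Commute Mb Mc) {x : A} (hLb : Lb * x = x * Lb) (hLc : Lc * x = x * Lc)
    (hH : H * x - x * H = x) : D * (D * x - x * D) - (D * x - x * D) * D = -x := by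
  have t1 := (t.sl2_of_sq Complex.I_mul_I).adMap
  have t2 := (t.sl2_of_sq (j := -Complex.I) (by rw [neg_mul_neg, Complex.I_mul_I])).adMap
  have hlin : ∀ (j : ℂ) (u : A), adMap ((2⁻¹ : ℂ) • (H - j • D)) u =
      (2⁻¹ : ℂ) • ((H * u - u * H) - j • (D * u - u * D)) := by
    intro j u
    simp only [adMap_apply, smul_mul_assoc, mul_smul_comm, sub_mul, mul_sub]
    module
  have hHD := t.H_mul_D
  -- For both triples `x` is a highest weight vector, and the weight operators add up to `H`, with
  -- `[H, x] = x`. On `x` the first one acts as `(1 - √-1 ad D) / 2`, so that `h² = h` becomes `(ad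
  -- D)² = -1`.
  have h1 := IsSl2.weights_zero_one t1 t2 (v := x) (g := adMap H)
    (sub_eq_zero.2 (IsPair.commute_e _ hLb hLc)) (sub_eq_zero.2 (IsPair.commute_e _ hLb hLc))
    (isNilpotent_adMap (IsPair.isNilpotent hb hc hbc _))
    (isNilpotent_adMap (IsPair.isNilpotent hb hc hbc _))
    (by
      ext u
      rw [LinearMap.add_apply, hlin, hlin, adMap_apply]
      module) hH
    (by
      have : adMap H * adMap ((2⁻¹ : ℂ) • (H - Complex.I • D)) -
          adMap ((2⁻¹ : ℂ) • (H - Complex.I • D)) * adMap H = 0 := by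
        rw [adMap_commutator]
        have e : H * ((2⁻¹ : ℂ) • (H - Complex.I • D)) - ((2⁻¹ : ℂ) • (H - Complex.I • D)) * H = 0 := by
          simp only [smul_mul_assoc, mul_smul_comm, sub_mul, mul_sub, hHD, sub_self]
        rw [e]
        ext u
        simp [adMap_apply]
      exact sub_eq_zero.1 this)
  rw [hlin Complex.I x, hH] at h1
  set y := D * x - x * D with hy
  have hHy : H * y - y * H = y := by
    have e : H * y - y * H = D * (H * x - x * H) - (H * x - x * H) * D + (H * D - D * H) * x -
        x * (H * D - D * H) := by rw [hy]; noncomm_ring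
    rw [e, hH, hHD]; simp [hy]
  rw [hlin] at h1
  have h2 : (H * ((2⁻¹ : ℂ) • (x - Complex.I • y)) - ((2⁻¹ : ℂ) • (x - Complex.I • y)) * H) =
      (2⁻¹ : ℂ) • (x - Complex.I • y) := by
    have e : (H * ((2⁻¹ : ℂ) • (x - Complex.I • y)) - ((2⁻¹ : ℂ) • (x - Complex.I • y)) * H) =
        (2⁻¹ : ℂ) • ((H * x - x * H) - Complex.I • (H * y - y * H)) := by
      simp only [smul_mul_assoc, mul_smul_comm, sub_mul, mul_sub]
      module
    rw [e, hH, hHy]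
  have h3 : (D * ((2⁻¹ : ℂ) • (x - Complex.I • y)) - ((2⁻¹ : ℂ) • (x - Complex.I • y)) * D) =
      (2⁻¹ : ℂ) • (y - Complex.I • (D * y - y * D)) := by
    simp only [smul_mul_assoc, mul_smul_comm, sub_mul, mul_sub, hy]
    module
  rw [h2, h3] at h1
  have hI := Complex.I_mul_I
  generalize D * y - y * D = z at h1 ⊢
  have h4 : z = -x + (4 : ℂ) • ((2⁻¹ : ℂ) • ((2⁻¹ : ℂ) • (x - Complex.I • y) - Complex.I •
      ((2⁻¹ : ℂ) • (y - Complex.I • z))) - (2⁻¹ : ℂ) • (x - Complex.I • y)) * (-1) := by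
    rw [mul_neg_one]
    match_scalars
    · linear_combination hI
    all_goals ring
  rw [h4, h1, sub_self, smul_zero, zero_mul, add_zero]

end Adjoint

/-! ### Conjugation by the Hodge star as a commutator. -/

section StarFormula
variable {A : Type*} [Ring A] [Algebra ℚ A]

/-- Conjugation by an operator of the form of the Hodge star. -/
theorem star_mul_mul_star {S P Q R s e f x : A} (hS : S = weyl e f * Q * s) (hSS : S * S = P)
    (hPP : P * P = 1) (hSP : S * P = P * S) (hQR : Q * R = 1) (hRQ : R * Q = 1)
    (hQe : Q * e = e * Q) (hQf : Q * f = f * Q) (hsx : s * x = x * s * P) (he : IsNilpotent e)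
    (hf : IsNilpotent f) (h1 : e * x = x * e) (h3 : f * (f * x - x * f) = (f * x - x * f) * f)
    (h4 : e * (f * x - x * f) - (f * x - x * f) * e = x) :
    S * x * S = -(Q * (f * x - x * f) * R) := by
  have hRe : R * e = e * R := by
    calc R * e = R * (e * Q) * R := by rw [mul_assoc, mul_assoc, hQR, mul_one]
      _ = e * R := by rw [← hQe, ← mul_assoc, hRQ, one_mul]
  have hRf : R * f = f * R := by
    calc R * f = R * (f * Q) * R := by rw [mul_assoc, mul_assoc, hQR, mul_one]
      _ = f * R := by rw [← hQf, ← mul_assoc, hRQ, one_mul]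
  have cl : ∀ {g : A} (_ : Q * g = g * Q) (u : A), g * (Q * u * R) = Q * (g * u) * R := by
    intro g hg u
    rw [← mul_assoc, ← mul_assoc, ← hg, mul_assoc Q g u]
  have cr : ∀ {g : A} (_ : R * g = g * R) (u : A), (Q * u * R) * g = Q * (u * g) * R := by
    intro g hg u
    rw [mul_assoc, hg, ← mul_assoc, mul_assoc Q u g]
  set y := f * x - x * f with hy
  have hy' : f * (Q * x * R) - (Q * x * R) * f = Q * y * R := by
    rw [cl hQf, cr hRf, hy]; noncomm_ring
  -- `Q` commutes with the triple, so `Q x R` is again a highest weight vector of weight `1`, with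
  -- lowered vector `Q y R`. In the computation below, the two stars combine to `S * S = P` once the
  -- Weyl element has passed it.
  have hw := weyl_mul_highest (x := Q * x * R) (y := Q * y * R) he hf
    (by rw [cl hQe, cr hRe, h1]) hy' (by rw [cl hQf, cr hRf, h3])
    (by rw [cl hQe, cr hRe, ← sub_mul, ← mul_sub, h4])
  calc S * x * S = weyl e f * Q * (s * x) * S := by rw [hS]; simp only [mul_assoc]
    _ = weyl e f * (Q * x * R) * (Q * s * P * S) := by
        rw [hsx]
        simp only [mul_assoc]
        rw [← mul_assoc R Q, hRQ, one_mul]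
    _ = -(Q * y * R) * (weyl e f * Q * s) * (P * S) := by rw [hw]; simp only [mul_assoc]
    _ = -(Q * y * R) * (P * (S * S)) := by rw [← hS, mul_assoc, ← mul_assoc S, hSP, mul_assoc P]
    _ = _ := by rw [hSS, hPP, mul_one]

end StarFormula

/-! ### Consequences of the hyperkähler relations in an abstract algebra. -/

section System
variable {A : Type*} [Ring A] [Algebra ℂ A]

theorem commute_inv {Q R g : A} (hQR : Q * R = 1) (hRQ : R * Q = 1) (h : Q * g = g * Q) :
    R * g = g * R := by
  calc R * g = R * (g * Q) * R := by rw [mul_assoc, mul_assoc, hQR, mul_one]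
    _ = g * R := by rw [← h, ← mul_assoc, hRQ, one_mul]

theorem anticommute_inv {Q R g : A} (hQR : Q * R = 1) (hRQ : R * Q = 1) (h : Q * g = -(g * Q)) :
    R * g = -(g * R) := by
  calc R * g = -(R * -(g * Q) * R) := by
        rw [mul_neg, neg_mul, neg_neg, mul_assoc, mul_assoc, hQR, mul_one]
    _ = -(g * R) := by rw [← h, ← mul_assoc, hRQ, one_mul]

/-- The relations between the operators of a hyperkähler manifold: the Lefschetz operators
`LJ`, `LK`, their adjoints `MJ`, `MK`, the degree operator `H`, `D = ad I`, the parity operator `P`,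
the action `Q` of `J` and its inverse `R`, the Dolbeault differentials `a`, `b` of `I`, and the
Dolbeault differentials `p`, `q` of `J`. -/
structure IsHKSystem (LJ LK MJ MK H D P Q R a b p q : A) : Prop where
  pair : IsPair LJ LK MJ MK H D
  nilJ : IsNilpotent MJ
  nilK : IsNilpotent MK
  commJK : Commute MJ MK
  LJ_d : LJ * (a + b) = (a + b) * LJ
  LK_d : LK * (a + b) = (a + b) * LK
  d_d : (a + b) * (a + b) = 0
  D_a : IsWt D Complex.I a
  D_b : IsWt D (-Complex.I) b
  H_a : H * a - a * H = a
  H_b : H * b - b * H = b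
  P_a : P * a = -(a * P)
  P_b : P * b = -(b * P)
  P_P : P * P = 1
  Q_Q : Q * Q = P
  Q_R : Q * R = 1
  R_Q : R * Q = 1
  Q_LJ : Q * LJ = LJ * Q
  Q_LK : Q * LK = -(LK * Q)
  Q_MJ : Q * MJ = MJ * Q
  Q_MK : Q * MK = -(MK * Q)
  Q_H : Q * H = H * Q
  Q_D : Q * D = -(D * Q)
  p_q : a + b = p + q
  p_p : p * p = 0
  q_q : q * q = 0
  Q_p : Q * p = Complex.I • (p * Q)
  Q_q : Q * q = -(Complex.I • (q * Q))

namespace IsHKSystem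
variable {LJ LK MJ MK H D P Q R a b p q : A} (t : IsHKSystem LJ LK MJ MK H D P Q R a b p q)
include t

theorem sl2 : IsSl2 ((2⁻¹ : ℂ) • (LJ + Complex.I • LK)) ((2⁻¹ : ℂ) • (MJ - Complex.I • MK))
    ((2⁻¹ : ℂ) • (H - Complex.I • D)) := t.pair.sl2_of_sq Complex.I_mul_I

theorem sl2bar : IsSl2 ((2⁻¹ : ℂ) • (LJ - Complex.I • LK)) ((2⁻¹ : ℂ) • (MJ + Complex.I • MK))
    ((2⁻¹ : ℂ) • (H + Complex.I • D)) := by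
  have := t.pair.sl2_of_sq (j := -Complex.I) (by rw [neg_mul_neg, Complex.I_mul_I])
  simpa only [neg_smul, sub_neg_eq_add, ← sub_eq_add_neg] using this

theorem nil_f : IsNilpotent ((2⁻¹ : ℂ) • (MJ - Complex.I • MK)) :=
  IsPair.isNilpotent t.nilJ t.nilK t.commJK _

theorem nil_fbar : IsNilpotent ((2⁻¹ : ℂ) • (MJ + Complex.I • MK)) := by
  have := IsPair.isNilpotent t.nilJ t.nilK t.commJK (-Complex.I)
  simpa only [neg_smul, sub_neg_eq_add] using this

theorem D_e : IsWt D (2 * Complex.I) ((2⁻¹ : ℂ) • (LJ + Complex.I • LK)) := by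
  have e : D * ((2⁻¹ : ℂ) • (LJ + Complex.I • LK)) - ((2⁻¹ : ℂ) • (LJ + Complex.I • LK)) * D =
      (2⁻¹ : ℂ) • ((D * LJ - LJ * D) + Complex.I • (D * LK - LK * D)) := by
    simp only [mul_add, add_mul, mul_smul_comm, smul_mul_assoc]
    module
  have hI := Complex.I_mul_I
  rw [IsWt, e, t.pair.Db, t.pair.Dc, two_mul, two_mul]
  match_scalars
  · linear_combination -hI
  · ring

theorem D_ebar : IsWt D (-(2 * Complex.I)) ((2⁻¹ : ℂ) • (LJ - Complex.I • LK)) := by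
  have e : D * ((2⁻¹ : ℂ) • (LJ - Complex.I • LK)) - ((2⁻¹ : ℂ) • (LJ - Complex.I • LK)) * D =
      (2⁻¹ : ℂ) • ((D * LJ - LJ * D) - Complex.I • (D * LK - LK * D)) := by
    simp only [mul_sub, sub_mul, mul_smul_comm, smul_mul_assoc]
    module
  have hI := Complex.I_mul_I
  rw [IsWt, e, t.pair.Db, t.pair.Dc, two_mul, two_mul]
  match_scalars
  · linear_combination -hI
  · ring

/-- The raising operator has weight `2 √-1` for `D`, while `a` and `b` have the different weights
`±√-1`; hence its commutator with `a + b` vanishes only if both parts do. -/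
theorem commute_e : ((2⁻¹ : ℂ) • (LJ + Complex.I • LK)) * a = a * ((2⁻¹ : ℂ) • (LJ + Complex.I • LK)) ∧
    ((2⁻¹ : ℂ) • (LJ + Complex.I • LK)) * b = b * ((2⁻¹ : ℂ) • (LJ + Complex.I • LK)) :=
  t.D_e.commute_of_add t.D_a t.D_b (by simp [Complex.ext_iff]; norm_num)
    (IsPair.commute_e _ t.LJ_d t.LK_d)

theorem commute_ebar :
    ((2⁻¹ : ℂ) • (LJ - Complex.I • LK)) * a = a * ((2⁻¹ : ℂ) • (LJ - Complex.I • LK)) ∧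
    ((2⁻¹ : ℂ) • (LJ - Complex.I • LK)) * b = b * ((2⁻¹ : ℂ) • (LJ - Complex.I • LK)) := by
  refine t.D_ebar.commute_of_add t.D_a t.D_b (by simp [Complex.ext_iff]; norm_num) ?_
  have := IsPair.commute_e (-Complex.I) t.LJ_d t.LK_d
  simpa only [neg_smul, ← sub_eq_add_neg] using this

theorem LJ_eq : LJ = (2⁻¹ : ℂ) • (LJ + Complex.I • LK) + (2⁻¹ : ℂ) • (LJ - Complex.I • LK) := by
  module

theorem MJ_eq : MJ = (2⁻¹ : ℂ) • (MJ - Complex.I • MK) + (2⁻¹ : ℂ) • (MJ + Complex.I • MK) := by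
  module

theorem LJ_a : LJ * a = a * LJ := by
  rw [t.LJ_eq, add_mul, mul_add, t.commute_e.1, t.commute_ebar.1]

theorem LJ_b : LJ * b = b * LJ := by
  rw [t.LJ_eq, add_mul, mul_add, t.commute_e.2, t.commute_ebar.2]

omit t in
theorem weight_h {x : A} (j c : ℂ) (hD : IsWt D c x) (hH : H * x - x * H = x) :
    ((2⁻¹ : ℂ) • (H - j • D)) * x - x * ((2⁻¹ : ℂ) • (H - j • D)) = (2⁻¹ * (1 - j * c)) • x := by
  have e : ((2⁻¹ : ℂ) • (H - j • D)) * x - x * ((2⁻¹ : ℂ) • (H - j • D)) =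
      (2⁻¹ : ℂ) • ((H * x - x * H) - j • (D * x - x * D)) := by
    simp only [mul_sub, sub_mul, mul_smul_comm, smul_mul_assoc]
    module
  rw [e, hH, hD]
  module

omit t in
theorem weight_h_I {x : A} (hD : IsWt D Complex.I x) (hH : H * x - x * H = x) :
    ((2⁻¹ : ℂ) • (H - Complex.I • D)) * x - x * ((2⁻¹ : ℂ) • (H - Complex.I • D)) = x := by
  rw [weight_h _ _ hD hH, Complex.I_mul_I]; norm_num

omit t in
theorem weight_hbar_I {x : A} (hD : IsWt D Complex.I x) (hH : H * x - x * H = x) :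
    ((2⁻¹ : ℂ) • (H + Complex.I • D)) * x = x * ((2⁻¹ : ℂ) • (H + Complex.I • D)) := by
  have := weight_h (-Complex.I) _ hD hH
  rw [neg_mul, Complex.I_mul_I] at this
  rw [← sub_eq_zero]
  simpa only [neg_smul, sub_neg_eq_add, neg_neg, sub_self, mul_zero, zero_smul] using this

omit t in
theorem weight_h_neg_I {x : A} (hD : IsWt D (-Complex.I) x) (hH : H * x - x * H = x) :
    ((2⁻¹ : ℂ) • (H - Complex.I • D)) * x = x * ((2⁻¹ : ℂ) • (H - Complex.I • D)) := by
  have := weight_h Complex.I _ hD hH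
  rw [mul_neg, Complex.I_mul_I] at this
  rw [← sub_eq_zero]
  simpa only [neg_neg, sub_self, mul_zero, zero_smul] using this

/-- `b` is of type `(0, 1)`, so it has weight `0` for the triple of `Ω`; commuting with the raising
operator, it commutes with the lowering one. -/
theorem f_b : ((2⁻¹ : ℂ) • (MJ - Complex.I • MK)) * b = b * ((2⁻¹ : ℂ) • (MJ - Complex.I • MK)) :=
  t.sl2.commute_of_weight_zero t.nil_f t.commute_e.2 (weight_h_neg_I t.D_b t.H_b)

theorem fbar_a : ((2⁻¹ : ℂ) • (MJ + Complex.I • MK)) * a = a * ((2⁻¹ : ℂ) • (MJ + Complex.I • MK)) :=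
  t.sl2bar.commute_of_weight_zero t.nil_fbar t.commute_ebar.1 (weight_hbar_I t.D_a t.H_a)

theorem a_a : a * a = 0 := (IsWt.sq_eq_zero_of_add Complex.I_ne_zero t.D_a t.D_b t.d_d).1

theorem a_b : a * b + b * a = 0 := (IsWt.sq_eq_zero_of_add Complex.I_ne_zero t.D_a t.D_b t.d_d).2.1

theorem b_b : b * b = 0 := (IsWt.sq_eq_zero_of_add Complex.I_ne_zero t.D_a t.D_b t.d_d).2.2

/-! Relations for `∂_J = R b Q` and its conjugate `R a Q`. -/

theorem conj_mul_conj (u v : A) : (R * u * Q) * (R * v * Q) = R * (u * v) * Q := by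
  simp only [mul_assoc]
  rw [← mul_assoc Q R, t.Q_R, one_mul]

theorem mul_conj {g : A} (hg : Q * g = g * Q) (u : A) : g * (R * u * Q) = R * (g * u) * Q := by
  rw [← mul_assoc, ← mul_assoc, ← commute_inv t.Q_R t.R_Q hg, mul_assoc R g]

theorem conj_mul {g : A} (hg : Q * g = g * Q) (u : A) : (R * u * Q) * g = R * (u * g) * Q := by
  rw [mul_assoc, hg, ← mul_assoc, mul_assoc R u]

theorem mul_conj_anti {g : A} (hg : Q * g = -(g * Q)) (u : A) :
    g * (R * u * Q) = -(R * (g * u) * Q) := by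
  have h := anticommute_inv t.Q_R t.R_Q hg
  have h' : g * R = -(R * g) := by rw [h, neg_neg]
  rw [← mul_assoc, ← mul_assoc, h', neg_mul, neg_mul, mul_assoc R g]

omit t in
theorem conj_mul_anti {g : A} (hg : Q * g = -(g * Q)) (u : A) :
    (R * u * Q) * g = -(R * (u * g) * Q) := by
  rw [mul_assoc, hg, mul_neg, ← mul_assoc, mul_assoc R u]

theorem conj_wt {u : A} {c : ℂ} (hu : IsWt D c u) : IsWt D (-c) (R * u * Q) := by
  rw [IsWt, t.mul_conj_anti t.Q_D, conj_mul_anti t.Q_D]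
  have : -(R * (D * u) * Q) - -(R * (u * D) * Q) = -(R * (D * u - u * D) * Q) := by noncomm_ring
  rw [this, hu, mul_smul_comm, smul_mul_assoc, neg_smul]

theorem D_aJ : IsWt D Complex.I (R * b * Q) := by
  have := t.conj_wt t.D_b
  rwa [neg_neg] at this

theorem D_bJ : IsWt D (-Complex.I) (R * a * Q) := t.conj_wt t.D_a

theorem H_aJ : H * (R * b * Q) - (R * b * Q) * H = R * b * Q := by
  rw [t.mul_conj t.Q_H, t.conj_mul t.Q_H, ← sub_mul, ← mul_sub, t.H_b]

theorem Q_e_smul (j : ℂ) {g g' : A} (h : Q * g = g * Q) (h' : Q * g' = -(g' * Q)) :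
    Q * ((2⁻¹ : ℂ) • (g + j • g')) = ((2⁻¹ : ℂ) • (g - j • g')) * Q := by
  simp only [mul_smul_comm, smul_mul_assoc, mul_add, sub_mul, h, h']
  module

/-- If conjugation by `Q` takes `g'` to `g`, then conjugating back turns operators commuting with
`g` into operators commuting with `g'`. As `Q` exchanges `Ω` with its conjugate, facts about `b`
become facts about `∂_J`. -/
theorem comm_conj {u g g' : A} (h : Q * g' = g * Q) (hg : g * u = u * g) :
    g' * (R * u * Q) = (R * u * Q) * g' := by
  have h1 : g' * R = R * g := by
    calc g' * R = R * (Q * g') * R := by rw [← mul_assoc, t.R_Q, one_mul]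
      _ = R * g := by rw [h, mul_assoc, mul_assoc, t.Q_R, mul_one]
  calc g' * (R * u * Q) = (g' * R) * u * Q := by simp only [mul_assoc]
    _ = R * (g * u) * Q := by rw [h1, mul_assoc R g u]
    _ = R * u * (Q * g') := by rw [hg, h]; simp only [mul_assoc]
    _ = _ := by simp only [mul_assoc]

theorem e_aJ : ((2⁻¹ : ℂ) • (LJ + Complex.I • LK)) * (R * b * Q) =
    (R * b * Q) * ((2⁻¹ : ℂ) • (LJ + Complex.I • LK)) :=
  t.comm_conj (t.Q_e_smul _ t.Q_LJ t.Q_LK) t.commute_ebar.2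

theorem fbar_aJ : ((2⁻¹ : ℂ) • (MJ + Complex.I • MK)) * (R * b * Q) =
    (R * b * Q) * ((2⁻¹ : ℂ) • (MJ + Complex.I • MK)) :=
  t.comm_conj (t.Q_e_smul _ t.Q_MJ t.Q_MK) t.f_b

theorem aJ_aJ : (R * b * Q) * (R * b * Q) = 0 := by
  rw [t.conj_mul_conj, t.b_b, mul_zero, zero_mul]

/-- Conjugating `d = p + q` by the action of `J` gives `√-1 (q - p)`, and `{p + q, q - p} = 2 (q² -
p²) = 0`. The component of weight `2 √-1` of this identity for `D` is the claim. -/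
theorem a_aJ : a * (R * b * Q) + (R * b * Q) * a = 0 := by
  have hp : R * p * Q = -(Complex.I • p) := by
    have : p * Q = -(Complex.I • (Q * p)) := by
      rw [t.Q_p, smul_smul, Complex.I_mul_I, neg_one_smul, neg_neg]
    rw [mul_assoc, this, mul_neg, mul_smul_comm, ← mul_assoc, t.R_Q, one_mul]
  have hq : R * q * Q = Complex.I • q := by
    have : q * Q = Complex.I • (Q * q) := by
      rw [t.Q_q, smul_neg, smul_smul, Complex.I_mul_I, neg_one_smul, neg_neg]
    rw [mul_assoc, this, mul_smul_comm, ← mul_assoc, t.R_Q, one_mul]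
  have hd : R * b * Q + R * a * Q = Complex.I • (q - p) := by
    have : R * b * Q + R * a * Q = R * (a + b) * Q := by noncomm_ring
    rw [this, t.p_q, mul_add, add_mul, hp, hq]
    module
  have h1 : (a + b) * (R * b * Q + R * a * Q) + (R * b * Q + R * a * Q) * (a + b) = 0 := by
    rw [hd, t.p_q, mul_smul_comm, smul_mul_assoc, ← smul_add]
    have : (p + q) * (q - p) + (q - p) * (p + q) = 2 * (q * q) - 2 * (p * p) := by noncomm_ring
    rw [this, t.q_q, t.p_p, mul_zero, sub_zero, smul_zero]
  exact (IsWt.anticommute_of_add Complex.I_ne_zero t.D_a t.D_b t.D_aJ t.D_bJ h1).1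

/-- `R` equals `P Q`, and the parity operator `P` anticommutes with the odd operator `b`. -/
theorem Q_b_R : Q * b * R = -(R * b * Q) := by
  have hR : R = P * Q := by
    have : P * Q * Q = 1 := by rw [mul_assoc, t.Q_Q, t.P_P]
    calc R = (P * Q * Q) * R := by rw [this, one_mul]
      _ = P * Q := by rw [mul_assoc, t.Q_R, mul_one]
  have hPQ : P * Q = Q * P := by rw [← t.Q_Q, mul_assoc]
  rw [hR, ← mul_assoc, hPQ, mul_assoc Q b P]
  have : b * P = -(P * b) := by rw [t.P_b, neg_neg]
  rw [this]
  noncomm_ring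

/-- The formula for `∂^*`, with the star operator expressed by means of `J`. -/
theorem conj_commutator_b : Q * (MJ * b - b * MJ) * R =
    -(((2⁻¹ : ℂ) • (MJ - Complex.I • MK)) * (R * b * Q) -
      (R * b * Q) * ((2⁻¹ : ℂ) • (MJ - Complex.I • MK))) := by
  have hR := commute_inv t.Q_R t.R_Q t.Q_MJ
  have h1 : Q * (MJ * b - b * MJ) * R = MJ * (Q * b * R) - (Q * b * R) * MJ := by
    have e1 : Q * (MJ * b) * R = MJ * (Q * b * R) := by
      rw [← mul_assoc, t.Q_MJ]; simp only [mul_assoc]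
    have e2 : Q * (b * MJ) * R = (Q * b * R) * MJ := by
      simp only [mul_assoc]; rw [hR]
    rw [mul_sub, sub_mul, e1, e2]
  rw [h1, t.Q_b_R]
  set x := R * b * Q with hx
  have h2 : MJ * -x - -x * MJ = -(MJ * x - x * MJ) := by noncomm_ring
  -- `MJ` is the sum of the lowering operators of `Ω` and of its conjugate, and the latter commutes
  -- with `∂_J`.
  rw [h2, t.MJ_eq, add_mul, mul_add, t.fbar_aJ, add_sub_add_right_eq_sub, ← t.MJ_eq]

/-- The formula for `∂_J^*`, with the star operator expressed by means of `J`. -/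
theorem conj_commutator_bJ : Q * (MJ * (R * a * Q) - (R * a * Q) * MJ) * R =
    ((2⁻¹ : ℂ) • (MJ - Complex.I • MK)) * a - a * ((2⁻¹ : ℂ) • (MJ - Complex.I • MK)) := by
  have h1 : MJ * (R * a * Q) - (R * a * Q) * MJ = R * (MJ * a - a * MJ) * Q := by
    rw [t.mul_conj t.Q_MJ, t.conj_mul t.Q_MJ, mul_sub, sub_mul]
  have h2 : ∀ u : A, Q * (R * u * Q) * R = u := fun u => by
    rw [← mul_assoc, ← mul_assoc, t.Q_R, one_mul, mul_assoc, t.Q_R, mul_one]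
  rw [h1, h2]
  conv_lhs => rw [t.MJ_eq, add_mul, mul_add, t.fbar_a, add_sub_add_right_eq_sub]

end IsHKSystem

/-- The Laplacian in terms of the Dolbeault differentials, from the Kähler identities. -/
theorem laplacian_eq_of_kaehler {a b a' b' m : A} (ha' : a' = -(Complex.I • (m * b - b * m)))
    (hb' : b' = Complex.I • (m * a - a * m)) (haa : a * a = 0) (hbb : b * b = 0)
    (hab : a * b + b * a = 0) :
    (a + b) * (a' + b') + (a' + b') * (a + b) = (2 : ℂ) • (a * a' + a' * a) := by
  -- By the Jacobi identity `{a, [m, a]} = [m, a²]`, which vanishes; similarly for `b` in the next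
  -- step.
  have h1 : a * b' + b' * a = 0 := by
    have e : a * (m * a - a * m) + (m * a - a * m) * a = m * (a * a) - (a * a) * m := by noncomm_ring
    rw [hb', mul_smul_comm, smul_mul_assoc, ← smul_add, e, haa, mul_zero, zero_mul, sub_zero, smul_zero]
  have h2 : b * a' + a' * b = 0 := by
    have e : b * (m * b - b * m) + (m * b - b * m) * b = m * (b * b) - (b * b) * m := by noncomm_ring
    rw [ha', mul_neg, neg_mul, ← neg_add, mul_smul_comm, smul_mul_assoc, ← smul_add, e, hbb, mul_zero,
      zero_mul, sub_zero, smul_zero, neg_zero]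
  -- The commutator of `m` with `{a, b} = 0` identifies the Laplacians of `∂` and `\bar∂`.
  have h3 : b * b' + b' * b = a * a' + a' * a := by
    have e : b * (m * a - a * m) + (m * a - a * m) * b =
        m * (a * b + b * a) - (a * b + b * a) * m - (a * (m * b - b * m) + (m * b - b * m) * a) := by
      noncomm_ring
    rw [hb', ha', mul_smul_comm, smul_mul_assoc, ← smul_add, e, hab, mul_zero, zero_mul, sub_zero,
      zero_sub, mul_neg, neg_mul, mul_smul_comm, smul_mul_assoc, ← neg_add, ← smul_add, smul_neg]
  calc _ = (a * a' + a' * a) + (b * b' + b' * b) + (a * b' + b' * a) + (b * a' + a' * b) := by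
        noncomm_ring
    _ = _ := by rw [h1, h2, h3, add_zero, add_zero, two_smul]

end System

end

end HK

namespace HK

noncomputable section

open ContinuousAlternatingMap

set_option linter.unusedSectionVars false
set_option maxSynthPendingDepth 3

/-! ### Two pointwise complements: linearity of the wedge, commuting contractions. -/

section Wedge
variable {E : Type*} [NormedAddCommGroup E] [NormedSpace ℝ E] [FiniteDimensional ℝ E]
  {g : E →L[ℝ] E →L[ℝ] ℝ} {G : (E →L[ℝ] ℝ) →L[ℝ] E} {A B : E →L[ℝ] E}

theorem wedgeAux_smul_left (k l : ℕ) (c : ℂ) (α : Alt E k) (β : Alt E l) :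
    wedgeAux k l (c • α) β = c • wedgeAux k l α β := by
  induction k with
  | zero => simp only [wedgeAux_zero]; exact smul_assoc c (ev0 α) β
  | succ k ih =>
    rw [wedgeAux_succ, wedgeAux_succ, ← alternatizeUncurryFin_smul]
    congr 1
    ext1 v
    exact ih (α.curryLeft v)

theorem pLam_comm :
    pLam G A * pLam G B = pLam G B * pLam G A := by
  rw [pLam.eq_def G B, mul_smul_comm, smul_mul_assoc, Finset.mul_sum, Finset.sum_mul]
  congr 1
  refine Finset.sum_congr rfl fun i _ => ?_
  rw [← mul_assoc, pLam_mul_iota, mul_assoc, pLam_mul_iota, mul_assoc]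

end Wedge

/-! ### The abstract relations for the operators of a hyperkähler manifold. -/

section Operators
variable {E : Type*} [NormedAddCommGroup E] [NormedSpace ℝ E] [FiniteDimensional ℝ E]
  {M : Type*} [TopologicalSpace M] [ChartedSpace E M] [IsManifold 𝓘(ℝ, E) ∞ M]

theorem wedgeOp_add (w w' : Form E M 2) : wedgeOp (w + w') = wedgeOp w + wedgeOp w' := by
  refine LinearMap.ext fun η => funext fun k => ?_
  match k with
  | 0 => exact (add_zero (0 : Form E M 0)).symm
  | 1 => exact (add_zero (0 : Form E M 1)).symm
  | k + 2 =>
    refine Subtype.ext (funext fun x => ?_)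
    change ((Nat.factorial 2 : ℂ)⁻¹) • wedgeAux 2 k (w.1 x + w'.1 x) _ =
      ((Nat.factorial 2 : ℂ)⁻¹) • wedgeAux 2 k (w.1 x) _ +
        ((Nat.factorial 2 : ℂ)⁻¹) • wedgeAux 2 k (w'.1 x) _
    rw [_root_.map_add, _root_.add_apply, smul_add]

theorem wedgeOp_smul (c : ℂ) (w : Form E M 2) : wedgeOp (c • w) = c • wedgeOp w := by
  refine LinearMap.ext fun η => funext fun k => ?_
  match k with
  | 0 => exact (smul_zero c).symm
  | 1 => exact (smul_zero c).symm
  | k + 2 =>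
    refine Subtype.ext (funext fun x => ?_)
    change ((Nat.factorial 2 : ℂ)⁻¹) • wedgeAux 2 k (c • w.1 x) _ =
      c • ((Nat.factorial 2 : ℂ)⁻¹) • wedgeAux 2 k (w.1 x) _
    rw [wedgeAux_smul_left, smul_comm]

theorem gradeOp_add (c c' : ℕ → ℂ) :
    (gradeOp (fun k => c k + c' k) : FormEnd E M) = gradeOp c + gradeOp c' :=
  LinearMap.ext fun η => funext fun k => add_smul (c k) (c' k) (η k)

theorem gradeOp_mul (c c' : ℕ → ℂ) :
    (gradeOp c * gradeOp c' : FormEnd E M) = gradeOp fun k => c k * c' k :=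
  LinearMap.ext fun η => funext fun k => (mul_smul (c k) (c' k) (η k)).symm

theorem gradeOp_one : (gradeOp (fun _ => 1) : FormEnd E M) = 1 :=
  LinearMap.ext fun η => funext fun k => one_smul ℂ (η k)

/-- Operators raising the degree of forms by one. -/
def IsDegOne (T : FormEnd E M) : Prop :=
  ∀ c : ℕ → ℂ, gradeOp c * T = T * gradeOp fun k => c (k + 1)

theorem IsDegOne.degreeOp {T : FormEnd E M} (h : IsDegOne T) :
    HypercomplexHermitian.degreeOp E M * T - T * HypercomplexHermitian.degreeOp E M = T := by
  have e : (gradeOp (fun k => ((k + 1 : ℕ) : ℂ) - (Module.finrank ℝ E : ℂ) / 2) : FormEnd E M) =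
      HypercomplexHermitian.degreeOp E M + 1 := by
    rw [HypercomplexHermitian.degreeOp, ← gradeOp_one, ← gradeOp_add]
    congr 1; funext k; push_cast; ring
  rw [HypercomplexHermitian.degreeOp, h, e, ← HypercomplexHermitian.degreeOp]
  noncomm_ring

theorem IsDegOne.parityOp {T : FormEnd E M} (h : IsDegOne T) :
    parityOp E M * T = -(T * parityOp E M) := by
  have e : (gradeOp (fun k => (-1 : ℂ) ^ (k + 1)) : FormEnd E M) = -HK.parityOp E M := by
    refine LinearMap.ext fun η => funext fun k => ?_
    change (-1 : ℂ) ^ (k + 1) • η k = -((-1 : ℂ) ^ k • η k)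
    rw [pow_succ, mul_neg_one, neg_smul]
  rw [HK.parityOp, h, e, mul_neg, HK.parityOp]

theorem IsDegOne.sign {T : FormEnd E M} (h : IsDegOne T) :
    (gradeOp (fun k => (-1) ^ k.choose 2) : FormEnd E M) * T =
      T * gradeOp (fun k => (-1) ^ k.choose 2) * HK.parityOp E M := by
  rw [h, mul_assoc, HK.parityOp, gradeOp_mul]
  congr 2
  funext k
  rw [Nat.choose_succ_succ' k 1, Nat.choose_one_right, pow_add, mul_comm]

theorem isDegOne_dOp : IsDegOne (dOp E M) := gradeOp_mul_dOp

theorem isDegOne_delOp (X : HypercomplexStructure E M) (q : ImagUnit) : IsDegOne (X.delOp q) :=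
  fun c => LinearMap.ext fun η => funext fun k => by
    cases k with
    | zero => exact smul_zero (c 0)
    | succ k => exact ((X.delForm q k).map_smul (c (k + 1)) (η k)).symm

theorem isDegOne_delBarOp (X : HypercomplexStructure E M) (q : ImagUnit) : IsDegOne (X.delBarOp q) :=
  fun c => LinearMap.ext fun η => funext fun k => by
    cases k with
    | zero => exact smul_zero (c 0)
    | succ k => exact ((X.delBarForm q k).map_smul (c (k + 1)) (η k)).symm

theorem IsDegOne.conj {T U V : FormEnd E M} (h : IsDegOne T)
    (hU : ∀ c, gradeOp c * U = U * gradeOp c) (hV : ∀ c, gradeOp c * V = V * gradeOp c) :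
    IsDegOne (U * T * V) := fun c => by
  rw [← mul_assoc, ← mul_assoc, hU, mul_assoc U, h, mul_assoc, mul_assoc, mul_assoc, hV, mul_assoc]

theorem conjOp_mul (S T : FormEnd E M) : conjOp (S * T) = conjOp S * conjOp T := by
  refine LinearMap.ext fun η => ?_
  change conjAll E M (S (T (conjAll E M η))) =
    conjAll E M (S (conjAll E M (conjAll E M (T (conjAll E M η)))))
  congr 2
  funext k
  exact (conjForm_conjForm k _).symm

theorem conjOp_add (S T : FormEnd E M) : conjOp (S + T) = conjOp S + conjOp T :=
  LinearMap.ext fun _ => _root_.map_add (conjAll E M) _ _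

theorem conjOp_sub (S T : FormEnd E M) : conjOp (S - T) = conjOp S - conjOp T :=
  LinearMap.ext fun _ => _root_.map_sub (conjAll E M) _ _

theorem conjOp_smul (c : ℂ) (S : FormEnd E M) : conjOp (c • S) = starRingEnd ℂ c • conjOp S :=
  LinearMap.ext fun _ => (conjAll E M).map_smulₛₗ c _

namespace HypercomplexHermitian
variable (X : HypercomplexHermitian E M)

theorem conjOp_quatOp (q : ℍ[ℝ]) : conjOp (X.quatOp q) = X.quatOp q :=
  (X.isFib_quatOp q).conjOp fun _ => isRealEnd_pull _

theorem conjOp_adOp (q : ImagUnit) : conjOp (X.adOp q) = X.adOp q :=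
  (X.isFib_adOp q).conjOp fun _ => isRealEnd_der _

theorem quatOp_mul_quatOp (q r : ℍ[ℝ]) : X.quatOp q * X.quatOp r = X.quatOp (r * q) :=
  ((X.isFib_quatOp q).mul (X.isFib_quatOp r)).eq (X.isFib_quatOp _) fun x => by
    rw [pull_mul_pull, X.endo_comp]

theorem quatOp_one : X.quatOp 1 = 1 :=
  (X.isFib_quatOp 1).eq IsFib.one fun x => by rw [X.endo_one, pull_one]

theorem quatOp_mul_self (q : ImagUnit) : X.quatOp q.1 * X.quatOp q.1 = parityOp E M := by
  rw [X.quatOp_mul_quatOp, q.2]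
  exact (X.isFib_quatOp _).eq (isFib_gradeOp _) fun x => by
    rw [X.endo_neg, X.endo_one, pull_neg_one]

theorem quatOp_mul_quatOp_neg (q : ImagUnit) : X.quatOp q.1 * X.quatOp (-q.1) = 1 := by
  rw [X.quatOp_mul_quatOp, neg_mul, q.2, neg_neg, X.quatOp_one]

theorem quatOp_neg_mul_quatOp (q : ImagUnit) : X.quatOp (-q.1) * X.quatOp q.1 = 1 := by
  rw [X.quatOp_mul_quatOp, mul_neg, q.2, neg_neg, X.quatOp_one]

theorem gradeOp_mul_quatOp (q : ℍ[ℝ]) (c : ℕ → ℂ) :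
    gradeOp c * X.quatOp q = X.quatOp q * gradeOp c := by
  refine LinearMap.ext fun η => funext fun k => ?_
  exact ((pullForm (X.endo q) (X.isSmoothEnd q) k).map_smul (c k) (η k)).symm

theorem quatOp_mul_lefschetz (q : ImagUnit) :
    X.quatOp q.1 * X.lefschetz q = X.lefschetz q * X.quatOp q.1 :=
  ((X.isFib_quatOp _).mul (X.isFib_lefschetz q)).eq ((X.isFib_lefschetz q).mul (X.isFib_quatOp _))
    fun x => by
      rw [pull_mul_pL (X.isDualMetric x) (X.isSkew q x), X.endo_sq]
      congr 2; ext v; simp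

theorem quatOp_mul_lefschetzDual (q : ImagUnit) :
    X.quatOp q.1 * X.lefschetzDual q = X.lefschetzDual q * X.quatOp q.1 :=
  ((X.isFib_quatOp _).mul (X.isFib_lefschetzDual q)).eq
    ((X.isFib_lefschetzDual q).mul (X.isFib_quatOp _)) fun x => by
      rw [pull_mul_pLam (X.isDualMetric x) (X.isSkew q x) (X.endo_sq q x), X.endo_sq]
      congr 2; ext v; simp

theorem lefschetzDual_commute (q r : ImagUnit) : Commute (X.lefschetzDual q) (X.lefschetzDual r) :=
  ((X.isFib_lefschetzDual q).mul (X.isFib_lefschetzDual r)).eq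
    ((X.isFib_lefschetzDual r).mul (X.isFib_lefschetzDual q)) fun _ =>
      pLam_comm

section Triple
variable {a b c : ImagUnit} (t : IsQuatTriple a b c)
include t

theorem isPair : IsPair (X.lefschetz b) (X.lefschetz c) (X.lefschetzDual b) (X.lefschetzDual c)
    (degreeOp E M) (X.adOp a) := by
  have p := fun x => (t.isHypTriple (X := X) x).isPair (X.isDualMetric x)
  have Lb := X.isFib_lefschetz b
  have Lc := X.isFib_lefschetz c
  have Mb := X.isFib_lefschetzDual b
  have Mc := X.isFib_lefschetzDual c
  have H : IsFib (degreeOp E M) fun _ => pH E := isFib_gradeOp _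
  have D := X.isFib_adOp a
  exact {
    bb := ((Lb.mul Mb).sub (Mb.mul Lb)).eq H fun x => (p x).bb
    cc := ((Lc.mul Mc).sub (Mc.mul Lc)).eq H fun x => (p x).cc
    bc := ((Lb.mul Mc).sub (Mc.mul Lb)).eq D fun x => (p x).bc
    cb := ((Lc.mul Mb).sub (Mb.mul Lc)).eq D.neg fun x => (p x).cb
    Hb := ((H.mul Lb).sub (Lb.mul H)).eq Lb.two_mul fun x => (p x).Hb
    Hc := ((H.mul Lc).sub (Lc.mul H)).eq Lc.two_mul fun x => (p x).Hc
    Hb' := ((H.mul Mb).sub (Mb.mul H)).eq Mb.two_mul.neg fun x => (p x).Hb'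
    Hc' := ((H.mul Mc).sub (Mc.mul H)).eq Mc.two_mul.neg fun x => (p x).Hc'
    Db := ((D.mul Lb).sub (Lb.mul D)).eq Lc.two_mul.neg fun x => (p x).Db
    Dc := ((D.mul Lc).sub (Lc.mul D)).eq Lb.two_mul fun x => (p x).Dc
    Db' := ((D.mul Mb).sub (Mb.mul D)).eq Mc.two_mul.neg fun x => (p x).Db'
    Dc' := ((D.mul Mc).sub (Mc.mul D)).eq Mb.two_mul fun x => (p x).Dc' }

theorem IsQuatTriple.endo_bcb (x : M) :
    -(X.endo b.1 x ∘L X.endo c.1 x ∘L X.endo b.1 x) = -X.endo c.1 x := by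
  rw [X.endo_comp, X.endo_comp, t.cb, mul_neg, t.ba, neg_neg]

theorem IsQuatTriple.endo_bab (x : M) :
    -(X.endo b.1 x ∘L X.endo a.1 x ∘L X.endo b.1 x) = -X.endo a.1 x := by
  rw [X.endo_comp, X.endo_comp, t.ab, t.bc]

theorem quatOp_mul_lefschetz_anti :
    X.quatOp b.1 * X.lefschetz c = -(X.lefschetz c * X.quatOp b.1) :=
  ((X.isFib_quatOp _).mul (X.isFib_lefschetz c)).eq
    ((X.isFib_lefschetz c).mul (X.isFib_quatOp _)).neg fun x => by
      rw [pull_mul_pL (X.isDualMetric x) (X.isSkew b x), IsQuatTriple.endo_bcb X t, pL_neg, neg_mul]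

theorem quatOp_mul_lefschetzDual_anti :
    X.quatOp b.1 * X.lefschetzDual c = -(X.lefschetzDual c * X.quatOp b.1) :=
  ((X.isFib_quatOp _).mul (X.isFib_lefschetzDual c)).eq
    ((X.isFib_lefschetzDual c).mul (X.isFib_quatOp _)).neg fun x => by
      rw [pull_mul_pLam (X.isDualMetric x) (X.isSkew b x) (X.endo_sq b x), IsQuatTriple.endo_bcb X t,
        pLam_neg, neg_mul]

theorem quatOp_mul_adOp_anti :
    X.quatOp b.1 * X.adOp a = -(X.adOp a * X.quatOp b.1) :=
  ((X.isFib_quatOp _).mul (X.isFib_adOp a)).eq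
    ((X.isFib_adOp a).mul (X.isFib_quatOp _)).neg fun x => by
      rw [pull_mul_der (X.endo_sq b x), IsQuatTriple.endo_bab X t, der_neg, neg_mul]

end Triple

section Hyperkahler
variable {X} (hX : X.IsHyperkahler)
include hX

theorem lefschetz_mul_dOp (q : ImagUnit) : X.lefschetz q * dOp E M = dOp E M * X.lefschetz q :=
  wedgeOp_mul_dOp (hX q)

/-- `d` has degree one and commutes with two Lefschetz operators, so `IsPair.ad_ad_eq_neg` gives the
condition on the double commutator with `ad a`. It is applied to `I` and to `J`. -/
theorem dOp_eq_delOp_add {a b c : ImagUnit} (t : IsQuatTriple a b c) :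
    dOp E M = X.delOp a + X.delBarOp a :=
  X.dOp_eq_add a <| (X.isPair t).ad_ad_eq_neg (X.isNilpotent_lefschetzDual b)
    (X.isNilpotent_lefschetzDual c) (X.lefschetzDual_commute b c) (lefschetz_mul_dOp hX b)
    (lefschetz_mul_dOp hX c) isDegOne_dOp.degreeOp

theorem delOp_sq {a b c : ImagUnit} (t : IsQuatTriple a b c) :
    X.delOp a * X.delOp a = 0 ∧ X.delBarOp a * X.delBarOp a = 0 := by
  have h1 : IsWt (X.adOp a) Complex.I (X.delOp a) := X.adOp_mul_delOp a
  have h2 : IsWt (X.adOp a) (-Complex.I) (X.delBarOp a) := by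
    rw [IsWt, neg_smul]; exact X.adOp_mul_delBarOp a
  obtain ⟨h3, -, h4⟩ := IsWt.sq_eq_zero_of_add Complex.I_ne_zero h1 h2
    (by rw [← dOp_eq_delOp_add hX t, dOp_mul_dOp])
  exact ⟨h3, h4⟩

theorem isHKSystem : IsHKSystem (X.lefschetz qJ) (X.lefschetz qK) (X.lefschetzDual qJ)
    (X.lefschetzDual qK) (degreeOp E M) (X.adOp qI) (parityOp E M) (X.quatOp qJ.1)
    (X.quatOp (-qJ.1)) (X.delOp qI) (X.delBarOp qI) (X.delOp qJ) (X.delBarOp qJ) := by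
  have t := isQuatTriple_IJK
  have hd := dOp_eq_delOp_add hX t
  have hJ : X.lefschetz qJ * (X.delOp qI + X.delBarOp qI) =
      (X.delOp qI + X.delBarOp qI) * X.lefschetz qJ := by
    rw [← hd]; exact lefschetz_mul_dOp hX qJ
  have hK : X.lefschetz qK * (X.delOp qI + X.delBarOp qI) =
      (X.delOp qI + X.delBarOp qI) * X.lefschetz qK := by
    rw [← hd]; exact lefschetz_mul_dOp hX qK
  have hdd : (X.delOp qI + X.delBarOp qI) * (X.delOp qI + X.delBarOp qI) = 0 := by
    rw [← hd]; exact dOp_mul_dOp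
  have hpq : X.delOp qI + X.delBarOp qI = X.delOp qJ + X.delBarOp qJ := by
    rw [← hd]; exact dOp_eq_delOp_add hX t.rotate
  have hPP : HK.parityOp E M * HK.parityOp E M = 1 := parityOp_parityOp
  exact {
    pair := X.isPair t
    nilJ := X.isNilpotent_lefschetzDual _
    nilK := X.isNilpotent_lefschetzDual _
    commJK := X.lefschetzDual_commute _ _
    LJ_d := hJ
    LK_d := hK
    d_d := hdd
    D_a := X.adOp_mul_delOp qI
    D_b := by rw [IsWt, neg_smul]; exact X.adOp_mul_delBarOp qI
    H_a := (isDegOne_delOp _ _).degreeOp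
    H_b := (isDegOne_delBarOp _ _).degreeOp
    P_a := (isDegOne_delOp _ _).parityOp
    P_b := (isDegOne_delBarOp _ _).parityOp
    P_P := hPP
    Q_Q := X.quatOp_mul_self qJ
    Q_R := X.quatOp_mul_quatOp_neg qJ
    R_Q := X.quatOp_neg_mul_quatOp qJ
    Q_LJ := X.quatOp_mul_lefschetz qJ
    Q_LK := X.quatOp_mul_lefschetz_anti t
    Q_MJ := X.quatOp_mul_lefschetzDual qJ
    Q_MK := X.quatOp_mul_lefschetzDual_anti t
    Q_H := (X.gradeOp_mul_quatOp _ _).symm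
    Q_D := X.quatOp_mul_adOp_anti t
    p_q := hpq
    p_p := (delOp_sq hX t.rotate).1
    q_q := (delOp_sq hX t.rotate).2
    Q_p := X.quatOp_mul_delOp qJ
    Q_q := X.quatOp_mul_delBarOp qJ }

end Hyperkahler
end HypercomplexHermitian
end Operators

/-! ### Recovering the parts of weights `±√-1` from their sum. -/

section Components
variable {A : Type*} [Ring A] [Algebra ℂ A] {D a b : A}

theorem IsWt.commutator_add (ha : IsWt D Complex.I a) (hb : IsWt D (-Complex.I) b) :
    D * (a + b) - (a + b) * D = Complex.I • (a - b) := by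
  have h : D * (a + b) - (a + b) * D = (D * a - a * D) + (D * b - b * D) := by noncomm_ring
  rw [h, ha, hb]; module

theorem IsWt.fst_eq (ha : IsWt D Complex.I a) (hb : IsWt D (-Complex.I) b) :
    a = (2⁻¹ : ℂ) • ((a + b) - Complex.I • (D * (a + b) - (a + b) * D)) := by
  rw [ha.commutator_add hb, smul_smul, Complex.I_mul_I]; module

theorem IsWt.snd_eq (ha : IsWt D Complex.I a) (hb : IsWt D (-Complex.I) b) :
    b = (2⁻¹ : ℂ) • ((a + b) + Complex.I • (D * (a + b) - (a + b) * D)) := by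
  rw [ha.commutator_add hb, smul_smul, Complex.I_mul_I]; module

end Components

/-! ### The adjoints `∂^*`, `∂_J^*`, the Kähler identities and the Laplacian. -/

section Operators
variable {E : Type*} [NormedAddCommGroup E] [NormedSpace ℝ E] [FiniteDimensional ℝ E]
  {M : Type*} [TopologicalSpace M] [ChartedSpace E M] [IsManifold 𝓘(ℝ, E) ∞ M]

namespace HypercomplexHermitian
variable (X : HypercomplexHermitian E M)

theorem opL_eq : X.opL = (2⁻¹ : ℂ) • (X.lefschetz qJ + Complex.I • X.lefschetz qK) := by
  rw [opL, omegaForm, wedgeOp_smul, wedgeOp_add, wedgeOp_smul]; rfl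

theorem opLambda_eq :
    X.opLambda = (2⁻¹ : ℂ) • (X.lefschetzDual qJ - Complex.I • X.lefschetzDual qK) := by
  refine LinearMap.ext fun η => funext fun l => ?_
  change contract X.metric 2 l (conjForm 2 X.omegaForm) (η (l + 2)) =
    (2⁻¹ : ℂ) • (contract X.metric 2 l (conjForm 2 (X.kahlerForm qJ)) (η (l + 2)) -
      Complex.I • contract X.metric 2 l (conjForm 2 (X.kahlerForm qK)) (η (l + 2)))
  have h : conjForm 2 X.omegaForm = (2⁻¹ : ℂ) • (conjForm 2 (X.kahlerForm qJ) -
      Complex.I • conjForm 2 (X.kahlerForm qK)) := by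
    rw [omegaForm, (conjForm 2).map_smulₛₗ, (conjForm 2).map_add, (conjForm 2).map_smulₛₗ,
      Complex.conj_I, neg_smul, ← sub_eq_add_neg]
    congr 1
    rw [map_inv₀, map_ofNat]
  rw [h, (contract X.metric 2 l).map_smul, (contract X.metric 2 l).map_sub,
    (contract X.metric 2 l).map_smul]
  rfl

theorem parityOp_mul_lefschetz (q : ImagUnit) :
    parityOp E M * X.lefschetz q = X.lefschetz q * parityOp E M :=
  ((isFib_gradeOp _).mul (X.isFib_lefschetz q)).eq
    ((X.isFib_lefschetz q).mul (isFib_gradeOp _)) fun _ => pPar_comm_pL.symm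

theorem parityOp_mul_lefschetzDual (q : ImagUnit) :
    parityOp E M * X.lefschetzDual q = X.lefschetzDual q * parityOp E M :=
  ((isFib_gradeOp _).mul (X.isFib_lefschetzDual q)).eq
    ((X.isFib_lefschetzDual q).mul (isFib_gradeOp _)) fun _ => pPar_comm_pLam.symm

theorem parityOp_mul_opL : parityOp E M * X.opL = X.opL * parityOp E M := by
  simp only [opL_eq, mul_smul_comm, smul_mul_assoc, mul_add, add_mul, parityOp_mul_lefschetz]

theorem parityOp_mul_opLambda : parityOp E M * X.opLambda = X.opLambda * parityOp E M := by
  simp only [opLambda_eq, mul_smul_comm, smul_mul_assoc, mul_sub, sub_mul,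
    parityOp_mul_lefschetzDual]

theorem adOp_mul_lefschetz_self (q : ImagUnit) :
    X.adOp q * X.lefschetz q = X.lefschetz q * X.adOp q :=
  ((X.isFib_adOp q).mul (X.isFib_lefschetz q)).eq ((X.isFib_lefschetz q).mul (X.isFib_adOp q))
    fun x => by rw [der_mul_pL (X.isDualMetric x) (X.isSkew q x), pL_sub, sub_self, add_zero]

theorem parityOp_mul_star : parityOp E M * X.star = X.star * parityOp E M := by
  rw [← X.star_mul_star, mul_assoc]

theorem starAdjoint_add (S T : FormEnd E M) :
    X.starAdjoint (S + T) = X.starAdjoint S + X.starAdjoint T := by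
  change -(X.star * (conjOp (S + T) * X.star)) =
    -(X.star * (conjOp S * X.star)) + -(X.star * (conjOp T * X.star))
  rw [conjOp_add]; noncomm_ring

/-- An operator of degree one commuting with `L_b` is a highest weight vector of weight `1` for the
Lefschetz triple of `b`, which supplies the hypotheses of the abstract formula. -/
theorem star_mul_mul_star {a b c : ImagUnit} (t : IsQuatTriple a b c) (hb : b = qI ∨ b = qJ)
    {T : FormEnd E M} (hT : IsDegOne T) (h : X.lefschetz b * T = T * X.lefschetz b) :
    X.star * T * X.star =
      -(X.quatOp b.1 * (X.lefschetzDual b * T - T * X.lefschetzDual b) * X.quatOp (-b.1)) := by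
  have s := (X.isPair t).sl2
  have hP : HK.parityOp E M * HK.parityOp E M = 1 := parityOp_parityOp
  exact HK.star_mul_mul_star (X.star_eq hb) X.star_mul_star hP X.parityOp_mul_star.symm
    (X.quatOp_mul_quatOp_neg b) (X.quatOp_neg_mul_quatOp b) (X.quatOp_mul_lefschetz b)
    (X.quatOp_mul_lefschetzDual b) hT.sign (X.isNilpotent_lefschetz b)
    (X.isNilpotent_lefschetzDual b) h
    (s.double_commutator (X.isNilpotent_lefschetzDual b) h hT.degreeOp)
    (s.commutator_lower h hT.degreeOp)

theorem isDegOne_conj_quatOp {T : FormEnd E M} (hT : IsDegOne T) :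
    IsDegOne (X.quatOp (-qJ.1) * T * X.quatOp qJ.1) :=
  hT.conj (X.gradeOp_mul_quatOp _) (X.gradeOp_mul_quatOp _)

theorem delJOp_eq : X.delJOp = X.quatOp (-qJ.1) * X.delBarOp qI * X.quatOp qJ.1 := by
  rw [mul_assoc]; rfl

theorem quatOp_conj_commutator {T : FormEnd E M} {c : ℂ}
    (h : X.quatOp qI.1 * T = c • (T * X.quatOp qI.1)) :
    X.quatOp qI.1 * (X.lefschetzDual qI * T - T * X.lefschetzDual qI) * X.quatOp (-qI.1) =
      c • (X.lefschetzDual qI * T - T * X.lefschetzDual qI) := by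
  have h1 : X.quatOp qI.1 * (X.lefschetzDual qI * T - T * X.lefschetzDual qI) =
      c • ((X.lefschetzDual qI * T - T * X.lefschetzDual qI) * X.quatOp qI.1) := by
    rw [mul_sub, ← mul_assoc, ← mul_assoc, quatOp_mul_lefschetzDual, h, mul_assoc, h,
      smul_mul_assoc, mul_assoc T, quatOp_mul_lefschetzDual, mul_smul_comm, ← smul_sub]
    noncomm_ring
  rw [h1, smul_mul_assoc, mul_assoc, quatOp_mul_quatOp_neg, mul_one]

section Hyperkahler
variable {X} (hX : X.IsHyperkahler)
include hX

/-- This expression shows that `∂` lies in the superalgebra, and it gives the complex conjugate of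
`∂`, because `d` and `ad I` are real. -/
theorem delOp_eq : X.delOp qI =
    (2⁻¹ : ℂ) • (dOp E M - Complex.I • (X.adOp qI * dOp E M - dOp E M * X.adOp qI)) := by
  rw [dOp_eq_delOp_add hX isQuatTriple_IJK]
  exact IsWt.fst_eq (isHKSystem hX).D_a (isHKSystem hX).D_b

theorem delBarOp_eq : X.delBarOp qI =
    (2⁻¹ : ℂ) • (dOp E M + Complex.I • (X.adOp qI * dOp E M - dOp E M * X.adOp qI)) := by
  rw [dOp_eq_delOp_add hX isQuatTriple_IJK]
  exact IsWt.snd_eq (isHKSystem hX).D_a (isHKSystem hX).D_b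

theorem conjOp_delOp : conjOp (X.delOp qI) = X.delBarOp qI := by
  rw [delOp_eq hX, delBarOp_eq hX]
  simp only [conjOp_smul, conjOp_sub, conjOp_mul, conjOp_adOp, conjOp_dOp, Complex.conj_I,
    neg_smul, sub_neg_eq_add, map_inv₀, map_ofNat]

theorem conjOp_delBarOp : conjOp (X.delBarOp qI) = X.delOp qI := by
  rw [delOp_eq hX, delBarOp_eq hX]
  simp only [conjOp_smul, conjOp_sub, conjOp_add, conjOp_mul, conjOp_adOp, conjOp_dOp,
    Complex.conj_I, neg_smul, ← sub_eq_add_neg, map_inv₀, map_ofNat]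

theorem conjOp_delJOp : conjOp X.delJOp = X.quatOp (-qJ.1) * X.delOp qI * X.quatOp qJ.1 := by
  rw [delJOp_eq, conjOp_mul, conjOp_mul, conjOp_quatOp, conjOp_quatOp, conjOp_delBarOp hX]

/-- The star is written through `J`. Conjugating by it turns `\bar∂`, the complex conjugate of `∂`,
into a commutator with `Λ_J` conjugated by the action of `J`; this carries `\bar∂` to `∂_J` up to
sign, on which only the `Λ_Ω`-part of `Λ_J` acts. -/
theorem starAdjoint_opDel :
    X.starAdjoint X.opDel = -(X.opLambda * X.opDelJ - X.opDelJ * X.opLambda) := by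
  have t := isHKSystem hX
  change -(X.star * (conjOp (X.delOp qI) * X.star)) = _
  rw [conjOp_delOp hX, ← mul_assoc, X.star_mul_mul_star isQuatTriple_IJK (Or.inr rfl)
    (isDegOne_delBarOp _ _) t.LJ_b, t.conj_commutator_b, opLambda_eq, opDelJ, delJOp_eq, neg_neg]

theorem starAdjoint_opDelJ :
    X.starAdjoint X.opDelJ = X.opLambda * X.opDel - X.opDel * X.opLambda := by
  have t := isHKSystem hX
  change -(X.star * (conjOp X.delJOp * X.star)) = _
  rw [conjOp_delJOp hX, ← mul_assoc, X.star_mul_mul_star isQuatTriple_IJK (Or.inr rfl)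
    (X.isDegOne_conj_quatOp (isDegOne_delOp _ _))
    (by rw [t.mul_conj t.Q_LJ, t.LJ_a, t.conj_mul t.Q_LJ]), t.conj_commutator_bJ, opLambda_eq,
    opDel, neg_neg]

theorem lefschetz_mul_delOp : X.lefschetz qI * X.delOp qI = X.delOp qI * X.lefschetz qI ∧
    X.lefschetz qI * X.delBarOp qI = X.delBarOp qI * X.lefschetz qI := by
  have t := isHKSystem hX
  have h0 : IsWt (X.adOp qI) 0 (X.lefschetz qI) := by
    rw [IsWt, zero_smul, adOp_mul_lefschetz_self, sub_self]
  refine h0.commute_of_add t.D_a t.D_b (by simp [Complex.ext_iff]; norm_num) ?_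
  rw [← dOp_eq_delOp_add hX isQuatTriple_IJK]
  exact lefschetz_mul_dOp hX qI

/-- Here the star is written through `I`, whose action commutes with `∂` up to the scalar `√-1`; the
result is a classical Kähler identity. -/
theorem starAdjoint_delBarOp : X.starAdjoint (X.delBarOp qI) =
    Complex.I • (X.lefschetzDual qI * X.delOp qI - X.delOp qI * X.lefschetzDual qI) := by
  change -(X.star * (conjOp (X.delBarOp qI) * X.star)) = _
  rw [conjOp_delBarOp hX, ← mul_assoc, X.star_mul_mul_star isQuatTriple_IJK.rotate.rotate
    (Or.inl rfl) (isDegOne_delOp _ _) (lefschetz_mul_delOp hX).1, neg_neg]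
  exact X.quatOp_conj_commutator (X.quatOp_mul_delOp qI)

theorem starAdjoint_delOp : X.starAdjoint (X.delOp qI) =
    -(Complex.I • (X.lefschetzDual qI * X.delBarOp qI - X.delBarOp qI * X.lefschetzDual qI)) := by
  change -(X.star * (conjOp (X.delOp qI) * X.star)) = _
  rw [conjOp_delOp hX, ← mul_assoc, X.star_mul_mul_star isQuatTriple_IJK.rotate.rotate
    (Or.inl rfl) (isDegOne_delBarOp _ _) (lefschetz_mul_delOp hX).2, neg_neg, ← neg_smul]
  refine X.quatOp_conj_commutator ?_
  rw [neg_smul]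
  exact X.quatOp_mul_delBarOp qI

theorem laplacian_eq : X.laplacian = (2 : ℂ) •
    (X.opDel * X.starAdjoint X.opDel + X.starAdjoint X.opDel * X.opDel) := by
  have t := isHKSystem hX
  change dOp E M * X.starAdjoint (dOp E M) + X.starAdjoint (dOp E M) * dOp E M = _
  rw [dOp_eq_delOp_add hX isQuatTriple_IJK, starAdjoint_add]
  exact laplacian_eq_of_kaehler (starAdjoint_delOp hX) (starAdjoint_delBarOp hX) t.a_a t.b_b t.a_b

end Hyperkahler
end HypercomplexHermitian
end Operators

/-! ### Multiplication by functions and the symbol of `d`. -/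

section FunctionMultiplication
variable {E : Type*} [NormedAddCommGroup E] [NormedSpace ℝ E] [FiniteDimensional ℝ E]
  {M : Type*} [TopologicalSpace M] [ChartedSpace E M] [IsManifold 𝓘(ℝ, E) ∞ M]

theorem IsSmoothForm.function_smul {φ : M → ℝ} (hφ : ContMDiff 𝓘(ℝ, E) 𝓘(ℝ, ℝ) ∞ φ) {k : ℕ}
    {η : M → Alt E k} (hη : IsSmoothForm η) : IsSmoothForm fun x => φ x • η x := fun x₀ =>
  (hφ.contMDiffAt (x := x₀)).smul (hη x₀)

/-- Multiplication of forms by a function. -/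
def funOp (φ : M → ℝ) (hφ : ContMDiff 𝓘(ℝ, E) 𝓘(ℝ, ℝ) ∞ φ) : FormEnd E M where
  toFun η k := ⟨fun x => φ x • (η k).1 x, (η k).2.function_smul hφ⟩
  map_add' _ _ := funext fun _ => Subtype.ext <| funext fun _ => smul_add _ _ _
  map_smul' c _ := funext fun _ => Subtype.ext <| funext fun x => smul_comm (φ x) c _

variable {φ : M → ℝ} (hφ : ContMDiff 𝓘(ℝ, E) 𝓘(ℝ, ℝ) ∞ φ)

theorem isFib_funOp : IsFib (funOp φ hφ) fun x => φ x • 1 := fun _ _ => rfl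

theorem IsFib.mul_funOp {T : FormEnd E M} {t : M → Module.End ℂ (PForm E)} (hT : IsFib T t) :
    T * funOp φ hφ = funOp φ hφ * T :=
  (hT.mul (isFib_funOp hφ)).eq ((isFib_funOp hφ).mul hT) fun x => by
    rw [mul_smul_comm, smul_mul_assoc, mul_one, one_mul]

/-- The differential of a function at a point, in the preferred chart. -/
def diffAt (φ : M → ℝ) (x : M) : E →L[ℝ] ℝ :=
  fderiv ℝ (fun y => φ ((extChartAt 𝓘(ℝ, E) x).symm y)) (extChartAt 𝓘(ℝ, E) x x)

include hφ in
theorem dForm_function_smul {k : ℕ} (η : Form E M k) (x : M) :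
    extDerivAt (fun x => φ x • η.1 x) x =
      alternatizeUncurryFin ((diffAt φ x).smulRight (η.1 x)) + φ x • extDerivAt η.1 x := by
  set y := extChartAt 𝓘(ℝ, E) x x with hy
  have h1 : DifferentiableAt ℝ (fun y => φ ((extChartAt 𝓘(ℝ, E) x).symm y)) y := by
    have := (contMDiffAt_iff.1 (hφ.contMDiffAt (x := x))).2
    simp only [modelWithCornersSelf_coe, Set.range_id, contDiffWithinAt_univ] at this
    exact this.differentiableAt (by simp)
  have h2 : DifferentiableAt ℝ (chartRep η.1 x) y :=
    (contDiffAt_chartRep (η.2 x)).differentiableAt (by simp)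
  have h3 : chartRep (fun x => φ x • η.1 x) x =
      fun z => φ ((extChartAt 𝓘(ℝ, E) x).symm z) • chartRep η.1 x z := rfl
  have h4 : fderiv ℝ (chartRep (fun x => φ x • η.1 x) x) y =
      φ x • fderiv ℝ (chartRep η.1 x) y + (diffAt φ x).smulRight (η.1 x) := by
    rw [h3]
    refine (h1.hasFDerivAt.smul h2.hasFDerivAt).fderiv.trans ?_
    rw [hy, extChartAt_to_inv, chartRep_self]
    rfl
  change alternatizeUncurryFin (fderiv ℝ (chartRep (fun x => φ x • η.1 x) x) y) = _
  rw [h4, alternatizeUncurryFin_add, alternatizeUncurryFin_smul]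
  exact add_comm _ _

/-- By the Leibniz rule the commutator of `d` with a function `φ` is exterior multiplication by the
differential of `φ`. -/
theorem isFib_dOp_commutator : IsFib (dOp E M * funOp φ hφ - funOp φ hφ * dOp E M)
    fun x => eps (diffAt φ x) := fun η x => by
  funext k
  cases k with
  | zero =>
    change (0 : Alt E 0) - φ x • (0 : Alt E 0) = 0
    rw [smul_zero, sub_zero]
  | succ k =>
    change extDerivAt (fun x => φ x • (η k).1 x) x - φ x • extDerivAt (η k).1 x = _
    rw [dForm_function_smul hφ, add_sub_cancel_right]
    rfl

/-- A nonzero linear functional of the chart, cut off by a bump function equal to `1` near `x`; the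
Hausdorff condition makes its extension by zero smooth. -/
theorem exists_diffAt_ne_zero [Nontrivial E] [T2Space M] (x : M) :
    ∃ φ : M → ℝ, ContMDiff 𝓘(ℝ, E) 𝓘(ℝ, ℝ) ∞ φ ∧ diffAt (E := E) φ x ≠ 0 := by
  obtain ⟨v, hv⟩ := exists_ne (0 : E)
  obtain ⟨l, hl⟩ := SeparatingDual.exists_ne_zero (R := ℝ) hv
  obtain ⟨b⟩ : Nonempty (SmoothBumpFunction 𝓘(ℝ, E) x) := inferInstance
  refine ⟨fun y => b y • l (extChartAt 𝓘(ℝ, E) x y), b.contMDiff_smul ?_, fun h => hl ?_⟩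
  · exact l.contMDiff.comp_contMDiffOn (contMDiffOn_extChartAt (n := ∞) (x := x))
  · have h1 : (fun y => b ((extChartAt 𝓘(ℝ, E) x).symm y) •
        l (extChartAt 𝓘(ℝ, E) x ((extChartAt 𝓘(ℝ, E) x).symm y))) =ᶠ[𝓝 (extChartAt 𝓘(ℝ, E) x x)] l := by
      have h2 : ∀ᶠ y in 𝓝 (extChartAt 𝓘(ℝ, E) x x), b ((extChartAt 𝓘(ℝ, E) x).symm y) = 1 := by
        have h3 : Filter.Tendsto (extChartAt 𝓘(ℝ, E) x).symm (𝓝 (extChartAt 𝓘(ℝ, E) x x)) (𝓝 x) := by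
          have := continuousAt_extChartAt_symm (I := 𝓘(ℝ, E)) x
          rwa [ContinuousAt, extChartAt_to_inv] at this
        exact h3.eventually b.eventuallyEq_one
      filter_upwards [h2, extChartAt_target_mem_nhds (I := 𝓘(ℝ, E)) x] with y hy hy'
      rw [hy, one_smul, (extChartAt 𝓘(ℝ, E) x).right_inv hy']
    have h4 : diffAt (fun y => b y • l (extChartAt 𝓘(ℝ, E) x y)) x = l :=
      h1.fderiv_eq.trans l.fderiv
    rw [← h4, h]; rfl

end FunctionMultiplication

/-- The double commutator of a Laplacian with an operator commuting with the symbols. -/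
theorem symbol_anticommute {A : Type*} [Ring A] [Algebra ℂ A] {d d' m : A}
    (h : d * d' + d' * d = 0) (hu : (d * m - m * d) * m = m * (d * m - m * d))
    (hv : (d' * m - m * d') * m = m * (d' * m - m * d')) :
    (d * m - m * d) * (d' * m - m * d') + (d' * m - m * d') * (d * m - m * d) = 0 := by
  -- An identity of noncommutative polynomials: the double commutator of `{d, d'}` with `m` is twice
  -- the anticommutator of the symbols, plus terms that vanish when the symbols commute with `m`.
  have key : ((d * d' + d' * d) * m - m * (d * d' + d' * d)) * m -
      m * ((d * d' + d' * d) * m - m * (d * d' + d' * d)) =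
      2 * ((d * m - m * d) * (d' * m - m * d') + (d' * m - m * d') * (d * m - m * d)) +
      d * ((d' * m - m * d') * m - m * (d' * m - m * d')) +
      ((d * m - m * d) * m - m * (d * m - m * d)) * d' +
      d' * ((d * m - m * d) * m - m * (d * m - m * d)) +
      ((d' * m - m * d') * m - m * (d' * m - m * d')) * d := by noncomm_ring
  rw [h, hu, hv, sub_self, sub_self, mul_zero, zero_mul, mul_zero, zero_mul, zero_mul, mul_zero,
    sub_self, zero_mul, mul_zero, sub_self, add_zero, add_zero, add_zero, add_zero, two_mul,
    ← two_smul ℂ] at key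
  exact (smul_eq_zero.1 key.symm).resolve_left two_ne_zero

/-! ### Nonvanishing of the Laplacian and of `H_Ω`. -/

section Operators
variable {E : Type*} [NormedAddCommGroup E] [NormedSpace ℝ E] [FiniteDimensional ℝ E]
  {M : Type*} [TopologicalSpace M] [ChartedSpace E M] [IsManifold 𝓘(ℝ, E) ∞ M]

namespace HypercomplexHermitian
variable (X : HypercomplexHermitian E M)

/-- Move the first star past `eps ξ` by `pStar_mul_eps`; the two stars then combine to the parity
operator, which cancels the parity factor of that rule. -/
theorem pStar_mul_eps_mul_pStar (x : M) (ξ : E →L[ℝ] ℝ) :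
    pStar (metricAt X.metric x).inverse (evAt x X.volForm) * eps ξ *
      pStar (metricAt X.metric x).inverse (evAt x X.volForm) =
        iota ((metricAt X.metric x).inverse ξ) := by
  have hG := X.isDualMetric x
  have hA := X.isSkew qI x
  have hA2 := X.endo_sq qI x
  have hμ := X.evAt_volForm x (Or.inl rfl : qI = qI ∨ qI = qJ)
  have hmem : evAt x X.volForm ∈ hom E (Module.finrank ℝ E) := hμ ▸ (pWeyl_pOne_mem hG hA hA2).1
  have : Nonempty M := ⟨x⟩
  obtain ⟨n, hn⟩ := X.exists_finrank
  have hSS : pStar (metricAt X.metric x).inverse (evAt x X.volForm) *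
      pStar (metricAt X.metric x).inverse (evAt x X.volForm) = pPar E := by
    rw [pStar_eq hG hA hA2 hμ]
    exact pStar_mul_pStar hG hA hA2 (N := 2 * n) (by omega)
  rw [pStar_mul_eps hmem]
  generalize pStar (metricAt X.metric x).inverse (evAt x X.volForm) = S at hSS ⊢
  have hPS : pPar E * S = S * pPar E := by rw [← hSS, mul_assoc]
  rw [mul_assoc, hPS, mul_assoc, ← mul_assoc S, hSS, pPar_mul_pPar, mul_one]

/-- Were `Δ` zero, the symbols of `d` and `d^*` would anticommute. They are exterior multiplication
by `dφ` and minus contraction with its gradient, whose anticommutator is `-|dφ|²`, and `φ` can be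
chosen with `dφ ≠ 0` at a point. -/
theorem laplacian_ne_zero [Nontrivial E] [T2Space M] [Nonempty M] : X.laplacian ≠ 0 := by
  intro h
  obtain ⟨x⟩ := ‹Nonempty M›
  obtain ⟨φ, hφ, hx⟩ := exists_diffAt_ne_zero (E := E) x
  set m := funOp φ hφ
  set S := X.star
  have hS : IsFib S _ := X.isFib_star
  have hu := isFib_dOp_commutator hφ
  have hSm : S * m = m * S := hS.mul_funOp hφ
  have hstar : X.starAdjoint (dOp E M) = -(S * dOp E M * S) := by
    change -(S * (conjOp (dOp E M) * S)) = _
    rw [conjOp_dOp, mul_assoc]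
  have hd' : -(S * dOp E M * S) * m - m * -(S * dOp E M * S) =
      -(S * (dOp E M * m - m * dOp E M) * S) := by
    have e1 : S * dOp E M * S * m = S * (dOp E M * m) * S := by
      rw [mul_assoc _ S m, hSm]; simp only [mul_assoc]
    have e2 : m * (S * dOp E M * S) = S * (m * dOp E M) * S := by
      simp only [← mul_assoc, hSm]
    rw [mul_sub, sub_mul, ← e1, ← e2]; noncomm_ring
  have hv : IsFib (-(S * dOp E M * S) * m - m * -(S * dOp E M * S))
      fun x => -iota ((metricAt X.metric x).inverse (diffAt φ x)) := by
    rw [hd']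
    intro η x
    rw [((hS.mul hu).mul hS).neg]
    beta_reduce
    rw [X.pStar_mul_eps_mul_pStar]
  have hΔ : dOp E M * -(S * dOp E M * S) + -(S * dOp E M * S) * dOp E M = 0 := by
    rw [← hstar]; exact h
  have key := symbol_anticommute hΔ (hu.mul_funOp hφ) (hv.mul_funOp hφ)
  have h1 := ((hu.mul hv).add (hv.mul hu)) (Pi.single 0 (oneForm E M)) x
  rw [key, LinearMap.zero_apply, _root_.map_zero, evAt_single_oneForm] at h1
  beta_reduce at h1
  rw [neg_mul, iota_mul_eps] at h1
  set ξ := diffAt (E := E) φ x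
  set w := (metricAt X.metric x).inverse ξ with hw
  have h2 : eps ξ * -iota w + -(ξ w • 1 - eps ξ * iota w) = -(ξ w • (1 : Module.End ℂ (PForm E))) := by
    rw [mul_neg]; abel
  rw [h2, LinearMap.neg_apply, LinearMap.smul_apply, Module.End.one_apply, zero_eq_neg] at h1
  have h3 := congrArg (fun α => α 0) (congrFun h1 0)
  have h4 : ξ w = 0 := by simpa [pOne_zero] using h3
  have h5 : metricAt X.metric x w = ξ := (X.isDualMetric x).left ξ
  have h6 : w = 0 := by
    by_contra hne
    have := metricAt_pos X.metric x w hne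
    rw [h5, h4] at this
    exact lt_irrefl _ this
  rw [h6, _root_.map_zero] at h5
  exact hx h5.symm

/-- On the constant function `1` the operator `ad I` vanishes and `H` is `-dim M / 2`, which is
nonzero. -/
theorem degreeOp_sub_adOp_ne_zero [Nontrivial E] [Nonempty M] :
    degreeOp E M - Complex.I • X.adOp qI ≠ 0 := by
  intro h
  obtain ⟨x⟩ := ‹Nonempty M›
  have h1 := congrFun (LinearMap.congr_fun h (Pi.single 0 (oneForm E M))) 0
  have h2 : (Pi.single 0 (oneForm E M) : AllForms E M) 0 = oneForm E M := Pi.single_eq_same _ _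
  change ((0 : ℕ) - (Module.finrank ℝ E : ℂ) / 2) • (Pi.single 0 (oneForm E M) : AllForms E M) 0 -
    Complex.I • (∑ p ∈ Finset.range 1, (Complex.I * (2 * p - (0 : ℕ))) • X.typeProj qI 0 p)
      ((Pi.single 0 (oneForm E M) : AllForms E M) 0) = 0 at h1
  rw [h2, Finset.sum_range_one] at h1
  have h3 := congrArg (fun α : Form E M 0 => α.1 x 0) h1
  have h5 : ((0 : ℕ) - (Module.finrank ℝ E : ℂ) / 2) * 1 = 0 := by
    simpa [oneForm] using h3
  simp at h5
  exact Module.finrank_pos.ne' h5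

end HypercomplexHermitian
end Operators

end

end HK

namespace HK

noncomputable section

set_option linter.unusedSectionVars false

/-! ### A bilinear product as a non-associative algebra, for use with the free algebra. -/

section BilinearAlgebra
variable {V : Type*} [AddCommGroup V] [Module ℂ V]

/-- The vector space `V` with the product given by a bilinear map. -/
def BilinearAlgebra (_ : V →ₗ[ℂ] V →ₗ[ℂ] V) : Type _ := V

variable (B : V →ₗ[ℂ] V →ₗ[ℂ] V)

instance : AddCommGroup (BilinearAlgebra B) := inferInstanceAs (AddCommGroup V)

instance : Module ℂ (BilinearAlgebra B) := inferInstanceAs (Module ℂ V)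

instance : NonUnitalNonAssocRing (BilinearAlgebra B) where
  mul x y := B x y
  left_distrib x y z := (B x).map_add y z
  right_distrib x y z := B.map_add₂ x y z
  zero_mul y := B.map_zero₂ y
  mul_zero x := (B x).map_zero

instance : IsScalarTower ℂ (BilinearAlgebra B) (BilinearAlgebra B) :=
  ⟨fun c x y => B.map_smul₂ c x y⟩

instance : SMulCommClass ℂ (BilinearAlgebra B) (BilinearAlgebra B) :=
  ⟨fun c x y => ((B x).map_smul c y).symm⟩

end BilinearAlgebra

theorem koszulSign_zero_left (b : ZMod 2) : koszulSign 0 b = 1 := if_neg (by simp)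

theorem koszulSign_zero_right (b : ZMod 2) : koszulSign b 0 = 1 := if_neg (by simp)

theorem koszulSign_one_one : koszulSign 1 1 = -1 := if_pos ⟨rfl, rfl⟩

/-! ### The structure of the abstract Kähler-de Rham superalgebra. -/

namespace KaehlerDeRham

theorem span_word : Submodule.span ℂ (Set.range word) = ⊤ := by
  refine eq_top_iff.2 fun x _ => ?_
  induction x using MonoidAlgebra.induction_linear with
  | zero => exact zero_mem _
  | add x y hx hy => exact add_mem (hx trivial) (hy trivial)
  | single m r =>
    have h : (MonoidAlgebra.single m r : KFree) = r • word m := by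
      rw [word, MonoidAlgebra.smul_single, smul_eq_mul, mul_one]
    rw [h]
    exact Submodule.smul_mem _ _ (Submodule.subset_span ⟨m, rfl⟩)

/-- The class of a monomial. -/
def cls (u : FreeMagma KGen) : KaehlerDeRham := kIdeal.mkQ (word u)

theorem cls_mul (u v : FreeMagma KGen) : cls (u * v) = bracket (cls u) (cls v) := by
  rw [cls, word_mul]; rfl

theorem span_cls : Submodule.span ℂ (Set.range cls) = ⊤ := by
  have h : Set.range cls = kIdeal.mkQ '' Set.range word := by rw [← Set.range_comp]; rfl
  rw [h, ← Submodule.map_span, span_word, Submodule.map_top, Submodule.range_mkQ]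

theorem linearMap_ext {V : Type*} [AddCommGroup V] [Module ℂ V] {S T : KaehlerDeRham →ₗ[ℂ] V}
    (h : ∀ u, S (cls u) = T (cls u)) : S = T :=
  LinearMap.ext_on_range span_cls h

theorem mkQ_eq_zero {x : KFree} (h : KRel x) : kIdeal.mkQ x = 0 :=
  (Submodule.Quotient.mk_eq_zero _).2 (mem_kIdeal_of_rel h)

theorem anticomm (u v : FreeMagma KGen) : bracket (cls u) (cls v) =
    -(koszulSign (wordParity u) (wordParity v) • bracket (cls v) (cls u)) := by
  have h := mkQ_eq_zero (.anticomm u v)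
  rw [map_add, map_smul] at h
  exact eq_neg_of_add_eq_zero_left h

/-- The sign depends on the parities of the first two arguments only, so these stay monomials while
the third is extended by linearity. -/
theorem jacobi (u v : FreeMagma KGen) (x : KaehlerDeRham) :
    bracket (cls u) (bracket (cls v) x) = bracket (bracket (cls u) (cls v)) x +
      koszulSign (wordParity u) (wordParity v) • bracket (cls v) (bracket (cls u) x) := by
  have h : bracket (cls u) ∘ₗ bracket (cls v) = bracket (bracket (cls u) (cls v)) +
      koszulSign (wordParity u) (wordParity v) • (bracket (cls v) ∘ₗ bracket (cls u)) :=
    linearMap_ext fun w => by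
      have h := mkQ_eq_zero (.jacobi u v w)
      rw [map_sub, map_sub, map_smul] at h
      exact sub_eq_zero.1 ((sub_add_eq_sub_sub _ _ _).trans h)
  exact congrArg (fun T => T x) h

theorem anticomm_gen (g g' : KGen) : bracket (gen g) (gen g') =
    -(koszulSign g.parity g'.parity • bracket (gen g') (gen g)) :=
  anticomm (.of g) (.of g')

theorem jacobi_gen (g g' : KGen) (x : KaehlerDeRham) :
    bracket (gen g) (bracket (gen g') x) = bracket (bracket (gen g) (gen g')) x +
      koszulSign g.parity g'.parity • bracket (gen g') (bracket (gen g) x) :=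
  jacobi (.of g) (.of g') x

theorem eq_zero_of_eq_neg {V : Type*} [AddCommGroup V] [Module ℂ V] {x : V} (h : x = -x) : x = 0 := by
  have h1 : (2 : ℂ) • x = 0 := by rw [two_smul]; exact add_eq_zero_iff_eq_neg.2 h
  exact (smul_eq_zero.1 h1).resolve_left two_ne_zero

theorem L_Lam : bracket (gen .L) (gen .Lam) = gen .H := sub_eq_zero.1 (mkQ_eq_zero .L_Lam)
theorem H_L : bracket (gen .H) (gen .L) = (2 : ℂ) • gen .L := sub_eq_zero.1 (mkQ_eq_zero .H_L)
theorem H_Lam : bracket (gen .H) (gen .Lam) = -((2 : ℂ) • gen .Lam) :=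
  eq_neg_of_add_eq_zero_left (mkQ_eq_zero .H_Lam)
theorem H_d : bracket (gen .H) (gen .d) = gen .d := sub_eq_zero.1 (mkQ_eq_zero .H_d)
theorem H_dc : bracket (gen .H) (gen .dc) = gen .dc := sub_eq_zero.1 (mkQ_eq_zero .H_dc)
theorem L_d : bracket (gen .L) (gen .d) = 0 := mkQ_eq_zero .L_d
theorem L_dc : bracket (gen .L) (gen .dc) = 0 := mkQ_eq_zero .L_dc
theorem Lam_Lam_d : bracket (gen .Lam) (bracket (gen .Lam) (gen .d)) = 0 := mkQ_eq_zero .Lam_Lam_d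
theorem Lam_Lam_dc : bracket (gen .Lam) (bracket (gen .Lam) (gen .dc)) = 0 :=
  mkQ_eq_zero .Lam_Lam_dc
theorem d_d : bracket (gen .d) (gen .d) = 0 := mkQ_eq_zero .d_d
theorem dc_dc : bracket (gen .dc) (gen .dc) = 0 := mkQ_eq_zero .dc_dc
theorem d_dc : bracket (gen .d) (gen .dc) = 0 := mkQ_eq_zero .d_dc

theorem self_of_even {g : KGen} (h : g.parity = 0) : bracket (gen g) (gen g) = 0 := by
  have := anticomm_gen g g
  rw [h, koszulSign_zero_left, one_smul] at this
  exact eq_zero_of_eq_neg this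

theorem swap_even {g : KGen} (h : g.parity = 0) (g' : KGen) :
    bracket (gen g') (gen g) = -bracket (gen g) (gen g') := by
  rw [anticomm_gen, h, koszulSign_zero_right, one_smul]

theorem jacobi_even {g : KGen} (h : g.parity = 0) (g' : KGen) (x : KaehlerDeRham) :
    bracket (gen g) (bracket (gen g') x) = bracket (bracket (gen g) (gen g')) x +
      bracket (gen g') (bracket (gen g) x) := by
  rw [jacobi_gen, h, koszulSign_zero_left, one_smul]

/-- The element `[Λ, d]`. -/
def dStar : KaehlerDeRham := bracket (gen .Lam) (gen .d)

/-- The element `[Λ, d^c]`. -/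
def dcStar : KaehlerDeRham := bracket (gen .Lam) (gen .dc)

/-- The element `{d, [Λ, d^c]}`. -/
def lap : KaehlerDeRham := bracket (gen .d) dcStar

theorem L_dStar : bracket (gen .L) dStar = gen .d := by
  rw [dStar, jacobi_even rfl, L_Lam, H_d, L_d, map_zero, add_zero]

theorem L_dcStar : bracket (gen .L) dcStar = gen .dc := by
  rw [dcStar, jacobi_even rfl, L_Lam, H_dc, L_dc, map_zero, add_zero]

theorem H_dStar : bracket (gen .H) dStar = -dStar := by
  rw [dStar, jacobi_even rfl, H_Lam, H_d, map_neg, map_smul, LinearMap.neg_apply,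
    LinearMap.smul_apply]
  module

theorem H_dcStar : bracket (gen .H) dcStar = -dcStar := by
  rw [dcStar, jacobi_even rfl, H_Lam, H_dc, map_neg, map_smul, LinearMap.neg_apply,
    LinearMap.smul_apply]
  module

/-- For odd generators `x, y` with `{x, y} = 0`, the bracket with `Λ` gives
`{[Λ, x], y} + {x, [Λ, y]} = 0`. -/
theorem star_swap (g g' : KGen) (h : bracket (gen g) (gen g') = 0) (hg : g.parity = 1)
    (hg' : g'.parity = 1) : bracket (gen g) (bracket (gen .Lam) (gen g')) =
      -bracket (gen g') (bracket (gen .Lam) (gen g)) := by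
  have h1 := jacobi_even (g := .Lam) rfl g (gen g')
  have h2 : bracket (bracket (gen .Lam) (gen g)) (gen g') =
      bracket (gen g') (bracket (gen .Lam) (gen g)) := by
    have h3 := anticomm (FreeMagma.of .Lam * .of g) (.of g')
    have h4 : wordParity (FreeMagma.of .Lam * .of g) = 1 := by
      change KGen.parity .Lam + g.parity = 1
      rw [hg]; rfl
    have h5 : wordParity (.of g') = 1 := hg'
    rw [h4, h5, koszulSign_one_one, neg_one_smul, neg_neg, cls_mul] at h3
    exact h3
  rw [h, map_zero, h2] at h1
  exact eq_neg_of_add_eq_zero_right h1.symm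

theorem d_dStar : bracket (gen .d) dStar = 0 := eq_zero_of_eq_neg (star_swap .d .d d_d rfl rfl)
theorem dc_dcStar : bracket (gen .dc) dcStar = 0 := eq_zero_of_eq_neg (star_swap .dc .dc dc_dc rfl rfl)
theorem dc_d : bracket (gen .dc) (gen .d) = 0 := by rw [anticomm_gen, d_dc, smul_zero, neg_zero]
theorem dc_dStar : bracket (gen .dc) dStar = -lap := star_swap .dc .d dc_d rfl rfl

theorem L_lap : bracket (gen .L) lap = 0 := by
  rw [lap, jacobi_even rfl, L_d, L_dcStar, d_dc, map_zero, LinearMap.zero_apply, add_zero]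

theorem H_lap : bracket (gen .H) lap = 0 := by
  rw [lap, jacobi_even rfl, H_d, H_dcStar, map_neg, add_neg_cancel]

/-- Write `d^* = [Λ, d]` and `d^c^* = [Λ, d^c]`. Bracketing `Λ` with `{d, d^c^*}` and with `{d^*,
d^c}` gives the element in question both times, because double brackets with `Λ` vanish. But the two
anticommutators are opposite, so the element equals its negative. -/
theorem dStar_dcStar : bracket dStar dcStar = 0 := by
  have h1 : bracket (gen .Lam) (bracket dStar (gen .dc)) = bracket dStar dcStar := by
    have h := jacobi (.of .Lam) (FreeMagma.of .Lam * .of .d) (gen .dc)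
    have h0 : wordParity (.of .Lam) = 0 := rfl
    rw [h0, koszulSign_zero_left, one_smul, cls_mul] at h
    refine h.trans ?_
    change bracket (bracket (gen .Lam) (bracket (gen .Lam) (gen .d))) (gen .dc) + _ = _
    rw [Lam_Lam_d, map_zero, LinearMap.zero_apply, zero_add]; rfl
  have h2 : bracket (gen .Lam) lap = bracket dStar dcStar := by
    rw [lap, jacobi_even rfl]
    change _ + bracket (gen .d) (bracket (gen .Lam) (bracket (gen .Lam) (gen .dc))) = _
    rw [Lam_Lam_dc, map_zero, add_zero]; rfl
  have h3 := jacobi_even (g := .Lam) rfl .d (gen .dc)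
  rw [d_dc, map_zero] at h3
  have h4 : bracket dStar (gen .dc) = -lap := eq_neg_of_add_eq_zero_left h3.symm
  rw [h4, map_neg, h2] at h1
  exact eq_zero_of_eq_neg h1.symm

theorem Lam_lap : bracket (gen .Lam) lap = 0 := by
  rw [lap, jacobi_even rfl]
  change bracket dStar dcStar + bracket (gen .d) (bracket (gen .Lam) (bracket (gen .Lam) (gen .dc))) = 0
  rw [Lam_Lam_dc, map_zero, add_zero, dStar_dcStar]

theorem jacobi_odd {g g' : KGen} (h : g.parity = 1) (h' : g'.parity = 1) (x : KaehlerDeRham) :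
    bracket (gen g) (bracket (gen g') x) = bracket (bracket (gen g) (gen g')) x -
      bracket (gen g') (bracket (gen g) x) := by
  rw [jacobi_gen, h, h', koszulSign_one_one, neg_one_smul, sub_eq_add_neg]

theorem d_lap : bracket (gen .d) lap = 0 := by
  have h := jacobi_odd (g := .d) (g' := .d) rfl rfl dcStar
  rw [d_d, map_zero, LinearMap.zero_apply, zero_sub] at h
  exact eq_zero_of_eq_neg h

theorem dc_lap : bracket (gen .dc) lap = 0 := by
  rw [lap, jacobi_odd rfl rfl, dc_d, dc_dcStar, map_zero, map_zero, LinearMap.zero_apply, sub_zero]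

/-- A basis of the Kähler-de Rham superalgebra. -/
def basisVec : Fin 8 → KaehlerDeRham :=
  ![gen .L, gen .Lam, gen .H, gen .d, -dcStar, gen .dc, dStar, (-2 : ℂ) • lap]

/-- The multiplication table of the five generators against the eight spanning elements, up to
scalars. -/
theorem bracket_gen_mem (g : KGen) {x : KaehlerDeRham}
    (hx : x ∈ Submodule.span ℂ (Set.range basisVec)) :
    bracket (gen g) x ∈ Submodule.span ℂ (Set.range basisVec) := by
  set T := Submodule.span ℂ (Set.range basisVec)
  have hb : ∀ i, basisVec i ∈ T := fun i => Submodule.subset_span ⟨i, rfl⟩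
  have hL : gen .L ∈ T := hb 0
  have hM : gen .Lam ∈ T := hb 1
  have hH : gen .H ∈ T := hb 2
  have hd : gen .d ∈ T := hb 3
  have hcs : dcStar ∈ T := by
    have : -dcStar ∈ T := hb 4
    exact neg_mem_iff.1 this
  have hc : gen .dc ∈ T := hb 5
  have hds : dStar ∈ T := hb 6
  have hl : lap ∈ T := by
    have : (-2 : ℂ) • lap ∈ T := hb 7
    exact (Submodule.smul_mem_iff _ (by norm_num)).1 this
  have h0 := T.zero_mem
  suffices h : ∀ y ∈ ({gen .L, gen .Lam, gen .H, gen .d, dcStar, gen .dc, dStar, lap} : Set _),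
      bracket (gen g) y ∈ T by
    induction hx using Submodule.span_induction with
    | mem y hy =>
      obtain ⟨i, rfl⟩ := hy
      fin_cases i
      · exact h (gen .L) (by simp)
      · exact h (gen .Lam) (by simp)
      · exact h (gen .H) (by simp)
      · exact h (gen .d) (by simp)
      · change bracket (gen g) (-dcStar) ∈ T
        rw [map_neg]; exact neg_mem (h _ (by simp))
      · exact h (gen .dc) (by simp)
      · exact h (dStar) (by simp)
      · change bracket (gen g) ((-2 : ℂ) • lap) ∈ T
        rw [map_smul]; exact T.smul_mem _ (h _ (by simp))
    | zero => rw [map_zero]; exact h0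
    | add y z _ _ hy hz => rw [map_add]; exact add_mem hy hz
    | smul c y _ hy => rw [map_smul]; exact T.smul_mem c hy
  intro y hy
  simp only [Set.mem_insert_iff, Set.mem_singleton_iff] at hy
  cases g
  · rcases hy with rfl | rfl | rfl | rfl | rfl | rfl | rfl | rfl
    · rw [self_of_even rfl]; exact h0
    · rw [L_Lam]; exact hH
    · rw [swap_even rfl, H_L]; exact neg_mem (T.smul_mem _ hL)
    · rw [L_d]; exact h0
    · rw [L_dcStar]; exact hc
    · rw [L_dc]; exact h0
    · rw [L_dStar]; exact hd
    · rw [L_lap]; exact h0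
  · rcases hy with rfl | rfl | rfl | rfl | rfl | rfl | rfl | rfl
    · rw [swap_even rfl, L_Lam]; exact neg_mem hH
    · rw [self_of_even rfl]; exact h0
    · rw [swap_even rfl, H_Lam]; exact neg_mem (neg_mem (T.smul_mem _ hM))
    · exact hds
    · rw [dcStar, Lam_Lam_dc]; exact h0
    · exact hcs
    · rw [dStar, Lam_Lam_d]; exact h0
    · rw [Lam_lap]; exact h0
  · rcases hy with rfl | rfl | rfl | rfl | rfl | rfl | rfl | rfl
    · rw [H_L]; exact T.smul_mem _ hL
    · rw [H_Lam]; exact neg_mem (T.smul_mem _ hM)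
    · rw [self_of_even rfl]; exact h0
    · rw [H_d]; exact hd
    · rw [H_dcStar]; exact neg_mem hcs
    · rw [H_dc]; exact hc
    · rw [H_dStar]; exact neg_mem hds
    · rw [H_lap]; exact h0
  · rcases hy with rfl | rfl | rfl | rfl | rfl | rfl | rfl | rfl
    · rw [swap_even rfl, L_d, neg_zero]; exact h0
    · rw [swap_even rfl]; exact neg_mem hds
    · rw [swap_even rfl, H_d]; exact neg_mem hd
    · rw [d_d]; exact h0
    · exact hl
    · rw [d_dc]; exact h0
    · rw [d_dStar]; exact h0
    · rw [d_lap]; exact h0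
  · rcases hy with rfl | rfl | rfl | rfl | rfl | rfl | rfl | rfl
    · rw [swap_even rfl, L_dc, neg_zero]; exact h0
    · rw [swap_even rfl]; exact neg_mem hcs
    · rw [swap_even rfl, H_dc]; exact neg_mem hc
    · rw [dc_d]; exact h0
    · rw [dc_dcStar]; exact h0
    · rw [dc_dc]; exact h0
    · rw [dc_dStar]; exact neg_mem hl
    · rw [dc_lap]; exact h0

theorem gen_mem_span (g : KGen) : gen g ∈ Submodule.span ℂ (Set.range basisVec) := by
  cases g
  · exact Submodule.subset_span ⟨0, rfl⟩
  · exact Submodule.subset_span ⟨1, rfl⟩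
  · exact Submodule.subset_span ⟨2, rfl⟩
  · exact Submodule.subset_span ⟨3, rfl⟩
  · exact Submodule.subset_span ⟨5, rfl⟩

/-- By the Jacobi identity the bracket with a product of monomials is a combination of successive
brackets with its factors, so stability under generators suffices. -/
theorem bracket_cls_mem (u : FreeMagma KGen) {x : KaehlerDeRham}
    (hx : x ∈ Submodule.span ℂ (Set.range basisVec)) :
    bracket (cls u) x ∈ Submodule.span ℂ (Set.range basisVec) := by
  induction u generalizing x with
  | ih1 g => exact bracket_gen_mem g hx
  | ih2 u v hu hv =>
    have h := jacobi u v x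
    have h1 : bracket (cls (u * v)) x = bracket (cls u) (bracket (cls v) x) -
        koszulSign (wordParity u) (wordParity v) • bracket (cls v) (bracket (cls u) x) := by
      rw [h, cls_mul, add_sub_cancel_right]
    exact h1 ▸ sub_mem (hu (hv hx)) (Submodule.smul_mem _ _ (hv (hu hx)))

theorem cls_mem_span (u : FreeMagma KGen) : cls u ∈ Submodule.span ℂ (Set.range basisVec) := by
  induction u with
  | ih1 g => exact gen_mem_span g
  | ih2 u v hu hv => exact (cls_mul u v).symm ▸ bracket_cls_mem u hv

theorem span_basisVec : Submodule.span ℂ (Set.range basisVec) = ⊤ := by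
  rw [eq_top_iff, ← span_cls, Submodule.span_le]
  rintro _ ⟨u, rfl⟩
  exact cls_mem_span u

/-- The elements `basisVec` are linearly independent modulo every ideal that contains neither `H` nor
`{d, [Λ, d^c]}`. -/
theorem coeff_eq_zero_of_mem {N : Submodule ℂ KaehlerDeRham} (hN : ∀ g, ∀ x ∈ N, bracket (gen g) x ∈ N)
    (hH : gen .H ∉ N) (hl : lap ∉ N) {c : Fin 8 → ℂ} (h : ∑ i, c i • basisVec i ∈ N) (i : Fin 8) :
    c i = 0 := by
  have key : ∀ {r : ℂ} {x : KaehlerDeRham}, x ∉ N → r • x ∈ N → r = 0 := fun hx h => by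
    by_contra hr
    exact hx ((Submodule.smul_mem_iff _ hr).1 h)
  have hM : gen .Lam ∉ N := fun h => hH (L_Lam ▸ hN .L _ h)
  have hL : gen .L ∉ N := fun h => hH <| neg_mem_iff.1 <| by
    have := hN .Lam _ h
    rwa [swap_even rfl, L_Lam] at this
  have hsum : ∑ i, c i • basisVec i = c 0 • gen .L + c 1 • gen .Lam + c 2 • gen .H + c 3 • gen .d +
      c 4 • -dcStar + c 5 • gen .dc + c 6 • dStar + c 7 • (-2 : ℂ) • lap := by
    rw [Fin.sum_univ_eight]; rfl
  rw [hsum] at h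
  -- Brackets with `L` and with `Λ` stay in `N` and separate the coefficients: the first leaves `c
  -- 1, c 2, c 4, c 6`, the second `c 0, c 2, c 3, c 5`.
  have hLx : c 1 • gen .H - (2 * c 2) • gen .L - c 4 • gen .dc + c 6 • gen .d ∈ N := by
    have h1 := hN .L _ h
    simp only [map_add, map_smul, map_neg, self_of_even (g := .L) rfl, L_Lam,
      swap_even (g := .H) rfl, H_L, L_d, L_dcStar, L_dc, L_dStar, L_lap] at h1
    convert h1 using 1; module
  have hMx : -(c 0 • gen .H) + (2 * c 2) • gen .Lam + c 3 • dStar + c 5 • dcStar ∈ N := by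
    have h1 := hN .Lam _ h
    have e1 : bracket (gen .Lam) dcStar = 0 := Lam_Lam_dc
    have e2 : bracket (gen .Lam) dStar = 0 := Lam_Lam_d
    have e3 : bracket (gen .Lam) (gen .d) = dStar := rfl
    have e4 : bracket (gen .Lam) (gen .dc) = dcStar := rfl
    simp only [map_add, map_smul, map_neg, swap_even (g := .L) rfl .Lam, L_Lam,
      swap_even (g := .H) rfl, H_Lam, self_of_even (g := .Lam) rfl, e1, e2, e3, e4, Lam_lap] at h1
    convert h1 using 1; module
  have h1 : c 1 = 0 := by
    have h2 := hN .L _ hLx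
    simp only [map_add, map_sub, map_smul, self_of_even (g := .L) rfl, swap_even (g := .H) rfl, H_L,
      L_d, L_dc] at h2
    have h3 := key (r := -(2 * c 1)) hL (by convert h2 using 1; module)
    simpa using h3
  have h0 : c 0 = 0 := by
    have h2 := hN .Lam _ hMx
    have e1 : bracket (gen .Lam) dcStar = 0 := Lam_Lam_dc
    have e2 : bracket (gen .Lam) dStar = 0 := Lam_Lam_d
    simp only [map_add, map_neg, map_smul, self_of_even (g := .Lam) rfl, swap_even (g := .H) rfl,
      H_Lam, e1, e2] at h2
    have h3 := key (r := -(2 * c 0)) hM (by convert h2 using 1; module)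
    simpa using h3
  -- With `c 1 = 0`, applying `ad H - 1` kills the weight-one terms `d` and `d^c` and keeps `L`,
  -- which has weight two.
  have h2 : c 2 = 0 := by
    have h3 := sub_mem (hN .H _ hLx) hLx
    simp only [map_add, map_sub, map_smul, self_of_even (g := .H) rfl, H_L, H_d, H_dc, h1] at h3
    have h4 := key (r := -(2 * c 2)) hL (by convert h3 using 1; module)
    simpa using h4
  rw [h1, h2] at hLx
  rw [h0, h2] at hMx
  -- The bracket with `d^c` or `d` isolates one of the two remaining coefficients, as a multiple of
  -- `lap ∉ N`.
  have h3 : c 3 = 0 := by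
    have h4 := hN .dc _ hMx
    simp only [zero_smul, mul_zero, neg_zero, zero_add, map_add, map_smul, dc_dStar, dc_dcStar] at h4
    have h5 := key (r := -c 3) hl (by convert h4 using 1; module)
    simpa using h5
  have h5 : c 5 = 0 := by
    have h4 := hN .d _ hMx
    simp only [zero_smul, mul_zero, neg_zero, zero_add, map_add, map_smul, d_dStar] at h4
    exact key hl (by convert h4 using 1; rw [lap]; module)
  have hMLx := hN .Lam _ hLx
  have hMLx' : c 6 • dStar - c 4 • dcStar ∈ N := by
    convert hMLx using 1
    simp only [zero_smul, mul_zero, map_add, map_sub, map_smul, map_zero, dStar, dcStar]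
    module
  have h6 : c 6 = 0 := by
    have h4 := hN .dc _ hMLx'
    simp only [map_sub, map_smul, dc_dStar, dc_dcStar] at h4
    have h5 := key (r := -c 6) hl (by convert h4 using 1; module)
    simpa using h5
  have h4 : c 4 = 0 := by
    have h4 := hN .d _ hMLx'
    simp only [map_sub, map_smul, d_dStar] at h4
    have h5 := key (r := -c 4) hl (by convert h4 using 1; rw [lap]; module)
    simpa using h5
  have h7 : c 7 = 0 := by
    rw [h0, h1, h2, h3, h4, h5, h6] at h
    have h8 := key (r := -(2 * c 7)) hl (by convert h using 1; module)
    simpa using h8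
  fin_cases i <;> assumption

end KaehlerDeRham

end

end HK

namespace HK

noncomputable section

open ContinuousAlternatingMap

set_option linter.unusedSectionVars false
set_option maxSynthPendingDepth 3

theorem koszulSign_add_left (a b c : ZMod 2) :
    koszulSign (a + b) c = koszulSign a c * koszulSign b c := by
  have h : ∀ a b c : ZMod 2, (a + b = 1 ∧ c = 1) ↔ ¬((a = 1 ∧ c = 1) ↔ (b = 1 ∧ c = 1)) := by decide
  simp only [koszulSign, h]
  split_ifs <;> first | (exfalso; tauto) | norm_num

theorem koszulSign_comm (a b : ZMod 2) : koszulSign a b = koszulSign b a := by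
  simp only [koszulSign, and_comm]

theorem koszulSign_mul_self (a b : ZMod 2) : koszulSign a b * koszulSign a b = 1 := by
  rw [koszulSign]; split_ifs <;> norm_num

theorem zmod_two_cases (i : ZMod 2) : i = 0 ∨ i = 1 := by revert i; decide

/-! ### The supercommutator of operators, and representations of the abstract superalgebra. -/

section Operators
variable {E : Type*} [NormedAddCommGroup E] [NormedSpace ℝ E] [FiniteDimensional ℝ E]
  {M : Type*} [TopologicalSpace M] [ChartedSpace E M] [IsManifold 𝓘(ℝ, E) ∞ M]

/-- The difference of even and odd part is conjugation by the parity operator; this makes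
bilinearity evident. -/
theorem superBracket_eq (A B : FormEnd E M) : superBracket A B =
    A * B - ((2 : ℂ)⁻¹ • (B + parityOp E M * B * parityOp E M)) * A -
      ((2 : ℂ)⁻¹ • (B - parityOp E M * B * parityOp E M)) *
        (parityOp E M * A * parityOp E M) := by
  have h : evenPart A - oddPart A = parityOp E M * A * parityOp E M := by
    change (2 : ℂ)⁻¹ • (A + parityOp E M * (A * parityOp E M)) -
      (2 : ℂ)⁻¹ • (A - parityOp E M * (A * parityOp E M)) = _
    rw [mul_assoc]; module
  rw [← h]; rfl

/-- The supercommutator as a bilinear map. -/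
def superBracketHom : FormEnd E M →ₗ[ℂ] FormEnd E M →ₗ[ℂ] FormEnd E M :=
  LinearMap.mk₂ ℂ superBracket
    (fun A A' B => by simp only [superBracket_eq, mul_add, add_mul]; abel)
    (fun c A B => by
      simp only [superBracket_eq, smul_mul_assoc, mul_smul_comm, smul_sub, smul_comm c (2⁻¹ : ℂ)])
    (fun A B B' => by
      simp only [superBracket_eq, mul_add, add_mul, sub_mul, smul_add, smul_sub]; abel)
    (fun c A B => by
      simp only [superBracket_eq, smul_mul_assoc, mul_smul_comm, smul_sub, smul_add, add_mul, sub_mul,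
        smul_comm c (2⁻¹ : ℂ)])

/-- The operator has parity `i`. -/
def HasParity (i : ZMod 2) (A : FormEnd E M) : Prop :=
  parityOp E M * A = koszulSign i 1 • (A * parityOp E M)

theorem hasParity_zero {A : FormEnd E M} : HasParity 0 A ↔ IsEvenOp A := by
  rw [HasParity, koszulSign_zero_left, one_smul]; rfl

theorem hasParity_one {A : FormEnd E M} : HasParity 1 A ↔ IsOddOp A := by
  rw [HasParity, koszulSign_one_one, neg_one_smul]; rfl

namespace HasParity
variable {i j k : ZMod 2} {A B C : FormEnd E M}

theorem mul (hA : HasParity i A) (hB : HasParity j B) : HasParity (i + j) (A * B) := by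
  rw [HasParity, ← mul_assoc, hA, smul_mul_assoc, mul_assoc, hB, mul_smul_comm, smul_smul, mul_assoc,
    koszulSign_add_left]

theorem sub (hA : HasParity i A) (hB : HasParity i B) : HasParity i (A - B) := by
  rw [HasParity, mul_sub, hA, hB, sub_mul, smul_sub]

theorem add (hA : HasParity i A) (hB : HasParity i B) : HasParity i (A + B) := by
  rw [HasParity, mul_add, hA, hB, add_mul, smul_add]

theorem zero : HasParity i (0 : FormEnd E M) := by rw [HasParity, mul_zero, zero_mul, smul_zero]

theorem smul (c : ℂ) (hA : HasParity i A) : HasParity i (c • A) := by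
  rw [HasParity, mul_smul_comm, hA, smul_mul_assoc, smul_comm]

theorem superBracket_eq (hA : HasParity i A) (hB : HasParity j B) :
    superBracket A B = A * B - koszulSign i j • (B * A) := by
  rcases zmod_two_cases j with rfl | rfl
  · rw [superBracket_of_even (hasParity_zero.1 hB), koszulSign_zero_right, one_smul]; rfl
  rcases zmod_two_cases i with rfl | rfl
  · rw [superBracket_even_odd (hasParity_zero.1 hA) (hasParity_one.1 hB), koszulSign_zero_left,
      one_smul]; rfl
  · rw [superBracket_odd_odd (hasParity_one.1 hA) (hasParity_one.1 hB), koszulSign_one_one,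
      neg_one_smul, sub_neg_eq_add]; rfl

theorem superBracket (hA : HasParity i A) (hB : HasParity j B) :
    HasParity (i + j) (superBracket A B) := by
  rw [hA.superBracket_eq hB]
  exact (hA.mul hB).sub (add_comm j i ▸ (hB.mul hA).smul _)

theorem anticomm (hA : HasParity i A) (hB : HasParity j B) :
    HK.superBracket A B + koszulSign i j • HK.superBracket B A = 0 := by
  rw [hA.superBracket_eq hB, hB.superBracket_eq hA, koszulSign_comm j i, smul_sub, smul_smul,
    koszulSign_mul_self, one_smul]
  abel

/-- Expanded into associative triple products, the terms cancel because the sign is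
bimultiplicative, symmetric and of square one. -/
theorem jacobi (hA : HasParity i A) (hB : HasParity j B) (hC : HasParity k C) :
    HK.superBracket A (HK.superBracket B C) - HK.superBracket (HK.superBracket A B) C -
      koszulSign i j • HK.superBracket B (HK.superBracket A C) = 0 := by
  rw [hA.superBracket_eq (hB.superBracket hC), (hA.superBracket hB).superBracket_eq hC,
    hB.superBracket_eq (hA.superBracket hC), hA.superBracket_eq hB, hB.superBracket_eq hC,
    hA.superBracket_eq hC, koszulSign_comm i (j + k), koszulSign_comm j (i + k)]
  simp only [koszulSign_add_left, koszulSign_comm j i, koszulSign_comm k i, koszulSign_comm k j]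
  have h := koszulSign_mul_self i j
  generalize koszulSign i j = r at h ⊢
  generalize koszulSign i k = s
  generalize koszulSign j k = t
  simp only [mul_sub, sub_mul, mul_smul_comm, smul_mul_assoc, smul_sub, smul_smul, mul_assoc]
  match_scalars <;> first | ring1 | linear_combination t * h | linear_combination (-(s * t)) * h

end HasParity

/-- Operators satisfying the relations of the generators of the Kähler-de Rham superalgebra. -/
structure IsKaehlerSystem (e f h d c : FormEnd E M) : Prop where
  sl2 : IsSl2 e f h
  even_e : HasParity 0 e
  even_f : HasParity 0 f
  odd_d : HasParity 1 d
  odd_c : HasParity 1 c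
  h_d : h * d - d * h = d
  h_c : h * c - c * h = c
  e_d : e * d = d * e
  e_c : e * c = c * e
  f_f_d : f * (f * d - d * f) = (f * d - d * f) * f
  f_f_c : f * (f * c - c * f) = (f * c - c * f) * f
  d_d : d * d = 0
  c_c : c * c = 0
  d_c : d * c + c * d = 0

/-- The operators assigned to the generators. -/
def genOp (e f h d c : FormEnd E M) : KGen → FormEnd E M
  | .L => e
  | .Lam => f
  | .H => h
  | .d => d
  | .dc => c

/-- The universal property of the free non-associative algebra, applied to operators with the
supercommutator as product. -/
theorem exists_freeHom (F : KGen → FormEnd E M) : ∃ Φ : KFree →ₗ[ℂ] FormEnd E M,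
    (∀ x y, Φ (x * y) = superBracket (Φ x) (Φ y)) ∧ ∀ g, Φ (kgen g) = F g := by
  let φ : KFree →ₙₐ[ℂ] BilinearAlgebra (superBracketHom (E := E) (M := M)) :=
    FreeNonUnitalNonAssocAlgebra.lift ℂ F
  exact ⟨⟨⟨fun x => φ x, map_add φ⟩, map_smul φ⟩, map_mul φ,
    FreeNonUnitalNonAssocAlgebra.lift_of_apply (R := ℂ)
      (A := BilinearAlgebra (superBracketHom (E := E) (M := M))) F⟩

namespace IsKaehlerSystem
variable {e f h d c : FormEnd E M} (t : IsKaehlerSystem e f h d c)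
include t

theorem even_h : HasParity 0 h := by
  rw [← t.sl2.ef]
  exact (t.even_e.mul t.even_f).sub (t.even_f.mul t.even_e)

theorem hasParity_word {Φ : KFree →ₗ[ℂ] FormEnd E M}
    (hmul : ∀ x y, Φ (x * y) = superBracket (Φ x) (Φ y)) (hgen : ∀ g, Φ (kgen g) = genOp e f h d c g)
    (u : FreeMagma KGen) :
    HasParity (wordParity u) (Φ (word u)) := by
  induction u with
  | ih1 g =>
    change HasParity g.parity (Φ (kgen g))
    rw [hgen]
    cases g
    exacts [t.even_e, t.even_f, t.even_h, t.odd_d, t.odd_c]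
  | ih2 u v hu hv =>
    rw [KaehlerDeRham.word_mul, hmul]
    exact hu.superBracket hv

theorem hom_rel {Φ : KFree →ₗ[ℂ] FormEnd E M}
    (hmul : ∀ x y, Φ (x * y) = superBracket (Φ x) (Φ y)) (hgen : ∀ g, Φ (kgen g) = genOp e f h d c g)
    {x : KFree} (hx : KRel x) : Φ x = 0 := by
  have two : ∀ x : FormEnd E M, (2 : ℂ) • x = 2 * x := fun x => by rw [two_smul, two_mul]
  have ee := t.even_e
  have ef := t.even_f
  have eh := t.even_h
  have od := t.odd_d
  have oc := t.odd_c
  have s : ∀ {i : ZMod 2} {A B : FormEnd E M}, HasParity 0 A → HasParity i B →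
      superBracket A B = A * B - B * A := fun hA hB => by
    rw [hA.superBracket_eq hB, koszulSign_zero_left, one_smul]
  have s1 : ∀ {A B : FormEnd E M}, HasParity 1 A → HasParity 1 B →
      superBracket A B = A * B + B * A := fun hA hB => by
    rw [hA.superBracket_eq hB, koszulSign_one_one, neg_one_smul, sub_neg_eq_add]
  cases hx with
  | anticomm u v =>
    rw [_root_.map_add, _root_.map_smul, hmul, hmul]
    exact (t.hasParity_word hmul hgen u).anticomm (t.hasParity_word hmul hgen v) 
  | jacobi u v w =>
    rw [_root_.map_sub, _root_.map_sub, _root_.map_smul, hmul, hmul, hmul, hmul, hmul, hmul]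
    exact (t.hasParity_word hmul hgen u).jacobi (t.hasParity_word hmul hgen v) (t.hasParity_word hmul hgen w)
  | L_Lam =>
    rw [_root_.map_sub]
    rw [sub_eq_zero, hmul, hgen, hgen, hgen]
    exact (s ee ef).trans t.sl2.ef
  | H_L =>
    rw [_root_.map_sub, _root_.map_smul]
    rw [sub_eq_zero, hmul, hgen, hgen]
    exact (s eh ee).trans (t.sl2.he.trans (two e).symm)
  | H_Lam =>
    rw [_root_.map_add, _root_.map_smul]
    rw [add_eq_zero_iff_eq_neg, hmul, hgen, hgen]
    exact (s eh ef).trans (t.sl2.hf.trans (congrArg Neg.neg (two f).symm))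
  | H_d =>
    rw [_root_.map_sub]
    rw [sub_eq_zero, hmul, hgen, hgen]
    exact (s eh od).trans t.h_d
  | H_dc =>
    rw [_root_.map_sub]
    rw [sub_eq_zero, hmul, hgen, hgen]
    exact (s eh oc).trans t.h_c
  | L_d =>
    rw [hmul, hgen, hgen]
    exact (s ee od).trans (sub_eq_zero.2 t.e_d)
  | L_dc =>
    rw [hmul, hgen, hgen]
    exact (s ee oc).trans (sub_eq_zero.2 t.e_c)
  | Lam_Lam_d =>
    rw [hmul, hmul, hgen, hgen]
    refine (s ef (ef.superBracket od)).trans ?_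
    rw [s ef od]
    exact sub_eq_zero.2 t.f_f_d
  | Lam_Lam_dc =>
    rw [hmul, hmul, hgen, hgen]
    refine (s ef (ef.superBracket oc)).trans ?_
    rw [s ef oc]
    exact sub_eq_zero.2 t.f_f_c
  | d_d =>
    rw [hmul, hgen]
    refine (s1 od od).trans ?_
    rw [t.d_d, add_zero]
  | dc_dc =>
    rw [hmul, hgen]
    refine (s1 oc oc).trans ?_
    rw [t.c_c, add_zero]
  | d_dc =>
    rw [hmul, hgen, hgen]
    exact (s1 od oc).trans t.d_c

theorem exists_rep : ∃ ρ : KaehlerDeRham →ₗ[ℂ] FormEnd E M,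
    (∀ x y, ρ (KaehlerDeRham.bracket x y) = superBracket (ρ x) (ρ y)) ∧
    (∀ g, ρ (KaehlerDeRham.gen g) = genOp e f h d c g) ∧
    ∀ i, ∀ x ∈ KaehlerDeRham.homogeneous i, HasParity i (ρ x) := by
  obtain ⟨Φ, hmul, hgen⟩ := exists_freeHom (genOp e f h d c)
  have hz : ∀ A : FormEnd E M, superBracket A 0 = 0 ∧ superBracket 0 A = 0 := fun A =>
    ⟨(superBracketHom A).map_zero, superBracketHom.map_zero₂ A⟩
  -- The kernel is closed under brackets with arbitrary elements and contains the relations, so it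
  -- is one of the ideals whose infimum is `kIdeal`.
  have hker : kIdeal ≤ LinearMap.ker Φ := by
    refine sInf_le ⟨fun x hx => t.hom_rel hmul hgen hx, fun x s hs => ?_⟩
    rw [LinearMap.mem_ker] at hs
    rw [LinearMap.mem_ker, LinearMap.mem_ker, hmul, hmul, hs]
    exact hz _
  refine ⟨kIdeal.liftQ Φ hker, fun x y => ?_, hgen, fun i x hx => ?_⟩
  · obtain ⟨x, rfl⟩ := kIdeal.mkQ_surjective x
    obtain ⟨y, rfl⟩ := kIdeal.mkQ_surjective y
    exact hmul x y
  · induction hx using Submodule.span_induction with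
    | mem x hx =>
      obtain ⟨u, hu, rfl⟩ := hx
      exact hu ▸ t.hasParity_word hmul hgen u
    | zero => rw [_root_.map_zero]; exact .zero
    | add x y _ _ hx hy => rw [_root_.map_add]; exact hx.add hy
    | smul c x _ hx => rw [_root_.map_smul]; exact hx.smul c

/-- The representation of the Kähler-de Rham superalgebra given by operators satisfying the relations. -/
def rep : KaehlerDeRham →ₗ[ℂ] FormEnd E M := t.exists_rep.choose

theorem rep_bracket (x y : KaehlerDeRham) :
    t.rep (KaehlerDeRham.bracket x y) = superBracket (t.rep x) (t.rep y) :=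
  t.exists_rep.choose_spec.1 x y

theorem rep_gen (g : KGen) : t.rep (KaehlerDeRham.gen g) = genOp e f h d c g :=
  t.exists_rep.choose_spec.2.1 g

theorem hasParity_rep {i : ZMod 2} {x : KaehlerDeRham} (hx : x ∈ KaehlerDeRham.homogeneous i) :
    HasParity i (t.rep x) := t.exists_rep.choose_spec.2.2 i x hx

theorem rep_dStar : t.rep KaehlerDeRham.dStar = f * d - d * f := by
  rw [KaehlerDeRham.dStar, t.rep_bracket, t.rep_gen, t.rep_gen]
  change superBracket f d = _
  rw [t.even_f.superBracket_eq t.odd_d, koszulSign_zero_left, one_smul]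

theorem rep_dcStar : t.rep KaehlerDeRham.dcStar = f * c - c * f := by
  rw [KaehlerDeRham.dcStar, t.rep_bracket, t.rep_gen, t.rep_gen]
  change superBracket f c = _
  rw [t.even_f.superBracket_eq t.odd_c, koszulSign_zero_left, one_smul]

theorem rep_lap : t.rep KaehlerDeRham.lap = d * (f * c - c * f) + (f * c - c * f) * d := by
  have h1 : HasParity 1 (f * c - c * f) := (zero_add (1 : ZMod 2) ▸ t.even_f.mul t.odd_c).sub
    (add_zero (1 : ZMod 2) ▸ t.odd_c.mul t.even_f)
  rw [KaehlerDeRham.lap, t.rep_bracket, t.rep_gen, t.rep_dcStar]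
  change superBracket d _ = _
  rw [t.odd_d.superBracket_eq h1, koszulSign_one_one, neg_one_smul, sub_neg_eq_add]

theorem rep_basisVec : t.rep ∘ KaehlerDeRham.basisVec = ![e, f, h, d, -(f * c - c * f), c,
    f * d - d * f, (-2 : ℂ) • (d * (f * c - c * f) + (f * c - c * f) * d)] := by
  funext i
  fin_cases i
  · exact t.rep_gen .L
  · exact t.rep_gen .Lam
  · exact t.rep_gen .H
  · exact t.rep_gen .d
  · exact (_root_.map_neg t.rep _).trans (congrArg Neg.neg t.rep_dcStar)
  · exact t.rep_gen .dc
  · exact t.rep_dStar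
  · exact (_root_.map_smul t.rep _ _).trans (congrArg ((-2 : ℂ) • ·) t.rep_lap)

variable (hh : h ≠ 0) (hl : d * (f * c - c * f) + (f * c - c * f) * d ≠ 0)
include hh hl

/-- The kernel of the representation is stable under brackets with generators and contains neither
`H` nor `lap`, so `coeff_eq_zero_of_mem` applies to it. -/
theorem linearIndependent_rep : LinearIndependent ℂ (t.rep ∘ KaehlerDeRham.basisVec) := by
  rw [Fintype.linearIndependent_iff]
  intro r hr
  refine KaehlerDeRham.coeff_eq_zero_of_mem (N := LinearMap.ker t.rep) (fun g x hx => ?_) ?_ ?_ ?_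
  · rw [LinearMap.mem_ker, t.rep_bracket, LinearMap.mem_ker.1 hx]
    exact (superBracketHom _).map_zero
  · rw [LinearMap.mem_ker, t.rep_gen]; exact hh
  · rw [LinearMap.mem_ker, t.rep_lap]; exact hl
  · rw [LinearMap.mem_ker, _root_.map_sum, ← hr]
    exact Finset.sum_congr rfl fun i _ => _root_.map_smul _ _ _

theorem rep_injective : Function.Injective t.rep := by
  rw [← LinearMap.ker_eq_bot, LinearMap.ker_eq_bot']
  intro x hx
  have h1 : x ∈ Submodule.span ℂ (Set.range KaehlerDeRham.basisVec) :=
    KaehlerDeRham.span_basisVec ▸ Submodule.mem_top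
  obtain ⟨r, rfl⟩ := (Submodule.mem_span_range_iff_exists_fun ℂ).1 h1
  have h2 := Fintype.linearIndependent_iff.1 (t.linearIndependent_rep hh hl) r (by
    rw [← hx, _root_.map_sum]
    exact Finset.sum_congr rfl fun i _ => (_root_.map_smul _ _ _).symm)
  exact Finset.sum_eq_zero fun i _ => by rw [h2 i, zero_smul]

omit hh hl in
theorem range_rep : LinearMap.range t.rep =
    Submodule.span ℂ (Set.range (t.rep ∘ KaehlerDeRham.basisVec)) := by
  rw [Set.range_comp, ← Submodule.map_span, KaehlerDeRham.span_basisVec, Submodule.map_top]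

end IsKaehlerSystem
end Operators

/-! ### The eight operators as images of the abstract basis, and their membership in `𝔤`. -/

section Operators
variable {E : Type*} [NormedAddCommGroup E] [NormedSpace ℝ E] [FiniteDimensional ℝ E]
  {M : Type*} [TopologicalSpace M] [ChartedSpace E M] [IsManifold 𝓘(ℝ, E) ∞ M]

theorem hasParity_zero_of_commute {A : FormEnd E M} (h : parityOp E M * A = A * parityOp E M) :
    HasParity 0 A := by rw [HasParity, koszulSign_zero_left, one_smul, h]

theorem IsDegOne.hasParity {A : FormEnd E M} (h : IsDegOne A) : HasParity 1 A := by
  rw [HasParity, koszulSign_one_one, neg_one_smul, h.parityOp]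

namespace HypercomplexHermitian
variable (X : HypercomplexHermitian E M)

theorem gradeOp_mul_adOp (q : ImagUnit) (c : ℕ → ℂ) :
    gradeOp c * X.adOp q = X.adOp q * gradeOp c :=
  LinearMap.ext fun η => funext fun k => ((X.adForm q k).map_smul (c k) (η k)).symm

theorem hasParity_opL : HasParity 0 X.opL := hasParity_zero_of_commute X.parityOp_mul_opL

theorem hasParity_opLambda : HasParity 0 X.opLambda :=
  hasParity_zero_of_commute X.parityOp_mul_opLambda

theorem hasParity_adOp (q : ImagUnit) : HasParity 0 (X.adOp q) :=
  hasParity_zero_of_commute (X.gradeOp_mul_adOp q _)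

theorem hasParity_lefschetzDual (q : ImagUnit) : HasParity 0 (X.lefschetzDual q) :=
  hasParity_zero_of_commute (X.parityOp_mul_lefschetzDual q)

theorem hasParity_opDelJ : HasParity 1 X.opDelJ := by
  rw [opDelJ, delJOp_eq]
  exact (X.isDegOne_conj_quatOp (isDegOne_delBarOp _ _)).hasParity

theorem opH_eq_commutator : X.opH = X.opL * X.opLambda - X.opLambda * X.opL :=
  superBracket_of_even (hasParity_zero.1 X.hasParity_opLambda)

theorem opH_eq : X.opH = (2⁻¹ : ℂ) • (degreeOp E M - Complex.I • X.adOp qI) := by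
  rw [opH_eq_commutator, opL_eq, opLambda_eq]
  exact ((X.isPair isQuatTriple_IJK).sl2_of_sq Complex.I_mul_I).ef

theorem opH_ne_zero [Nontrivial E] [Nonempty M] : X.opH ≠ 0 := by
  rw [opH_eq]
  exact smul_ne_zero (by norm_num) X.degreeOp_sub_adOp_ne_zero

section Hyperkahler
variable {X} (hX : X.IsHyperkahler)
include hX

theorem isKaehlerSystem : IsKaehlerSystem X.opL X.opLambda X.opH X.opDel X.opDelJ := by
  have t := isHKSystem hX
  have s : IsSl2 X.opL X.opLambda X.opH := by
    rw [opH_eq, opL_eq, opLambda_eq]; exact t.sl2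
  have nil : IsNilpotent X.opLambda := by rw [opLambda_eq]; exact t.nil_f
  have hd : X.opH * X.opDel - X.opDel * X.opH = X.opDel := by
    rw [opH_eq]; exact IsHKSystem.weight_h_I t.D_a t.H_a
  have hc : X.opH * X.opDelJ - X.opDelJ * X.opH = X.opDelJ := by
    rw [opH_eq, opDelJ, delJOp_eq]; exact IsHKSystem.weight_h_I t.D_aJ t.H_aJ
  have ed : X.opL * X.opDel = X.opDel * X.opL := by rw [opL_eq]; exact t.commute_e.1
  have ec : X.opL * X.opDelJ = X.opDelJ * X.opL := by
    rw [opL_eq, opDelJ, delJOp_eq]; exact t.e_aJ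
  exact {
    sl2 := s
    even_e := X.hasParity_opL
    even_f := X.hasParity_opLambda
    odd_d := (isDegOne_delOp _ _).hasParity
    odd_c := X.hasParity_opDelJ
    h_d := hd
    h_c := hc
    e_d := ed
    e_c := ec
    f_f_d := s.double_commutator nil ed hd
    f_f_c := s.double_commutator nil ec hc
    d_d := t.a_a
    c_c := by rw [opDelJ, delJOp_eq]; exact t.aJ_aJ
    d_c := by rw [opDelJ, delJOp_eq]; exact t.a_aJ }

theorem laplacian_eq_smul : X.laplacian = (-2 : ℂ) •
    (X.opDel * (X.opLambda * X.opDelJ - X.opDelJ * X.opLambda) +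
      (X.opLambda * X.opDelJ - X.opDelJ * X.opLambda) * X.opDel) := by
  rw [laplacian_eq hX, starAdjoint_opDel hX, mul_neg, neg_mul, ← neg_add, smul_neg, neg_smul]

/-- The order, signs and the factor `-2` in `basisVec` are those of `∂^* = -[Λ_Ω, ∂_J]`, `∂_J^* =
[Λ_Ω, ∂]` and `Δ = -2 {∂, [Λ_Ω, ∂_J]}`. -/
theorem rep_comp_basisVec :
    (isKaehlerSystem hX).rep ∘ KaehlerDeRham.basisVec = X.dolbeaultOps := by
  rw [IsKaehlerSystem.rep_basisVec, dolbeaultOps, starAdjoint_opDel hX, starAdjoint_opDelJ hX,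
    laplacian_eq_smul hX]

theorem dolbeaultOps_mem (i : Fin 8) : X.dolbeaultOps i ∈ X.hyperkahlerDeRham := by
  set S := X.hyperkahlerDeRham
  have t := isKaehlerSystem hX
  have hc : IsSuperClosed S := superAlgebraGenerated_isSuperClosed _
  have gens : ({X.lefschetz qI, X.lefschetz qJ, X.lefschetz qK,
      X.lefschetzDual qI, X.lefschetzDual qJ, X.lefschetzDual qK, degreeOp E M,
      X.adOp qI, X.adOp qJ, X.adOp qK} ∪ {dOp E M} : Set (FormEnd E M)) ⊆ S := fun A hA =>
    Submodule.mem_sInf.2 fun T hT => hT.1 hA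
  have comm : ∀ {j : ZMod 2} {A B : FormEnd E M}, HasParity 0 A → HasParity j B → A ∈ S → B ∈ S →
      A * B - B * A ∈ S := fun hA hB hAS hBS => by
    have h := hc _ hAS _ hBS
    rwa [hA.superBracket_eq hB, koszulSign_zero_left, one_smul] at h
  have hL : X.opL ∈ S := by
    rw [opL_eq]
    exact S.smul_mem _ (S.add_mem (gens (by simp)) (S.smul_mem _ (gens (by simp))))
  have hM : X.opLambda ∈ S := by
    rw [opLambda_eq]
    exact S.smul_mem _ (S.sub_mem (gens (by simp)) (S.smul_mem _ (gens (by simp))))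
  have hd : dOp E M ∈ S := gens (by simp)
  have hDd : X.adOp qI * dOp E M - dOp E M * X.adOp qI ∈ S :=
    comm (X.hasParity_adOp qI) isDegOne_dOp.hasParity (gens (by simp)) hd
  have hdel : X.opDel ∈ S := by
    rw [opDel, delOp_eq hX]
    exact S.smul_mem _ (S.sub_mem hd (S.smul_mem _ hDd))
  have hbar : X.delBarOp qI ∈ S := by
    rw [delBarOp_eq hX]
    exact S.smul_mem _ (S.add_mem hd (S.smul_mem _ hDd))
  -- The Kähler identity through `Λ_I` is used here, since `∂_J` is not yet known to lie in the
  -- superalgebra.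
  have hdels : X.starAdjoint X.opDel ∈ S := by
    rw [opDel, starAdjoint_delOp hX]
    exact S.neg_mem (S.smul_mem _ (comm (X.hasParity_lefschetzDual qI)
      (isDegOne_delBarOp _ _).hasParity (gens (by simp)) hbar))
  have hpar : HasParity 1 (X.opLambda * X.opDelJ - X.opDelJ * X.opLambda) :=
    (zero_add (1 : ZMod 2) ▸ t.even_f.mul t.odd_c).sub
      (add_zero (1 : ZMod 2) ▸ t.odd_c.mul t.even_f)
  have hfc : X.opLambda * X.opDelJ - X.opDelJ * X.opLambda ∈ S := by
    have h := S.neg_mem hdels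
    rwa [starAdjoint_opDel hX, neg_neg] at h
  -- `[Λ_Ω, ∂_J] = -∂^*` is already available, and raising it with `L_Ω` returns the weight-one
  -- vector `∂_J`.
  have hdelJ : X.opDelJ ∈ S := by
    have h := comm t.even_e hpar hL hfc
    rwa [t.sl2.commutator_lower t.e_c t.h_c] at h
  have hdelJs : X.starAdjoint X.opDelJ ∈ S := by
    rw [starAdjoint_opDelJ hX]
    exact comm t.even_f t.odd_d hM hdel
  have hΔ : X.laplacian ∈ S := by
    have h := hc _ hdel _ hfc
    rw [t.odd_d.superBracket_eq hpar, koszulSign_one_one, neg_one_smul, sub_neg_eq_add] at h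
    rw [laplacian_eq_smul hX]
    exact S.smul_mem _ h
  fin_cases i
  exacts [hL, hM, hc _ hL _ hM, hdel, hdels, hdelJ, hdelJs, hΔ]

end Hyperkahler
end HypercomplexHermitian
end Operators

end

end HK

/-! ### The main theorem. -/

theorem mainTheorem9 {E : Type*} [NormedAddCommGroup E] [NormedSpace ℝ E] [FiniteDimensional ℝ E]
    [Nontrivial E] {M : Type*} [TopologicalSpace M] [T2Space M] [Nonempty M] [ChartedSpace E M]
    [IsManifold 𝓘(ℝ, E) ∞ M] (X : HK.HypercomplexHermitian E M) (hX : X.IsHyperkahler) :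
    (∀ i, X.dolbeaultOps i ∈ X.hyperkahlerDeRham) ∧
    LinearIndependent ℂ X.dolbeaultOps ∧
    HK.IsSuperClosed X.dolbeaultSpan ∧
    ∃ φ : HK.KaehlerDeRham ≃ₗ[ℂ] X.dolbeaultSpan,
      (∀ a b, (φ (HK.KaehlerDeRham.bracket a b) : HK.FormEnd E M) =
        HK.superBracket (φ a : HK.FormEnd E M) (φ b : HK.FormEnd E M)) ∧
      (∀ a ∈ HK.KaehlerDeRham.homogeneous 0, HK.IsEvenOp (φ a : HK.FormEnd E M)) ∧
      (∀ a ∈ HK.KaehlerDeRham.homogeneous 1, HK.IsOddOp (φ a : HK.FormEnd E M)) ∧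
      (φ (HK.KaehlerDeRham.gen .L) : HK.FormEnd E M) = X.opL ∧
      (φ (HK.KaehlerDeRham.gen .Lam) : HK.FormEnd E M) = X.opLambda ∧
      (φ (HK.KaehlerDeRham.gen .H) : HK.FormEnd E M) = X.opH ∧
      (φ (HK.KaehlerDeRham.gen .d) : HK.FormEnd E M) = X.opDel ∧
      (φ (HK.KaehlerDeRham.gen .dc) : HK.FormEnd E M) = X.opDelJ := by
  have t := HK.HypercomplexHermitian.isKaehlerSystem hX
  have hb := HK.HypercomplexHermitian.rep_comp_basisVec hX
  have hh := X.opH_ne_zero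
  have hl : X.opDel * (X.opLambda * X.opDelJ - X.opDelJ * X.opLambda) +
      (X.opLambda * X.opDelJ - X.opDelJ * X.opLambda) * X.opDel ≠ 0 := fun h => by
    refine X.laplacian_ne_zero ?_
    rw [HK.HypercomplexHermitian.laplacian_eq_smul hX, h, smul_zero]
  -- The span is the image of the representation, so it is closed under the supercommutator and, by
  -- injectivity, isomorphic to the abstract superalgebra.
  have hrange : LinearMap.range t.rep = X.dolbeaultSpan := by
    rw [t.range_rep, hb]; rfl
  refine ⟨HK.HypercomplexHermitian.dolbeaultOps_mem hX, hb ▸ t.linearIndependent_rep hh hl, ?_,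
    (LinearEquiv.ofInjective t.rep (t.rep_injective hh hl)).trans (LinearEquiv.ofEq _ _ hrange),
    t.rep_bracket, fun a ha => HK.hasParity_zero.1 (t.hasParity_rep ha),
    fun a ha => HK.hasParity_one.1 (t.hasParity_rep ha),
    t.rep_gen .L, t.rep_gen .Lam, t.rep_gen .H, t.rep_gen .d, t.rep_gen .dc⟩
  rw [← hrange]
  rintro _ ⟨x, rfl⟩ _ ⟨y, rfl⟩
  exact ⟨_, t.rep_bracket x y⟩
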